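/- **Setting.** Let $\mathcal G$ be a finite-dimensional semisimple Hopf algebra over $\mathbb C$ with unit $e$, coproduct $\Delta$, counit $\epsilon$, antipode $\mathcal S$, and an antilinear anti-multiplicative involution $*$ (on tensor products $(\xi\otimes\eta)^*=\xi^*\otimes\eta^*$). Write $X'=\sigma(X)$ for the flip of $X\in\mathcal G\otimes\mathcal G$ and $\Delta'=\sigma\circ\Delta$. Let $R\in\mathcal G\otimes\mathcal G$ be a universal $R$-matrix, i.e. invertible with $R\Delta(\xi)=\Delta'(\xi)R$, $(\mathrm{id}\otimes\Delta)(R)=R_{13}R_{12}$, $(\Delta\otimes \mathrm{id})(R)=R_{13}R_{23}$, and let $v$ be a ribbon element: invertible, central, $v^2=u\,\mathcal S(u)$ with $u=\sum\mathcal S(r^2_\varsigma)r^1_\varsigma$ for $R=\sum r^1_\varsigma\otimes r^2_\varsigma$, $\mathcal S(v)=v$, $\epsilon(v)=1$, $R'R=(v\otimes v)\Delta(v^{-1})$. Put $g^{-1}=v^{-1}u$. Assume $R^*=(R^{-1})'$, $\Delta(\xi)^*=\Delta'(\xi^*)$, and that $v,g$ are unitary. Let $\tau^I$ on finite-dimensional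 Hilbert spaces $V^I$ be representatives of the (finitely many) classes of irreducible representations of $\mathcal G$, each of them a $*$-representation, and assume that $\mathcal G$ is modular: the matrix $S_{IJ}=(\mathrm{Tr}_{V^I}\otimes\mathrm{Tr}_{V^J})\big((\tau^I\otimes\tau^J)(R'R\,(g\otimes g))\big)$ is invertible. Finally let $\kappa$ be a central element with $\kappa^2=v$ for which $S=\Delta(\kappa^{-1})(\kappa\otimes\kappa)R^{-1}$ acts as a positive operator on every Hilbert space $V^I\otimes V^J$. **The algebra $\mathcal K_N$.** Let $N\ge1$ and let $n$ run over $\mathbb Z/N$. $\mathcal K_N$ is the unital algebra generated by $\mathcal G^{\otimes N}$, with embeddings $\iota_n:\mathcal G\to\mathcal K_N$ of the tensor factors, and by the components $(\pi\otimes \mathrm{id})(J_n^{\pm1})$, $\pi\in\mathcal G^\vee$ (the linear dual of $\mathcal G$), of elements $J_n\in\mathcal G\otimes\mathcal K_N$ and their inverses $J_n^{-1}\in\mathcal G\otimes\mathcal K_N$. The relations are as follows; $\Delta_n(\xi)=(\mathrm{id}\otimes\iota_n)\Delta(\xi)$, $\Delta_a$ acts on the first factor, upper indices $1,2$ denote the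 position of the first factor in $\mathcal G\otimes\mathcal G\otimes\mathcal K_N$, and elements of $\mathcal G$, $\mathcal G\otimes\mathcal G$ or $\mathcal K_N$ are extended by units. * For $N\ge2$: $\iota_n(\xi)J_n=J_n\Delta_n(\xi)$, $\Delta_{n-1}(\xi)J_n=J_n\iota_{n-1}(\xi)$, $\iota_m(\xi)J_n=J_n\iota_m(\xi)$ for $m\ne n,n-1$; $J^1_nJ^2_n=R\,\Delta_a(J_n)$; $J^1_nJ^2_m=J^2_mJ^1_n$ for $n\neq m,m\pm1$; and $J^1_nRJ^2_{n+1}=J^2_{n+1}J^1_n$ if $N\ge3$, respectively $J^1_nRJ^2_{n+1}=J^2_{n+1}R'J^1_n$ if $N=2$ (where consecutive links share both end points). * For $N=1$, with $J=J_0$: $\Delta_0(\xi)J=J\Delta_0(\xi)$ and $J^1RJ^2=R\,\Delta_a(J)$. Put $S_n=(\mathrm{id}\otimes\iota_n)(S)$, $U_\nu=v_a^{1-\nu}J_1\cdots J_\nu$ for $1\le\nu\le N-1$, and $M=v_a^{1-N}J_1\cdots J_N$, where $v_a=v\otimes 1$. **The carrier spaces.** Let $\Re=\mathcal G^\vee$,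 with vectors written $|\pi\rangle$, and let $D$ be given on $\Re$ by $$\pi_1(U)|\pi_2\rangle=|\pi_1*\pi_2\rangle,\quad (\pi_1*\pi_2)(\xi)=(\pi_1\otimes\pi_2)(R\Delta(\xi)),\quad \iota_1(\xi)|\pi\rangle=|\pi(\,\cdot\,\xi)\rangle,\quad \iota_0(\xi)|\pi\rangle=|\pi(\mathcal S(\xi)\,\cdot\,)\rangle .$$ On $W^{IJ}_N=\Re^{\otimes(N-1)}\otimes V^I\otimes V^J$ let $D_\nu$ denote the action of these operators on the $\nu$-th factor $\Re$, with $D_\nu(U_\nu)\in\mathcal G\otimes\mathrm{End}(W^{IJ}_N)$ standing for $D(U)$ and $D_\nu(\iota_\nu(\xi))$ for $D(\iota_1(\xi))$; let $\vartheta_1=\epsilon$, let $\vartheta_\nu$ be the tensor product (via $\Delta$) of the representations $D_\mu\circ\iota_0$ of $\mathcal G$, $\mu=1,\dots,\nu-1$ in this order, and let $\tau^I\boxtimes\tau^J=(\tau^I\otimes\tau^J)\circ\Delta$ on $V^I\otimes V^J$. **Theorem.** For every $N\ge1$: 1. There is a unique $*$-operation (antilinear, anti-multiplicative, involutive) on $\mathcal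 K_N$ such that $\iota_n(\xi)^*=\iota_n(\xi^*)$ and $J_n^*=S_n^{-1}J_n^{-1}S_{n-1}$ for all $n$. 2. For all $I,J$ there is a unique representation $D^{IJ}_N$ of $\mathcal K_N$ on $W^{IJ}_N$ such that $$\begin{aligned}D^{IJ}_N(U_\nu)&=(\mathrm{id}\otimes\vartheta_\nu)(R^{-1})\,D_\nu(U_\nu),& D^{IJ}_N(\iota_\nu(\xi))&=D_\nu(\iota_\nu(\xi))\quad(1\le\nu\le N-1),\\ D^{IJ}_N(M)&=(\mathrm{id}\otimes\vartheta_N)(R^{-1})\,(\mathrm{id}\otimes\tau^I)(R'R)\,(\mathrm{id}\otimes\vartheta_N)(R),& D^{IJ}_N(\iota_0(\xi))&=(\vartheta_N\otimes(\tau^I\boxtimes\tau^J))(\Delta(\xi)).\end{aligned}$$ 3. Each $D^{IJ}_N$ is irreducible, and $W^{IJ}_N$ carries a Hilbert space inner product with respect to which $D^{IJ}_N$ is a $*$-representation. 4. Every (unital) $*$-representation of $\mathcal K_N$ by bounded operators on a Hilbert space is an orthogonal Hilbert space direct sum of subrepresentations, each of which is unitarily equivalent to some $D^{IJ}_N$.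 -/

import Mathlib

open scoped TensorProduct

universe u v w x

noncomputable section

namespace LatticeCurrent

/-! ## Leg placement in tensor products

`A` is an arbitrary algebra; a first factor `G` plays the role of the auxiliary copy of `G`. -/

section Legs

variable (G : Type u) [Ring G] [HopfAlgebra ℂ G] (A : Type v) [Ring A] [Algebra ℂ A]

/-- `a ⊗ x ↦ a ⊗ 1 ⊗ x`. -/
def leg₁ : G ⊗[ℂ] A →ₐ[ℂ] G ⊗[ℂ] (G ⊗[ℂ] A) :=
  Algebra.TensorProduct.map (AlgHom.id ℂ G) Algebra.TensorProduct.includeRight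

/-- `a ⊗ x ↦ 1 ⊗ a ⊗ x`. -/
def leg₂ : G ⊗[ℂ] A →ₐ[ℂ] G ⊗[ℂ] (G ⊗[ℂ] A) :=
  Algebra.TensorProduct.includeRight

/-- `a ⊗ b ↦ a ⊗ b ⊗ 1`. -/
def aux : G ⊗[ℂ] G →ₐ[ℂ] G ⊗[ℂ] (G ⊗[ℂ] A) :=
  Algebra.TensorProduct.map (AlgHom.id ℂ G) Algebra.TensorProduct.includeLeft

/-- `Δ ⊗ id`, the coproduct acting on the auxiliary factor. -/
def comulAux : G ⊗[ℂ] A →ₐ[ℂ] G ⊗[ℂ] (G ⊗[ℂ] A) :=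
  (Algebra.TensorProduct.assoc ℂ ℂ ℂ G G A).toAlgHom.comp
    (Algebra.TensorProduct.map (Bialgebra.comulAlgHom ℂ G) (AlgHom.id ℂ A))

/-- The flip `σ(a ⊗ b) = b ⊗ a`, written `X' = σ(X)`. -/
def flipTensor : G ⊗[ℂ] G →ₐ[ℂ] G ⊗[ℂ] G :=
  (Algebra.TensorProduct.comm ℂ G G).toAlgHom

variable {G A}

/-- The `π`-component `(π ⊗ id)(X) ∈ A` of `X ∈ G ⊗ A`. -/
def component (π : Module.Dual ℂ G) : G ⊗[ℂ] A →ₗ[ℂ] A :=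
  (TensorProduct.lid ℂ A).toLinearMap ∘ₗ LinearMap.rTensor A π

/-- `(id ⊗ f)(Δ(ξ)) ∈ G ⊗ A` for a linear map `f : G → A`. -/
def comulSite (f : G →ₗ[ℂ] A) : G →ₗ[ℂ] G ⊗[ℂ] A :=
  LinearMap.lTensor G f ∘ₗ Coalgebra.comul

/-- The convolution product `ξ ↦ f(ξ₁) g(ξ₂)`. When `f` and `g` act on different tensor factors
this is the tensor product `f ⊠ g` of representations. -/
def conv (f g : G →ₗ[ℂ] A) : G →ₗ[ℂ] A :=
  LinearMap.mul' ℂ A ∘ₗ TensorProduct.map f g ∘ₗ Coalgebra.comul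

/-- `conv (… conv (conv ε (f 0)) (f 1) …) (f (k - 1))`; for `k = 0` the trivial representation. -/
def iterConv (f : ℕ → (G →ₗ[ℂ] A)) : ℕ → (G →ₗ[ℂ] A)
  | 0 => Algebra.linearMap ℂ A ∘ₗ Coalgebra.counit
  | k + 1 => conv (iterConv f k) (f k)

/-- The element of `G ⊗ A` whose `π`-component is `f π`, for every `π` in the dual of `G`. -/
def ofComponents [Module.Finite ℂ G] (f : Module.Dual ℂ G →ₗ[ℂ] A) : G ⊗[ℂ] A :=
  ∑ i, Module.finBasis ℂ G i ⊗ₜ[ℂ] f ((Module.finBasis ℂ G).coord i)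

end Legs

/-! ## Ribbon Hopf *-algebras -/

/-- `u = ∑ S(r²) r¹` for `X = ∑ r¹ ⊗ r²`. -/
def drinfeldElement {G : Type u} [Ring G] [HopfAlgebra ℂ G] (X : G ⊗[ℂ] G) : G :=
  LinearMap.mul' ℂ G (LinearMap.rTensor G (HopfAlgebra.antipode ℂ) (flipTensor G X))

/-- A ribbon Hopf *-algebra structure on the Hopf algebra `G` with involution `star`: a universal
`R`-matrix, a ribbon element `v`, and their compatibility with the involution. The involution of
`G ⊗ G` is `(ξ ⊗ η)^* = ξ^* ⊗ η^*`, and `Δ(ξ)^* = Δ'(ξ^*)`. -/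
structure RibbonStar (G : Type u) [Ring G] [HopfAlgebra ℂ G] [StarRing G] [StarModule ℂ G] where
  /-- the universal `R`-matrix -/
  R : (G ⊗[ℂ] G)ˣ
  /-- the ribbon element -/
  v : Gˣ
  R_comul : ∀ ξ : G, (R : G ⊗[ℂ] G) * Coalgebra.comul (R := ℂ) ξ =
    flipTensor G (Coalgebra.comul (R := ℂ) ξ) * R
  /-- `(id ⊗ Δ)(R) = R₁₃ R₁₂` -/
  comul_right : LinearMap.lTensor G (Coalgebra.comul (R := ℂ) (A := G)) (R : G ⊗[ℂ] G) =
    leg₁ G G R * aux G G R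
  /-- `(Δ ⊗ id)(R) = R₁₃ R₂₃` -/
  comul_left : comulAux G G R = leg₁ G G R * leg₂ G G R
  v_central : ∀ ξ : G, (v : G) * ξ = ξ * v
  /-- `v² = u S(u)` -/
  v_sq : (v : G) * v =
    drinfeldElement (R : G ⊗[ℂ] G) * HopfAlgebra.antipode ℂ (drinfeldElement (R : G ⊗[ℂ] G))
  antipode_v : HopfAlgebra.antipode ℂ (v : G) = v
  counit_v : Coalgebra.counit (R := ℂ) (v : G) = 1
  /-- `R' R = (v ⊗ v) Δ(v⁻¹)` -/
  ribbon : flipTensor G R * R = ((v : G) ⊗ₜ[ℂ] (v : G)) * Coalgebra.comul (R := ℂ) ((v⁻¹ : Gˣ) : G)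
  /-- `R^* = (R⁻¹)'` -/
  star_R : star (R : G ⊗[ℂ] G) = flipTensor G ((R⁻¹ : (G ⊗[ℂ] G)ˣ) : G ⊗[ℂ] G)
  star_comul : ∀ ξ : G, star (Coalgebra.comul (R := ℂ) ξ) =
    flipTensor G (Coalgebra.comul (R := ℂ) (star ξ))
  v_unitary : (v : G) ∈ unitary G
  /-- the element `g⁻¹ = v⁻¹ ∑ S(r²) r¹`, equivalently `g`, is unitary -/
  g_unitary : ((v⁻¹ : Gˣ) : G) * drinfeldElement (R : G ⊗[ℂ] G) ∈ unitary G

/-- A representation is irreducible if it is nonzero and has no proper invariant subspace. -/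
def IsIrreducibleRep {A : Type u} [Ring A] [Algebra ℂ A] {W : Type v} [AddCommGroup W] [Module ℂ W]
    (ρ : A →ₐ[ℂ] Module.End ℂ W) : Prop :=
  Nontrivial W ∧ ∀ p : Submodule ℂ W, (∀ a : A, ∀ x ∈ p, ρ a x ∈ p) → p = ⊥ ∨ p = ⊤

/-- `τ` is a list of representatives, on Hilbert spaces `V I`, of the equivalence classes of
irreducible representations of the *-algebra `G`. -/
structure IsIrrepList {G : Type u} [Ring G] [Algebra ℂ G] [StarRing G]
    {Λ : Type w} (V : Λ → Type v) [∀ I, NormedAddCommGroup (V I)] [∀ I, InnerProductSpace ℂ (V I)]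
    (τ : ∀ I, G →ₐ[ℂ] Module.End ℂ (V I)) : Prop where
  irreducible : ∀ I, IsIrreducibleRep (τ I)
  star : ∀ I (ξ : G) (x y : V I), inner ℂ (τ I (star ξ) x) y = inner ℂ x (τ I ξ y)
  inequivalent : ∀ I J, (∃ e : V I ≃ₗ[ℂ] V J, ∀ (ξ : G) (x : V I), e (τ I ξ x) = τ J ξ (e x)) → I = J
  complete : ∀ (M : Type u) [AddCommGroup M] [Module ℂ M] (ρ : G →ₐ[ℂ] Module.End ℂ M),
    IsIrreducibleRep ρ → ∃ I, ∃ e : M ≃ₗ[ℂ] V I, ∀ (ξ : G) (x : M), e (ρ ξ x) = τ I ξ (e x)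

/-- `τ ⊗ τ' : G ⊗ G → End(V ⊗ V')`. -/
def pairRep {G : Type u} [Ring G] [Algebra ℂ G] {V V' : Type v} [AddCommGroup V] [Module ℂ V]
    [AddCommGroup V'] [Module ℂ V'] (τ : G →ₐ[ℂ] Module.End ℂ V) (τ' : G →ₐ[ℂ] Module.End ℂ V') :
    G ⊗[ℂ] G →ₐ[ℂ] Module.End ℂ (V ⊗[ℂ] V') :=
  (Module.endTensorEndAlgHom (R := ℂ) (A := ℂ)).comp (Algebra.TensorProduct.map τ τ')

namespace RibbonStar

variable {G : Type u} [Ring G] [HopfAlgebra ℂ G] [StarRing G] [StarModule ℂ G] (𝓖 : RibbonStar G)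

/-- The grouplike element `g`, with `g⁻¹ = v⁻¹ ∑ S(r²) r¹`. -/
def g : G := Ring.inverse (((𝓖.v⁻¹ : Gˣ) : G) * drinfeldElement (𝓖.R : G ⊗[ℂ] G))

/-- The matrix `S_{IJ} = (tr_q^I ⊗ tr_q^J)(R'R)`, where `tr_q^I(X) = Tr(X τ^I(g))`. A nonzero
overall normalization factor is irrelevant for its invertibility. -/
def sMatrix {Λ : Type w} {V : Λ → Type v} [∀ I, AddCommGroup (V I)] [∀ I, Module ℂ (V I)]
    (τ : ∀ I, G →ₐ[ℂ] Module.End ℂ (V I)) : Matrix Λ Λ ℂ :=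
  Matrix.of fun I J => LinearMap.trace ℂ (V I ⊗[ℂ] V J)
    (pairRep (τ I) (τ J) (flipTensor G 𝓖.R * 𝓖.R * (𝓖.g ⊗ₜ[ℂ] 𝓖.g)))

/-- `S = Δ(κ⁻¹) (κ ⊗ κ) R⁻¹`. -/
def twist (κ : Gˣ) : (G ⊗[ℂ] G)ˣ :=
  Units.map (Bialgebra.comulAlgHom ℂ G : G →* G ⊗[ℂ] G) κ⁻¹ *
    (Units.map (Algebra.TensorProduct.includeLeft : G →ₐ[ℂ] G ⊗[ℂ] G) κ *
      Units.map (Algebra.TensorProduct.includeRight : G →ₐ[ℂ] G ⊗[ℂ] G) κ) * 𝓖.R⁻¹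

/-- `κ` is a central square root of the ribbon element for which `S = Δ(κ⁻¹) (κ ⊗ κ) R⁻¹` is a
positive operator on each Hilbert space `V^I ⊗ V^J`. -/
structure IsAdmissibleRoot {Λ : Type w} {V : Λ → Type v} [∀ I, NormedAddCommGroup (V I)]
    [∀ I, InnerProductSpace ℂ (V I)] (τ : ∀ I, G →ₐ[ℂ] Module.End ℂ (V I)) (κ : Gˣ) : Prop where
  central : ∀ ξ : G, (κ : G) * ξ = ξ * κ
  sq : κ * κ = 𝓖.v
  positive : ∀ I J, (pairRep (τ I) (τ J) (𝓖.twist κ : G ⊗[ℂ] G)).IsPositive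

end RibbonStar

/-! ## The lattice current algebra -/

/-- Free generators: the values of `ι_n` on a basis of `G` and the components of `J_n`, `J_n⁻¹`
with respect to the dual basis (`d = dim G`). -/
inductive Gen (N d : ℕ) : Type
  | site (n : ZMod N) (i : Fin d)
  | link (n : ZMod N) (i : Fin d)
  | linkInv (n : ZMod N) (i : Fin d)

section Algebra

variable {G : Type u} [Ring G] [HopfAlgebra ℂ G] [StarRing G] [StarModule ℂ G] [Module.Finite ℂ G]

variable (G) in
/-- The free algebra on the generators. -/
abbrev Free (N : ℕ) : Type := FreeAlgebra ℂ (Gen N (Module.finrank ℂ G))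

/-- `ι_n : G → Free`, linear. -/
def freeSite (N : ℕ) (n : ZMod N) : G →ₗ[ℂ] Free G N :=
  (Module.finBasis ℂ G).constr ℂ fun i => FreeAlgebra.ι ℂ (Gen.site n i)

variable (G) in
/-- `J_n ∈ G ⊗ Free`. -/
def freeLink (N : ℕ) (n : ZMod N) : G ⊗[ℂ] Free G N :=
  ∑ i, Module.finBasis ℂ G i ⊗ₜ[ℂ] FreeAlgebra.ι ℂ (Gen.link n i)

variable (G) in
/-- `J_n⁻¹ ∈ G ⊗ Free`. -/
def freeLinkInv (N : ℕ) (n : ZMod N) : G ⊗[ℂ] Free G N :=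
  ∑ i, Module.finBasis ℂ G i ⊗ₜ[ℂ] FreeAlgebra.ι ℂ (Gen.linkInv n i)

variable (G) in
/-- The site elements generate the tensor product algebra `G^{⊗ N}`. -/
inductive SiteRel (N : ℕ) : Free G N → Free G N → Prop
  | one (n : ZMod N) : SiteRel N (freeSite N n (1 : G)) 1
  | mul (n : ZMod N) (ξ η : G) :
      SiteRel N (freeSite N n (ξ * η)) (freeSite N n ξ * freeSite N n η)
  | comm (n m : ZMod N) (ξ η : G) (h : n ≠ m) :
      SiteRel N (freeSite N n ξ * freeSite N m η) (freeSite N m η * freeSite N n ξ)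

variable (G) in
/-- Invertibility of `J_n` and the covariance relations, as relations in `G ⊗ K_N`. The first
three covariance relations are those for `N ≥ 2`, the last one is that for `N = 1`. -/
inductive CovRel (N : ℕ) : G ⊗[ℂ] Free G N → G ⊗[ℂ] Free G N → Prop
  | inv_right (n : ZMod N) : CovRel N (freeLink G N n * freeLinkInv G N n) 1
  | inv_left (n : ZMod N) : CovRel N (freeLinkInv G N n * freeLink G N n) 1
  | target (hN : 2 ≤ N) (n : ZMod N) (ξ : G) :
      CovRel N ((1 ⊗ₜ[ℂ] freeSite N n ξ) * freeLink G N n)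
        (freeLink G N n * comulSite (freeSite N n) ξ)
  | source (hN : 2 ≤ N) (n : ZMod N) (ξ : G) :
      CovRel N (comulSite (freeSite N (n - 1)) ξ * freeLink G N n)
        (freeLink G N n * (1 ⊗ₜ[ℂ] freeSite N (n - 1) ξ))
  | far (hN : 2 ≤ N) (n m : ZMod N) (h : m ≠ n) (h' : m ≠ n - 1) (ξ : G) :
      CovRel N ((1 ⊗ₜ[ℂ] freeSite N m ξ) * freeLink G N n)
        (freeLink G N n * (1 ⊗ₜ[ℂ] freeSite N m ξ))
  | loop (hN : N = 1) (n : ZMod N) (ξ : G) :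
      CovRel N (comulSite (freeSite N n) ξ * freeLink G N n)
        (freeLink G N n * comulSite (freeSite N n) ξ)

/-- Functoriality and braid relations, as relations in `G ⊗ G ⊗ K_N`. For `N = 1` functoriality
is `J₁ R J₂ = R Δ(J)`; for `N = 2` the links `n` and `n + 1` have both end points in common, and
the braid relation has one factor `R` for each of them. -/
inductive LinkRel (𝓖 : RibbonStar G) (N : ℕ) :
    G ⊗[ℂ] (G ⊗[ℂ] Free G N) → G ⊗[ℂ] (G ⊗[ℂ] Free G N) → Prop
  | funct (hN : 2 ≤ N) (n : ZMod N) :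
      LinkRel 𝓖 N (leg₁ G _ (freeLink G N n) * leg₂ G _ (freeLink G N n))
        (aux G _ 𝓖.R * comulAux G _ (freeLink G N n))
  | funct_loop (hN : N = 1) (n : ZMod N) :
      LinkRel 𝓖 N (leg₁ G _ (freeLink G N n) * aux G _ 𝓖.R * leg₂ G _ (freeLink G N n))
        (aux G _ 𝓖.R * comulAux G _ (freeLink G N n))
  | far (n m : ZMod N) (h : n ≠ m) (h₁ : n ≠ m + 1) (h₂ : n ≠ m - 1) :
      LinkRel 𝓖 N (leg₁ G _ (freeLink G N n) * leg₂ G _ (freeLink G N m))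
        (leg₂ G _ (freeLink G N m) * leg₁ G _ (freeLink G N n))
  | next (hN : 3 ≤ N) (n : ZMod N) :
      LinkRel 𝓖 N
        (leg₁ G _ (freeLink G N n) * aux G _ 𝓖.R * leg₂ G _ (freeLink G N (n + 1)))
        (leg₂ G _ (freeLink G N (n + 1)) * leg₁ G _ (freeLink G N n))
  | next_two (hN : N = 2) (n : ZMod N) :
      LinkRel 𝓖 N
        (leg₁ G _ (freeLink G N n) * aux G _ 𝓖.R * leg₂ G _ (freeLink G N (n + 1)))
        (leg₂ G _ (freeLink G N (n + 1)) * aux G _ (flipTensor G 𝓖.R) * leg₁ G _ (freeLink G N n))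

/-- The defining relations of `K_N`: all components of the relations above. -/
inductive CurrentRel (𝓖 : RibbonStar G) (N : ℕ) : Free G N → Free G N → Prop
  | site {x y : Free G N} (h : SiteRel G N x y) : CurrentRel 𝓖 N x y
  | cov {X Y : G ⊗[ℂ] Free G N} (h : CovRel G N X Y) (π : Module.Dual ℂ G) :
      CurrentRel 𝓖 N (component π X) (component π Y)
  | link {X Y : G ⊗[ℂ] (G ⊗[ℂ] Free G N)} (h : LinkRel 𝓖 N X Y) (π₁ π₂ : Module.Dual ℂ G) :
      CurrentRel 𝓖 N (component π₂ (component π₁ X)) (component π₂ (component π₁ Y))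

/-- The lattice current algebra `K_N`. -/
def CurrentAlgebra (𝓖 : RibbonStar G) (N : ℕ) : Type := RingQuot (CurrentRel 𝓖 N)

instance (𝓖 : RibbonStar G) (N : ℕ) : Ring (CurrentAlgebra 𝓖 N) :=
  inferInstanceAs (Ring (RingQuot (CurrentRel 𝓖 N)))

instance (𝓖 : RibbonStar G) (N : ℕ) : Algebra ℂ (CurrentAlgebra 𝓖 N) :=
  inferInstanceAs (Algebra ℂ (RingQuot (CurrentRel 𝓖 N)))

namespace CurrentAlgebra

variable (𝓖 : RibbonStar G) (N : ℕ)

/-- The quotient map. -/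
def mk : Free G N →ₐ[ℂ] CurrentAlgebra 𝓖 N := RingQuot.mkAlgHom ℂ (CurrentRel 𝓖 N)

/-- `ι_n : G → K_N`. -/
def site (n : ZMod N) : G →ₗ[ℂ] CurrentAlgebra 𝓖 N := (mk 𝓖 N).toLinearMap ∘ₗ freeSite N n

/-- `J_n ∈ G ⊗ K_N`. -/
def link (n : ZMod N) : G ⊗[ℂ] CurrentAlgebra 𝓖 N :=
  Algebra.TensorProduct.map (AlgHom.id ℂ G) (mk 𝓖 N) (freeLink G N n)

/-- `J_n⁻¹ ∈ G ⊗ K_N`. -/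
def linkInv (n : ZMod N) : G ⊗[ℂ] CurrentAlgebra 𝓖 N :=
  Algebra.TensorProduct.map (AlgHom.id ℂ G) (mk 𝓖 N) (freeLinkInv G N n)

/-- `U_ν = v_a^{1-ν} J_1 ⋯ J_ν ∈ G ⊗ K_N`, for `ν ≥ 1`. -/
def holonomy (ν : ℕ) : G ⊗[ℂ] CurrentAlgebra 𝓖 N :=
  (((𝓖.v⁻¹ ^ (ν - 1) : Gˣ) : G) ⊗ₜ[ℂ] 1) *
    ((List.range ν).map fun k => link 𝓖 N ((k + 1 : ℕ) : ZMod N)).prod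

/-- The left monodromy `M = v_a^{1-N} J_1 ⋯ J_N ∈ G ⊗ K_N`. -/
def monodromy : G ⊗[ℂ] CurrentAlgebra 𝓖 N := holonomy 𝓖 N N

/-- The conjugate linear map `σ` is the *-operation of `K_N`: an involutive anti-automorphism that
extends the involution on the sites and satisfies `J_n^* = S_n⁻¹ J_n⁻¹ S_{n-1}`, with
`S_n = (id ⊗ ι_n)(S)`. Here `(a ⊗ x)^* = a^* ⊗ x^*` in `G ⊗ K_N`. -/
structure IsStarOperation (κ : Gˣ) (σ : CurrentAlgebra 𝓖 N →ₗ⋆[ℂ] CurrentAlgebra 𝓖 N) :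
    Prop where
  mul : ∀ x y, σ (x * y) = σ y * σ x
  involutive : ∀ x, σ (σ x) = x
  site : ∀ n (ξ : G), σ (site 𝓖 N n ξ) = site 𝓖 N n (star ξ)
  link : ∀ n, TensorProduct.map (starLinearEquiv ℂ : G ≃ₗ⋆[ℂ] G).toLinearMap σ (link 𝓖 N n) =
    LinearMap.lTensor G (CurrentAlgebra.site 𝓖 N n) ((𝓖.twist κ)⁻¹ : (G ⊗[ℂ] G)ˣ) *
      linkInv 𝓖 N n *
      LinearMap.lTensor G (CurrentAlgebra.site 𝓖 N (n - 1)) (𝓖.twist κ : G ⊗[ℂ] G)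

end CurrentAlgebra

end Algebra

/-! ## The representation of the holonomies on `Re` -/

section Holonomy

/-- The space `Re`, whose vectors are the `|π⟩` for `π` in the dual of `G`. -/
def Re (G : Type u) [Ring G] [Algebra ℂ G] : Type u := Module.Dual ℂ G

instance (G : Type u) [Ring G] [Algebra ℂ G] : AddCommGroup (Re G) :=
  inferInstanceAs (AddCommGroup (G →ₗ[ℂ] ℂ))

instance (G : Type u) [Ring G] [Algebra ℂ G] : Module ℂ (Re G) :=
  inferInstanceAs (Module ℂ (G →ₗ[ℂ] ℂ))

/-- `π ↦ |π⟩`. -/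
def Re.vec (G : Type u) [Ring G] [Algebra ℂ G] : Module.Dual ℂ G ≃ₗ[ℂ] Re G where
  toFun π := π
  invFun π := π
  map_add' _ _ := rfl
  map_smul' _ _ := rfl

variable {G : Type u} [Ring G] [HopfAlgebra ℂ G] [StarRing G] [StarModule ℂ G]

/-- The twisted product `(π₁ * π₂)(ξ) = (π₁ ⊗ π₂)(R Δ(ξ))` on the dual of `G`. -/
def twistedMul (𝓖 : RibbonStar G) :
    Module.Dual ℂ G →ₗ[ℂ] Module.Dual ℂ G →ₗ[ℂ] Module.Dual ℂ G :=
  (TensorProduct.mk ℂ (Module.Dual ℂ G) (Module.Dual ℂ G)).compr₂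
    (Module.Dual.transpose (LinearMap.mulLeft ℂ (𝓖.R : G ⊗[ℂ] G) ∘ₗ Coalgebra.comul) ∘ₗ
      TensorProduct.dualDistrib ℂ G G)

/-- The components of the holonomy act by `π₁(U)|π₂⟩ = |π₁ * π₂⟩`. -/
def reHol (𝓖 : RibbonStar G) : Module.Dual ℂ G →ₗ[ℂ] Module.End ℂ (Re G) :=
  (Re.vec G).conj.toLinearMap ∘ₗ twistedMul 𝓖

theorem reHol_apply (𝓖 : RibbonStar G) (π₁ π₂ : Module.Dual ℂ G) :
    reHol 𝓖 π₁ (Re.vec G π₂) = Re.vec G (twistedMul 𝓖 π₁ π₂) := rfl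

theorem twistedMul_apply (𝓖 : RibbonStar G) (π₁ π₂ : Module.Dual ℂ G) (ξ : G) :
    twistedMul 𝓖 π₁ π₂ ξ =
      TensorProduct.lid ℂ ℂ (TensorProduct.map π₁ π₂ (𝓖.R * Coalgebra.comul (R := ℂ) ξ)) := rfl

end Holonomy

/-- `ι_1(ξ)|π⟩ = |π(· ξ)⟩`. -/
def reTarget (G : Type u) [Ring G] [HopfAlgebra ℂ G] : G →ₗ[ℂ] Module.End ℂ (Re G) :=
  (Re.vec G).conj.toLinearMap ∘ₗ Module.Dual.transpose ∘ₗ (LinearMap.mul ℂ G).flip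

/-- `ι_0(ξ)|π⟩ = |π(S(ξ) ·)⟩`. -/
def reSource (G : Type u) [Ring G] [HopfAlgebra ℂ G] : G →ₗ[ℂ] Module.End ℂ (Re G) :=
  (Re.vec G).conj.toLinearMap ∘ₗ Module.Dual.transpose ∘ₗ LinearMap.mul ℂ G ∘ₗ
    HopfAlgebra.antipode ℂ

theorem reTarget_apply {G : Type u} [Ring G] [HopfAlgebra ℂ G] (π : Module.Dual ℂ G) (ξ η : G) :
    (Re.vec G).symm (reTarget G ξ (Re.vec G π)) η = π (η * ξ) := rfl

theorem reSource_apply {G : Type u} [Ring G] [HopfAlgebra ℂ G] (π : Module.Dual ℂ G) (ξ η : G) :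
    (Re.vec G).symm (reSource G ξ (Re.vec G π)) η = π (HopfAlgebra.antipode ℂ ξ * η) := rfl

/-! ## The representations `D^{IJ}_N` -/

section Representation

variable {G : Type u} [Ring G] [HopfAlgebra ℂ G] [StarRing G] [StarModule ℂ G] [Module.Finite ℂ G]
  {V V' : Type v} [AddCommGroup V] [Module ℂ V] [AddCommGroup V'] [Module ℂ V']

variable (G V V') in
/-- The carrier space `Re^{⊗(N-1)} ⊗ V^I ⊗ V^J`. -/
abbrev Carrier (N : ℕ) : Type (max u v) :=
  (⨂[ℂ] _ : Fin (N - 1), Re G) ⊗[ℂ] (V ⊗[ℂ] V')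

variable (G V V') in
/-- An operator acting on the `k`-th factor `Re` (the factors are numbered from `0`). -/
def onRe (N : ℕ) (k : Fin (N - 1)) :
    Module.End ℂ (Re G) →ₗ[ℂ] Module.End ℂ (Carrier G V V' N) :=
  LinearMap.rTensorHom (V ⊗[ℂ] V') ∘ₗ
    (PiTensorProduct.mapMultilinear ℂ (fun _ : Fin (N - 1) => Re G) (fun _ => Re G)).toLinearMap (fun _ => LinearMap.id) k

variable (G V V') in
/-- An operator acting on `V^I ⊗ V^J`. -/
def onLast (N : ℕ) : Module.End ℂ (V ⊗[ℂ] V') →ₗ[ℂ] Module.End ℂ (Carrier G V V' N) :=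
  LinearMap.lTensorHom _

variable (G V V') in
/-- `ϑ_{k+1} = (D_1 ⊠ ⋯ ⊠ D_k) ∘ ι_0`, acting on the first `k` factors `Re`, for `k ≤ N - 1`. -/
def tail (N k : ℕ) : G →ₗ[ℂ] Module.End ℂ (Carrier G V V' N) :=
  iterConv (A := Module.End ℂ (Carrier G V V' N)) (fun j => if h : j < N - 1 then onRe G V V' N ⟨j, h⟩ ∘ₗ reSource G else 0) k

/-- The explicit formulas that define `D^{IJ}_N`, for `τ = τ^I` and `τ' = τ^J`. The holonomy with
number `ν = k + 1` acts on the `Re`-factor with index `k`. -/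
structure IsJordanWigner (𝓖 : RibbonStar G) (N : ℕ) (τ : G →ₐ[ℂ] Module.End ℂ V)
    (τ' : G →ₐ[ℂ] Module.End ℂ V')
    (D : CurrentAlgebra 𝓖 N →ₐ[ℂ] Module.End ℂ (Carrier G V V' N)) : Prop where
  /-- `D(U_ν) = (id ⊗ ϑ_ν)(R⁻¹) D_ν(U_ν)` -/
  holonomy : ∀ k : Fin (N - 1),
    Algebra.TensorProduct.map (AlgHom.id ℂ G) D (CurrentAlgebra.holonomy 𝓖 N (k + 1)) =
      LinearMap.lTensor G (tail G V V' N k) ((𝓖.R⁻¹ : (G ⊗[ℂ] G)ˣ) : G ⊗[ℂ] G) *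
        ofComponents (A := Module.End ℂ (Carrier G V V' N)) (onRe G V V' N k ∘ₗ reHol 𝓖)
  /-- `D(M) = (id ⊗ ϑ_N)(R⁻¹) (id ⊗ τ^I)(R'R) (id ⊗ ϑ_N)(R)` -/
  monodromy :
    Algebra.TensorProduct.map (AlgHom.id ℂ G) D (CurrentAlgebra.monodromy 𝓖 N) =
      LinearMap.lTensor G (tail G V V' N (N - 1)) ((𝓖.R⁻¹ : (G ⊗[ℂ] G)ˣ) : G ⊗[ℂ] G) *
        LinearMap.lTensor G (onLast G V V' N ∘ₗ LinearMap.rTensorHom V' ∘ₗ τ.toLinearMap)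
          (flipTensor G 𝓖.R * 𝓖.R) *
        LinearMap.lTensor G (tail G V V' N (N - 1)) (𝓖.R : G ⊗[ℂ] G)
  /-- `D(ι_ν(ξ)) = D_ν(ι_ν(ξ))` -/
  site : ∀ (k : Fin (N - 1)) (ξ : G),
    D (CurrentAlgebra.site 𝓖 N ((k + 1 : ℕ) : ZMod N) ξ) = onRe G V V' N k (reTarget G ξ)
  /-- `D(ι_0(ξ)) = (ϑ_N ⊗ τ^I ⊠ τ^J)(Δ(ξ))` -/
  base : ∀ ξ : G, D (CurrentAlgebra.site 𝓖 N 0 ξ) =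
    conv (tail G V V' N (N - 1))
      (onLast G V V' N ∘ₗ (pairRep τ τ').toLinearMap ∘ₗ Coalgebra.comul) ξ

end Representation

end LatticeCurrent

end

set_option linter.unusedSectionVars false

noncomputable section

namespace LatticeCurrent

open HopfAlgebra (antipode)
open Coalgebra (comul counit)
open Module (End Dual)
open LinearMap (lTensor comp_apply)
open InnerProductSpace (Core)

variable {G : Type u} [Ring G] [HopfAlgebra ℂ G] [StarRing G] [StarModule ℂ G] {Γ : RibbonStar G}
  {A B E F : Type*} [Ring A] [Algebra ℂ A] [Ring B] [Algebra ℂ B] [Ring E] [Algebra ℂ E]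
  [Ring F] [Algebra ℂ F]

/-! ## Evaluation of tensors at commuting homomorphisms -/

section Evaluation

variable {C : Type*} [Ring C] [Algebra ℂ C]

/-- The linear map `f` is a homomorphism of unital algebras. -/
class IsMulMap (f : B →ₗ[ℂ] E) : Prop where
  protected map_one : f 1 = 1
  protected map_mul : ∀ x y, f (x * y) = f x * f y

/-- The ranges of `f` and `g` commute. -/
class Comm {B C E : Type*} [AddCommMonoid B] [Module ℂ B] [AddCommMonoid C] [Module ℂ C] [Ring E]
    [Algebra ℂ E] (f : B →ₗ[ℂ] E) (g : C →ₗ[ℂ] E) : Prop where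
  protected comm : ∀ x y, Commute (f x) (g y)

lemma mm_one (f : B →ₗ[ℂ] E) [h : IsMulMap f] : f 1 = 1 := h.map_one

lemma mm_mul (f : B →ₗ[ℂ] E) [h : IsMulMap f] (x y : B) : f (x * y) = f x * f y := h.map_mul x y

instance (f : B →ₐ[ℂ] E) : IsMulMap f.toLinearMap := ⟨map_one f, map_mul f⟩

instance : IsMulMap (LinearMap.id : B →ₗ[ℂ] B) := ⟨rfl, fun _ _ => rfl⟩

instance (f : B →ₗ[ℂ] C) (g : C →ₗ[ℂ] E) [IsMulMap f] [IsMulMap g] : IsMulMap (g ∘ₗ f) :=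
  ⟨by simp [mm_one], fun x y => by simp [mm_mul]⟩

instance {B C E : Type*} [AddCommMonoid B] [Module ℂ B] [AddCommMonoid C] [Module ℂ C] [Ring E]
    [Algebra ℂ E] (f : B →ₗ[ℂ] E) (g : C →ₗ[ℂ] E) [h : Comm f g] : Comm g f :=
  ⟨fun x y => (h.comm y x).symm⟩

lemma comm_of {B C E : Type*} [AddCommMonoid B] [Module ℂ B] [AddCommMonoid C] [Module ℂ C]
    [Ring E] [Algebra ℂ E] (f : B →ₗ[ℂ] E) (g : C →ₗ[ℂ] E) [h : Comm f g] (x : B) (y : C) :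
    Commute (f x) (g y) := h.comm x y

instance Comm.comp_left {B B' C E : Type*} [AddCommMonoid B] [Module ℂ B] [AddCommMonoid B']
    [Module ℂ B'] [AddCommMonoid C] [Module ℂ C] [Ring E] [Algebra ℂ E] (f : B →ₗ[ℂ] E)
    (k : B' →ₗ[ℂ] B) (g : C →ₗ[ℂ] E) [h : Comm f g] : Comm (f ∘ₗ k) g :=
  ⟨fun x y => h.comm (k x) y⟩

/-- Two commuting maps into `C`, composed with a homomorphism `C → E`. -/
instance Comm.comp_both {B B' C E : Type*} [AddCommMonoid B] [Module ℂ B] [AddCommMonoid B']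
    [Module ℂ B'] [Ring C] [Algebra ℂ C] [Ring E] [Algebra ℂ E] (j : C →ₗ[ℂ] E) [IsMulMap j]
    (f : B →ₗ[ℂ] C) (g : B' →ₗ[ℂ] C) [h : Comm f g] : Comm (j ∘ₗ f) (j ∘ₗ g) :=
  ⟨fun x y => by
    have := (h.comm x y).eq
    simp only [comp_apply, commute_iff_eq, ← mm_mul, this]⟩

/-- `(f · g)(X)`: evaluation of the two tensor factors at `f` and `g`. -/
def ev {B C E : Type*} [AddCommMonoid B] [Module ℂ B] [AddCommMonoid C] [Module ℂ C] [Ring E]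
    [Algebra ℂ E] (f : B →ₗ[ℂ] E) (g : C →ₗ[ℂ] E) : B ⊗[ℂ] C →ₗ[ℂ] E :=
  LinearMap.mul' ℂ E ∘ₗ TensorProduct.map f g

@[simp] lemma ev_tmul {B C E : Type*} [AddCommMonoid B] [Module ℂ B] [AddCommMonoid C]
    [Module ℂ C] [Ring E] [Algebra ℂ E] (f : B →ₗ[ℂ] E) (g : C →ₗ[ℂ] E) (x : B) (y : C) :
    ev f g (x ⊗ₜ y) = f x * g y := by simp [ev]

instance ev_isMulMap (f : B →ₗ[ℂ] E) (g : C →ₗ[ℂ] E) [IsMulMap f] [IsMulMap g] [Comm f g] :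
    IsMulMap (ev f g) where
  map_one := by simp [Algebra.TensorProduct.one_def, mm_one]
  map_mul X Y := by
    induction X with
    | tmul x y =>
      induction Y with
      | zero => simp
      | add Y Y' h h' => simp only [mul_add, map_add, h, h']
      | tmul x' y' =>
        simp only [Algebra.TensorProduct.tmul_mul_tmul, ev_tmul, mm_mul, mul_assoc]
        rw [← mul_assoc (f x'), (comm_of f g x' y).eq, mul_assoc]
    | _ => simp_all [add_mul]

lemma commute_ev {B C E : Type*} [AddCommMonoid B] [Module ℂ B] [AddCommMonoid C] [Module ℂ C]
    [Ring E] [Algebra ℂ E] (f : B →ₗ[ℂ] E) (g : C →ₗ[ℂ] E) (X : B ⊗[ℂ] C) (z : E)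
    (hf : ∀ x, Commute (f x) z) (hg : ∀ x, Commute (g x) z) : Commute (ev f g X) z := by
  induction X with
  | zero => simp
  | add X Y h h' => simpa using h.add_left h'
  | tmul x y => simpa using (hf x).mul_left (hg y)

instance Comm.ev_left {B C B' E : Type*} [AddCommMonoid B] [Module ℂ B] [AddCommMonoid C]
    [Module ℂ C] [AddCommMonoid B'] [Module ℂ B'] [Ring E] [Algebra ℂ E] (f : B →ₗ[ℂ] E)
    (g : C →ₗ[ℂ] E) (h : B' →ₗ[ℂ] E) [Comm f h] [Comm g h] : Comm (ev f g) h :=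
  ⟨fun X z => commute_ev f g X _ (fun x => comm_of f h x z) (fun x => comm_of g h x z)⟩

lemma ev_eq_of_eq {B C E : Type*} [AddCommMonoid B] [Module ℂ B] [AddCommMonoid C] [Module ℂ C]
    [Ring E] [Algebra ℂ E] {B' C' : Type*} [AddCommMonoid B'] [Module ℂ B'] [AddCommMonoid C']
    [Module ℂ C'] (f : B →ₗ[ℂ] E) (g : C →ₗ[ℂ] E) (k : B' →ₗ[ℂ] B) (l : C' →ₗ[ℂ] C)
    (X : B' ⊗[ℂ] C') : ev f g (TensorProduct.map k l X) = ev (f ∘ₗ k) (g ∘ₗ l) X := by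
  induction X with
  | tmul x y => simp
  | _ => simp_all

/-- A homomorphism can be pulled into an evaluation. -/
lemma map_ev {B C D E : Type*} [AddCommMonoid B] [Module ℂ B] [AddCommMonoid C] [Module ℂ C]
    [Ring D] [Algebra ℂ D] [Ring E] [Algebra ℂ E] (j : D →ₗ[ℂ] E) [IsMulMap j] (f : B →ₗ[ℂ] D)
    (g : C →ₗ[ℂ] D) (X : B ⊗[ℂ] C) : j (ev f g X) = ev (j ∘ₗ f) (j ∘ₗ g) X := by
  induction X with
  | tmul x y => simp [mm_mul]
  | _ => simp_all

/-- Moving an intertwining element through an evaluation, in the second argument. -/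
lemma ev_conj_right {B C E : Type*} [AddCommMonoid B] [Module ℂ B] [AddCommMonoid C]
    [Module ℂ C] [Ring E] [Algebra ℂ E] (f : B →ₗ[ℂ] E) (g g' : C →ₗ[ℂ] E) (z : E)
    (hf : ∀ x, Commute (f x) z) (hg : ∀ x, z * g x = g' x * z) (X : B ⊗[ℂ] C) :
    z * ev f g X = ev f g' X * z := by
  induction X with
  | tmul x y => rw [ev_tmul, ev_tmul, ← mul_assoc, ← (hf x).eq, mul_assoc, hg, mul_assoc]
  | _ => simp_all [mul_add, add_mul]

lemma ev_conj_left {B C E : Type*} [AddCommMonoid B] [Module ℂ B] [AddCommMonoid C]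
    [Module ℂ C] [Ring E] [Algebra ℂ E] (f f' : B →ₗ[ℂ] E) (g : C →ₗ[ℂ] E) (z : E)
    (hf : ∀ x, z * f x = f' x * z) (hg : ∀ x, Commute (g x) z) (X : B ⊗[ℂ] C) :
    z * ev f g X = ev f' g X * z := by
  induction X with
  | tmul x y => rw [ev_tmul, ev_tmul, ← mul_assoc, hf, mul_assoc, ← (hg y).eq, mul_assoc]
  | _ => simp_all [mul_add, add_mul]

lemma ev_comm {B C E : Type*} [AddCommMonoid B] [Module ℂ B] [AddCommMonoid C] [Module ℂ C]
    [Ring E] [Algebra ℂ E] (f : B →ₗ[ℂ] E) (g : C →ₗ[ℂ] E) [Comm f g] (X : B ⊗[ℂ] C) :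
    ev f g X = ev g f (TensorProduct.comm ℂ B C X) := by
  induction X with
  | tmul x y => simp [(comm_of f g x y).eq]
  | _ => simp_all

/-- Evaluation of a threefold tensor. -/
lemma ev_assoc {B C D E : Type*} [AddCommMonoid B] [Module ℂ B] [AddCommMonoid C] [Module ℂ C]
    [AddCommMonoid D] [Module ℂ D] [Ring E] [Algebra ℂ E] (f : B →ₗ[ℂ] E) (g : C →ₗ[ℂ] E)
    (h : D →ₗ[ℂ] E) (X : (B ⊗[ℂ] C) ⊗[ℂ] D) :
    ev f (ev g h) (TensorProduct.assoc ℂ B C D X) = ev (ev f g) h X := by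
  induction X with
  | tmul x y =>
    induction x with
    | zero => simp
    | add X Y h h' => simp only [map_add, TensorProduct.add_tmul, h, h']
    | tmul x z => simp [mul_assoc]
  | _ => simp_all

end Evaluation

section Hopf

lemma conv_apply (f g : G →ₗ[ℂ] E) (ξ : G) : conv f g ξ = ev f g (comul ξ) := rfl

instance (f g : G →ₗ[ℂ] E) [IsMulMap f] [IsMulMap g] [Comm f g] : IsMulMap (conv f g) where
  map_one := by rw [conv_apply, Bialgebra.comul_one, mm_one]
  map_mul x y := by simp only [conv_apply, Bialgebra.comul_mul, mm_mul]

instance Comm.conv_left {B' : Type*} [AddCommMonoid B'] [Module ℂ B'] (f g : G →ₗ[ℂ] E)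
    (h : B' →ₗ[ℂ] E) [Comm f h] [Comm g h] : Comm (conv f g) h :=
  ⟨fun x y => comm_of (ev f g) h (comul x) y⟩

lemma conv_assoc (f g h : G →ₗ[ℂ] E) : conv (conv f g) h = conv f (conv g h) := by
  ext ξ
  have h1 := Coalgebra.coassoc_apply (R := ℂ) ξ
  have h2 : conv f (conv g h) ξ =
      ev f (ev g h) ((comul (R := ℂ) (A := G)).lTensor G (comul ξ)) := by
    rw [lTensor, ev_eq_of_eq]; rfl
  rw [h2, ← h1, ev_assoc, LinearMap.rTensor, ev_eq_of_eq]
  rfl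

variable (G E) in
/-- The trivial representation `ξ ↦ ε(ξ) 1`. -/
def triv : G →ₗ[ℂ] E := Algebra.linearMap ℂ E ∘ₗ counit

@[simp] lemma triv_apply (ξ : G) : triv G E ξ = algebraMap ℂ E (counit ξ) := rfl

instance : IsMulMap (triv G E) := ⟨by simp, fun x y => by simp⟩

instance {B : Type*} [AddCommMonoid B] [Module ℂ B] (f : B →ₗ[ℂ] E) : Comm (triv G E) f :=
  ⟨fun _ _ => Algebra.commutes _ _⟩

lemma conv_triv (f : G →ₗ[ℂ] E) : conv f (triv G E) = f := by
  ext ξ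
  have h := congrArg (ev f (Algebra.linearMap ℂ E)) (Coalgebra.lTensor_counit_comul (R := ℂ) ξ)
  rw [lTensor, ev_eq_of_eq] at h
  exact h.trans (by simp)

lemma triv_conv (f : G →ₗ[ℂ] E) : conv (triv G E) f = f := by
  ext ξ
  have h := congrArg (ev (Algebra.linearMap ℂ E) f) (Coalgebra.rTensor_counit_comul (R := ℂ) ξ)
  rw [LinearMap.rTensor, ev_eq_of_eq] at h
  exact h.trans (by simp)

lemma map_conv {D : Type*} [Ring D] [Algebra ℂ D] (j : D →ₗ[ℂ] E) [IsMulMap j]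
    (f g : G →ₗ[ℂ] D) : j ∘ₗ conv f g = conv (j ∘ₗ f) (j ∘ₗ g) := by
  ext ξ
  exact map_ev j f g _

/-- The antipode is the convolution inverse of a homomorphism. -/
lemma conv_antipode (f : G →ₗ[ℂ] E) [IsMulMap f] : conv f (f ∘ₗ antipode ℂ) = triv G E := by
  ext ξ
  have h := congrArg f (HopfAlgebra.mul_antipode_lTensor_comul_apply (R := ℂ) ξ)
  have h2 : conv f (f ∘ₗ antipode ℂ) ξ = f (LinearMap.mul' ℂ G
      ((antipode ℂ (A := G)).lTensor G (comul ξ))) := by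
    have := map_ev f LinearMap.id (antipode ℂ) (comul (R := ℂ) ξ)
    exact this.symm
  rw [h2, h, Algebra.algebraMap_eq_smul_one, map_smul, mm_one, triv_apply,
    Algebra.algebraMap_eq_smul_one]

lemma antipode_conv (f : G →ₗ[ℂ] E) [IsMulMap f] : conv (f ∘ₗ antipode ℂ) f = triv G E := by
  ext ξ
  have h := congrArg f (HopfAlgebra.mul_antipode_rTensor_comul_apply (R := ℂ) ξ)
  have h2 : conv (f ∘ₗ antipode ℂ) f ξ = f (LinearMap.mul' ℂ G
      ((antipode ℂ (A := G)).rTensor G (comul ξ))) := by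
    have := map_ev f (antipode ℂ) LinearMap.id (comul (R := ℂ) ξ)
    exact this.symm
  rw [h2, h, Algebra.algebraMap_eq_smul_one, map_smul, mm_one, triv_apply,
    Algebra.algebraMap_eq_smul_one]

/-! ### Legs as evaluations -/

variable (G A) in
/-- The embedding of the first tensor factor. -/
def inl : G →ₗ[ℂ] G ⊗[ℂ] A := (Algebra.TensorProduct.includeLeft : G →ₐ[ℂ] G ⊗[ℂ] A).toLinearMap

variable (G A) in
/-- The embedding of the second tensor factor. -/
def inr : A →ₗ[ℂ] G ⊗[ℂ] A := (Algebra.TensorProduct.includeRight : A →ₐ[ℂ] G ⊗[ℂ] A).toLinearMap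

@[simp] lemma inl_apply (x : G) : inl G A x = x ⊗ₜ 1 := rfl
@[simp] lemma inr_apply (x : A) : inr G A x = 1 ⊗ₜ x := rfl

instance : IsMulMap (inl G A) := inferInstanceAs (IsMulMap (AlgHom.toLinearMap _))
instance : IsMulMap (inr G A) := inferInstanceAs (IsMulMap (AlgHom.toLinearMap _))
instance : Comm (inl G A) (inr G A) := ⟨fun x y => by simp [commute_iff_eq]⟩
instance {B : Type*} [AddCommMonoid B] [Module ℂ B] (f : B →ₗ[ℂ] A) :
    Comm (inl G A) (inr G A ∘ₗ f) := ⟨fun x y => by simp [commute_iff_eq]⟩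

lemma ev_inl_inr (X : G ⊗[ℂ] A) : ev (inl G A) (inr G A) X = X := by
  induction X with
  | tmul x y => simp
  | _ => simp_all

lemma ev_inl_inr_comp (f : G →ₗ[ℂ] A) (X : G ⊗[ℂ] G) :
    ev (inl G A) (inr G A ∘ₗ f) X = f.lTensor G X := by
  conv_rhs => rw [← ev_inl_inr (f.lTensor G X), lTensor, ev_eq_of_eq]
  simp

lemma comulSite_eq (f : G →ₗ[ℂ] A) (ξ : G) : comulSite f ξ = conv (inl G A) (inr G A ∘ₗ f) ξ := by
  rw [conv_apply, ev_inl_inr_comp]; rfl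

/-- Evaluation of a threefold tensor, as a homomorphism. -/
def ev₃ (f g : G →ₗ[ℂ] E) (h : A →ₗ[ℂ] E) : G ⊗[ℂ] (G ⊗[ℂ] A) →ₗ[ℂ] E := ev f (ev g h)

instance (f g : G →ₗ[ℂ] E) (h : A →ₗ[ℂ] E) [IsMulMap f] [IsMulMap g] [IsMulMap h] [Comm f g]
    [Comm f h] [Comm g h] : IsMulMap (ev₃ f g h) := inferInstanceAs (IsMulMap (ev f (ev g h)))

section

variable (f g : G →ₗ[ℂ] E) (h : A →ₗ[ℂ] E)

lemma ev₃_aux [IsMulMap h] (X : G ⊗[ℂ] G) : ev₃ f g h (aux G A X) = ev f g X := by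
  have : aux G A X = TensorProduct.map LinearMap.id (inl G A) X := rfl
  rw [this, ev₃, ev_eq_of_eq]
  congr 2
  ext x
  simp [mm_one]

lemma ev₃_leg₁ [IsMulMap g] (X : G ⊗[ℂ] A) : ev₃ f g h (leg₁ G A X) = ev f h X := by
  have : leg₁ G A X = TensorProduct.map LinearMap.id (inr G A) X := rfl
  rw [this, ev₃, ev_eq_of_eq]
  congr 2
  ext x
  simp [mm_one]

lemma ev₃_leg₂ [IsMulMap f] (X : G ⊗[ℂ] A) : ev₃ f g h (leg₂ G A X) = ev g h X := by
  have : leg₂ G A X = (1 : G) ⊗ₜ X := rfl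
  rw [this, ev₃, ev_tmul, mm_one, one_mul]

lemma ev₃_comulAux (X : G ⊗[ℂ] A) : ev₃ f g h (comulAux G A X) = ev (conv f g) h X := by
  have : comulAux G A X = TensorProduct.assoc ℂ G G A
    (TensorProduct.map (comul (R := ℂ)) LinearMap.id X) := rfl
  rw [this, ev₃, ev_assoc, ev_eq_of_eq]
  rfl

end

lemma ev₃_self (X : G ⊗[ℂ] (G ⊗[ℂ] A)) :
    ev₃ (inl G (G ⊗[ℂ] A)) (inr G (G ⊗[ℂ] A) ∘ₗ inl G A) (inr G (G ⊗[ℂ] A) ∘ₗ inr G A) X = X := by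
  rw [ev₃]
  have : ev (inr G (G ⊗[ℂ] A) ∘ₗ inl G A) (inr G (G ⊗[ℂ] A) ∘ₗ inr G A) = inr G (G ⊗[ℂ] A) := by
    ext x y
    simp [Algebra.TensorProduct.tmul_mul_tmul]
  rw [this, ev_inl_inr]

lemma flipTensor_apply (X : G ⊗[ℂ] G) : flipTensor G X = TensorProduct.comm ℂ G G X := rfl

lemma ev_flip (f g : G →ₗ[ℂ] E) [Comm f g] (X : G ⊗[ℂ] G) : ev f g (flipTensor G X) = ev g f X := by
  rw [ev_comm g f, flipTensor_apply]

end Hopf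

/-! ## The universal `R`-matrix at commuting homomorphisms -/

section RMatrix

variable (Γ)

namespace RibbonStar

/-- `(f · g)(R)`. -/
def r (f g : G →ₗ[ℂ] E) : E := ev f g Γ.R.1

/-- `(f · g)(R⁻¹)`. -/
def ri (f g : G →ₗ[ℂ] E) : E := ev f g (Γ.R⁻¹).1

variable (f g h : G →ₗ[ℂ] E)

lemma r_mul_ri [IsMulMap f] [IsMulMap g] [Comm f g] : Γ.r f g * Γ.ri f g = 1 := by
  rw [r, ri, ← mm_mul (ev f g), Units.mul_inv, mm_one]

lemma ri_mul_r [IsMulMap f] [IsMulMap g] [Comm f g] : Γ.ri f g * Γ.r f g = 1 := by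
  rw [r, ri, ← mm_mul (ev f g), Units.inv_mul, mm_one]

lemma r_mul_conv [IsMulMap f] [IsMulMap g] [Comm f g] (ξ : G) :
    Γ.r f g * conv f g ξ = conv g f ξ * Γ.r f g := by
  rw [conv_apply, conv_apply, ← ev_flip f g, r, ← mm_mul (ev f g), ← mm_mul (ev f g), Γ.R_comul]

lemma commute_r {z : E} (hf : ∀ x, Commute (f x) z) (hg : ∀ x, Commute (g x) z) :
    Commute (Γ.r f g) z := commute_ev f g _ z hf hg

lemma commute_ri {z : E} (hf : ∀ x, Commute (f x) z) (hg : ∀ x, Commute (g x) z) :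
    Commute (Γ.ri f g) z := commute_ev f g _ z hf hg

lemma r_mul_ev_conv {C : Type*} [AddCommMonoid C] [Module ℂ C] [IsMulMap f] [IsMulMap g]
    [Comm f g] (k : C →ₗ[ℂ] E) [Comm f k] [Comm g k] (X : G ⊗[ℂ] C) :
    Γ.r f g * ev (conv f g) k X = ev (conv g f) k X * Γ.r f g :=
  ev_conj_left _ _ k _ (fun ξ => Γ.r_mul_conv f g ξ)
    (fun y => (Γ.commute_r f g (fun x => comm_of f k x y) (fun x => comm_of g k x y)).symm) X

lemma r_mul_ev_conv' {C : Type*} [AddCommMonoid C] [Module ℂ C] [IsMulMap f] [IsMulMap g]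
    [Comm f g] (k : C →ₗ[ℂ] E) [Comm f k] [Comm g k] (X : C ⊗[ℂ] G) :
    Γ.r f g * ev k (conv f g) X = ev k (conv g f) X * Γ.r f g :=
  ev_conj_right k _ _ _
    (fun y => (Γ.commute_r f g (fun x => comm_of f k x y) (fun x => comm_of g k x y)).symm)
    (fun ξ => Γ.r_mul_conv f g ξ) X

section

variable [IsMulMap f] [IsMulMap g] [IsMulMap h] [Comm f g] [Comm f h] [Comm g h]

lemma r_conv_left : Γ.r (conv f g) h = Γ.r f h * Γ.r g h := by
  have := congrArg (ev₃ f g h) Γ.comul_left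
  rwa [ev₃_comulAux, mm_mul (ev₃ f g h), ev₃_leg₁, ev₃_leg₂] at this

lemma r_conv_right : Γ.r f (conv g h) = Γ.r f h * Γ.r f g := by
  have := congrArg (ev₃ f g h) Γ.comul_right
  rw [mm_mul (ev₃ f g h), ev₃_leg₁, ev₃_aux] at this
  rw [r, r, r, ← this, ev₃, lTensor, ev_eq_of_eq]
  rfl

lemma ri_conv_left : Γ.ri (conv f g) h = Γ.ri g h * Γ.ri f h := by
  have h1 := Γ.r_mul_ri (conv f g) h
  rw [r_conv_left] at h1
  have h2 : (Γ.ri g h * Γ.ri f h) * (Γ.r f h * Γ.r g h) = 1 := by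
    rw [mul_assoc, ← mul_assoc (Γ.ri f h), ri_mul_r, one_mul, ri_mul_r]
  exact (left_inv_eq_right_inv h2 h1).symm

lemma ri_conv_right : Γ.ri f (conv g h) = Γ.ri f g * Γ.ri f h := by
  have h1 := Γ.r_mul_ri f (conv g h)
  rw [r_conv_right] at h1
  have h2 : (Γ.ri f g * Γ.ri f h) * (Γ.r f h * Γ.r f g) = 1 := by
    rw [mul_assoc, ← mul_assoc (Γ.ri f h), ri_mul_r, one_mul, ri_mul_r]
  exact (left_inv_eq_right_inv h2 h1).symm

/-- The Yang-Baxter equation. -/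
lemma yang_baxter : Γ.r f g * Γ.r f h * Γ.r g h = Γ.r g h * Γ.r f h * Γ.r f g := by
  rw [mul_assoc, ← r_conv_left, ← r_conv_left]
  exact Γ.r_mul_ev_conv f g h _

end

lemma r_triv [IsMulMap f] : Γ.r f (triv G E) = 1 := by
  have h := Γ.r_conv_right f (triv G E) (triv G E)
  rw [conv_triv] at h
  have h2 := congrArg (Γ.ri f (triv G E) * ·) h
  simpa [← mul_assoc, ri_mul_r] using h2.symm

lemma triv_r [IsMulMap f] : Γ.r (triv G E) f = 1 := by
  have h := Γ.r_conv_left (triv G E) (triv G E) f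
  rw [conv_triv] at h
  have h2 := congrArg (Γ.ri (triv G E) f * ·) h
  simpa [← mul_assoc, ri_mul_r] using h2.symm

lemma ri_triv [IsMulMap f] : Γ.ri f (triv G E) = 1 := by
  simpa [Γ.r_triv f] using Γ.r_mul_ri f (triv G E)

lemma triv_ri [IsMulMap f] : Γ.ri (triv G E) f = 1 := by
  simpa [Γ.triv_r f] using Γ.r_mul_ri (triv G E) f

/-- A central invertible element `z` with `R'R = (z ⊗ z) Δ(z⁻¹)`. -/
structure IsRibbon (z : Gˣ) : Prop where
  central : ∀ ξ : G, (z : G) * ξ = ξ * z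
  eq : flipTensor G Γ.R * Γ.R = ((z : G) ⊗ₜ[ℂ] (z : G)) * comul (R := ℂ) ((z⁻¹ : Gˣ) : G)

lemma isRibbon_v : Γ.IsRibbon Γ.v := ⟨Γ.v_central, Γ.ribbon⟩

lemma mm_unit_mul_inv (f : B →ₗ[ℂ] E) [IsMulMap f] (z : Bˣ) :
    f (z : B) * f ((z⁻¹ : Bˣ) : B) = 1 := by rw [← mm_mul, Units.mul_inv, mm_one]

lemma mm_unit_inv_mul (f : B →ₗ[ℂ] E) [IsMulMap f] (z : Bˣ) :
    f ((z⁻¹ : Bˣ) : B) * f (z : B) = 1 := by rw [← mm_mul, Units.inv_mul, mm_one]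

lemma central_inv {z : Gˣ} (hz : ∀ ξ : G, (z : G) * ξ = ξ * z) (ξ : G) :
    ((z⁻¹ : Gˣ) : G) * ξ = ξ * ((z⁻¹ : Gˣ) : G) := by
  have : Commute (z : G) ξ := hz ξ
  exact this.units_inv_left

lemma commute_central {z : G} (hz : ∀ ξ : G, z * ξ = ξ * z) [IsMulMap f] (x : G) :
    Commute (f x) (f z) := by
  rw [commute_iff_eq, ← mm_mul, ← mm_mul, hz]

lemma IsRibbon.ev_eq {Γ : RibbonStar G} {z : Gˣ} (hz : Γ.IsRibbon z) [IsMulMap f] [IsMulMap g]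
    [Comm f g] : Γ.r g f * Γ.r f g = f z * g z * conv f g ((z⁻¹ : Gˣ) : G) := by
  have h := congrArg (ev f g) hz.eq
  rwa [mm_mul (ev f g), mm_mul (ev f g), ev_flip, ev_tmul, ← conv_apply] at h

/-! ### The twist `S` -/

variable (κ : Gˣ)

/-- `(f · g)(S)`. -/
def s (f g : G →ₗ[ℂ] E) : E := ev f g (Γ.twist κ).1

/-- `(f · g)(S⁻¹)`. -/
def si (f g : G →ₗ[ℂ] E) : E := ev f g ((Γ.twist κ)⁻¹).1

/-- `κ` is a central square root of the ribbon element. -/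
structure IsRoot (κ : Gˣ) : Prop where
  central : ∀ ξ : G, (κ : G) * ξ = ξ * κ
  sq : κ * κ = Γ.v

lemma s_eq [IsMulMap f] [IsMulMap g] [Comm f g] : Γ.s κ f g =
    conv f g (κ⁻¹).1 * (f (κ : G) * g (κ : G)) * Γ.ri f g := by
  simp only [s, twist, Units.val_mul, mm_mul (ev f g), Units.coe_map, ri]
  congr 2
  simp [mm_one]

lemma s_mul_si [IsMulMap f] [IsMulMap g] [Comm f g] : Γ.s κ f g * Γ.si κ f g = 1 := by
  rw [s, si, ← mm_mul (ev f g), Units.mul_inv, mm_one]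

lemma si_mul_s [IsMulMap f] [IsMulMap g] [Comm f g] : Γ.si κ f g * Γ.s κ f g = 1 := by
  rw [s, si, ← mm_mul (ev f g), Units.inv_mul, mm_one]

lemma commute_s {z : E} (hf : ∀ x, Commute (f x) z) (hg : ∀ x, Commute (g x) z) :
    Commute (Γ.s κ f g) z := commute_ev f g _ z hf hg

lemma commute_si {z : E} (hf : ∀ x, Commute (f x) z) (hg : ∀ x, Commute (g x) z) :
    Commute (Γ.si κ f g) z := commute_ev f g _ z hf hg

variable {κ}

section

variable {Γ} (hκ : Γ.IsRoot κ) [IsMulMap f] [IsMulMap g] [IsMulMap h] [Comm f g] [Comm f h]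
  [Comm g h]
include hκ

omit [IsMulMap h] [Comm f h] [Comm g h] in
lemma IsRoot.si_eq : Γ.si κ f g =
    Γ.r f g * (f (κ⁻¹).1 * g (κ⁻¹).1) * conv f g (κ : G) := by
  have h1 := Γ.si_mul_s f g κ
  refine left_inv_eq_right_inv h1 ?_
  rw [s_eq]
  have e1 := mm_unit_mul_inv f κ
  have e2 := mm_unit_mul_inv g κ
  have e3 := mm_unit_inv_mul (conv f g) κ
  have e4 : g (κ : G) * f (κ⁻¹).1 = f (κ⁻¹).1 * g κ := (comm_of g f _ _).eq
  have e5 := Γ.ri_mul_r f g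
  linear_combination (norm := noncomm_ring)
    conv f g (κ⁻¹).1 * (f (κ : G) * g (κ : G)) * e5 *
      ((f (κ⁻¹).1 * g (κ⁻¹).1) * conv f g (κ : G)) +
    conv f g (κ⁻¹).1 * f (κ : G) * e4 * g (κ⁻¹).1 * conv f g (κ : G) +
    conv f g (κ⁻¹).1 * e1 * (g (κ : G) * g (κ⁻¹).1) * conv f g (κ : G) +
    conv f g (κ⁻¹).1 * e2 * conv f g (κ : G) + e3

omit [IsMulMap h] [Comm f h] [Comm g h] in
lemma IsRoot.commute_r (X : G ⊗[ℂ] G) : Commute (f (κ : G)) (ev f g X) :=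
  (commute_ev f g X _ (fun x => commute_central f hκ.central x) (fun x => comm_of g f x _)).symm

omit [IsMulMap h] [Comm f h] [Comm g h] in
lemma IsRoot.commute_inv_r (X : G ⊗[ℂ] G) : Commute (f (κ⁻¹).1) (ev f g X) :=
  (commute_ev f g X _ (fun x => commute_central f (central_inv hκ.central) x)
    (fun x => comm_of g f x _)).symm

omit [IsMulMap h] [Comm f h] [Comm g h] in
lemma IsRoot.commute_r' (X : G ⊗[ℂ] G) : Commute (g (κ : G)) (ev f g X) :=
  (commute_ev f g X _ (fun x => comm_of f g x _) (fun x => commute_central g hκ.central x)).symm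

omit [IsMulMap h] [Comm f h] [Comm g h] in
lemma IsRoot.commute_inv_r' (X : G ⊗[ℂ] G) : Commute (g (κ⁻¹).1) (ev f g X) :=
  (commute_ev f g X _ (fun x => comm_of f g x _)
    (fun x => commute_central g (central_inv hκ.central) x)).symm

lemma IsRoot.si_assoc : Γ.si κ f g * Γ.si κ (conv f g) h = Γ.si κ g h * Γ.si κ f (conv g h) := by
  rw [hκ.si_eq f g, hκ.si_eq (conv f g) h, hκ.si_eq g h, hκ.si_eq f (conv g h), conv_assoc]
  have e1 : conv f g (κ : G) * Γ.r (conv f g) h = Γ.r (conv f g) h * conv f g (κ : G) :=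
    hκ.commute_r (conv f g) h _
  have e2 : conv g h (κ : G) * Γ.r f (conv g h) = Γ.r f (conv g h) * conv g h (κ : G) :=
    hκ.commute_r' f (conv g h) _
  have e3 := mm_unit_mul_inv (conv f g) κ
  have e4 := mm_unit_mul_inv (conv g h) κ
  have e5 : f (κ⁻¹).1 * Γ.r f h = Γ.r f h * f (κ⁻¹).1 := hκ.commute_inv_r f h _
  have e6 : g (κ⁻¹).1 * Γ.r g h = Γ.r g h * g (κ⁻¹).1 := hκ.commute_inv_r g h _
  have e7 : h (κ⁻¹).1 * Γ.r f h = Γ.r f h * h (κ⁻¹).1 := hκ.commute_inv_r' f h _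
  have e8 : g (κ⁻¹).1 * Γ.r f g = Γ.r f g * g (κ⁻¹).1 := hκ.commute_inv_r' f g _
  have c1 : f (κ⁻¹).1 * Γ.r g h = Γ.r g h * f (κ⁻¹).1 :=
    (Γ.commute_r g h (fun x => comm_of g f x _) (fun x => comm_of h f x _)).symm
  have c2 : g (κ⁻¹).1 * Γ.r f h = Γ.r f h * g (κ⁻¹).1 :=
    (Γ.commute_r f h (fun x => comm_of f g x _) (fun x => comm_of h g x _)).symm
  have c3 : h (κ⁻¹).1 * Γ.r f g = Γ.r f g * h (κ⁻¹).1 :=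
    (Γ.commute_r f g (fun x => comm_of f h x _) (fun x => comm_of g h x _)).symm
  have c4 : f (κ⁻¹).1 * g (κ⁻¹).1 = g (κ⁻¹).1 * f (κ⁻¹).1 :=
    comm_of f g _ _
  have c5 : f (κ⁻¹).1 * h (κ⁻¹).1 = h (κ⁻¹).1 * f (κ⁻¹).1 :=
    comm_of f h _ _
  have y := Γ.yang_baxter f g h
  have l := Γ.r_conv_left f g h
  have m := Γ.r_conv_right f g h
  generalize conv f (conv g h) (κ : G) = C at *
  have L : Γ.r f g * (f (κ⁻¹).1 * g (κ⁻¹).1) * conv f g (κ : G) *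
      (Γ.r (conv f g) h * (conv f g (κ⁻¹).1 * h (κ⁻¹).1) * C) =
      Γ.r f g * Γ.r f h * Γ.r g h * (f (κ⁻¹).1 * g (κ⁻¹).1 *
        h (κ⁻¹).1) * C := by
    simp only [mul_assoc]
    rw [← mul_assoc (conv f g (κ : G)), e1, mul_assoc, ← mul_assoc (conv f g (κ : G)), e3, one_mul,
      l]
    simp only [mul_assoc]
    rw [← mul_assoc (g _) (Γ.r f h), c2, mul_assoc, ← mul_assoc (g _) (Γ.r g h), e6, mul_assoc,
      ← mul_assoc (f _) (Γ.r f h), e5, mul_assoc, ← mul_assoc (f _) (Γ.r g h), c1, mul_assoc]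
  have M : Γ.r g h * (g (κ⁻¹).1 * h (κ⁻¹).1) * conv g h (κ : G) *
      (Γ.r f (conv g h) * (f (κ⁻¹).1 * conv g h (κ⁻¹).1) * C) =
      Γ.r g h * Γ.r f h * Γ.r f g * (f (κ⁻¹).1 * g (κ⁻¹).1 *
        h (κ⁻¹).1) * C := by
    have c6 : f (κ⁻¹).1 * conv g h (κ⁻¹).1 =
      conv g h (κ⁻¹).1 * f (κ⁻¹).1 := comm_of f (conv g h) _ _
    rw [c6]
    simp only [mul_assoc]
    rw [← mul_assoc (conv g h (κ : G)), e2, mul_assoc, ← mul_assoc (conv g h (κ : G)), e4, one_mul,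
      m]
    simp only [mul_assoc]
    rw [← mul_assoc (h _) (Γ.r f h), e7, mul_assoc, ← mul_assoc (h _) (Γ.r f g), c3, mul_assoc,
      ← mul_assoc (g _) (Γ.r f h), c2, mul_assoc, ← mul_assoc (g _) (Γ.r f g), e8, mul_assoc,
      ← mul_assoc (h _) (f _), ← c5, mul_assoc, ← mul_assoc (g _) (f _), ← c4, mul_assoc]
  rw [L, M, y]

omit [IsMulMap h] [Comm f h] [Comm g h] in
/-- `S R = Δ(κ⁻¹) (κ ⊗ κ)`. -/
lemma IsRoot.s_mul_r : Γ.s κ f g * Γ.r f g =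
    conv f g (κ⁻¹).1 * (f (κ : G) * g (κ : G)) := by
  rw [s_eq, mul_assoc, ri_mul_r, mul_one]

omit [IsMulMap h] [Comm f h] [Comm g h] in
lemma IsRoot.sq_ev : (conv f g (κ⁻¹).1 * (f (κ : G) * g (κ : G))) *
    (conv f g (κ⁻¹).1 * (f (κ : G) * g (κ : G))) = Γ.r g f * Γ.r f g := by
  have hv : f (κ : G) * f (κ : G) = f Γ.v.1 := by rw [← mm_mul, ← hκ.sq, Units.val_mul]
  have hv' : g (κ : G) * g (κ : G) = g Γ.v.1 := by rw [← mm_mul, ← hκ.sq, Units.val_mul]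
  have hv2 : conv f g (κ⁻¹).1 * conv f g (κ⁻¹).1 = conv f g (Γ.v⁻¹).1 := by
    rw [← mm_mul, ← hκ.sq, mul_inv_rev, Units.val_mul]
  have c1 : f (κ : G) * conv f g (κ⁻¹).1 = conv f g (κ⁻¹).1 * f (κ : G) :=
    hκ.commute_r f g _
  have c2 : g (κ : G) * conv f g (κ⁻¹).1 = conv f g (κ⁻¹).1 * g (κ : G) :=
    hκ.commute_r' f g _
  have c3 : g (κ : G) * f (κ : G) = f (κ : G) * g (κ : G) := comm_of g f _ _
  have c4 : f Γ.v.1 * conv f g (Γ.v⁻¹).1 = conv f g (Γ.v⁻¹).1 * f Γ.v.1 :=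
    ((commute_ev f g _ _ (fun x => commute_central f Γ.v_central x)
      (fun x => comm_of g f x _)).symm)
  have c5 : g Γ.v.1 * conv f g (Γ.v⁻¹).1 = conv f g (Γ.v⁻¹).1 * g Γ.v.1 :=
    ((commute_ev f g _ _ (fun x => comm_of f g x _)
      (fun x => commute_central g Γ.v_central x)).symm)
  rw [Γ.isRibbon_v.ev_eq f g, mul_assoc (f _), c5, ← mul_assoc (f _), c4, ← hv, ← hv', ← hv2]
  simp only [mul_assoc]
  rw [← mul_assoc (g _) (conv f g _), c2, mul_assoc, ← mul_assoc (f _) (conv f g _), c1, mul_assoc,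
    ← mul_assoc (g _) (f _), c3, mul_assoc]

omit [IsMulMap h] [Comm f h] [Comm g h] in
lemma IsRoot.s_mul_r_mul_s : Γ.s κ f g * Γ.r f g * Γ.s κ f g = Γ.r g f := by
  have h := congrArg (· * Γ.ri f g) (hκ.sq_ev f g)
  simp only [← hκ.s_mul_r f g] at h
  simpa only [mul_assoc, r_mul_ri, mul_one] using h

omit [IsMulMap h] [Comm f h] [Comm g h] in
lemma IsRoot.s_flip : Γ.s κ g f = Γ.si κ f g := by
  have h := hκ.sq_ev g f
  have h1 : conv f g (κ : G) * Γ.ri f g = Γ.ri f g * conv g f (κ : G) := by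
    have := Γ.r_mul_conv f g (κ : G)
    have e1 := Γ.r_mul_ri f g
    have e2 := Γ.ri_mul_r f g
    calc conv f g (κ : G) * Γ.ri f g = Γ.ri f g * (Γ.r f g * conv f g (κ : G)) * Γ.ri f g := by
          rw [← mul_assoc, e2, one_mul]
      _ = _ := by rw [this, mul_assoc, mul_assoc, e1, mul_one]
  refine (left_inv_eq_right_inv ?_ (Γ.s_mul_si f g κ))
  rw [s_eq, s_eq]
  have h2 : (conv g f (κ⁻¹).1 * (g (κ : G) * f (κ : G))) * Γ.ri g f * Γ.ri f g *
      (conv g f (κ⁻¹).1 * (g (κ : G) * f (κ : G))) = 1 := by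
    set P := conv g f (κ⁻¹).1 * (g (κ : G) * f (κ : G))
    have hP : (conv g f (κ : G) * (g (κ⁻¹).1 * f (κ⁻¹).1)) * P = 1 := by
      have d1 : f (κ⁻¹).1 * conv g f (κ⁻¹).1 =
        conv g f (κ⁻¹).1 * f (κ⁻¹).1 := hκ.commute_inv_r' g f _
      have d2 : g (κ⁻¹).1 * conv g f (κ⁻¹).1 =
        conv g f (κ⁻¹).1 * g (κ⁻¹).1 := hκ.commute_inv_r g f _
      have d3 : f (κ⁻¹).1 * g (κ : G) = g (κ : G) * f (κ⁻¹).1 :=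
        comm_of f g _ _
      simp only [P, mul_assoc]
      rw [← mul_assoc (f _) (conv g f _), d1, mul_assoc, ← mul_assoc (g _) (conv g f _), d2,
        mul_assoc, ← mul_assoc (f _) (g _), d3, mul_assoc, mm_unit_inv_mul f, mul_one,
        mm_unit_inv_mul g, mul_one, mm_unit_mul_inv]
    have hP2 : P * (conv g f (κ : G) * (g (κ⁻¹).1 * f (κ⁻¹).1)) = 1 := by
      have d1 : f (κ : G) * conv g f (κ : G) = conv g f (κ : G) * f (κ : G) := hκ.commute_r' g f _
      have d2 : g (κ : G) * conv g f (κ : G) = conv g f (κ : G) * g (κ : G) := hκ.commute_r g f _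
      have d3 : f (κ : G) * g (κ⁻¹).1 = g (κ⁻¹).1 * f (κ : G) :=
        comm_of f g _ _
      simp only [P, mul_assoc]
      rw [← mul_assoc (f _) (conv g f _), d1, mul_assoc, ← mul_assoc (g _) (conv g f _), d2,
        mul_assoc, ← mul_assoc (f _) (g _), d3, mul_assoc, mm_unit_mul_inv f, mul_one,
        mm_unit_mul_inv g, mul_one, mm_unit_inv_mul]
    have hQ : (Γ.ri g f * Γ.ri f g) * (P * P) = 1 := by
      rw [h, mul_assoc, ← mul_assoc (Γ.ri f g), ri_mul_r, one_mul, ri_mul_r]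
    have hQ' : (Γ.ri g f * Γ.ri f g) * P =
        conv g f (κ : G) * (g (κ⁻¹).1 * f (κ⁻¹).1) := by
      have := congrArg (· * (conv g f (κ : G) * (g (κ⁻¹).1 * f (κ⁻¹).1))) hQ
      simpa only [mul_assoc, hP2, mul_one, one_mul] using this
    rw [mul_assoc, mul_assoc, ← mul_assoc (Γ.ri g f), hQ', hP2]
  have h3 : conv f g (κ⁻¹).1 * (f (κ : G) * g (κ : G)) * Γ.ri f g =
      Γ.ri f g * (conv g f (κ⁻¹).1 * (g (κ : G) * f (κ : G))) := by
    have d1 : f (κ : G) * Γ.ri f g = Γ.ri f g * f (κ : G) := hκ.commute_r f g _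
    have d2 : g (κ : G) * Γ.ri f g = Γ.ri f g * g (κ : G) := hκ.commute_r' f g _
    have d3 : f (κ : G) * g (κ : G) = g (κ : G) * f (κ : G) := comm_of f g _ _
    have d4 : conv f g (κ⁻¹).1 * Γ.ri f g = Γ.ri f g * conv g f (κ⁻¹).1 := by
      have := Γ.r_mul_conv f g (κ⁻¹).1
      calc conv f g (κ⁻¹).1 * Γ.ri f g =
          Γ.ri f g * (Γ.r f g * conv f g (κ⁻¹).1) * Γ.ri f g := by
            rw [← mul_assoc, ri_mul_r, one_mul]
        _ = _ := by rw [this, mul_assoc, mul_assoc, r_mul_ri, mul_one]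
    rw [d3]
    simp only [mul_assoc]
    rw [d1, ← mul_assoc (g _) (Γ.ri f g), d2, mul_assoc, ← mul_assoc (conv f g _), d4]
    simp only [mul_assoc]
  rw [h3, ← mul_assoc, h2]

end

end RibbonStar

end RMatrix

/-! ## Data that define homomorphisms on `K_N` -/

@[simp] lemma component_tmul (π : Dual ℂ G) (x : G) (a : A) :
    component π (x ⊗ₜ[ℂ] a) = π x • a := by
  simp [component]

lemma component_ext [Module.Finite ℂ G] {X Y : G ⊗[ℂ] A}
    (h : ∀ π : Dual ℂ G, component π X = component π Y) : X = Y := by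
  have key : ∀ Z : G ⊗[ℂ] A, Z = ∑ i, Module.finBasis ℂ G i ⊗ₜ[ℂ]
      component ((Module.finBasis ℂ G).coord i) Z := by
    intro Z
    induction Z with
    | zero => simp
    | add Z W hZ hW =>
      conv_lhs => rw [hZ, hW]
      simp [TensorProduct.tmul_add, Finset.sum_add_distrib]
    | tmul x a =>
      simp only [component_tmul, TensorProduct.tmul_smul]
      simp only [TensorProduct.smul_tmul', ← TensorProduct.sum_tmul]
      congr 1
      exact ((Module.finBasis ℂ G).sum_repr x).symm
  rw [key X, key Y]
  simp [h]

lemma sum_tmul_component [Module.Finite ℂ G] (Z : G ⊗[ℂ] A) :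
    ∑ i, Module.finBasis ℂ G i ⊗ₜ[ℂ] component ((Module.finBasis ℂ G).coord i) Z = Z := by
  refine component_ext fun π => ?_
  induction Z with
  | zero => simp
  | add Z W hZ hW =>
    simp only [map_add, map_sum, component_tmul, smul_add, Finset.sum_add_distrib] at hZ hW ⊢
    rw [hZ, hW]
  | tmul x a =>
    simp only [map_sum, component_tmul, smul_smul, ← Finset.sum_smul]
    congr 1
    conv_rhs => rw [← (Module.finBasis ℂ G).sum_repr x, map_sum]
    exact Finset.sum_congr rfl fun i _ => by simp [mul_comm]

/-- `id ⊗ φ`. -/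
abbrev idTensor (G : Type u) [Ring G] [HopfAlgebra ℂ G] (φ : A →ₐ[ℂ] B) : G ⊗[ℂ] A →ₐ[ℂ] G ⊗[ℂ] B :=
  Algebra.TensorProduct.map (AlgHom.id ℂ G) φ

lemma component_idTensor (φ : A →ₐ[ℂ] B) (π : Dual ℂ G) (X : G ⊗[ℂ] A) :
    component π (idTensor G φ X) = φ (component π X) := by
  induction X with
  | tmul x a => simp
  | _ => simp_all

lemma idTensor_ev_inl (φ : A →ₐ[ℂ] B) (f : G →ₗ[ℂ] A) (X : G ⊗[ℂ] G) :
    idTensor G φ (ev (inl G A) (inr G A ∘ₗ f) X) =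
      ev (inl G B) (inr G B ∘ₗ φ.toLinearMap ∘ₗ f) X := by
  induction X with
  | tmul x a => simp
  | _ => simp_all

lemma idTensor_leg₁ (φ : A →ₐ[ℂ] B) (X : G ⊗[ℂ] A) :
    idTensor G (idTensor G φ) (leg₁ G A X) = leg₁ G B (idTensor G φ X) := by
  induction X with
  | tmul x a => simp [leg₁]
  | _ => simp_all

lemma idTensor_leg₂ (φ : A →ₐ[ℂ] B) (X : G ⊗[ℂ] A) :
    idTensor G (idTensor G φ) (leg₂ G A X) = leg₂ G B (idTensor G φ X) := by
  simp [leg₂]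

lemma idTensor_aux (φ : A →ₐ[ℂ] B) (X : G ⊗[ℂ] G) :
    idTensor G (idTensor G φ) (aux G A X) = aux G B X := by
  induction X with
  | tmul x a => simp [aux]
  | _ => simp_all

lemma idTensor_comulAux (φ : A →ₐ[ℂ] B) (X : G ⊗[ℂ] A) :
    idTensor G (idTensor G φ) (comulAux G A X) = comulAux G B (idTensor G φ X) := by
  induction X with
  | tmul x a =>
    simp only [comulAux, AlgHom.coe_comp,
      Function.comp_apply, Algebra.TensorProduct.map_tmul, AlgHom.coe_id, id_eq]
    generalize (Bialgebra.comulAlgHom ℂ G) x = Y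
    induction Y with
    | zero => simp
    | add X Y h h' => simp only [map_add, TensorProduct.add_tmul, h, h']
    | tmul y z => simp
  | _ => simp_all

section Data

/-- Elements of an algebra `A` that satisfy the defining relations of `K_N`. -/
structure CurrentData (Γ : RibbonStar G) (N : ℕ) (A : Type*) [Ring A] [Algebra ℂ A] where
  /-- the sites -/
  site : ZMod N → G →ₗ[ℂ] A
  /-- the links -/
  link : ZMod N → G ⊗[ℂ] A
  /-- the inverse links -/
  linkInv : ZMod N → G ⊗[ℂ] A
  site_mul : ∀ n, IsMulMap (site n)
  site_comm : ∀ n m, n ≠ m → Comm (site n) (site m)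
  inv_right : ∀ n, link n * linkInv n = 1
  inv_left : ∀ n, linkInv n * link n = 1
  target : 2 ≤ N → ∀ n ξ, inr G A (site n ξ) * link n =
    link n * conv (inl G A) (inr G A ∘ₗ site n) ξ
  source : 2 ≤ N → ∀ n ξ, conv (inl G A) (inr G A ∘ₗ site (n - 1)) ξ * link n =
    link n * inr G A (site (n - 1) ξ)
  far : 2 ≤ N → ∀ n m, m ≠ n → m ≠ n - 1 → ∀ ξ, inr G A (site m ξ) * link n =
    link n * inr G A (site m ξ)
  loop : N = 1 → ∀ n ξ, conv (inl G A) (inr G A ∘ₗ site n) ξ * link n =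
    link n * conv (inl G A) (inr G A ∘ₗ site n) ξ
  funct : 2 ≤ N → ∀ n, leg₁ G A (link n) * leg₂ G A (link n) = aux G A Γ.R * comulAux G A (link n)
  funct_loop : N = 1 → ∀ n, leg₁ G A (link n) * aux G A Γ.R * leg₂ G A (link n) =
    aux G A Γ.R * comulAux G A (link n)
  link_far : ∀ n m, n ≠ m → n ≠ m + 1 → n ≠ m - 1 →
    leg₁ G A (link n) * leg₂ G A (link m) = leg₂ G A (link m) * leg₁ G A (link n)
  next : 3 ≤ N → ∀ n, leg₁ G A (link n) * aux G A Γ.R * leg₂ G A (link (n + 1)) =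
    leg₂ G A (link (n + 1)) * leg₁ G A (link n)
  next_two : N = 2 → ∀ n, leg₁ G A (link n) * aux G A Γ.R * leg₂ G A (link (n + 1)) =
    leg₂ G A (link (n + 1)) * aux G A (flipTensor G Γ.R) * leg₁ G A (link n)

variable {N : ℕ}

variable [Module.Finite ℂ G]

namespace CurrentAlgebra

variable (Γ N)

lemma mk_eq {X Y : Free G N} (h : CurrentRel Γ N X Y) : mk Γ N X = mk Γ N Y :=
  RingQuot.mkAlgHom_rel ℂ h

lemma idTensor_mk_eq {X Y : G ⊗[ℂ] Free G N} (h : CovRel G N X Y) :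
    idTensor G (mk Γ N) X = idTensor G (mk Γ N) Y :=
  component_ext fun π => by rw [component_idTensor, component_idTensor]; exact mk_eq Γ N (.cov h π)

lemma idTensor₂_mk_eq {X Y : G ⊗[ℂ] (G ⊗[ℂ] Free G N)} (h : LinkRel Γ N X Y) :
    idTensor G (idTensor G (mk Γ N)) X = idTensor G (idTensor G (mk Γ N)) Y :=
  component_ext fun π₁ => component_ext fun π₂ => by
    rw [component_idTensor, component_idTensor, component_idTensor, component_idTensor]
    exact mk_eq Γ N (.link h π₁ π₂)

lemma idTensor_comulSite (n : ZMod N) (ξ : G) :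
    idTensor G (mk Γ N) (comulSite (freeSite N n) ξ) = conv (inl G _) (inr G _ ∘ₗ site Γ N n) ξ := by
  rw [comulSite_eq, conv_apply, idTensor_ev_inl]; rfl

/-- The generators of `K_N`. -/
def data : CurrentData Γ N (CurrentAlgebra Γ N) where
  site := site Γ N
  link := link Γ N
  linkInv := linkInv Γ N
  site_mul n := ⟨by simpa [site] using mk_eq Γ N (.site (.one n)), fun x y => by
    simpa [site] using mk_eq Γ N (.site (.mul n x y))⟩
  site_comm n m h := ⟨fun x y => by
    simpa [site, commute_iff_eq] using mk_eq Γ N (.site (.comm n m x y h))⟩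
  inv_right n := by simpa [link, linkInv] using idTensor_mk_eq Γ N (.inv_right n)
  inv_left n := by simpa [link, linkInv] using idTensor_mk_eq Γ N (.inv_left n)
  target h n ξ := by
    have := idTensor_mk_eq Γ N (.target h n ξ)
    rw [map_mul, map_mul, idTensor_comulSite] at this
    exact this
  source h n ξ := by
    have := idTensor_mk_eq Γ N (.source h n ξ)
    rw [map_mul, map_mul, idTensor_comulSite] at this
    exact this
  far h n m h1 h2 ξ := by
    have := idTensor_mk_eq Γ N (.far h n m h1 h2 ξ)
    rw [map_mul, map_mul] at this
    exact this
  loop h n ξ := by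
    have := idTensor_mk_eq Γ N (.loop h n ξ)
    rw [map_mul, map_mul, idTensor_comulSite] at this
    exact this
  funct h n := by
    have := idTensor₂_mk_eq Γ N (.funct h n)
    rwa [map_mul, map_mul, idTensor_leg₁, idTensor_leg₂, idTensor_aux, idTensor_comulAux] at this
  funct_loop h n := by
    have := idTensor₂_mk_eq Γ N (.funct_loop h n)
    rwa [map_mul, map_mul, map_mul, idTensor_leg₁, idTensor_leg₂, idTensor_aux,
      idTensor_comulAux] at this
  link_far n m h1 h2 h3 := by
    have := idTensor₂_mk_eq Γ N (.far n m h1 h2 h3)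
    rwa [map_mul, map_mul, idTensor_leg₁, idTensor_leg₂] at this
  next h n := by
    have := idTensor₂_mk_eq Γ N (.next h n)
    rwa [map_mul, map_mul, map_mul, idTensor_leg₁, idTensor_leg₂, idTensor_aux] at this
  next_two h n := by
    have := idTensor₂_mk_eq Γ N (.next_two h n)
    rwa [map_mul, map_mul, map_mul, map_mul, idTensor_leg₁, idTensor_leg₂, idTensor_aux,
      idTensor_aux] at this

end CurrentAlgebra

namespace CurrentData

variable (D : CurrentData Γ N A)

/-- The values on free generators. -/
def gen : Gen N (Module.finrank ℂ G) → A
  | .site n i => D.site n (Module.finBasis ℂ G i)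
  | .link n i => component ((Module.finBasis ℂ G).coord i) (D.link n)
  | .linkInv n i => component ((Module.finBasis ℂ G).coord i) (D.linkInv n)

/-- The homomorphism on the free algebra. -/
def freeLift : Free G N →ₐ[ℂ] A := FreeAlgebra.lift ℂ D.gen

lemma freeLift_site (n : ZMod N) (ξ : G) : D.freeLift (freeSite N n ξ) = D.site n ξ := by
  have : D.freeLift.toLinearMap ∘ₗ freeSite N n = D.site n :=
    (Module.finBasis ℂ G).ext fun i => by simp [freeSite, freeLift, gen]
  exact LinearMap.congr_fun this ξ

lemma idTensor_freeLift_link (n : ZMod N) : idTensor G D.freeLift (freeLink G N n) = D.link n := by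
  conv_rhs => rw [← sum_tmul_component (D.link n)]
  simp [freeLink, freeLift, gen]

lemma idTensor_freeLift_linkInv (n : ZMod N) :
    idTensor G D.freeLift (freeLinkInv G N n) = D.linkInv n := by
  conv_rhs => rw [← sum_tmul_component (D.linkInv n)]
  simp [freeLinkInv, freeLift, gen]

lemma idTensor_freeLift_comulSite (n : ZMod N) (ξ : G) :
    idTensor G D.freeLift (comulSite (freeSite N n) ξ) =
      conv (inl G _) (inr G _ ∘ₗ D.site n) ξ := by
  rw [comulSite_eq, conv_apply, idTensor_ev_inl]
  have : D.freeLift.toLinearMap ∘ₗ freeSite N n = D.site n := LinearMap.ext (D.freeLift_site n)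
  rw [this, ← conv_apply]

lemma freeLift_cov {X Y : G ⊗[ℂ] Free G N} (h : CovRel G N X Y) :
    idTensor G D.freeLift X = idTensor G D.freeLift Y := by
  cases h with
  | inv_right n =>
    rw [map_mul, idTensor_freeLift_link, idTensor_freeLift_linkInv, D.inv_right, map_one]
  | inv_left n =>
    rw [map_mul, idTensor_freeLift_link, idTensor_freeLift_linkInv, D.inv_left, map_one]
  | target h n ξ =>
    rw [map_mul, map_mul, idTensor_freeLift_link, idTensor_freeLift_comulSite,
      Algebra.TensorProduct.map_tmul, freeLift_site]
    exact D.target h n ξ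
  | source h n ξ =>
    rw [map_mul, map_mul, idTensor_freeLift_link, idTensor_freeLift_comulSite,
      Algebra.TensorProduct.map_tmul, freeLift_site]
    exact D.source h n ξ
  | far h n m h1 h2 ξ =>
    rw [map_mul, map_mul, idTensor_freeLift_link, Algebra.TensorProduct.map_tmul, freeLift_site]
    exact D.far h n m h1 h2 ξ
  | loop h n ξ =>
    rw [map_mul, map_mul, idTensor_freeLift_link, idTensor_freeLift_comulSite]
    exact D.loop h n ξ

lemma freeLift_linkRel {X Y : G ⊗[ℂ] (G ⊗[ℂ] Free G N)} (h : LinkRel Γ N X Y) :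
    idTensor G (idTensor G D.freeLift) X = idTensor G (idTensor G D.freeLift) Y := by
  cases h <;> simp only [map_mul, idTensor_leg₁, idTensor_leg₂, idTensor_aux, idTensor_comulAux,
    idTensor_freeLift_link]
  case funct h n => exact D.funct h n
  case funct_loop h n => exact D.funct_loop h n
  case far n m h1 h2 h3 => exact D.link_far n m h1 h2 h3
  case next h n => exact D.next h n
  case next_two h n => exact D.next_two h n

lemma freeLift_rel {x y : Free G N} (h : CurrentRel Γ N x y) : D.freeLift x = D.freeLift y := by
  cases h with
  | site h =>
    cases h with
    | one n => rw [freeLift_site, (D.site_mul n).map_one, map_one]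
    | mul n ξ η =>
      rw [freeLift_site, (D.site_mul n).map_mul, map_mul D.freeLift, freeLift_site, freeLift_site]
    | comm n m ξ η h =>
      rw [map_mul, map_mul, freeLift_site, freeLift_site, ((D.site_comm n m h).comm ξ η).eq]
  | cov h π => rw [← component_idTensor, ← component_idTensor, D.freeLift_cov h]
  | link h π₁ π₂ =>
    rw [← component_idTensor, ← component_idTensor, ← component_idTensor, ← component_idTensor,
      D.freeLift_linkRel h]

/-- The homomorphism `K_N → A` given by data in `A`. -/
def lift : CurrentAlgebra Γ N →ₐ[ℂ] A :=
  RingQuot.liftAlgHom ℂ ⟨D.freeLift, fun _ _ h => D.freeLift_rel h⟩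

lemma lift_mk (x : Free G N) : D.lift (CurrentAlgebra.mk Γ N x) = D.freeLift x :=
  RingQuot.liftAlgHom_mkAlgHom_apply ℂ _ _ _

lemma lift_site (n : ZMod N) (ξ : G) : D.lift (CurrentAlgebra.site Γ N n ξ) = D.site n ξ := by
  rw [← D.freeLift_site n ξ, ← lift_mk]; rfl

lemma lift_link (n : ZMod N) : idTensor G D.lift (CurrentAlgebra.link Γ N n) = D.link n := by
  rw [← D.idTensor_freeLift_link n]
  refine component_ext fun π => ?_
  rw [CurrentAlgebra.link, component_idTensor, component_idTensor, component_idTensor, lift_mk]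

end CurrentData

/-- Induction on `K_N`: it is generated by the sites and the components of the links and of their
inverses. -/
lemma CurrentAlgebra.induction {p : CurrentAlgebra Γ N → Prop}
    (scalar : ∀ c : ℂ, p (algebraMap ℂ _ c)) (add : ∀ x y, p x → p y → p (x + y))
    (mul : ∀ x y, p x → p y → p (x * y)) (hsite : ∀ n ξ, p (site Γ N n ξ))
    (hlink : ∀ n π, p (component π (link Γ N n)))
    (hlinkInv : ∀ n π, p (component π (linkInv Γ N n))) (x : CurrentAlgebra Γ N) : p x := by
  obtain ⟨y, rfl⟩ : ∃ y, mk Γ N y = x := RingQuot.mkAlgHom_surjective ℂ _ x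
  induction y using FreeAlgebra.induction with
  | grade0 c => simpa using scalar c
  | add x y hx hy => simpa using add _ _ hx hy
  | mul x y hx hy => simpa using mul _ _ hx hy
  | grade1 g =>
    cases g with
    | site n i =>
      have := hsite n (Module.finBasis ℂ G i)
      simpa [site, freeSite] using this
    | link n i =>
      have := hlink n ((Module.finBasis ℂ G).coord i)
      rw [link, component_idTensor] at this
      simpa [freeLink, Finsupp.single_apply] using this
    | linkInv n i =>
      have := hlinkInv n ((Module.finBasis ℂ G).coord i)
      rw [linkInv, component_idTensor] at this
      simpa [freeLinkInv, Finsupp.single_apply] using this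

end Data

/-! ## Evaluation of elements of `G ⊗ A` -/

lemma reassoc {M : Type*} [Semigroup M] {a b c : M} (h : a * b = c) (z : M) :
    a * (b * z) = c * z := by rw [← mul_assoc, h]

lemma reassoc₂ {M : Type*} [Semigroup M] {a b c d : M} (h : a * b = c * d) (z : M) :
    a * (b * z) = c * (d * z) := by rw [← mul_assoc, h, mul_assoc]

section Universal

variable (G A) in
/-- The first factor of `G ⊗ G ⊗ A`. -/
abbrev fst : G →ₗ[ℂ] G ⊗[ℂ] (G ⊗[ℂ] A) := inl G (G ⊗[ℂ] A)

variable (G A) in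
/-- The second factor of `G ⊗ G ⊗ A`. -/
abbrev snd : G →ₗ[ℂ] G ⊗[ℂ] (G ⊗[ℂ] A) := inr G (G ⊗[ℂ] A) ∘ₗ inl G A

variable (G A) in
/-- The third factor of `G ⊗ G ⊗ A`. -/
abbrev thd : A →ₗ[ℂ] G ⊗[ℂ] (G ⊗[ℂ] A) := inr G (G ⊗[ℂ] A) ∘ₗ inr G A

lemma leg₁_eq (X : G ⊗[ℂ] A) : leg₁ G A X = ev (fst G A) (thd G A) X := by
  rw [← ev₃_leg₁ (fst G A) (snd G A) (thd G A) X, ev₃_self]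

lemma leg₂_eq (X : G ⊗[ℂ] A) : leg₂ G A X = ev (snd G A) (thd G A) X := by
  rw [← ev₃_leg₂ (fst G A) (snd G A) (thd G A) X, ev₃_self]

lemma aux_eq (X : G ⊗[ℂ] G) : aux G A X = ev (fst G A) (snd G A) X := by
  rw [← ev₃_aux (fst G A) (snd G A) (thd G A) X, ev₃_self]

lemma comulAux_eq (X : G ⊗[ℂ] A) : comulAux G A X = ev (conv (fst G A) (snd G A)) (thd G A) X := by
  rw [← ev₃_comulAux (fst G A) (snd G A) (thd G A) X, ev₃_self]

section

variable (a : G →ₗ[ℂ] E) (j : A →ₗ[ℂ] E) [IsMulMap a] [IsMulMap j]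

@[simp] lemma ev_comp_inl : ev a j ∘ₗ inl G A = a := by ext ξ; simp [mm_one]

@[simp] lemma ev_comp_inr : ev a j ∘ₗ inr G A = j := by ext ξ; simp [mm_one]

@[simp] lemma ev_comp_inr_comp {B : Type*} [AddCommMonoid B] [Module ℂ B] (f : B →ₗ[ℂ] A) :
    ev a j ∘ₗ (inr G A ∘ₗ f) = j ∘ₗ f := by
  rw [← LinearMap.comp_assoc, ev_comp_inr]

@[simp] lemma ev_inr (y : A) : ev a j (inr G A y) = j y := by simp [mm_one]

end

end Universal

section Links

namespace RibbonStar

lemma map_r (k : E →ₗ[ℂ] F) [IsMulMap k] (f g : G →ₗ[ℂ] E) :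
    k (Γ.r f g) = Γ.r (k ∘ₗ f) (k ∘ₗ g) := map_ev k f g _

lemma map_ri (k : E →ₗ[ℂ] F) [IsMulMap k] (f g : G →ₗ[ℂ] E) :
    k (Γ.ri f g) = Γ.ri (k ∘ₗ f) (k ∘ₗ g) := map_ev k f g _

lemma conv_mul_ri (f g : G →ₗ[ℂ] E) [IsMulMap f] [IsMulMap g] [Comm f g] (ξ : G) :
    conv f g ξ * Γ.ri f g = Γ.ri f g * conv g f ξ := by
  have h := Γ.r_mul_conv f g ξ
  calc conv f g ξ * Γ.ri f g = Γ.ri f g * (Γ.r f g * conv f g ξ) * Γ.ri f g := by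
        rw [← mul_assoc, ri_mul_r, one_mul]
    _ = _ := by rw [h, mul_assoc, mul_assoc, r_mul_ri, mul_one]

end RibbonStar

/-- An invertible link `U` whose target and source are sites that act by `t` and `s`. -/
structure Link (Γ : RibbonStar G) (B : Type*) [Ring B] [Algebra ℂ B] where
  /-- the action at the target -/
  t : G →ₗ[ℂ] B
  /-- the action at the source -/
  s : G →ₗ[ℂ] B
  /-- the link -/
  U : G ⊗[ℂ] B
  /-- the inverse link -/
  Ui : G ⊗[ℂ] B
  [mul_t : IsMulMap t]
  [mul_s : IsMulMap s]
  [comm : Comm t s]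
  right_inv : U * Ui = 1
  left_inv : Ui * U = 1
  target : ∀ ξ, inr G B (t ξ) * U = U * conv (inl G B) (inr G B ∘ₗ t) ξ
  source : ∀ ξ, conv (inl G B) (inr G B ∘ₗ s) ξ * U = U * inr G B (s ξ)
  funct : leg₁ G B U * leg₂ G B U = aux G B Γ.R * comulAux G B U

attribute [instance] Link.mul_t Link.mul_s Link.comm

namespace Link

variable (d : Link Γ B) (a b : G →ₗ[ℂ] E) (x : B →ₗ[ℂ] E) [IsMulMap a] [IsMulMap b] [IsMulMap x]
  [Comm a b] [Comm a x] [Comm b x]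

lemma u_mul_ui : ev a x d.U * ev a x d.Ui = 1 := by rw [← mm_mul (ev a x), d.right_inv, mm_one]

lemma ui_mul_u : ev a x d.Ui * ev a x d.U = 1 := by rw [← mm_mul (ev a x), d.left_inv, mm_one]

lemma target_ev (ξ : G) : x (d.t ξ) * ev a x d.U = ev a x d.U * conv a (x ∘ₗ d.t) ξ := by
  have h := congrArg (ev a x) (d.target ξ)
  rw [mm_mul (ev a x), mm_mul (ev a x), ev_inr, conv_apply, map_ev (ev a x)] at h
  simpa [← conv_apply] using h

lemma source_ev (ξ : G) : conv a (x ∘ₗ d.s) ξ * ev a x d.U = ev a x d.U * x (d.s ξ) := by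
  have h := congrArg (ev a x) (d.source ξ)
  rw [mm_mul (ev a x), mm_mul (ev a x), ev_inr, conv_apply, map_ev (ev a x)] at h
  simpa [← conv_apply] using h

lemma funct_ev : ev a x d.U * ev b x d.U = Γ.r a b * ev (conv a b) x d.U := by
  have h := congrArg (ev₃ a b x) d.funct
  rwa [mm_mul (ev₃ a b x), mm_mul (ev₃ a b x), ev₃_leg₁, ev₃_leg₂, ev₃_aux, ev₃_comulAux] at h

lemma conv_mul_ui (ξ : G) : conv a (x ∘ₗ d.t) ξ * ev a x d.Ui = ev a x d.Ui * x (d.t ξ) := by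
  have h := d.target_ev a x ξ
  calc _ = ev a x d.Ui * (ev a x d.U * conv a (x ∘ₗ d.t) ξ) * ev a x d.Ui := by
        rw [← mul_assoc, ui_mul_u, one_mul]
    _ = _ := by rw [← h, mul_assoc, mul_assoc, u_mul_ui, mul_one]

lemma source_mul_ui (ξ : G) : x (d.s ξ) * ev a x d.Ui = ev a x d.Ui * conv a (x ∘ₗ d.s) ξ := by
  have h := d.source_ev a x ξ
  calc _ = ev a x d.Ui * (ev a x d.U * x (d.s ξ)) * ev a x d.Ui := by
        rw [← mul_assoc, ui_mul_u, one_mul]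
    _ = _ := by rw [← h, mul_assoc, mul_assoc, u_mul_ui, mul_one]

/-- `R_{bs} R_{ba} U(a) = U(a) R_{bs}`. -/
lemma r_mul_r_mul_u : Γ.r b (x ∘ₗ d.s) * (Γ.r b a * ev a x d.U) =
    ev a x d.U * Γ.r b (x ∘ₗ d.s) := by
  rw [← mul_assoc, ← Γ.r_conv_right b a (x ∘ₗ d.s)]
  exact (ev_conj_right b (x ∘ₗ d.s) _ _ (fun y => (comm_of (ev a x) b d.U y).symm)
    (fun ξ => (d.source_ev a x ξ).symm) _).symm

lemma ri_mul_u : Γ.ri b (x ∘ₗ d.s) * ev a x d.U = Γ.r b a * (ev a x d.U * Γ.ri b (x ∘ₗ d.s)) := by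
  have h := d.r_mul_r_mul_u a b x
  calc _ = Γ.ri b (x ∘ₗ d.s) * ((ev a x d.U * Γ.r b (x ∘ₗ d.s)) * Γ.ri b (x ∘ₗ d.s)) := by
        rw [mul_assoc (ev a x d.U), Γ.r_mul_ri, mul_one]
    _ = _ := by rw [← h]; simp only [mul_assoc]; rw [reassoc (Γ.ri_mul_r b (x ∘ₗ d.s)), one_mul]

lemma ri_mul_ui : Γ.ri a (x ∘ₗ d.s) * ev b x d.Ui =
    ev b x d.Ui * (Γ.ri a b * Γ.ri a (x ∘ₗ d.s)) := by
  have h := d.ri_mul_u b a x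
  calc _ = ev b x d.Ui * (Γ.ri a b * (Γ.r a b * (ev b x d.U * Γ.ri a (x ∘ₗ d.s)))) *
        ev b x d.Ui := by
        rw [reassoc (Γ.ri_mul_r a b), one_mul, reassoc (d.ui_mul_u b x), one_mul]
    _ = _ := by rw [← h]; simp only [mul_assoc]; rw [d.u_mul_ui b x, mul_one]

lemma r_mul_u_conv : Γ.r a b * ev (conv a b) x d.U = ev (conv b a) x d.U * Γ.r a b :=
  Γ.r_mul_ev_conv a b x d.U

lemma r_mul_ui_conv : Γ.r a b * ev (conv a b) x d.Ui = ev (conv b a) x d.Ui * Γ.r a b :=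
  Γ.r_mul_ev_conv a b x d.Ui

/-- `U(b) U(a) R_{ab} = R_{ba} U(a) U(b)`. -/
lemma u_mul_u_mul_r : ev b x d.U * (ev a x d.U * Γ.r a b) =
    Γ.r b a * (ev a x d.U * ev b x d.U) := by
  rw [← mul_assoc, d.funct_ev b a x, d.funct_ev a b x, mul_assoc, ← d.r_mul_u_conv a b x]

/-- `U(a) R_{ab} U(b)⁻¹ = U(b)⁻¹ R_{ba} U(a)`. -/
lemma u_mul_r_mul_ui : ev a x d.U * (Γ.r a b * ev b x d.Ui) =
    ev b x d.Ui * (Γ.r b a * ev a x d.U) := by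
  have h := d.u_mul_u_mul_r a b x
  calc _ = ev b x d.Ui * (ev b x d.U * (ev a x d.U * Γ.r a b)) * ev b x d.Ui := by
        rw [reassoc (d.ui_mul_u b x), one_mul, mul_assoc]
    _ = _ := by rw [h]; simp only [mul_assoc]; rw [d.u_mul_ui b x, mul_one]

/-- `L(a) = v_a U(a)⁻¹ R_{as}⁻¹`. -/
def left : E := a Γ.v.1 * (ev a x d.Ui * Γ.ri a (x ∘ₗ d.s))

/-- The inverse of `L(a)`. -/
def leftInv : E := Γ.r a (x ∘ₗ d.s) * (ev a x d.U * a (Γ.v⁻¹).1)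

lemma left_mul_leftInv : d.left a x * d.leftInv a x = 1 := by
  simp only [left, leftInv, mul_assoc]
  rw [reassoc (Γ.ri_mul_r a (x ∘ₗ d.s)), one_mul, reassoc (d.ui_mul_u a x), one_mul,
    RibbonStar.mm_unit_mul_inv]

lemma leftInv_mul_left : d.leftInv a x * d.left a x = 1 := by
  simp only [left, leftInv, mul_assoc]
  rw [reassoc (RibbonStar.mm_unit_inv_mul a Γ.v), one_mul, reassoc (d.u_mul_ui a x), one_mul,
    Γ.r_mul_ri]

lemma commute_v (X : G ⊗[ℂ] B) : a Γ.v.1 * ev a x X = ev a x X * a Γ.v.1 :=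
  (commute_ev a x X _ (fun y => RibbonStar.commute_central a Γ.v_central y)
    (fun y => comm_of x a y _)).eq.symm

/-- `U L = v_a R_{as}⁻¹`. -/
lemma u_mul_left : ev a x d.U * d.left a x = a Γ.v.1 * Γ.ri a (x ∘ₗ d.s) := by
  rw [left, reassoc (commute_v a x d.U).symm, mul_assoc, reassoc (d.u_mul_ui a x), one_mul]

lemma source_mul_left (ξ : G) : x (d.s ξ) * d.left a x = d.left a x * conv (x ∘ₗ d.s) a ξ := by
  rw [left, reassoc₂ (comm_of x a (d.s ξ) Γ.v.1).eq, reassoc₂ (d.source_mul_ui a x ξ),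
    RibbonStar.conv_mul_ri]
  simp only [mul_assoc]

lemma conv_mul_left (ξ : G) : conv a (x ∘ₗ d.t) ξ * d.left a x = d.left a x * x (d.t ξ) := by
  have h1 : conv a (x ∘ₗ d.t) ξ * a Γ.v.1 = a Γ.v.1 * conv a (x ∘ₗ d.t) ξ :=
    (commute_ev a (x ∘ₗ d.t) _ _ (fun y => RibbonStar.commute_central a Γ.v_central y)
      (fun y => comm_of (x ∘ₗ d.t) a y _)).eq
  have h2 : x (d.t ξ) * Γ.ri a (x ∘ₗ d.s) = Γ.ri a (x ∘ₗ d.s) * x (d.t ξ) :=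
    (Γ.commute_ri a (x ∘ₗ d.s) (fun y => comm_of a x y _)
      (fun y => comm_of (x ∘ₗ d.s) (x ∘ₗ d.t) y ξ)).eq.symm
  rw [left, reassoc₂ h1, reassoc₂ (d.conv_mul_ui a x ξ), h2]
  simp only [mul_assoc]

lemma u_mul_r_mul_left : ev a x d.U * (Γ.r a b * d.left b x) = d.left b x * ev a x d.U := by
  have h1 : Γ.r a b * b Γ.v.1 = b Γ.v.1 * Γ.r a b := (Γ.commute_r a b (fun y => comm_of a b y _)
      (fun y => RibbonStar.commute_central b Γ.v_central y)).eq
  have h2 : ev a x d.U * b Γ.v.1 = b Γ.v.1 * ev a x d.U := (comm_of (ev a x) b d.U Γ.v.1).eq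
  simp only [left, mul_assoc]
  rw [reassoc₂ h1, reassoc₂ h2, d.ri_mul_u a b x]
  have h3 := congrArg (· * Γ.ri b (x ∘ₗ d.s)) (d.u_mul_r_mul_ui a b x)
  simp only [mul_assoc] at h3
  rw [h3]

/-- `U(a)⁻¹ U(b)⁻¹ v_a v_b = R_{ab} U(ab)⁻¹ v_{ab}`. -/
lemma ui_mul_ui : ev a x d.Ui * ev b x d.Ui * (a Γ.v.1 * b Γ.v.1) =
    Γ.r a b * (ev (conv a b) x d.Ui * conv a b Γ.v.1) := by
  have hr := Γ.isRibbon_v.ev_eq a b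
  have h1 : Γ.r b a * Γ.r a b * conv a b Γ.v.1 = a Γ.v.1 * b Γ.v.1 := by
    rw [hr, mul_assoc, RibbonStar.mm_unit_inv_mul (conv a b), mul_one]
  rw [← h1]
  have h2 : ev a x d.Ui * ev b x d.Ui * (Γ.r b a * ev (conv b a) x d.U) = 1 := by
    rw [← d.funct_ev b a x, mul_assoc, reassoc (d.ui_mul_u b x), one_mul, d.ui_mul_u a x]
  have h3 : ev a x d.Ui * ev b x d.Ui * Γ.r b a = ev (conv b a) x d.Ui := by
    calc _ = ev a x d.Ui * ev b x d.Ui * (Γ.r b a * (ev (conv b a) x d.U *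
          ev (conv b a) x d.Ui)) := by rw [d.u_mul_ui (conv b a) x, mul_one]
      _ = _ := by rw [← mul_assoc (Γ.r b a), ← mul_assoc _ (_ * _), h2, one_mul]
  rw [← mul_assoc, ← mul_assoc, h3, ← d.r_mul_ui_conv a b x, mul_assoc]

lemma left_mul_left : d.left a x * (d.left b x * Γ.r a b) = Γ.r a b * d.left (conv a b) x := by
  have h1 : Γ.ri a (x ∘ₗ d.s) * b Γ.v.1 = b Γ.v.1 * Γ.ri a (x ∘ₗ d.s) :=
    (Γ.commute_ri a (x ∘ₗ d.s) (fun y => comm_of a b y _)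
      (fun y => comm_of (x ∘ₗ d.s) b y _)).eq
  have h2 : Γ.ri a b * (Γ.ri a (x ∘ₗ d.s) * (Γ.ri b (x ∘ₗ d.s) * Γ.r a b)) =
      Γ.ri (conv a b) (x ∘ₗ d.s) := by
    rw [Γ.ri_conv_left]
    have e1 : Γ.ri a b * (Γ.ri a (x ∘ₗ d.s) * Γ.ri b (x ∘ₗ d.s)) *
        (Γ.r b (x ∘ₗ d.s) * Γ.r a (x ∘ₗ d.s) * Γ.r a b) = 1 := by
      simp only [mul_assoc]
      rw [reassoc (Γ.ri_mul_r b (x ∘ₗ d.s)), one_mul, reassoc (Γ.ri_mul_r a (x ∘ₗ d.s)), one_mul,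
        Γ.ri_mul_r]
    rw [← Γ.yang_baxter a b (x ∘ₗ d.s)] at e1
    calc _ = Γ.ri a b * (Γ.ri a (x ∘ₗ d.s) * Γ.ri b (x ∘ₗ d.s)) *
        (Γ.r a b * Γ.r a (x ∘ₗ d.s) * Γ.r b (x ∘ₗ d.s)) *
        (Γ.ri b (x ∘ₗ d.s) * Γ.ri a (x ∘ₗ d.s)) := by
          simp only [mul_assoc]
          rw [reassoc (Γ.r_mul_ri b (x ∘ₗ d.s)), one_mul, Γ.r_mul_ri a (x ∘ₗ d.s), mul_one]
      _ = _ := by rw [e1, one_mul]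
  have h3 : a Γ.v.1 * (b Γ.v.1 * (ev a x d.Ui * ev b x d.Ui)) =
      ev a x d.Ui * ev b x d.Ui * (a Γ.v.1 * b Γ.v.1) := by
    have e1 : b Γ.v.1 * ev a x d.Ui = ev a x d.Ui * b Γ.v.1 := (comm_of b (ev a x) _ _).eq
    have e2 : a Γ.v.1 * ev b x d.Ui = ev b x d.Ui * a Γ.v.1 := (comm_of a (ev b x) _ _).eq
    rw [reassoc₂ e1, commute_v b x, reassoc₂ (commute_v a x _), reassoc₂ e2]
    simp only [mul_assoc]
  have h4 : ev (conv a b) x d.Ui * conv a b Γ.v.1 = conv a b Γ.v.1 * ev (conv a b) x d.Ui :=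
    (commute_v (conv a b) x _).symm
  calc _ = a Γ.v.1 * (b Γ.v.1 * (ev a x d.Ui * ev b x d.Ui)) *
      (Γ.ri a b * (Γ.ri a (x ∘ₗ d.s) * (Γ.ri b (x ∘ₗ d.s) * Γ.r a b))) := by
        simp only [left, mul_assoc]
        have e1 : b Γ.v.1 * ev a x d.Ui = ev a x d.Ui * b Γ.v.1 := (comm_of b (ev a x) _ _).eq
        rw [reassoc₂ h1, reassoc₂ (d.ri_mul_ui a b x), reassoc₂ e1.symm]
        simp only [mul_assoc]
    _ = _ := by rw [h2, h3, d.ui_mul_ui a b x, h4, left]; simp only [mul_assoc]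

end Link

end Links

/-! ## Chains of links -/

lemma conv_conj_left (f f' g : G →ₗ[ℂ] E) (z : E) (hf : ∀ ξ, f ξ * z = z * f' ξ)
    (hg : ∀ ξ, Commute (g ξ) z) (ξ : G) : conv f g ξ * z = z * conv f' g ξ :=
  (ev_conj_left f' f g z (fun x => (hf x).symm) hg _).symm

lemma conv_conj_right (f g g' : G →ₗ[ℂ] E) (z : E) (hf : ∀ ξ, Commute (f ξ) z)
    (hg : ∀ ξ, g ξ * z = z * g' ξ) (ξ : G) : conv f g ξ * z = z * conv f g' ξ :=
  (ev_conj_right f g' g z hf (fun x => (hg x).symm) _).symm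

lemma map_iterConv (k : E →ₗ[ℂ] F) [IsMulMap k]
    (f : ℕ → (G →ₗ[ℂ] E)) (n : ℕ) : k ∘ₗ iterConv f n = iterConv (fun i => k ∘ₗ f i) n := by
  induction n with
  | zero =>
    ext ξ
    have := mm_one k
    simp [iterConv, Algebra.algebraMap_eq_smul_one, this]
  | succ n ih => rw [iterConv, map_conv, ih, iterConv]

section Chain

/-- Commuting homomorphisms `y 0, …, y (n - 1)`, `p`, `q`. -/
structure IsChain (n : ℕ) (y : ℕ → (B →ₗ[ℂ] E)) (p q : G →ₗ[ℂ] E) : Prop where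
  mul : ∀ k < n, IsMulMap (y k)
  comm : ∀ k < n, ∀ l < n, k ≠ l → Comm (y k) (y l)
  mul_p : IsMulMap p
  mul_q : IsMulMap q
  comm_p : ∀ k < n, Comm (y k) p
  comm_q : ∀ k < n, Comm (y k) q
  comm_pq : Comm p q

/-- The homomorphism `a` commutes with the chain. -/
structure Off (n : ℕ) (y : ℕ → (B →ₗ[ℂ] E)) (p q : G →ₗ[ℂ] E) (a : G →ₗ[ℂ] E) : Prop where
  mul : IsMulMap a
  comm : ∀ k < n, Comm a (y k)
  comm_p : Comm a p
  comm_q : Comm a q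

lemma IsChain.map {n : ℕ} {y : ℕ → (B →ₗ[ℂ] E)} {p q : G →ₗ[ℂ] E} (h : IsChain n y p q)
    (k : E →ₗ[ℂ] F) [IsMulMap k] : IsChain n (fun i => k ∘ₗ y i) (k ∘ₗ p) (k ∘ₗ q) where
  mul i hi := by have := h.mul i hi; infer_instance
  comm i hi l hl hil := by have := h.comm i hi l hl hil; infer_instance
  mul_p := by have := h.mul_p; infer_instance
  mul_q := by have := h.mul_q; infer_instance
  comm_p i hi := by have := h.comm_p i hi; infer_instance
  comm_q i hi := by have := h.comm_q i hi; infer_instance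
  comm_pq := by have := h.comm_pq; infer_instance

namespace Link

variable (d : Link Γ B) (y : ℕ → (B →ₗ[ℂ] E)) (p q : G →ₗ[ℂ] E) (n : ℕ) (a b : G →ₗ[ℂ] E)

/-- `s_0 ⊠ ⋯ ⊠ s_{k-1}`. -/
def theta (k : ℕ) : G →ₗ[ℂ] E := iterConv (fun i => y i ∘ₗ d.s) k

/-- The left half of a link. -/
def pre : ℕ → E
  | 0 => 1
  | k + 1 => d.left a (y k)

/-- `R_{pa} R_{ap} R_{aθ}`. -/
def core : E := Γ.r p a * Γ.r a p * Γ.r a (d.theta y n)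

/-- The link of the chain with number `m`. -/
def chainLink (m : ℕ) : E := d.pre y a m * if m < n then ev a (y m) d.U else d.core y p n a

/-- The site of the chain with number `m`. -/
def chainSite (m : ℕ) : G →ₗ[ℂ] E := if m < n then y m ∘ₗ d.t else conv (d.theta y n) (conv p q)

variable {d y p q n a b}

section theta

lemma theta_comm {C : Type*} [AddCommMonoid C] [Module ℂ C] (f : C →ₗ[ℂ] E) (k : ℕ)
    (hf : ∀ i < k, Comm (y i) f) : Comm (d.theta y k) f := by
  induction k with
  | zero => exact inferInstanceAs (Comm (triv G E) f)
  | succ k ih =>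
    have := ih fun i hi => hf i (hi.trans k.lt_succ_self)
    have := hf k k.lt_succ_self
    exact inferInstanceAs (Comm (conv (d.theta y k) (y k ∘ₗ d.s)) f)

lemma commute_theta {z : E} (k : ℕ) (hf : ∀ i < k, ∀ ξ, Commute (y i (d.s ξ)) z) (ξ : G) :
    Commute (d.theta y k ξ) z := by
  induction k generalizing ξ with
  | zero => exact Algebra.commutes _ _
  | succ k ih =>
    exact commute_ev _ _ _ _ (ih fun i hi => hf i (hi.trans k.lt_succ_self)) (hf k k.lt_succ_self)

variable (h : IsChain n y p q)
include h

lemma theta_mul (k : ℕ) (hk : k ≤ n) : IsMulMap (d.theta y k) := by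
  induction k with
  | zero => exact inferInstanceAs (IsMulMap (triv G E))
  | succ k ih =>
    have := ih (Nat.le_of_succ_le hk)
    have := h.mul k hk
    have : Comm (d.theta y k) (y k) := theta_comm _ k fun i hi => h.comm i (hi.trans hk) k hk hi.ne
    exact inferInstanceAs (IsMulMap (conv (d.theta y k) (y k ∘ₗ d.s)))

end theta

section rels

variable (h : IsChain n y p q) (ha : Off n y p q a) (hb : Off n y p q b)

section
include ha

lemma off_theta (k : ℕ) (hk : k ≤ n) : Comm a (d.theta y k) := by
  have := theta_comm (d := d) a k fun i hi => (by
    have := ha.comm i (hi.trans_le hk); infer_instance : Comm (y i) a)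
  infer_instance

lemma commute_pre {z : E} (m : ℕ) (hz : ∀ ξ, Commute (a ξ) z)
    (hy : ∀ k, m = k + 1 → ∀ β, Commute (y k β) z) : Commute (d.pre y a m) z := by
  cases m with
  | zero => exact Commute.one_left z
  | succ k =>
    refine Commute.mul_left (hz _) (Commute.mul_left ?_ ?_)
    · exact commute_ev _ _ _ _ hz (hy k rfl)
    · exact commute_ev _ _ _ _ hz fun ξ => hy k rfl _

lemma commute_core {z : E} (hz : ∀ ξ, Commute (a ξ) z) (hp : ∀ ξ, Commute (p ξ) z)
    (hθ : ∀ ξ, Commute (d.theta y n ξ) z) : Commute (d.core y p n a) z :=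
  ((commute_ev _ _ _ _ hp hz).mul_left (commute_ev _ _ _ _ hz hp)).mul_left
    (commute_ev _ _ _ _ hz hθ)

end

include h ha

lemma theta_mul_pre (k : ℕ) (hk : k ≤ n) (hk0 : k ≠ 0) (ξ : G) :
    d.theta y k ξ * d.pre y a k = d.pre y a k * conv (d.theta y k) a ξ := by
  cases k with
  | zero => exact absurd rfl hk0
  | succ k =>
    have := h.mul k hk
    have := ha.mul
    have := ha.comm k hk
    change conv (d.theta y k) (y k ∘ₗ d.s) ξ * d.left a (y k) =
      d.left a (y k) * conv (conv (d.theta y k) (y k ∘ₗ d.s)) a ξ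
    rw [conv_assoc]
    refine conv_conj_right _ _ _ _ (fun ξ => ?_) (fun ξ => d.source_mul_left a (y k) ξ) ξ
    refine commute_theta k (fun i hi _ => ?_) ξ
    refine (commute_pre (d := d) ha (k + 1) (fun ξ => ?_) fun l hl β' => ?_).symm
    · have := ha.comm i (hi.trans hk)
      exact comm_of a (y i) _ _
    · obtain rfl : k = l := by omega
      have := h.comm k hk i (hi.trans hk) hi.ne'
      exact comm_of (y k) (y i) _ _

lemma conv_theta_mul_u (k : ℕ) (hk : k ≤ n) (hk0 : k ≠ 0) (ξ : G) :
    conv a (d.theta y k) ξ * ev a (y 0) d.U = ev a (y 0) d.U * d.theta y k ξ := by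
  induction k generalizing ξ with
  | zero => exact absurd rfl hk0
  | succ k ih =>
    have := ha.mul
    change conv a (conv (d.theta y k) (y k ∘ₗ d.s)) ξ * _ =
      _ * conv (d.theta y k) (y k ∘ₗ d.s) ξ
    by_cases hk1 : k = 0
    · subst hk1
      have := h.mul 0 hk
      have := ha.comm 0 hk
      have e : conv (d.theta y 0) (y 0 ∘ₗ d.s) = y 0 ∘ₗ d.s := triv_conv _
      rw [e]
      exact d.source_ev a (y 0) ξ
    · rw [← conv_assoc]
      refine conv_conj_left _ _ _ _ (ih (by omega) hk1) (fun ξ => ?_) ξ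
      have := ha.comm k hk
      have := h.comm k hk 0 (by omega) hk1
      exact (commute_ev a (y 0) d.U _ (fun η => comm_of a (y k) _ _)
        fun β => (comm_of (y k) (y 0) _ _).symm).symm

/-- `θ_k` commutes with the links inside. -/
lemma commute_theta_link (m k : ℕ) (hm : m ≠ 0) (hmk : m < k) (hk : k ≤ n) (ξ : G) :
    Commute (d.theta y k ξ) (d.pre y a m * ev a (y m) d.U) := by
  obtain ⟨l, rfl⟩ := Nat.exists_eq_succ_of_ne_zero hm
  induction k generalizing ξ with
  | zero => omega
  | succ k ih =>
    have := ha.mul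
    have := h.mul l (by omega)
    have := ha.comm l (by omega)
    have := h.mul (l + 1) (by omega)
    have := ha.comm (l + 1) (by omega)
    have key : ∀ i < n, i ≠ l → i ≠ l + 1 → ∀ β,
        Commute (y i β) (d.pre y a (l + 1) * ev a (y (l + 1)) d.U) := by
      intro i hi h1 h2 β
      have := ha.comm i hi
      have := h.comm i hi l (by omega) h1
      have := h.comm i hi (l + 1) (by omega) h2
      refine Commute.mul_right (commute_pre (d := d) ha (l + 1) (fun ξ => ?_) ?_).symm ?_
      · exact comm_of a (y i) _ _
      · intro j hj β'
        obtain rfl : l = j := by omega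
        exact (comm_of (y i) (y l) _ _).symm
      · exact comm_of (y i) (ev a (y (l + 1))) _ _
    by_cases hlk : l + 1 = k
    · subst hlk
      change conv (conv (d.theta y l) (y l ∘ₗ d.s)) (y (l + 1) ∘ₗ d.s) ξ * _ =
        _ * conv (conv (d.theta y l) (y l ∘ₗ d.s)) (y (l + 1) ∘ₗ d.s) ξ
      rw [conv_assoc]
      refine conv_conj_right _ _ _ _ (fun ξ => ?_) (fun ξ => ?_) ξ
      · exact commute_theta l (fun i hi _ => key i (by omega) (by omega) (by omega) _) ξ
      · have e1 := conv_conj_left (y l ∘ₗ d.s) (conv (y l ∘ₗ d.s) a) (y (l + 1) ∘ₗ d.s)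
          (d.left a (y l)) (d.source_mul_left a (y l)) (fun ξ => by
            refine (commute_pre (d := d) (y := y) ha (l + 1) (fun ξ => ?_) ?_).symm
            · exact comm_of a (y (l + 1)) _ _
            · intro j hj β'
              obtain rfl : l = j := by omega
              have := h.comm l (by omega) (l + 1) hk (by omega)
              exact comm_of (y l) (y (l + 1)) _ _) ξ
        have e2 := conv_conj_right (y l ∘ₗ d.s) (conv a (y (l + 1) ∘ₗ d.s)) (y (l + 1) ∘ₗ d.s)
          (ev a (y (l + 1)) d.U) (fun ξ => by
            have := h.comm l (by omega) (l + 1) hk (by omega)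
            exact comm_of (y l) (ev a (y (l + 1))) _ _) (d.source_ev a (y (l + 1))) ξ
        rw [← conv_assoc] at e2
        simp only [pre]
        rw [← mul_assoc, e1, mul_assoc, e2, mul_assoc]
    · exact commute_ev _ _ _ _ (fun ξ => ih (by omega) ξ (by omega)) fun ξ => key k hk (by omega) (by omega) _

end rels

/-! ### The relations between links and sites -/

section main

variable (h : IsChain n y p q) (ha : Off n y p q a) (hb : Off n y p q b) (hab : Comm a b)

include h

lemma comm_pq_theta (k : ℕ) (hk : k ≤ n) : Comm (d.theta y k) p ∧ Comm (d.theta y k) q :=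
  ⟨theta_comm _ k fun i hi => h.comm_p i (hi.trans_le hk),
    theta_comm _ k fun i hi => h.comm_q i (hi.trans_le hk)⟩

include ha

lemma commute_y_u {l k : ℕ} (hl : l < n) (hk : k < n) (hlk : l ≠ k) (X : G ⊗[ℂ] B) (β : B) :
    Commute (y l β) (ev a (y k) X) := by
  have := ha.comm l hl
  have := h.comm l hl k hk hlk
  exact comm_of (y l) (ev a (y k)) _ _

lemma commute_y_pre {l m : ℕ} (hl : l < n) (hm : m ≤ n) (hlm : l + 1 ≠ m) (β : B) :
    Commute (y l β) (d.pre y a m) := by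
  refine (commute_pre ha m (fun ξ => ?_) fun k hk β' => ?_).symm
  · have := ha.comm l hl
    exact comm_of a (y l) _ _
  · have := h.comm k (by omega) l hl (by omega)
    exact comm_of (y k) (y l) _ _

lemma commute_pq_pre {m : ℕ} (hm : m ≤ n) (ξ : G) :
    Commute (p ξ) (d.pre y a m) ∧ Commute (q ξ) (d.pre y a m) := by
  have := ha.comm_p
  have := ha.comm_q
  refine ⟨(commute_pre ha m (fun η => ?_) fun k hk β' => ?_).symm,
    (commute_pre ha m (fun η => ?_) fun k hk β' => ?_).symm⟩
  · exact comm_of a p _ _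
  · have := h.comm_p k (by omega)
    exact comm_of (y k) p _ _
  · exact comm_of a q _ _
  · have := h.comm_q k (by omega)
    exact comm_of (y k) q _ _

lemma commute_pq_u {m : ℕ} (hm : m < n) (X : G ⊗[ℂ] B) (ξ : G) :
    Commute (p ξ) (ev a (y m) X) ∧ Commute (q ξ) (ev a (y m) X) := by
  have := ha.comm_p
  have := ha.comm_q
  have := h.comm_p m hm
  have := h.comm_q m hm
  exact ⟨comm_of p (ev a (y m)) _ _, comm_of q (ev a (y m)) _ _⟩

lemma commute_t_theta {l k : ℕ} (hl : l < n) (hk : k ≤ n) (η ξ : G) :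
    Commute (d.theta y k η) (y l (d.t ξ)) := by
  refine commute_theta k (fun i hi η => ?_) η
  have := h.mul l hl
  by_cases hil : i = l
  · subst hil
    exact comm_of (y i ∘ₗ d.s) (y i ∘ₗ d.t) _ _
  · have := h.comm i (by omega) l hl hil
    exact comm_of (y i) (y l) _ _

omit ha in
lemma target_core_aux [IsMulMap a] (ha : Off n y p q a) (ξ : G) :
    conv (conv (d.theta y n) a) (conv p q) ξ * d.core y p n a =
      d.core y p n a * conv a (conv (d.theta y n) (conv p q)) ξ := by
  have := h.mul_p
  have := h.mul_q
  have := h.comm_pq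
  have := ha.comm_p
  have := ha.comm_q
  have := theta_mul (d := d) h n le_rfl
  obtain ⟨_, _⟩ := comm_pq_theta (d := d) h n le_rfl
  have := off_theta (d := d) ha n le_rfl
  have e1 : ∀ ξ, conv a p ξ * (Γ.r p a * Γ.r a p) = (Γ.r p a * Γ.r a p) * conv a p ξ := by
    intro ξ
    rw [mul_assoc, Γ.r_mul_conv a p, reassoc₂ (Γ.r_mul_conv p a ξ).symm]
  have e2 : ∀ ξ, conv (d.theta y n) (conv (conv a p) q) ξ * (Γ.r p a * Γ.r a p) =
      (Γ.r p a * Γ.r a p) * conv (d.theta y n) (conv (conv a p) q) ξ := by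
    refine conv_conj_right _ _ _ _ (fun ξ => ?_) (conv_conj_left _ _ _ _ e1 fun ξ => ?_)
    · exact (Γ.commute_r p a (fun x => comm_of p _ x ξ) fun x => comm_of a _ x ξ).symm.mul_right
        (Γ.commute_r a p (fun x => comm_of a _ x ξ) fun x => comm_of p _ x ξ).symm
    · exact (Γ.commute_r p a (fun x => comm_of p _ x ξ) fun x => comm_of a _ x ξ).symm.mul_right
        (Γ.commute_r a p (fun x => comm_of a _ x ξ) fun x => comm_of p _ x ξ).symm
  have e3 : ∀ ξ, conv (conv (d.theta y n) a) (conv p q) ξ * Γ.r a (d.theta y n) =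
      Γ.r a (d.theta y n) * conv (conv a (d.theta y n)) (conv p q) ξ := by
    refine conv_conj_left _ _ _ _ (fun ξ => (Γ.r_mul_conv _ _ ξ).symm) fun ξ => ?_
    exact (Γ.commute_r a _ (fun x => comm_of a _ x ξ) fun x => comm_of (d.theta y n) _ x ξ).symm
  simp only [conv_assoc] at e2 e3 ⊢
  rw [core, ← mul_assoc, e2, mul_assoc, e3]
  simp only [mul_assoc]

/-- `ι_m J_m = J_m (a ⊠ ι_m)`. -/
lemma site_mul_link (m : ℕ) (hm : m ≤ n) (hn : n ≠ 0) (ξ : G) :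
    d.chainSite y p q n m ξ * d.chainLink y p n a m =
      d.chainLink y p n a m * conv a (d.chainSite y p q n m) ξ := by
  have := ha.mul
  rcases hm.lt_or_eq with hm' | rfl
  · have := h.mul m hm'
    have := ha.comm m hm'
    simp only [chainSite, chainLink, if_pos hm']
    rw [comp_apply, reassoc₂ (commute_y_pre h ha hm' hm (by omega) _).eq,
      d.target_ev a (y m), mul_assoc]
  · simp only [chainSite, chainLink, if_neg (lt_irrefl _)]
    rw [← mul_assoc, conv_conj_left _ _ _ _ (theta_mul_pre h ha m le_rfl hn), mul_assoc,
      target_core_aux h ha, ← mul_assoc]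
    · intro ξ
      exact commute_ev _ _ _ _ (fun ξ => (commute_pq_pre h ha le_rfl ξ).1)
        (fun ξ => (commute_pq_pre h ha le_rfl ξ).2)

lemma commute_site_core {l : ℕ} (hl : l < n) (ξ : G) : Commute (y l (d.t ξ)) (d.core y p n a) := by
  refine (commute_core ha (fun η => ?_) (fun η => ?_) (fun η => ?_)).symm
  · have := ha.comm l hl
    exact comm_of a (y l) _ _
  · have := h.comm_p l hl
    exact comm_of p (y l) _ _
  · exact commute_t_theta h ha hl le_rfl η ξ

/-- `(a ⊠ ι_{m-1}) J_m = J_m ι_{m-1}`. -/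
lemma conv_site_mul_link (m : ℕ) (hm : m + 1 ≤ n) (ξ : G) :
    conv a (d.chainSite y p q n m) ξ * d.chainLink y p n a (m + 1) =
      d.chainLink y p n a (m + 1) * d.chainSite y p q n m ξ := by
  have := ha.mul
  have := h.mul m hm
  have := ha.comm m hm
  simp only [chainSite, chainLink, if_pos (Nat.lt_of_succ_le hm), pre]
  rw [← mul_assoc, d.conv_mul_left a (y m), mul_assoc, mul_assoc]
  congr 1
  split_ifs with h1
  · exact commute_y_u h ha hm h1 (by omega) _ _
  · exact commute_site_core h ha hm ξ

lemma conv_site_mul_link_zero (hn : n ≠ 0) (ξ : G) :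
    conv a (d.chainSite y p q n n) ξ * d.chainLink y p n a 0 =
      d.chainLink y p n a 0 * d.chainSite y p q n n ξ := by
  simp only [chainSite, chainLink, if_pos (Nat.pos_of_ne_zero hn), if_neg (lt_irrefl _), pre,
    one_mul]
  rw [← conv_assoc]
  refine conv_conj_left _ _ _ _ (conv_theta_mul_u h ha n le_rfl hn) (fun ξ => ?_) ξ
  exact commute_ev _ _ _ _ (fun ξ => (commute_pq_u h ha (Nat.pos_of_ne_zero hn) _ ξ).1)
      (fun ξ => (commute_pq_u h ha (Nat.pos_of_ne_zero hn) _ ξ).2)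

/-- The loop relation for a chain without links. -/
lemma loop_site (ξ : G) (hn : n = 0) : conv a (d.chainSite y p q n 0) ξ * d.chainLink y p n a 0 =
      d.chainLink y p n a 0 * conv a (d.chainSite y p q n 0) ξ := by
  subst hn
  have := ha.mul
  have e := target_core_aux (d := d) h ha ξ
  have e1 : d.theta y 0 = triv G E := rfl
  simp only [e1, triv_conv] at e
  simpa only [chainSite, chainLink, pre, one_mul, if_neg (lt_irrefl _), e1, triv_conv] using e

lemma commute_site_link_of_lt {l m : ℕ} (hm : m ≤ n) (hl : l < n) (h1 : l ≠ m)
    (h2 : l + 1 ≠ m) (ξ : G) :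
    Commute (d.chainSite y p q n l ξ) (d.chainLink y p n a m) := by
  simp only [chainSite, chainLink, if_pos hl]
  refine Commute.mul_right (commute_y_pre h ha hl hm h2 _) ?_
  split_ifs with h3
  · exact commute_y_u h ha hl h3 h1 _ _
  · exact commute_site_core h ha hl ξ

lemma commute_base_link {m : ℕ} (hm : m < n) (h1 : m ≠ 0) (ξ : G) :
    Commute (d.chainSite y p q n n ξ) (d.chainLink y p n a m) := by
  simp only [chainSite, chainLink, if_pos hm, if_neg (lt_irrefl _)]
  refine commute_ev _ _ _ _ (commute_theta_link h ha m n h1 hm le_rfl) fun ξ => ?_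
  exact commute_ev _ _ _ _ (fun ξ => (commute_pq_pre h ha hm.le ξ).1.mul_right
    (commute_pq_u h ha hm _ ξ).1) fun ξ => (commute_pq_pre h ha hm.le ξ).2.mul_right
    (commute_pq_u h ha hm _ ξ).2

include hb hab

lemma pre_mul_pre (m : ℕ) (hm : m ≤ n) :
    d.pre y a m * (d.pre y b m * Γ.r a b) = Γ.r a b * d.pre y (conv a b) m := by
  cases m with
  | zero => simp [pre]
  | succ k =>
    have := ha.mul
    have := hb.mul
    have := h.mul k hm
    have := ha.comm k hm
    have := hb.comm k hm
    exact d.left_mul_left a b (y k)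

lemma commute_pre_u {m k : ℕ} (hm : m ≤ n) (hk : k < n) (hmk : m ≠ k + 1) (X : G ⊗[ℂ] B) :
    Commute (d.pre y a m) (ev b (y k) X) := by
  refine (commute_ev _ _ _ _ (fun ξ => ?_) fun β => ?_).symm
  · refine (commute_pre ha m (fun η => comm_of a b η ξ) fun l hl β => ?_).symm
    have := hb.comm l (by omega)
    exact comm_of (y l) b _ _
  · exact commute_y_pre h ha hk hm (by omega) β

lemma commute_pre_pre {m k : ℕ} (hm : m ≤ n) (hk : k ≤ n) (hmk : m ≠ k) :
    Commute (d.pre y a m) (d.pre y b k) := by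
  refine (commute_pre hb k (fun ξ => ?_) fun l hl β => ?_).symm
  · refine (commute_pre ha m (fun η => comm_of a b η ξ) fun l hl β => ?_).symm
    have := hb.comm l (by omega)
    exact comm_of (y l) b _ _
  · exact commute_y_pre h ha (by omega) hm (by omega) β

omit h ha hb in
lemma q_mul_r_mul_q [IsMulMap a] [IsMulMap b] [IsMulMap p] [Comm a p] [Comm b p] :
    (Γ.r p a * Γ.r a p) * (Γ.r a b * (Γ.r p b * Γ.r b p)) =
      Γ.r a b * (Γ.r p (conv a b) * Γ.r (conv a b) p) := by
  have y1 := Γ.yang_baxter a p b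
  have y2 := Γ.yang_baxter a b p
  have c := Γ.r_mul_ev_conv' a b p Γ.R.1
  change Γ.r a b * Γ.r p (conv a b) = Γ.r p (conv b a) * Γ.r a b at c
  rw [reassoc₂ c, Γ.r_conv_right p b a, Γ.r_conv_left a b p]
  simp only [mul_assoc] at y1 y2 ⊢
  rw [y2]
  have y3 := congrArg (· * Γ.r b p) y1
  simp only [mul_assoc] at y3
  rw [y3, y2]

lemma core_mul_core : Γ.r p a * Γ.r a p * (Γ.r a b * (Γ.r a (d.theta y n) * d.core y p n b)) =
    Γ.r a b * d.core y p n (conv a b) := by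
  have := ha.mul
  have := hb.mul
  have := ha.comm_p
  have := hb.comm_p
  have := h.mul_p
  have := theta_mul (d := d) h n le_rfl
  obtain ⟨_, _⟩ := comm_pq_theta (d := d) h n le_rfl
  have := off_theta (d := d) ha n le_rfl
  have := off_theta (d := d) hb n le_rfl
  have c : Γ.r a (d.theta y n) * (Γ.r p b * Γ.r b p) = Γ.r p b * Γ.r b p * Γ.r a (d.theta y n) :=
    ((comm_of (ev a (d.theta y n)) (ev p b) Γ.R.1 Γ.R.1).mul_right
      (comm_of (ev a (d.theta y n)) (ev b p) Γ.R.1 Γ.R.1)).eq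
  have e := congrArg (· * Γ.r (conv a b) (d.theta y n)) (q_mul_r_mul_q (Γ := Γ) (p := p) hab)
  simp only [core] at e ⊢
  rw [reassoc c, Γ.r_conv_left a b (d.theta y n)] at *
  simp only [mul_assoc] at e ⊢
  exact e

omit hb in
lemma core_mul_u (hb : Off n y p q b) (hn : n ≠ 0) : d.core y p n a *
    (Γ.r a b * ev b (y 0) d.U) = ev b (y 0) d.U * d.core y p n a := by
  have := ha.mul
  have := hb.mul
  have := h.mul 0 (Nat.pos_of_ne_zero hn)
  have := ha.comm 0 (Nat.pos_of_ne_zero hn)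
  have := hb.comm 0 (Nat.pos_of_ne_zero hn)
  have := h.comm_p 0 (Nat.pos_of_ne_zero hn)
  have := theta_mul (d := d) h n le_rfl
  have := off_theta (d := d) ha n le_rfl
  have := off_theta (d := d) hb n le_rfl
  have := ha.comm_p
  have := hb.comm_p
  have c : Γ.r p a * Γ.r a p * ev b (y 0) d.U = ev b (y 0) d.U * (Γ.r p a * Γ.r a p) :=
    ((comm_of (ev p a) (ev b (y 0)) Γ.R.1 d.U).mul_left
      (comm_of (ev a p) (ev b (y 0)) Γ.R.1 d.U)).eq
  have e : Γ.r a (conv b (d.theta y n)) * ev b (y 0) d.U = ev b (y 0) d.U * Γ.r a (d.theta y n) :=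
    (ev_conj_right a (d.theta y n) (conv b (d.theta y n)) _
      (fun ξ => comm_of a (ev b (y 0)) ξ d.U)
      (fun ξ => (conv_theta_mul_u h hb n le_rfl hn ξ).symm) _).symm
  rw [Γ.r_conv_right a b (d.theta y n)] at e
  simp only [core]
  rw [mul_assoc _ (Γ.r a (d.theta y n)), ← mul_assoc (Γ.r a (d.theta y n)), e, reassoc₂ c]

omit hb in
lemma core_mul_pre (hb : Off n y p q b) (hn : n ≠ 0) : d.core y p n a * d.pre y b n =
    d.pre y b n * (Γ.r p a * Γ.r a p * (Γ.r a b * Γ.r a (d.theta y n))) := by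
  have := ha.mul
  have := hb.mul
  have := theta_mul (d := d) h n le_rfl
  have := off_theta (d := d) ha n le_rfl
  have := off_theta (d := d) hb n le_rfl
  have ca : ∀ ξ, Commute (a ξ) (d.pre y b n) := fun ξ => by
    refine (commute_pre hb n (fun η => (comm_of a b ξ η).symm) fun l hl β => ?_).symm
    have := ha.comm l (by omega)
    exact comm_of (y l) a _ _
  have cp : ∀ ξ, Commute (p ξ) (d.pre y b n) := fun ξ => (commute_pq_pre h hb le_rfl ξ).1
  have c : Γ.r p a * Γ.r a p * d.pre y b n = d.pre y b n * (Γ.r p a * Γ.r a p) :=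
    ((Γ.commute_r p a cp ca).mul_left (Γ.commute_r a p ca cp)).eq
  have e : Γ.r a (d.theta y n) * d.pre y b n = d.pre y b n * Γ.r a (conv (d.theta y n) b) :=
    (ev_conj_right a (conv (d.theta y n) b) (d.theta y n) _ ca
      (fun ξ => (theta_mul_pre h hb n le_rfl hn ξ).symm) _).symm
  rw [Γ.r_conv_right a (d.theta y n) b] at e
  simp only [core]
  rw [mul_assoc _ (Γ.r a (d.theta y n)), e, reassoc₂ c]

/-- `J_m(a) J_m(b) = R_{ab} J_m(ab)`. -/
lemma link_mul_link (m : ℕ) (hm : m ≤ n) (hn : n ≠ 0) :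
    d.chainLink y p n a m * d.chainLink y p n b m = Γ.r a b * d.chainLink y p n (conv a b) m := by
  have := ha.mul
  have := hb.mul
  have hp : d.pre y a m * d.pre y b m = Γ.r a b * d.pre y (conv a b) m * Γ.ri a b := by
    rw [← pre_mul_pre h ha hb hab m hm, mul_assoc, mul_assoc, Γ.r_mul_ri, mul_one]
  rcases hm.lt_or_eq with hm' | rfl
  · have := h.mul m hm'
    have := ha.comm m hm'
    have := hb.comm m hm'
    simp only [chainLink, if_pos hm']
    rw [mul_assoc, reassoc₂ (commute_pre_u h hb ha inferInstance hm hm' (by omega) _).symm.eq,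
      d.funct_ev a b (y m), reassoc hp]
    simp only [mul_assoc]
    rw [reassoc (Γ.ri_mul_r a b), one_mul]
  · simp only [chainLink, if_neg (lt_irrefl _)]
    rw [mul_assoc, ← mul_assoc (d.core y p m a), core_mul_pre h ha hab hb hn]
    simp only [mul_assoc]
    rw [← mul_assoc (Γ.r p a), core_mul_core h ha hb hab, reassoc hp]
    simp only [mul_assoc]
    rw [reassoc (Γ.ri_mul_r a b), one_mul]

lemma loop_mul_loop (hn : n = 0) : d.chainLink y p n a 0 * (Γ.r a b * d.chainLink y p n b 0) =
      Γ.r a b * d.chainLink y p n (conv a b) 0 := by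
  subst hn
  have := ha.mul
  have e := core_mul_core (d := d) h ha hb hab
  have e1 : Γ.r a (d.theta y 0) = 1 := Γ.r_triv a
  rw [e1, one_mul] at e
  simp only [chainLink, if_neg (lt_irrefl _), pre, one_mul]
  rw [core, e1, mul_one, e]

lemma commute_links {m l : ℕ} (hml : m + 1 < l) (hl : l ≤ n) (h0 : m ≠ 0 ∨ l < n) :
    Commute (d.chainLink y p n a m) (d.chainLink y p n b l) := by
  have := ha.mul
  have := h.mul m (by omega)
  have := ha.comm m (by omega)
  have hm : m < n := by omega
  have e1 : Commute (d.chainLink y p n a m) (d.pre y b l) := by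
    simp only [chainLink, if_pos hm]
    exact (commute_pre_pre h ha hb hab hm.le hl (by omega)).mul_left
      (commute_pre_u h hb ha inferInstance hl hm (by omega) _).symm
  refine e1.mul_right ?_
  simp only [chainLink, if_pos hm]
  split_ifs with h1
  · refine Commute.mul_left (commute_pre_u h ha hb hab hm.le h1 (by omega) _) ?_
    have := hb.comm m hm
    have := ha.comm l h1
    have := h.comm m hm l h1 (by omega)
    exact comm_of (ev a (y m)) (ev b (y l)) _ _
  · have ca : ∀ ξ, Commute (b ξ) (d.pre y a m * ev a (y m) d.U) := fun ξ => by
      refine Commute.mul_right (commute_pre ha m (fun η => comm_of a b η ξ) fun k hk β => ?_).symm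
        ?_
      · have := hb.comm k (by omega)
        exact comm_of (y k) b _ _
      · have := hb.comm m hm
        exact comm_of b (ev a (y m)) _ _
    exact (commute_core hb ca (fun ξ => (commute_pq_pre h ha hm.le ξ).1.mul_right
      (commute_pq_u h ha hm _ ξ).1)
      (commute_theta_link h ha m n (h0.resolve_right (by omega)) hm le_rfl)).symm

/-- `J_m(a) R_{ab} J_{m+1}(b) = J_{m+1}(b) J_m(a)`. -/
lemma link_mul_r_mul_next (m : ℕ) (hm : m + 1 ≤ n) (h0 : m ≠ 0 ∨ m + 1 < n) :
    d.chainLink y p n a m * (Γ.r a b * d.chainLink y p n b (m + 1)) =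
      d.chainLink y p n b (m + 1) * d.chainLink y p n a m := by
  have := ha.mul
  have := hb.mul
  have := h.mul m hm
  have := ha.comm m hm
  have := hb.comm m hm
  have e : ev a (y m) d.U * (Γ.r a b * d.pre y b (m + 1)) =
    d.pre y b (m + 1) * ev a (y m) d.U := d.u_mul_r_mul_left a b (y m)
  have e1 := commute_pre_pre (d := d) h ha hb hab (m := m) (k := m + 1) (by omega) hm (by omega)
  have e2 : Commute (d.chainLink y p n a m)
      (if m + 1 < n then ev b (y (m + 1)) d.U else d.core y p n b) := by
    simp only [chainLink, if_pos (Nat.lt_of_succ_le hm)]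
    split_ifs with h1
    · refine Commute.mul_left (commute_pre_u h ha hb hab (by omega) h1 (by omega) _) ?_
      have := ha.comm (m + 1) h1
      have := h.comm m hm (m + 1) h1 (by omega)
      exact comm_of (ev a (y m)) (ev b (y (m + 1))) _ _
    · have ca : ∀ ξ, Commute (b ξ) (d.pre y a m * ev a (y m) d.U) := fun ξ => by
        refine Commute.mul_right
          (commute_pre ha m (fun η => comm_of a b η ξ) fun k hk β => ?_).symm ?_
        · have := hb.comm k (by omega)
          exact comm_of (y k) b _ _
        · exact comm_of b (ev a (y m)) _ _
      exact (commute_core hb ca (fun ξ => (commute_pq_pre h ha (by omega) ξ).1.mul_right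
        (commute_pq_u h ha hm _ ξ).1)
        (commute_theta_link h ha m n (h0.resolve_right (by omega)) hm le_rfl)).symm
  generalize hX : (if m + 1 < n then ev b (y (m + 1)) d.U else d.core y p n b) = X at e2
  have hY : d.chainLink y p n b (m + 1) = d.pre y b (m + 1) * X := by rw [chainLink, hX]
  rw [hY, mul_assoc, ← e2.eq]
  simp only [chainLink, if_pos (Nat.lt_of_succ_le hm), mul_assoc]
  rw [← mul_assoc (Γ.r a b), reassoc₂ e, reassoc₂ e1.eq]

lemma last_mul_r_mul_first (hn : 2 ≤ n) :
    d.chainLink y p n a n * (Γ.r a b * d.chainLink y p n b 0) =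
      d.chainLink y p n b 0 * d.chainLink y p n a n := by
  have hn0 : 0 < n := by omega
  have e := core_mul_u (d := d) h ha hab hb (by omega)
  have hz : d.pre y b 0 = 1 := rfl
  simp only [chainLink, if_pos hn0, if_neg (lt_irrefl _), hz, one_mul]
  rw [mul_assoc, e, reassoc₂ (commute_pre_u h ha hb hab le_rfl hn0 (by omega) _).eq]

lemma first_mul_r_mul_last_two (hn : n = 1) :
    d.chainLink y p n a 0 * (Γ.r a b * d.chainLink y p n b 1) =
      d.chainLink y p n b 1 * (Γ.r b a * d.chainLink y p n a 0) := by
  subst hn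
  have := ha.mul
  have := hb.mul
  have := h.mul 0 one_pos
  have := ha.comm 0 one_pos
  have := hb.comm 0 one_pos
  have e := core_mul_u (d := d) h hb inferInstance ha one_ne_zero
  have e1 := d.u_mul_r_mul_left a b (y 0)
  simp only [chainLink, if_pos one_pos, if_neg (lt_irrefl _), pre, one_mul]
  rw [mul_assoc, e, ← mul_assoc (Γ.r a b), reassoc₂ e1]

lemma last_mul_r_mul_first_two (hn : n = 1) :
    d.chainLink y p n a 1 * (Γ.r a b * d.chainLink y p n b 0) =
      d.chainLink y p n b 0 * (Γ.r b a * d.chainLink y p n a 1) := by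
  subst hn
  have := ha.mul
  have := hb.mul
  have := h.mul 0 one_pos
  have := ha.comm 0 one_pos
  have := hb.comm 0 one_pos
  have e := core_mul_u (d := d) h ha hab hb one_ne_zero
  have e1 := d.u_mul_r_mul_left b a (y 0)
  simp only [chainLink, if_pos one_pos, if_neg (lt_irrefl _), pre, one_mul]
  rw [mul_assoc, e, ← mul_assoc (Γ.r b a), reassoc₂ e1]

end main

end Link

end Chain

/-! ## The homomorphism defined by a chain -/

section ChainData

namespace Link

variable (d : Link Γ B) (y : ℕ → (B →ₗ[ℂ] E)) (p q : G →ₗ[ℂ] E) (n : ℕ) (a : G →ₗ[ℂ] E)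
  (k : E →ₗ[ℂ] F) [IsMulMap k]

lemma map_theta (m : ℕ) : k ∘ₗ d.theta y m = d.theta (fun i => k ∘ₗ y i) m := map_iterConv k _ m

lemma map_left (x : B →ₗ[ℂ] E) : k (d.left a x) = d.left (k ∘ₗ a) (k ∘ₗ x) := by
  simp only [left, mm_mul k, map_ev k, RibbonStar.map_ri]; rfl

lemma map_pre (m : ℕ) : k (d.pre y a m) = d.pre (fun i => k ∘ₗ y i) (k ∘ₗ a) m := by
  cases m with
  | zero => exact mm_one k
  | succ m => exact d.map_left a k (y m)

lemma map_core : k (d.core y p n a) = d.core (fun i => k ∘ₗ y i) (k ∘ₗ p) n (k ∘ₗ a) := by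
  simp only [core, mm_mul k, RibbonStar.map_r, map_theta]

lemma map_chainLink (m : ℕ) : k (d.chainLink y p n a m) =
    d.chainLink (fun i => k ∘ₗ y i) (k ∘ₗ p) n (k ∘ₗ a) m := by
  simp only [chainLink, mm_mul k, map_pre]
  split_ifs
  · rw [map_ev k]
  · rw [map_core]

lemma map_chainSite (m : ℕ) : k ∘ₗ d.chainSite y p q n m =
    d.chainSite (fun i => k ∘ₗ y i) (k ∘ₗ p) (k ∘ₗ q) n m := by
  simp only [chainSite]
  split_ifs
  · rfl
  · simp only [map_conv, map_theta]

variable {d y p q n a}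

lemma isUnit_pre (h : IsChain n y p q) (ha : Off n y p q a) (m : ℕ) (hm : m ≤ n) :
    IsUnit (d.pre y a m) := by
  cases m with
  | zero => exact isUnit_one
  | succ m =>
    have := h.mul m hm
    have := ha.mul
    have := ha.comm m hm
    exact ⟨⟨_, _, d.left_mul_leftInv a (y m), d.leftInv_mul_left a (y m)⟩, rfl⟩

lemma isUnit_r (f g : G →ₗ[ℂ] E) [IsMulMap f] [IsMulMap g] [Comm f g] : IsUnit (Γ.r f g) :=
  ⟨⟨_, _, Γ.r_mul_ri f g, Γ.ri_mul_r f g⟩, rfl⟩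

lemma isUnit_chainLink (h : IsChain n y p q) (ha : Off n y p q a) (m : ℕ) (hm : m ≤ n) :
    IsUnit (d.chainLink y p n a m) := by
  have := ha.mul
  refine (isUnit_pre h ha m hm).mul ?_
  split_ifs with h1
  · have := h.mul m h1
    have := ha.comm m h1
    exact ⟨⟨_, _, d.u_mul_ui a (y m), d.ui_mul_u a (y m)⟩, rfl⟩
  · have := ha.comm_p
    have := h.mul_p
    have := theta_mul (d := d) h n le_rfl
    have := off_theta (d := d) ha n le_rfl
    exact ((isUnit_r p a).mul (isUnit_r a p)).mul (isUnit_r a _)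

lemma chainSite_mul (h : IsChain n y p q) (m : ℕ) : IsMulMap (d.chainSite y p q n m) := by
  simp only [chainSite]
  split_ifs with h1
  · have := h.mul m h1
    infer_instance
  · have := h.mul_p
    have := h.mul_q
    have := h.comm_pq
    have := theta_mul (d := d) h n le_rfl
    obtain ⟨_, _⟩ := comm_pq_theta (d := d) h n le_rfl
    infer_instance

lemma chainSite_comm_aux (h : IsChain n y p q) (m l : ℕ) (hm : m < n)
    (hml : m ≠ l) : Comm (d.chainSite y p q n m) (d.chainSite y p q n l) := by
  simp only [chainSite, if_pos hm]
  split_ifs with h1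
  · have := h.comm m hm l h1 hml
    infer_instance
  · have := h.comm_p m hm
    have := h.comm_q m hm
    have : Comm (d.theta y n) (y m ∘ₗ d.t) := ⟨fun ξ η => by
      refine commute_theta n (fun i hi ξ => ?_) ξ
      have := h.mul m hm
      by_cases hil : i = m
      · subst hil
        exact comm_of (y i ∘ₗ d.s) (y i ∘ₗ d.t) _ _
      · have := h.comm i (by omega) m hm hil
        exact comm_of (y i) (y m) _ _⟩
    infer_instance

lemma chainSite_comm (h : IsChain n y p q) (m l : ℕ) (hm : m ≤ n) (hl : l ≤ n)
    (hml : m ≠ l) : Comm (d.chainSite y p q n m) (d.chainSite y p q n l) := by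
  rcases hm.lt_or_eq with hm | rfl
  · exact chainSite_comm_aux h m l hm hml
  · have := chainSite_comm_aux (d := d) h l m (by omega) hml.symm
    infer_instance

end Link

lemma ZMod.exists_eq_add_one {n : ℕ} (k : ZMod (n + 1)) :
    ∃ m : ℕ, m ≤ n ∧ k = (m : ZMod (n + 1)) + 1 :=
  ⟨(k - 1).val, Nat.lt_succ_iff.mp (ZMod.val_lt _), by simp⟩

lemma ZMod.val_add_one_sub {n m : ℕ} (hm : m ≤ n) :
    ((m : ZMod (n + 1)) + 1 - 1).val = m := by
  rw [add_sub_cancel_right, ZMod.val_natCast_of_lt (Nat.lt_succ_of_le hm)]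

lemma ZMod.natCast_self_add_one (n : ℕ) : (n : ZMod (n + 1)) + 1 = 0 := by
  exact_mod_cast ZMod.natCast_self (n + 1)

namespace IsChain

variable {n : ℕ} {y : ℕ → (B →ₗ[ℂ] A)} {p q : G →ₗ[ℂ] A}

lemma off_inl (_ : IsChain n y p q) :
    Off n (fun i => inr G A ∘ₗ y i) (inr G A ∘ₗ p) (inr G A ∘ₗ q) (inl G A) :=
  ⟨inferInstance, fun _ _ => inferInstance, inferInstance, inferInstance⟩

lemma off_fst (_ : IsChain n y p q) :
    Off n (fun i => thd G A ∘ₗ y i) (thd G A ∘ₗ p) (thd G A ∘ₗ q) (fst G A) :=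
  ⟨inferInstance, fun _ _ => inferInstance, inferInstance, inferInstance⟩

instance : Comm (snd G A) (thd G A) := inferInstance

lemma off_snd (_ : IsChain n y p q) :
    Off n (fun i => thd G A ∘ₗ y i) (thd G A ∘ₗ p) (thd G A ∘ₗ q) (snd G A) :=
  ⟨inferInstance, fun _ _ => inferInstance, inferInstance, inferInstance⟩

variable (d : Link Γ B)

/-- The link with number `m`, as an element of `G ⊗ A`. -/
def link (y : ℕ → (B →ₗ[ℂ] A)) (p : G →ₗ[ℂ] A) (n m : ℕ) : G ⊗[ℂ] A :=
  d.chainLink (fun i => inr G A ∘ₗ y i) (inr G A ∘ₗ p) n (inl G A) m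

lemma ev_link (a : G →ₗ[ℂ] E) (x : A →ₗ[ℂ] E) [IsMulMap a] [IsMulMap x] [Comm a x] (m : ℕ) :
    ev a x (link d y p n m) = d.chainLink (fun i => x ∘ₗ y i) (x ∘ₗ p) n a m := by
  simp only [link, Link.map_chainLink, ev_comp_inr_comp, ev_comp_inl]

variable (h : IsChain n y p q)
include h

lemma inv_aux (m : ℕ) (hm : m ≤ n) : IsUnit (link d y p n m) :=
  Link.isUnit_chainLink (h.map (inr G A)) h.off_inl m hm

/-- The data defined by a chain. -/
def data : CurrentData Γ (n + 1) A where
  site k := d.chainSite y p q n (k - 1).val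
  link k := link d y p n (k - 1).val
  linkInv k := Ring.inverse (link d y p n (k - 1).val)
  site_mul k := Link.chainSite_mul h _
  site_comm k l hkl := by
    obtain ⟨m, hm, rfl⟩ := ZMod.exists_eq_add_one k
    obtain ⟨m', hm', rfl⟩ := ZMod.exists_eq_add_one l
    rw [ZMod.val_add_one_sub hm, ZMod.val_add_one_sub hm']
    exact Link.chainSite_comm h m m' hm hm' fun hmm => hkl (by rw [hmm])
  inv_right k := Ring.mul_inverse_cancel _ (h.inv_aux d _ (Nat.lt_succ_iff.mp (ZMod.val_lt _)))
  inv_left k := Ring.inverse_mul_cancel _ (h.inv_aux d _ (Nat.lt_succ_iff.mp (ZMod.val_lt _)))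
  target hn k ξ := by
    obtain ⟨m, hm, rfl⟩ := ZMod.exists_eq_add_one k
    rw [ZMod.val_add_one_sub hm, ← comp_apply, Link.map_chainSite]
    exact Link.site_mul_link (h.map (inr G A)) h.off_inl m hm (by omega) ξ
  source hn k ξ := by
    obtain ⟨m, hm, rfl⟩ := ZMod.exists_eq_add_one k
    rw [ZMod.val_add_one_sub hm, ← comp_apply, Link.map_chainSite]
    cases m with
    | zero =>
      have : ((((0 : ℕ) : ZMod (n + 1)) + 1 - 1) - 1).val = n := by
        rw [← ZMod.val_add_one_sub (le_refl n), ZMod.natCast_self_add_one]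
        simp
      rw [this]
      exact Link.conv_site_mul_link_zero (h.map (inr G A)) h.off_inl (by omega) ξ
    | succ m =>
      have : ((((m + 1 : ℕ) : ZMod (n + 1)) + 1 - 1) - 1).val = m := by
        rw [← ZMod.val_add_one_sub (show m ≤ n by omega)]
        simp
      rw [this]
      exact Link.conv_site_mul_link (h.map (inr G A)) h.off_inl m hm ξ
  far hn k l h1 h2 ξ := by
    obtain ⟨m, hm, rfl⟩ := ZMod.exists_eq_add_one k
    obtain ⟨m', hm', rfl⟩ := ZMod.exists_eq_add_one l
    rw [ZMod.val_add_one_sub hm, ZMod.val_add_one_sub hm',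
      ← comp_apply, Link.map_chainSite]
    have h1' : m' ≠ m := fun hh => h1 (by rw [hh])
    have h2' : m' + 1 ≠ m := fun hh => h2 (by rw [← hh]; push_cast; ring)
    rcases hm'.lt_or_eq with hlt | rfl
    · exact (Link.commute_site_link_of_lt (h.map (inr G A)) h.off_inl hm hlt h1' h2' ξ).eq
    · refine (Link.commute_base_link (h.map (inr G A)) h.off_inl (by omega) (fun hm0 => h2 ?_) ξ).eq
      rw [hm0, ZMod.natCast_self_add_one]
      simp
  loop hn k ξ := by
    obtain ⟨m, hm, rfl⟩ := ZMod.exists_eq_add_one k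
    obtain rfl : n = 0 := by omega
    obtain rfl : m = 0 := by omega
    rw [ZMod.val_add_one_sub hm, Link.map_chainSite]
    exact Link.loop_site (h.map (inr G A)) h.off_inl ξ rfl
  funct hn k := by
    obtain ⟨m, hm, rfl⟩ := ZMod.exists_eq_add_one k
    rw [ZMod.val_add_one_sub hm, leg₁_eq, leg₂_eq, aux_eq, comulAux_eq, ev_link,
      ev_link, ev_link]
    exact Link.link_mul_link (h.map (thd G A)) h.off_fst h.off_snd inferInstance m hm (by omega)
  funct_loop hn k := by
    obtain ⟨m, hm, rfl⟩ := ZMod.exists_eq_add_one k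
    obtain rfl : n = 0 := by omega
    obtain rfl : m = 0 := by omega
    rw [ZMod.val_add_one_sub hm, leg₁_eq, leg₂_eq, aux_eq, comulAux_eq, ev_link,
      ev_link, ev_link, mul_assoc]
    exact Link.loop_mul_loop (h.map (thd G A)) h.off_fst h.off_snd inferInstance rfl
  link_far k l h1 h2 h3 := by
    obtain ⟨m, hm, rfl⟩ := ZMod.exists_eq_add_one k
    obtain ⟨m', hm', rfl⟩ := ZMod.exists_eq_add_one l
    rw [ZMod.val_add_one_sub hm, ZMod.val_add_one_sub hm', leg₁_eq, leg₂_eq,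
      ev_link, ev_link]
    have h1' : m ≠ m' := fun hh => h1 (by rw [hh])
    have h2' : m' + 1 ≠ m := fun hh => h2 (by rw [← hh]; push_cast; ring)
    have h3' : m + 1 ≠ m' := fun hh => h3 (by rw [← hh]; push_cast; ring)
    rcases lt_or_gt_of_ne h1' with hlt | hlt
    · refine (Link.commute_links (h.map (thd G A)) h.off_fst h.off_snd inferInstance
        (by omega) hm' ?_).eq
      by_contra hh
      push Not at hh
      obtain rfl : m' = n := by omega
      exact h2 (by rw [hh.1, ZMod.natCast_self_add_one]; simp)
    · refine (Link.commute_links (h.map (thd G A)) h.off_snd h.off_fst inferInstance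
        (by omega) hm ?_).eq.symm
      by_contra hh
      push Not at hh
      obtain rfl : m = n := by omega
      exact h3 (by rw [hh.1, ZMod.natCast_self_add_one]; simp)
  next hn k := by
    obtain ⟨m, hm, rfl⟩ := ZMod.exists_eq_add_one k
    rw [ZMod.val_add_one_sub hm, leg₁_eq, leg₂_eq, aux_eq, mul_assoc, ev_link, ev_link]
    rcases hm.lt_or_eq with hlt | rfl
    · have : ((m : ZMod (n + 1)) + 1 + 1 - 1).val = m + 1 := by
        rw [← ZMod.val_add_one_sub (show m + 1 ≤ n by omega)]
        push_cast; rfl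
      rw [this]
      exact Link.link_mul_r_mul_next (h.map (thd G A)) h.off_fst h.off_snd inferInstance m hlt
        (by omega)
    · have : ((m : ZMod (m + 1)) + 1 + 1 - 1).val = 0 := by rw [ZMod.natCast_self_add_one]; simp
      rw [this]
      exact Link.last_mul_r_mul_first (h.map (thd G A)) h.off_fst h.off_snd inferInstance (by omega)
  next_two hn k := by
    obtain ⟨m, hm, rfl⟩ := ZMod.exists_eq_add_one k
    obtain rfl : n = 1 := by omega
    rw [ZMod.val_add_one_sub hm, leg₁_eq, leg₂_eq, aux_eq, aux_eq, mul_assoc,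
      mul_assoc, ev_link, ev_link, ev_flip]
    rcases hm.lt_or_eq with hlt | rfl
    · obtain rfl : m = 0 := by omega
      exact Link.first_mul_r_mul_last_two (h.map (thd G A)) h.off_fst h.off_snd inferInstance rfl
    · exact Link.last_mul_r_mul_first_two (h.map (thd G A)) h.off_fst h.off_snd inferInstance rfl

end IsChain

end ChainData

/-! ## The antipode and the `R`-matrix -/

section Antipode

variable (G) in
/-- The antipode, as a homomorphism to the opposite algebra. -/
def opAntipode : G →ₗ[ℂ] Gᵐᵒᵖ := (MulOpposite.opLinearEquiv ℂ).toLinearMap ∘ₗ antipode ℂ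

@[simp] lemma opAntipode_apply (ξ : G) : opAntipode G ξ = MulOpposite.op (antipode ℂ ξ) := rfl

instance : IsMulMap (opAntipode G) where
  map_one := by simp [HopfAlgebra.antipode_one]
  map_mul x y := by simp [HopfAlgebra.antipode_mul_antidistrib]

lemma conv_inv_unique (f g h : G →ₗ[ℂ] E) (h1 : conv f g = triv G E) (h2 : conv g h = triv G E) :
    f = h := by
  rw [← conv_triv f, ← h2, ← conv_assoc, h1, triv_conv]

/-- The antipode is an anti-homomorphism of coalgebras. -/
lemma conv_comp_antipode (f g : G →ₗ[ℂ] E) [IsMulMap f] [IsMulMap g] [Comm f g] :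
    conv f g ∘ₗ antipode ℂ = conv (g ∘ₗ antipode ℂ) (f ∘ₗ antipode ℂ) := by
  refine (conv_inv_unique _ (conv f g) _ ?_ (conv_antipode (conv f g))).symm
  rw [conv_assoc, ← conv_assoc _ f g, antipode_conv f, triv_conv, antipode_conv g]

lemma comul_eq_conv (ξ : G) : comul (R := ℂ) ξ = conv (inl G G) (inr G G) ξ := by
  rw [conv_apply, ev_inl_inr]

lemma comul_antipode (ξ : G) : comul (R := ℂ) (antipode ℂ ξ) =
    ev (inr G G ∘ₗ antipode ℂ) (inl G G ∘ₗ antipode ℂ) (comul ξ) := by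
  have h := LinearMap.congr_fun (conv_comp_antipode (inl G G) (inr G G)) ξ
  rwa [comp_apply, ← comul_eq_conv, conv_apply] at h

lemma antipode_leg_mul (X Y : G ⊗[ℂ] A) :
    ev (inl G A ∘ₗ antipode ℂ) LinearMap.id (leg₁ G A X * leg₂ G A Y) =
      LinearMap.rTensor A (antipode ℂ) X * Y := by
  induction X with
  | tmul x y =>
    simp only [leg₁, leg₂, Algebra.TensorProduct.map_tmul, Algebra.TensorProduct.includeRight_apply,
      Algebra.TensorProduct.tmul_mul_tmul, ev_tmul, LinearMap.rTensor_tmul, AlgHom.coe_id, id_eq,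
      mul_one, comp_apply, inl_apply, LinearMap.id_apply, ← mul_assoc, one_mul]
  | _ => simp_all [add_mul]

lemma mul_antipode_leg (X Y : G ⊗[ℂ] A) :
    ev₃ (inl G A) (inl G A ∘ₗ antipode ℂ) (inr G A) (leg₁ G A X * leg₂ G A Y) =
      X * LinearMap.rTensor A (antipode ℂ) Y := by
  induction X with
  | tmul x y =>
    induction Y with
    | zero => simp
    | add X X' h h' => simp only [map_add, mul_add, h, h']
    | tmul x' y' => simp [leg₁, leg₂, ev₃]
  | _ => simp_all [add_mul]

lemma mul_antipode_aux (X : G ⊗[ℂ] G) (Z : G ⊗[ℂ] A)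
    (hZ : ev₃ (inl G A) (inl G A ∘ₗ antipode ℂ) (inr G A) (comulAux G A Z) = 1) :
    ev₃ (inl G A) (inl G A ∘ₗ antipode ℂ) (inr G A) (aux G A X * comulAux G A Z) =
      inl G A (ev LinearMap.id (antipode ℂ) X) := by
  induction X with
  | zero => simp
  | add X X' h h' => simp only [map_add, add_mul, h, h']
  | tmul x y =>
    have : ∀ W, ev₃ (inl G A) (inl G A ∘ₗ antipode ℂ) (inr G A) (aux G A (x ⊗ₜ y) * W) = inl G A x *
          ev₃ (inl G A) (inl G A ∘ₗ antipode ℂ) (inr G A) W *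
          inl G A (antipode ℂ y) := by
      intro W
      induction W with
      | zero => simp
      | add X X' h h' => simp only [map_add, mul_add, add_mul, h, h']
      | tmul a W =>
        induction W with
        | zero => simp
        | add X X' h h' => simp only [map_add, mul_add, add_mul, TensorProduct.tmul_add, h, h']
        | tmul b c => simp [aux, ev₃, HopfAlgebra.antipode_mul_antidistrib, mul_assoc]
    rw [this, hZ]
    simp

lemma mul_antipode_aux_leg (X Y : G ⊗[ℂ] G) :
    lTensor G (ev LinearMap.id (antipode ℂ)) (aux G G X * leg₁ G G Y) =
      X * lTensor G (antipode ℂ) Y := by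
  induction X with
  | tmul x y =>
    induction Y with
    | zero => simp
    | add X X' h h' => simp only [map_add, mul_add, h, h']
    | tmul x' y' => simp [leg₁, aux]
  | _ => simp_all [add_mul]

variable (Γ)

namespace RibbonStar

/-- `(S ⊗ id)(R) = R⁻¹`. -/
lemma antipode_rTensor_R : LinearMap.rTensor G (antipode ℂ) Γ.R.1 = (Γ.R⁻¹).1 := by
  have h := congrArg (ev (inl G G ∘ₗ antipode ℂ) LinearMap.id) Γ.comul_left
  rw [antipode_leg_mul] at h
  have h1 : (LinearMap.id : G ⊗[ℂ] G →ₗ[ℂ] G ⊗[ℂ] G) = ev (inl G G) (inr G G) :=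
    LinearMap.ext fun X => (ev_inl_inr X).symm
  rw [h1] at h
  change ev₃ _ _ _ _ = _ at h
  rw [ev₃_comulAux, antipode_conv] at h
  change Γ.r (triv G _) (inr G G) = _ at h
  rw [triv_r] at h
  exact left_inv_eq_right_inv h.symm (Units.mul_inv _)

/-- `(id ⊗ S)(R⁻¹) = R`. -/
lemma antipode_lTensor_R_inv : lTensor G (antipode ℂ) (Γ.R⁻¹).1 = Γ.R := by
  let φ : G ⊗[ℂ] G →ₐ[ℂ] G ⊗[ℂ] (G ⊗[ℂ] G) :=
    Algebra.TensorProduct.map (AlgHom.id ℂ G) (Bialgebra.comulAlgHom ℂ G)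
  have h0 : φ Γ.R = leg₁ G G Γ.R * aux G G Γ.R := Γ.comul_right
  have h : φ (Γ.R⁻¹).1 = aux G G (Γ.R⁻¹).1 * leg₁ G G (Γ.R⁻¹).1 := by
    have e1 : φ (Γ.R⁻¹).1 * φ Γ.R = 1 := by rw [← map_mul, Units.inv_mul, map_one]
    refine left_inv_eq_right_inv e1 ?_
    rw [h0, mul_assoc, ← mul_assoc (aux G G _), ← map_mul, Units.mul_inv, map_one, one_mul,
      ← map_mul, Units.mul_inv, map_one]
  have h2 := congrArg (lTensor G (ev LinearMap.id (antipode ℂ))) h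
  rw [mul_antipode_aux_leg] at h2
  have h3 : ∀ X : G ⊗[ℂ] G, lTensor G (ev LinearMap.id (antipode ℂ)) (φ X) =
      ev (inl G G) (triv G _) X := by
    intro X
    induction X with
    | tmul x y =>
      have := LinearMap.congr_fun (conv_antipode (LinearMap.id : G →ₗ[ℂ] G)) y
      rw [conv_apply, LinearMap.id_comp] at this
      simp only [φ, Algebra.TensorProduct.map_tmul, LinearMap.lTensor_tmul, Bialgebra.comulAlgHom_apply]
      rw [this]
      simp [Algebra.algebraMap_eq_smul_one]
    | _ => simp_all
  rw [h3] at h2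
  change Γ.ri (inl G G) (triv G _) = _ at h2
  rw [ri_triv] at h2
  have := congrArg (Γ.R.1 * ·) h2
  simpa using this.symm

lemma antipode_map_R : TensorProduct.map (antipode ℂ) (antipode ℂ) Γ.R.1 = Γ.R := by
  conv_rhs => rw [← Γ.antipode_lTensor_R_inv, ← Γ.antipode_rTensor_R]
  rw [← comp_apply, LinearMap.lTensor_comp_rTensor]

/-- The element `u = ∑ S(r²) r¹`. -/
def u : G := drinfeldElement Γ.R.1

lemma op_drinfeldElement_mul (X Y : G ⊗[ℂ] G) : MulOpposite.op (drinfeldElement (X * Y)) =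
      ev ((MulOpposite.opLinearEquiv ℂ).toLinearMap ∘ₗ LinearMap.mulLeft ℂ (drinfeldElement X))
        (opAntipode G) Y := by
  induction Y with
  | zero => simp [drinfeldElement]
  | add Y Y' h h' =>
    have : ∀ Z W : G ⊗[ℂ] G, drinfeldElement (Z + W) = drinfeldElement Z + drinfeldElement W :=
      fun Z W => by simp [drinfeldElement]
    rw [mul_add, this, MulOpposite.op_add, h, h', map_add]
  | tmul x y =>
    have : ∀ Z W : G ⊗[ℂ] G, drinfeldElement (Z + W) = drinfeldElement Z + drinfeldElement W :=
      fun Z W => by simp [drinfeldElement]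
    rw [ev_tmul]
    simp only [comp_apply, LinearMap.mulLeft_apply, LinearEquiv.coe_coe,
      MulOpposite.coe_opLinearEquiv, opAntipode_apply, ← MulOpposite.op_mul]
    congr 1
    induction X with
    | zero => simp [drinfeldElement]
    | add X X' h h' => rw [add_mul, this, h, h', this, add_mul, mul_add]
    | tmul a b => simp [drinfeldElement, flipTensor, HopfAlgebra.antipode_mul_antidistrib, mul_assoc]

lemma drinfeldElement_flip_comul_mul (ξ : G) (X : G ⊗[ℂ] G) :
    drinfeldElement (flipTensor G (comul (R := ℂ) ξ) * X) =
      counit (R := ℂ) ξ • drinfeldElement X := by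
  have key : ∀ Y : G ⊗[ℂ] G, ∀ a b : G, drinfeldElement (flipTensor G Y * (a ⊗ₜ b)) =
      antipode ℂ b * ev (antipode ℂ) LinearMap.id Y * a := by
    intro Y a b
    induction Y with
    | zero => simp [drinfeldElement]
    | add Y Y' h h' =>
      have : ∀ Z W : G ⊗[ℂ] G, drinfeldElement (Z + W) = drinfeldElement Z + drinfeldElement W :=
        fun Z W => by simp [drinfeldElement]
      rw [map_add, add_mul, this, h, h', map_add, mul_add, add_mul]
    | tmul x y =>
      simp [drinfeldElement, flipTensor, HopfAlgebra.antipode_mul_antidistrib, mul_assoc]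
  have h1 := LinearMap.congr_fun (antipode_conv (LinearMap.id : G →ₗ[ℂ] G)) ξ
  rw [conv_apply, LinearMap.id_comp] at h1
  induction X with
  | zero => simp [drinfeldElement]
  | add X X' h h' =>
    have : ∀ Z W : G ⊗[ℂ] G, drinfeldElement (Z + W) = drinfeldElement Z + drinfeldElement W :=
        fun Z W => by simp [drinfeldElement]
    rw [mul_add, this, h, h', this, smul_add]
  | tmul a b =>
    rw [key, h1]
    simp [drinfeldElement, flipTensor, Algebra.algebraMap_eq_smul_one]

/-- `u ξ = S²(ξ) u`. -/
lemma u_mul (ξ : G) : Γ.u * ξ = antipode ℂ (antipode ℂ ξ) * Γ.u := by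
  set f : G →ₗ[ℂ] Gᵐᵒᵖ := (MulOpposite.opLinearEquiv ℂ).toLinearMap ∘ₗ LinearMap.mulLeft ℂ Γ.u
  have h1 : conv f (opAntipode G) = LinearMap.mulRight ℂ (MulOpposite.op Γ.u) ∘ₗ triv G _ := by
    ext ξ
    refine (op_drinfeldElement_mul _ _).symm.trans ?_
    rw [Γ.R_comul, drinfeldElement_flip_comul_mul]
    simp [u, Algebra.algebraMap_eq_smul_one]
  have h2 := conv_antipode (opAntipode G)
  have h3 := conv_assoc f (opAntipode G) (opAntipode G ∘ₗ antipode ℂ)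
  rw [h2, conv_triv, h1] at h3
  have h4 : conv (LinearMap.mulRight ℂ (MulOpposite.op Γ.u) ∘ₗ triv G _)
      (opAntipode G ∘ₗ antipode ℂ) = LinearMap.mulLeft ℂ (MulOpposite.op Γ.u) ∘ₗ
        conv (triv G _) (opAntipode G ∘ₗ antipode ℂ) := by
    ext ξ
    rw [comp_apply, conv_apply, conv_apply]
    generalize comul (R := ℂ) ξ = X
    induction X with
    | zero => simp
    | add X Y h h' => simp only [map_add, h, h']
    | tmul x y => simp [Algebra.algebraMap_eq_smul_one]
  rw [h4, triv_conv] at h3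
  have h5 := congrArg MulOpposite.unop (LinearMap.congr_fun h3 ξ)
  simpa [f] using h5.symm

lemma antipode_u : antipode ℂ Γ.u = ev LinearMap.id (antipode ℂ) Γ.R.1 := by
  conv_rhs => rw [← Γ.antipode_map_R, ev_eq_of_eq]
  rw [u]
  generalize Γ.R.1 = X
  induction X with
  | zero => simp [drinfeldElement]
  | add X Y h h' =>
    have : ∀ Z W : G ⊗[ℂ] G, drinfeldElement (Z + W) = drinfeldElement Z + drinfeldElement W :=
        fun Z W => by simp [drinfeldElement]
    rw [this, map_add, h, h', map_add]
  | tmul x y => simp [drinfeldElement, flipTensor, HopfAlgebra.antipode_mul_antidistrib]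

variable [Module.Finite ℂ G]

lemma isUnit_u : IsUnit Γ.u := by
  have := IsArtinianRing.of_finite ℂ G
  have h : Γ.u * (antipode ℂ Γ.u * ((Γ.v⁻¹ * Γ.v⁻¹ : Gˣ) : G)) = 1 := by
    rw [← mul_assoc, u, ← Γ.v_sq, ← Units.val_mul, ← Units.val_mul]
    simp
  exact ⟨⟨_, _, h, mul_eq_one_comm.mp h⟩, rfl⟩

lemma isUnit_antipode_u : IsUnit (antipode ℂ Γ.u) := by
  have := IsArtinianRing.of_finite ℂ G
  have h : (((Γ.v⁻¹ * Γ.v⁻¹ : Gˣ) : G) * Γ.u) * antipode ℂ Γ.u = 1 := by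
    rw [mul_assoc, u, ← Γ.v_sq, ← Units.val_mul, ← Units.val_mul]
    simp
  exact ⟨⟨_, _, mul_eq_one_comm.mp h, h⟩, rfl⟩

include Γ in
lemma antipode_bijective : Function.Bijective (antipode ℂ : G →ₗ[ℂ] G) := by
  obtain ⟨z, hz⟩ := Γ.isUnit_u
  have h : Function.Injective (antipode ℂ : G →ₗ[ℂ] G) := by
    intro x y hxy
    have hx := Γ.u_mul x
    rw [hxy, ← Γ.u_mul y, ← hz] at hx
    exact z.isUnit.mul_left_cancel hx
  exact ⟨h, LinearMap.surjective_of_injective h⟩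

end RibbonStar

end Antipode

/-! ## The link on `Re` -/

section ReLink

lemma mul_eq_one_of_finite [Module.Finite ℂ A] {a b : A}
    (h : a * b = 1) : b * a = 1 := by
  have := IsArtinianRing.of_finite ℂ A
  exact mul_eq_one_comm.mp h

lemma Re.end_ext {X Y : End ℂ (Re G)} (h : ∀ (π : Dual ℂ G) (η : G),
    (Re.vec G).symm (X (Re.vec G π)) η = (Re.vec G).symm (Y (Re.vec G π)) η) : X = Y := by
  refine LinearMap.ext fun z => (Re.vec G).symm.injective ?_
  obtain ⟨π, rfl⟩ := (Re.vec G).surjective z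
  exact LinearMap.ext (h π)

instance : IsMulMap (reTarget G) where
  map_one := Re.end_ext fun π η => by simp [reTarget_apply]
  map_mul x y := Re.end_ext fun π η => by
    rw [reTarget_apply, Module.End.mul_apply, ← (Re.vec G).apply_symm_apply (reTarget G y _),
      reTarget_apply, reTarget_apply, mul_assoc]

instance : IsMulMap (reSource G) where
  map_one := Re.end_ext fun π η => by simp [reSource_apply, HopfAlgebra.antipode_one]
  map_mul x y := Re.end_ext fun π η => by
    rw [reSource_apply, Module.End.mul_apply, ← (Re.vec G).apply_symm_apply (reSource G y _),
      reSource_apply, reSource_apply, HopfAlgebra.antipode_mul_antidistrib, mul_assoc]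

instance : Comm (reTarget G) (reSource G) where
  comm x y := Re.end_ext fun π η => congrArg π (mul_assoc (antipode ℂ y) η x).symm

instance [Module.Finite ℂ G] : Module.Finite ℂ (Re G) :=
  inferInstanceAs (Module.Finite ℂ (Dual ℂ G))

lemma component_ofComponents [Module.Finite ℂ G] (f : Dual ℂ G →ₗ[ℂ] A)
    (π : Dual ℂ G) : component π (ofComponents f) = f π := by
  simp only [ofComponents, map_sum, component_tmul, ← map_smul]
  rw [← map_sum]
  congr 1
  exact (Module.finBasis ℂ G).ext fun i => by simp

lemma component_mul_tmul (π : Dual ℂ G) (Z : G ⊗[ℂ] A) (x : G) (f : A) :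
    component π (Z * (x ⊗ₜ f)) = component (π ∘ₗ LinearMap.mulRight ℂ x) Z * f := by
  induction Z with
  | tmul y g => simp
  | _ => simp_all [add_mul]

lemma component_tmul_mul (π : Dual ℂ G) (Z : G ⊗[ℂ] A) (x : G) (f : A) :
    component π ((x ⊗ₜ f) * Z) = f * component (π ∘ₗ LinearMap.mulLeft ℂ x) Z := by
  induction Z with
  | tmul y g => simp
  | _ => simp_all [mul_add]

lemma component_component_legs (π₁ π₂ : Dual ℂ G) (X Y : G ⊗[ℂ] A) :
    component π₂ (component π₁ (leg₁ G A X * leg₂ G A Y)) = component π₁ X * component π₂ Y := by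
  induction X with
  | tmul x y =>
    simp only [leg₁, leg₂, Algebra.TensorProduct.map_tmul, Algebra.TensorProduct.includeRight_apply,
      Algebra.TensorProduct.tmul_mul_tmul, component_tmul, map_smul, AlgHom.coe_id, id_eq, mul_one]
    rw [component_tmul_mul]
    have : π₂ ∘ₗ LinearMap.mulLeft ℂ (1 : G) = π₂ := by ext; simp
    rw [this, smul_mul_assoc]
  | _ => simp_all [add_mul]

variable (Γ)

lemma twistedMul_eq (π₁ π₂ : Dual ℂ G) (ξ : G) :
    twistedMul Γ π₁ π₂ ξ = ev π₁ π₂ (Γ.R.1 * comul (R := ℂ) ξ) := by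
  rw [twistedMul_apply]
  generalize Γ.R.1 * comul (R := ℂ) ξ = X
  induction X with
  | tmul x y => simp
  | _ => simp_all

lemma reHol_symm_apply (π₁ π₂ : Dual ℂ G) (ξ : G) : (Re.vec G).symm (reHol Γ π₁ (Re.vec G π₂)) ξ =
      ev π₁ π₂ (Γ.R.1 * comul (R := ℂ) ξ) := by
  rw [reHol_apply, LinearEquiv.symm_apply_apply, twistedMul_eq]

lemma component_aux_comulAux (π₁ π₂ : Dual ℂ G)
    (Z : G ⊗[ℂ] A) : component π₂ (component π₁ (aux G A Γ.R * comulAux G A Z)) =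
      component (twistedMul Γ π₁ π₂) Z := by
  induction Z with
  | tmul z f =>
    rw [component_tmul, twistedMul_eq]
    have h1 : comulAux G A (z ⊗ₜ f) = aux G A (comul (R := ℂ) z) * (1 ⊗ₜ[ℂ] (1 ⊗ₜ[ℂ] f)) := by
      simp only [comulAux, AlgHom.coe_comp, Function.comp_apply, Algebra.TensorProduct.map_tmul,
        AlgHom.coe_id, id_eq, Bialgebra.comulAlgHom_apply]
      generalize comul (R := ℂ) z = X
      induction X with
      | zero => simp
      | add X Y h h' => simp only [map_add, TensorProduct.add_tmul, add_mul, h, h']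
      | tmul y z => simp [aux]
    rw [h1, ← mul_assoc, ← map_mul]
    generalize Γ.R.1 * comul (R := ℂ) z = X
    induction X with
    | zero => simp
    | add X Y h h' => simp only [map_add, add_mul, h, h', add_smul]
    | tmul y z => simp [aux, mul_smul]
  | _ => simp_all [mul_add]

/-- The twisted product is associative. -/
lemma twistedMul_assoc (π₁ π₂ π₃ : Dual ℂ G) :
    twistedMul Γ π₁ (twistedMul Γ π₂ π₃) = twistedMul Γ (twistedMul Γ π₁ π₂) π₃ := by
  ext ξ
  rw [twistedMul_eq, twistedMul_eq]
  have h1 : ∀ X : G ⊗[ℂ] G, ev π₁ (twistedMul Γ π₂ π₃) X = ev₃ π₁ π₂ π₃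
      (leg₂ G G Γ.R * lTensor G (comul (R := ℂ)) X) := by
    intro X
    induction X with
    | tmul x y => simp [ev₃, leg₂, twistedMul_eq]
    | _ => simp_all [mul_add]
  have h2 : ∀ X : G ⊗[ℂ] G, ev (twistedMul Γ π₁ π₂) π₃ X = ev₃ π₁ π₂ π₃
      (aux G G Γ.R * comulAux G G X) := by
    intro X
    induction X with
    | tmul x y =>
      rw [ev_tmul, twistedMul_eq]
      have h1 : comulAux G G (x ⊗ₜ y) = aux G G (comul (R := ℂ) x) * (1 ⊗ₜ[ℂ] (1 ⊗ₜ[ℂ] y)) := by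
        simp only [comulAux, AlgHom.coe_comp, Function.comp_apply, Algebra.TensorProduct.map_tmul,
          AlgHom.coe_id, id_eq, Bialgebra.comulAlgHom_apply]
        generalize comul (R := ℂ) x = X
        induction X with
        | zero => simp
        | add X Y h h' => simp only [map_add, TensorProduct.add_tmul, add_mul, h, h']
        | tmul y z => simp [aux]
      rw [h1, ← mul_assoc, ← map_mul]
      generalize Γ.R.1 * comul (R := ℂ) x = X
      induction X with
      | zero => simp
      | add X Y h h' => simp only [map_add, add_mul, h, h']
      | tmul y z => simp [aux, ev₃, mul_assoc]
    | _ => simp_all [mul_add]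
  rw [h1, h2]
  congr 1
  let φ : G ⊗[ℂ] G →ₐ[ℂ] G ⊗[ℂ] (G ⊗[ℂ] G) :=
    Algebra.TensorProduct.map (AlgHom.id ℂ G) (Bialgebra.comulAlgHom ℂ G)
  have h3 : lTensor G (comul (R := ℂ)) (Γ.R.1 * comul (R := ℂ) ξ) = leg₁ G G Γ.R * aux G G Γ.R *
        lTensor G (comul (R := ℂ)) (comul (R := ℂ) ξ) := by
    change φ _ = _ * φ _
    rw [map_mul]
    congr 1
    exact Γ.comul_right
  have h4 : lTensor G (comul (R := ℂ)) (comul (R := ℂ) ξ) =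
      comulAux G G (comul (R := ℂ) ξ) := (Coalgebra.coassoc_apply ξ).symm
  rw [h3, h4, map_mul, Γ.comul_left, ← mul_assoc, ← mul_assoc, ← mul_assoc]
  congr 1
  have := Γ.yang_baxter (fst G G) (snd G G) (thd G G)
  rw [leg₁_eq, leg₂_eq, aux_eq, ← mul_assoc]
  exact this.symm

variable [Module.Finite ℂ G]

/-- The holonomy acting on `Re`. -/
def reU : G ⊗[ℂ] End ℂ (Re G) := ofComponents (reHol Γ)

lemma component_reU (π : Dual ℂ G) : component π (reU Γ) = reHol Γ π := component_ofComponents _ _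

lemma reU_target (ξ : G) : inr G _ (reTarget G ξ) * reU Γ =
    reU Γ * conv (inl G _) (inr G _ ∘ₗ reTarget G) ξ := by
  refine component_ext fun π => Re.end_ext fun π₂ η => ?_
  have h : ∀ X : G ⊗[ℂ] G, (Re.vec G).symm (component π (reU Γ *
      ev (inl G _) (inr G _ ∘ₗ reTarget G) X) (Re.vec G π₂)) η =
      ev π π₂ (Γ.R.1 * comul (R := ℂ) η * X) := by
    intro X
    induction X with
    | tmul x y =>
      rw [ev_tmul, comp_apply, inl_apply, inr_apply, Algebra.TensorProduct.tmul_mul_tmul,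
        mul_one, one_mul, component_mul_tmul, component_reU, Module.End.mul_apply,
        ← (Re.vec G).apply_symm_apply (reTarget G y _), reHol_symm_apply]
      generalize Γ.R.1 * comul (R := ℂ) η = X
      induction X with
      | zero => simp
      | add X Y h h' => simp only [map_add, add_mul, h, h']
      | tmul x y => simp [reTarget_apply]
    | _ => simp_all [mul_add]
  rw [conv_apply, h, inr_apply, component_tmul_mul, component_reU, Module.End.mul_apply,
    ← (Re.vec G).apply_symm_apply (reHol Γ _ _), reTarget_apply, reHol_symm_apply, mul_assoc,
    Bialgebra.comul_mul]
  congr 2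
  ext; simp

lemma reU_source (ξ : G) : conv (inl G _) (inr G _ ∘ₗ reSource G) ξ * reU Γ =
    reU Γ * inr G _ (reSource G ξ) := by
  refine component_ext fun π => Re.end_ext fun π₂ η => ?_
  have h : ∀ X : G ⊗[ℂ] G, (Re.vec G).symm (component π (ev (inl G _) (inr G _ ∘ₗ reSource G) X *
      reU Γ) (Re.vec G π₂)) η =
      ev π π₂ (ev (inl G G) (LinearMap.mulLeft ℂ Γ.R.1 ∘ₗ comul ∘ₗ
        antipode ℂ) X * comul (R := ℂ) η) := by
    intro X
    induction X with
    | tmul x y =>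
      rw [ev_tmul, ev_tmul, comp_apply, inl_apply, inr_apply,
        Algebra.TensorProduct.tmul_mul_tmul, mul_one, one_mul, component_tmul_mul, component_reU,
        Module.End.mul_apply, ← (Re.vec G).apply_symm_apply (reHol Γ _ _), reSource_apply,
        reHol_symm_apply, Bialgebra.comul_mul]
      simp only [comp_apply, LinearMap.mulLeft_apply, inl_apply, mul_assoc]
      generalize Γ.R.1 * _ = X
      induction X with
      | zero => simp
      | add X Y h h' => simp only [map_add, mul_add, h, h']
      | tmul x y => simp
    | _ => simp_all [add_mul]
  have e0 : ∀ z, Γ.R.1 * comul (R := ℂ) (antipode ℂ z) =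
      conv (inl G G ∘ₗ antipode ℂ) (inr G G ∘ₗ antipode ℂ) z * Γ.R := by
    intro z
    rw [Γ.R_comul, comul_antipode, conv_apply]
    congr 1
    generalize comul (R := ℂ) z = X
    induction X with
    | tmul x y => simp [flipTensor]
    | _ => simp_all
  have e1 : ∀ X : G ⊗[ℂ] G, ev (inl G G) (LinearMap.mulLeft ℂ Γ.R.1 ∘ₗ comul ∘ₗ
        antipode ℂ) X = ev (inl G G) (conv (inl G G ∘ₗ antipode ℂ)
          (inr G G ∘ₗ antipode ℂ)) X * Γ.R := by
    intro X
    induction X with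
    | tmul x y =>
      rw [ev_tmul, ev_tmul, mul_assoc, ← e0]
      rfl
    | _ => simp_all [add_mul]
  have e2 : ev (inl G G) (conv (inl G G ∘ₗ antipode ℂ) (inr G G ∘ₗ antipode ℂ)) (comul ξ) =
      inr G G (antipode ℂ ξ) := by
    rw [← conv_apply, ← conv_assoc, conv_antipode, triv_conv]; rfl
  rw [conv_apply, h, e1, e2, inr_apply, inr_apply, component_mul_tmul, component_reU, Module.End.mul_apply,
    ← (Re.vec G).apply_symm_apply (reSource G ξ _), reHol_symm_apply, mul_assoc]
  generalize Γ.R.1 * comul (R := ℂ) η = X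
  induction X with
  | tmul x y => simp [reSource_apply]
  | _ => simp_all [mul_add]

lemma reU_funct : leg₁ G _ (reU Γ) * leg₂ G _ (reU Γ) = aux G _ Γ.R * comulAux G _ (reU Γ) := by
  refine component_ext fun π₁ => component_ext fun π₂ => Re.end_ext fun π₃ η => ?_
  rw [component_component_legs, component_aux_comulAux, component_reU, component_reU,
    component_reU, Module.End.mul_apply, reHol_apply, reHol_apply, reHol_apply, twistedMul_assoc]

/-- The inverse holonomy. -/
def reUi : G ⊗[ℂ] End ℂ (Re G) := LinearMap.rTensor _ (antipode ℂ) (reU Γ) *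
  inl G _ (Ring.inverse (antipode ℂ Γ.u))

lemma reU_mul_reUi : reU Γ * reUi Γ = 1 := by
  have hε : component (counit (R := ℂ)) (reU Γ) = 1 := by
    rw [component_reU]
    refine Re.end_ext fun π η => ?_
    rw [reHol_symm_apply]
    have h : ∀ X : G ⊗[ℂ] G, ev (counit (R := ℂ)) π X = π (ev (triv G G) LinearMap.id X) := by
      intro X
      induction X with
      | tmul x y => simp [Algebra.algebraMap_eq_smul_one]
      | _ => simp_all
    rw [h, mm_mul (ev (triv G G) LinearMap.id), ← conv_apply, triv_conv]
    change π (Γ.r (triv G G) LinearMap.id * η) = π η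
    rw [Γ.triv_r, one_mul]
  have h := mul_antipode_leg (reU Γ) (reU Γ)
  rw [reU_funct, mul_antipode_aux, ← Γ.antipode_u] at h
  · rw [reUi, ← mul_assoc, ← h, ← mm_mul (inl G _), Ring.mul_inverse_cancel _ Γ.isUnit_antipode_u,
      mm_one]
  · rw [ev₃_comulAux, conv_antipode]
    have : ∀ X : G ⊗[ℂ] End ℂ (Re G), ev (triv G _) (inr G _) X =
        inr G _ (component (counit (R := ℂ)) X) := by
      intro X
      induction X with
      | zero => simp
      | add X Y h h' => simp only [map_add, h, h']
      | tmul x y => simp [Algebra.algebraMap_eq_smul_one]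
    rw [this, hε, mm_one]

lemma reUi_mul_reU : reUi Γ * reU Γ = 1 := by
  exact mul_eq_one_of_finite (A := G ⊗[ℂ] End ℂ (Re G)) (reU_mul_reUi Γ)

/-- The link that acts on `Re`. -/
def reLink : Link Γ (End ℂ (Re G)) where
  t := reTarget G
  s := reSource G
  U := reU Γ
  Ui := reUi Γ
  right_inv := reU_mul_reUi Γ
  left_inv := reUi_mul_reU Γ
  target := reU_target Γ
  source := reU_source Γ
  funct := reU_funct Γ

end ReLink

/-! ## The representations `D^{IJ}_N` -/

section Holonomies

namespace Link

variable {d : Link Γ B} {y : ℕ → (B →ₗ[ℂ] E)} {p q : G →ₗ[ℂ] E} {n : ℕ} {a : G →ₗ[ℂ] E}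

lemma commute_v_ev {C : Type*} [AddCommMonoid C] [Module ℂ C] (f : C →ₗ[ℂ] E) [IsMulMap a]
    [Comm a f] (X : G ⊗[ℂ] C) (m : ℕ) : Commute (a Γ.v.1 ^ m) (ev a f X) :=
  ((commute_ev a f X _ (fun y => RibbonStar.commute_central a Γ.v_central y)
    (fun y => comm_of f a y _)).symm).pow_left m

lemma prod_links_mul_pre (h : IsChain n y p q) (ha : Off n y p q a) (m : ℕ) (hm : m ≤ n) :
    ((List.range m).map (d.chainLink y p n a)).prod * d.pre y a m =
      a Γ.v.1 ^ m * Γ.ri a (d.theta y m) := by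
  have := ha.mul
  induction m with
  | zero =>
    have e : Γ.ri a (d.theta y 0) = 1 := Γ.ri_triv a
    rw [e]
    simp [pre]
  | succ m ih =>
    have := h.mul m hm
    have := ha.comm m hm
    have := theta_mul (d := d) h m (by omega)
    have := off_theta (d := d) ha m (by omega)
    have : Comm (d.theta y m) (y m) := theta_comm _ m fun i hi => h.comm i (by omega) m hm hi.ne
    have e : Γ.ri a (d.theta y (m + 1)) = Γ.ri a (d.theta y m) * Γ.ri a (y m ∘ₗ d.s) :=
      Γ.ri_conv_right a (d.theta y m) (y m ∘ₗ d.s)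
    rw [List.range_succ, List.map_append, List.prod_append, List.map_singleton, List.prod_singleton,
      e]
    have e2 : ev a (y m) d.U * d.pre y a (m + 1) = a Γ.v.1 * Γ.ri a (y m ∘ₗ d.s) :=
      d.u_mul_left a (y m)
    have e3 : Γ.ri a (d.theta y m) * a Γ.v.1 = a Γ.v.1 * Γ.ri a (d.theta y m) := by
      have := (commute_v_ev (Γ := Γ) (a := a) (d.theta y m) (Γ.R⁻¹).1 1).eq.symm
      rwa [pow_one] at this
    simp only [chainLink, if_pos (Nat.lt_of_succ_le hm)]
    rw [mul_assoc, mul_assoc, e2, ← mul_assoc, ih (by omega), mul_assoc, ← mul_assoc (Γ.ri a _), e3,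
      pow_succ]
    simp only [mul_assoc]

lemma prod_links (h : IsChain n y p q) (ha : Off n y p q a) (m : ℕ) (hm : m ≤ n) :
    ((List.range (m + 1)).map (d.chainLink y p n a)).prod = a Γ.v.1 ^ m * (Γ.ri a (d.theta y m) *
        if m < n then ev a (y m) d.U else d.core y p n a) := by
  rw [List.range_succ, List.map_append, List.prod_append, List.map_singleton, List.prod_singleton,
    ← mul_assoc, ← prod_links_mul_pre h ha m hm, mul_assoc]
  rfl

end Link

end Holonomies

section Homs

variable [Module.Finite ℂ G] {N : ℕ}

namespace CurrentAlgebra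

lemma hom_ext {φ ψ : CurrentAlgebra Γ N →ₐ[ℂ] A} (hs : ∀ n ξ, φ (site Γ N n ξ) = ψ (site Γ N n ξ))
    (hl : ∀ n, idTensor G φ (link Γ N n) = idTensor G ψ (link Γ N n)) : φ = ψ := by
  have hli : ∀ n, idTensor G φ (linkInv Γ N n) = idTensor G ψ (linkInv Γ N n) := by
    intro n
    have h1 : idTensor G φ (linkInv Γ N n) * idTensor G φ (link Γ N n) = 1 := by
      rw [← map_mul]
      exact (congrArg (idTensor G φ) ((data Γ N).inv_left n)).trans (map_one _)
    refine left_inv_eq_right_inv h1 ?_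
    rw [hl, ← map_mul]
    exact (congrArg (idTensor G ψ) ((data Γ N).inv_right n)).trans (map_one _)
  ext x
  induction x using CurrentAlgebra.induction with
  | scalar c => simp
  | add x y hx hy => rw [map_add, map_add, hx, hy]
  | mul x y hx hy => rw [map_mul, map_mul, hx, hy]
  | hsite n ξ => exact hs n ξ
  | hlink n π => rw [← component_idTensor, ← component_idTensor, hl]
  | hlinkInv n π => rw [← component_idTensor, ← component_idTensor, hli]

lemma isUnit_idTensor_link (φ : CurrentAlgebra Γ N →ₐ[ℂ] A) (n : ZMod N) :
    IsUnit (idTensor G φ (link Γ N n)) :=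
  IsUnit.map (idTensor G φ) ⟨⟨_, _, (data Γ N).inv_right n, (data Γ N).inv_left n⟩, rfl⟩

lemma idTensor_holonomy (φ : CurrentAlgebra Γ N →ₐ[ℂ] A) (m : ℕ) :
    idTensor G φ (holonomy Γ N (m + 1)) = (inl G A (Γ.v⁻¹).1) ^ m *
      ((List.range (m + 1)).map fun k => idTensor G φ (link Γ N ((k + 1 : ℕ) : ZMod N))).prod := by
  rw [holonomy, map_mul, map_list_prod, List.map_map]
  congr 1
  simp

lemma isUnit_v_pow (A : Type*) [Ring A] [Algebra ℂ A] (m : ℕ) :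
    IsUnit ((inl G A (Γ.v⁻¹).1) ^ m) := by
  refine IsUnit.pow m ⟨⟨_, inl G A Γ.v.1, ?_, ?_⟩, rfl⟩
  · rw [RibbonStar.mm_unit_inv_mul]
  · rw [RibbonStar.mm_unit_mul_inv]

/-- The links are determined by the holonomies. -/
lemma link_eq_of_holonomy {φ ψ : CurrentAlgebra Γ N →ₐ[ℂ] A} (m : ℕ)
    (h : ∀ k < m, idTensor G φ (holonomy Γ N (k + 1)) = idTensor G ψ (holonomy Γ N (k + 1))) :
    ∀ k < m, idTensor G φ (link Γ N ((k + 1 : ℕ) : ZMod N)) =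
      idTensor G ψ (link Γ N ((k + 1 : ℕ) : ZMod N)) := by
  induction m with
  | zero => intro k hk; omega
  | succ m ih =>
    intro k hk
    have ih' := ih fun k hk => h k (by omega)
    rcases Nat.lt_succ_iff_lt_or_eq.mp hk with hk' | rfl
    · exact ih' k hk'
    · have h1 := h k (by omega)
      rw [idTensor_holonomy, idTensor_holonomy] at h1
      have h2 := (isUnit_v_pow A k).mul_left_cancel h1
      rw [List.range_succ, List.map_append, List.map_append, List.prod_append, List.prod_append,
        List.map_singleton, List.map_singleton, List.prod_singleton, List.prod_singleton] at h2
      have h3 : (List.range k).map (fun k => idTensor G φ (link Γ N ((k + 1 : ℕ) : ZMod N))) =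
          (List.range k).map (fun k => idTensor G ψ (link Γ N ((k + 1 : ℕ) : ZMod N))) :=
        List.map_congr_left fun i hi => ih' i (List.mem_range.mp hi)
      rw [h3] at h2
      have hu : IsUnit ((List.range k).map
          (fun k => idTensor G ψ (link Γ N ((k + 1 : ℕ) : ZMod N)))).prod := by
        clear h2 h3 h1 ih ih' h hk
        induction k with
        | zero => simp
        | succ k ih =>
          rw [List.range_succ, List.map_append, List.prod_append, List.map_singleton,
            List.prod_singleton]
          exact ih.mul (isUnit_idTensor_link ψ _)
      exact hu.mul_left_cancel h2

end CurrentAlgebra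

end Homs

section Carrier

variable [Module.Finite ℂ G] {V V' : Type v} [AddCommGroup V] [Module ℂ V] [AddCommGroup V']
  [Module ℂ V'] {n : ℕ}

variable (G V V' n) in
/-- The operators on the carrier space. -/
abbrev CEnd : Type (max u v) := End ℂ (Carrier G V V' (n + 1))

lemma onRe_apply (k : Fin n) (f : End ℂ (Re G)) :
    onRe G V V' (n + 1) k f = LinearMap.rTensor (V ⊗[ℂ] V')
      (PiTensorProduct.map (Function.update (fun _ => LinearMap.id) k f)) := rfl

instance (k : Fin n) : IsMulMap (B := End ℂ (Re G)) (E := CEnd G V V' n) (onRe G V V' (n + 1) k) where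
  map_one := by
    rw [onRe_apply]
    have : Function.update (fun _ : Fin n => (LinearMap.id : Re G →ₗ[ℂ] Re G)) k 1 =
        fun _ => LinearMap.id := Function.update_eq_self k _
    rw [this, PiTensorProduct.map_id, LinearMap.rTensor_id]
    rfl
  map_mul f g := by
    rw [onRe_apply, onRe_apply, onRe_apply, Module.End.mul_eq_comp, Module.End.mul_eq_comp,
      ← LinearMap.rTensor_comp,
      ← PiTensorProduct.map_comp]
    congr 2
    ext i : 1
    by_cases h : i = k
    · subst h; simp
    · simp [h]

lemma comm_onRe (k l : Fin n) (h : k ≠ l) :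
    Comm (E := CEnd G V V' n) (onRe G V V' (n + 1) k) (onRe G V V' (n + 1) l) where
  comm f g := by
    rw [commute_iff_eq, onRe_apply, onRe_apply, Module.End.mul_eq_comp, Module.End.mul_eq_comp,
      ← LinearMap.rTensor_comp, ← LinearMap.rTensor_comp, ← PiTensorProduct.map_comp,
      ← PiTensorProduct.map_comp]
    congr 2
    ext i : 1
    by_cases hk : i = k
    · subst hk; simp [h]
    · by_cases hl : i = l
      · subst hl; simp [hk]
      · simp [hk, hl]

instance : IsMulMap (B := End ℂ (V ⊗[ℂ] V')) (E := CEnd G V V' n) (onLast G V V' (n + 1)) where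
  map_one := LinearMap.lTensor_id _ _
  map_mul _ _ := LinearMap.lTensor_comp _ _ _

instance (k : Fin n) : Comm (E := CEnd G V V' n) (onRe G V V' (n + 1) k) (onLast G V V' (n + 1)) where
  comm f g := by
    rw [onRe_apply, commute_iff_eq, Module.End.mul_eq_comp, Module.End.mul_eq_comp]
    exact (LinearMap.rTensor_comp_lTensor ..).trans (LinearMap.lTensor_comp_rTensor ..).symm

variable (G V V') in
/-- The factors `Re` of the carrier space. -/
def onReChain (n k : ℕ) : End ℂ (Re G) →ₗ[ℂ] CEnd G V V' n :=
  if h : k < n then onRe G V V' (n + 1) ⟨k, h⟩ else 0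

variable (G V') in
/-- The action of `G` on the first factor of `V ⊗ V'`. -/
def onFst (n : ℕ) (τ : G →ₐ[ℂ] End ℂ V) : G →ₗ[ℂ] CEnd G V V' n :=
  onLast G V V' (n + 1) ∘ₗ LinearMap.rTensorHom V' ∘ₗ τ.toLinearMap

variable (G V) in
/-- The action of `G` on the second factor of `V ⊗ V'`. -/
def onSnd (n : ℕ) (τ' : G →ₐ[ℂ] End ℂ V') : G →ₗ[ℂ] CEnd G V V' n :=
  onLast G V V' (n + 1) ∘ₗ LinearMap.lTensorHom V ∘ₗ τ'.toLinearMap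

instance : IsMulMap (B := End ℂ V) (E := End ℂ (V ⊗[ℂ] V')) (LinearMap.rTensorHom V') where
  map_one := LinearMap.rTensor_id _ _
  map_mul _ _ := LinearMap.rTensor_comp _ _ _

instance : IsMulMap (B := End ℂ V') (E := End ℂ (V ⊗[ℂ] V')) (LinearMap.lTensorHom V) where
  map_one := LinearMap.lTensor_id _ _
  map_mul _ _ := LinearMap.lTensor_comp _ _ _

instance : Comm (E := End ℂ (V ⊗[ℂ] V')) (LinearMap.rTensorHom V' : End ℂ V →ₗ[ℂ] End ℂ (V ⊗[ℂ] V'))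
    (LinearMap.lTensorHom V : End ℂ V' →ₗ[ℂ] End ℂ (V ⊗[ℂ] V')) where
  comm _ _ := (LinearMap.rTensor_comp_lTensor ..).trans (LinearMap.lTensor_comp_rTensor ..).symm

lemma isChain_carrier (n : ℕ) (τ : G →ₐ[ℂ] End ℂ V) (τ' : G →ₐ[ℂ] End ℂ V') :
    IsChain (B := End ℂ (Re G)) (E := CEnd G V V' n) n (onReChain G V V' n) (onFst G V' n τ) (onSnd G V n τ') where
  mul k hk := by simp only [onReChain, dif_pos hk]; infer_instance
  comm k hk l hl hkl := by
    simp only [onReChain, dif_pos hk, dif_pos hl]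
    exact comm_onRe _ _ (by simpa using hkl)
  mul_p := by unfold onFst; infer_instance
  mul_q := by unfold onSnd; infer_instance
  comm_p k hk := by simp only [onReChain, dif_pos hk, onFst]; infer_instance
  comm_q k hk := by simp only [onReChain, dif_pos hk, onSnd]; infer_instance
  comm_pq := by unfold onFst onSnd; infer_instance

lemma tail_eq (k : ℕ) : tail G V V' (n + 1) k = (reLink Γ).theta (E := CEnd G V V' n) (onReChain G V V' n) k := by
  rw [tail, Link.theta]
  congr 1
  ext j : 1
  rw [onReChain]
  by_cases h : j < n
  · rw [dif_pos h, dif_pos (show j < n + 1 - 1 from h)]; rfl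
  · rw [dif_neg h, dif_neg (show ¬ j < n + 1 - 1 from h), LinearMap.zero_comp]

lemma conv_onFst_onSnd (τ : G →ₐ[ℂ] End ℂ V) (τ' : G →ₐ[ℂ] End ℂ V') :
    conv (A := CEnd G V V' n) (onFst G V' n τ) (onSnd G V n τ') =
      onLast G V V' (n + 1) ∘ₗ (pairRep τ τ').toLinearMap ∘ₗ comul := by
  ext1 ξ
  rw [conv_apply, comp_apply, comp_apply]
  generalize comul (R := ℂ) ξ = X
  induction X with
  | tmul x y =>
    rw [ev_tmul, onFst, onSnd, comp_apply, comp_apply (onLast G V V' (n + 1)),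
      ← mm_mul (B := End ℂ (V ⊗[ℂ] V')) (E := CEnd G V V' n) (onLast G V V' (n + 1))]
    congr 1
    exact TensorProduct.ext' fun a b => rfl
  | _ => simp_all

lemma lTensor_eq_ev (f : G →ₗ[ℂ] A) (X : G ⊗[ℂ] G) :
    lTensor G f X = ev (inl G A) (inr G A ∘ₗ f) X := (ev_inl_inr_comp f X).symm

lemma ofComponents_comp
    (k : A →ₗ[ℂ] B) (f : Dual ℂ G →ₗ[ℂ] A) :
    ofComponents (k ∘ₗ f) = ev (inl G B) (inr G B ∘ₗ k) (ofComponents f) := by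
  simp [ofComponents]

lemma lTensor_core
    (d : Link Γ B) (y : ℕ → B →ₗ[ℂ] A) (p : G →ₗ[ℂ] A) [IsMulMap p] (n : ℕ) :
    d.core (fun i => inr G A ∘ₗ y i) (inr G A ∘ₗ p) n (inl G A) =
      lTensor G p (flipTensor G Γ.R * Γ.R) * lTensor G (d.theta y n) Γ.R.1 := by
  have : Comm (inl G A) (inr G A ∘ₗ p) := inferInstance
  have h := mm_mul (ev (inl G A) (inr G A ∘ₗ p)) (flipTensor G Γ.R) Γ.R.1
  rw [ev_flip] at h
  rw [lTensor_eq_ev, lTensor_eq_ev, h, Link.core, ← Link.map_theta]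
  rfl

/-- The representation `D^{IJ}_N`. -/
def carrierRep (Γ : RibbonStar G) (n : ℕ) (τ : G →ₐ[ℂ] End ℂ V) (τ' : G →ₐ[ℂ] End ℂ V') :
    CurrentAlgebra Γ (n + 1) →ₐ[ℂ] CEnd G V V' n :=
  (IsChain.data (A := CEnd G V V' n) (reLink Γ) (isChain_carrier n τ τ')).lift

variable (τ : G →ₐ[ℂ] End ℂ V) (τ' : G →ₐ[ℂ] End ℂ V')

lemma carrierRep_link (m : ℕ) (hm : m ≤ n) :
    idTensor (B := CEnd G V V' n) G (carrierRep Γ n τ τ') (CurrentAlgebra.link Γ (n + 1) ((m + 1 : ℕ) : ZMod (n + 1))) =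
      IsChain.link (A := CEnd G V V' n) (reLink Γ) (onReChain G V V' n) (onFst G V' n τ) n m := by
  refine (CurrentData.lift_link _ _).trans ?_
  change IsChain.link _ _ _ _ _ = _
  rw [Nat.cast_succ, ZMod.val_add_one_sub hm]

lemma carrierRep_holonomy (m : ℕ) (hm : m ≤ n) :
    idTensor (B := CEnd G V V' n) G (carrierRep Γ n τ τ') (CurrentAlgebra.holonomy Γ (n + 1) (m + 1)) =
      lTensor G (tail G V V' (n + 1) m) (Γ.R⁻¹).1 *
        if m < n then ev (inl G _) (inr G (CEnd G V V' n) ∘ₗ onReChain G V V' n m) (reU Γ)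
        else (reLink Γ).core (fun i => inr G (CEnd G V V' n) ∘ₗ onReChain G V V' n i)
          (inr G (CEnd G V V' n) ∘ₗ onFst G V' n τ) n (inl G _) := by
  rw [CurrentAlgebra.idTensor_holonomy]
  have h1 : (List.range (m + 1)).map (fun k => idTensor (B := CEnd G V V' n) G (carrierRep Γ n τ τ')
      (CurrentAlgebra.link Γ (n + 1) ((k + 1 : ℕ) : ZMod (n + 1)))) = (List.range (m + 1)).map
      ((reLink Γ).chainLink (fun i => inr G (CEnd G V V' n) ∘ₗ onReChain G V V' n i)
          (inr G (CEnd G V V' n) ∘ₗ onFst G V' n τ) n (inl G _)) :=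
    List.map_congr_left fun i hi =>
      carrierRep_link τ τ' i ((Nat.lt_succ_iff.mp (List.mem_range.mp hi)).trans hm)
  have hc := isChain_carrier n τ τ'
  rw [h1, Link.prod_links (hc.map (inr G _)) hc.off_inl m hm, tail_eq (Γ := Γ), lTensor_eq_ev,
    ← mul_assoc]
  have h2 : (inl G (CEnd G V V' n) (Γ.v⁻¹).1) ^ m * (inl G (CEnd G V V' n) Γ.v.1) ^ m = 1 := by
    have : Commute (inl G (CEnd G V V' n) (Γ.v⁻¹).1) (inl G (CEnd G V V' n) Γ.v.1) := by
      rw [commute_iff_eq, RibbonStar.mm_unit_inv_mul, RibbonStar.mm_unit_mul_inv]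
    rw [← this.mul_pow, RibbonStar.mm_unit_inv_mul, one_pow]
  rw [h2, one_mul, Link.map_theta]
  rfl

lemma carrierRep_site (m : ℕ) (hm : m ≤ n) (ξ : G) :
    carrierRep Γ n τ τ' (CurrentAlgebra.site Γ (n + 1) ((m + 1 : ℕ) : ZMod (n + 1)) ξ) =
      (reLink Γ).chainSite (E := CEnd G V V' n) (onReChain G V V' n) (onFst G V' n τ) (onSnd G V n τ') n m ξ := by
  refine (CurrentData.lift_site _ _ _).trans ?_
  change Link.chainSite _ _ _ _ _ _ _ = _
  rw [Nat.cast_succ, ZMod.val_add_one_sub hm]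

lemma carrierRep_site_zero (ξ : G) : carrierRep Γ n τ τ' (CurrentAlgebra.site Γ (n + 1) 0 ξ) =
      conv (A := CEnd G V V' n) (tail G V V' (n + 1) n) (conv (A := CEnd G V V' n) (onFst G V' n τ) (onSnd G V n τ')) ξ := by
  have := carrierRep_site (Γ := Γ) τ τ' n le_rfl ξ
  rw [Nat.cast_succ, ZMod.natCast_self_add_one] at this
  rw [this, Link.chainSite, if_neg (lt_irrefl _), tail_eq (Γ := Γ)]

lemma isJordanWigner_carrierRep : IsJordanWigner Γ (n + 1) τ τ' (carrierRep Γ n τ τ') where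
  holonomy k := by
    have hk : (k : ℕ) < n := k.2
    refine (carrierRep_holonomy τ τ' k hk.le).trans ?_
    rw [if_pos hk, ofComponents_comp, onReChain, dif_pos hk]
    rfl
  monodromy := by
    refine (carrierRep_holonomy τ τ' n le_rfl).trans ?_
    have hc := isChain_carrier n τ τ'
    have := hc.mul_p
    rw [if_neg (lt_irrefl _), mul_assoc, lTensor_core (A := CEnd G V V' n) (reLink Γ), ← tail_eq]
    rfl
  site k ξ := by
    have hk : (k : ℕ) < n := k.2
    refine (carrierRep_site τ τ' k hk.le ξ).trans ?_
    rw [Link.chainSite, if_pos hk, onReChain, dif_pos hk]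
    rfl
  base ξ := by
    rw [carrierRep_site_zero, conv_onFst_onSnd]
    rfl

variable {τ τ'}

lemma IsJordanWigner.unique
    {D D' : CurrentAlgebra Γ (n + 1) →ₐ[ℂ] CEnd G V V' n}
    (h : IsJordanWigner Γ (n + 1) τ τ' D) (h' : IsJordanWigner Γ (n + 1) τ τ' D') : D = D' := by
  have hl : ∀ m < n + 1, idTensor (B := CEnd G V V' n) G D (CurrentAlgebra.link Γ (n + 1) ((m + 1 : ℕ) : ZMod (n + 1))) =
      idTensor (B := CEnd G V V' n) G D' (CurrentAlgebra.link Γ (n + 1) ((m + 1 : ℕ) : ZMod (n + 1))) := by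
    refine CurrentAlgebra.link_eq_of_holonomy (A := CEnd G V V' n) (n + 1) fun k hk => ?_
    rcases (Nat.lt_succ_iff.mp hk).lt_or_eq with hk' | rfl
    · exact (h.holonomy ⟨k, hk'⟩).trans (h'.holonomy ⟨k, hk'⟩).symm
    · exact h.monodromy.trans h'.monodromy.symm
  refine CurrentAlgebra.hom_ext (A := CEnd G V V' n) (fun k ξ => ?_) fun k => ?_
  · obtain ⟨m, hm, rfl⟩ := ZMod.exists_eq_add_one k
    rcases hm.lt_or_eq with hm' | rfl
    · exact_mod_cast (h.site ⟨m, hm'⟩ ξ).trans (h'.site ⟨m, hm'⟩ ξ).symm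
    · rw [ZMod.natCast_self_add_one]
      exact (h.base ξ).trans (h'.base ξ).symm
  · obtain ⟨m, hm, rfl⟩ := ZMod.exists_eq_add_one k
    exact_mod_cast hl m (Nat.lt_succ_of_le hm)

end Carrier

/-! ## The monodromy -/

namespace ZMod

lemma natCast_inj_of_le {n i m : ℕ} (hi : i ≤ n) (hm : m ≤ n)
    (h : (i : ZMod (n + 1)) = m) : i = m := by
  rw [ZMod.natCast_eq_natCast_iff', Nat.mod_eq_of_lt (Nat.lt_succ_of_le hi),
    Nat.mod_eq_of_lt (Nat.lt_succ_of_le hm)] at h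
  exact h

lemma natCast_add_one_inj {n i m : ℕ} (hi : i ≤ n) (hm : m ≤ n)
    (h : ((i + 1 : ℕ) : ZMod (n + 1)) = ((m + 1 : ℕ) : ZMod (n + 1))) : i = m := by
  push_cast at h
  exact natCast_inj_of_le hi hm (add_right_cancel h)

lemma natCast_succ_inj {n i m : ℕ} (hi : i ≤ n) (hm : m ≤ n)
    (h : ((i + 1 : ℕ) : ZMod (n + 1)) = ((m + 1 : ℕ) : ZMod (n + 1)) + 1) :
    i = m + 1 ∨ (i = 0 ∧ m = n) := by
  push_cast at h
  have h' : (i : ZMod (n + 1)) = ((m + 1 : ℕ) : ZMod (n + 1)) := by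
    push_cast; exact add_right_cancel h
  rcases hm.lt_or_eq with hm | rfl
  · exact Or.inl (natCast_inj_of_le hi hm h')
  · refine Or.inr ⟨natCast_inj_of_le (m := 0) hi (Nat.zero_le _) ?_, rfl⟩
    rw [h']; simp

end ZMod

namespace CurrentData

section

variable {N : ℕ} (D : CurrentData Γ N A) (a b : G →ₗ[ℂ] E) (j : A →ₗ[ℂ] E) [IsMulMap a] [IsMulMap b]
  [IsMulMap j] [Comm a b] [Comm a j] [Comm b j]

lemma funct_ev (h : 2 ≤ N) (k : ZMod N) : ev a j (D.link k) * ev b j (D.link k) =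
    Γ.r a b * ev (conv a b) j (D.link k) := by
  have := congrArg (ev₃ a b j) (D.funct h k)
  rwa [mm_mul (ev₃ a b j), mm_mul (ev₃ a b j), ev₃_leg₁, ev₃_leg₂, ev₃_aux, ev₃_comulAux] at this

lemma funct_loop_ev (h : N = 1) (k : ZMod N) : ev a j (D.link k) * Γ.r a b * ev b j (D.link k) =
      Γ.r a b * ev (conv a b) j (D.link k) := by
  have := congrArg (ev₃ a b j) (D.funct_loop h k)
  rwa [mm_mul (ev₃ a b j), mm_mul (ev₃ a b j), mm_mul (ev₃ a b j), ev₃_leg₁, ev₃_leg₂, ev₃_aux,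
    ev₃_comulAux] at this

lemma link_far_ev (k m : ZMod N) (h : k ≠ m) (h₁ : k ≠ m + 1) (h₂ : k ≠ m - 1) :
    ev a j (D.link k) * ev b j (D.link m) = ev b j (D.link m) * ev a j (D.link k) := by
  have := congrArg (ev₃ a b j) (D.link_far k m h h₁ h₂)
  rwa [mm_mul (ev₃ a b j), mm_mul (ev₃ a b j), ev₃_leg₁, ev₃_leg₂] at this

lemma next_ev (h : 3 ≤ N) (k : ZMod N) : ev a j (D.link k) * Γ.r a b * ev b j (D.link (k + 1)) =
      ev b j (D.link (k + 1)) * ev a j (D.link k) := by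
  have := congrArg (ev₃ a b j) (D.next h k)
  rwa [mm_mul (ev₃ a b j), mm_mul (ev₃ a b j), mm_mul (ev₃ a b j), ev₃_leg₁, ev₃_leg₂,
    ev₃_aux] at this

lemma next_two_ev (h : N = 2) (k : ZMod N) : ev a j (D.link k) * Γ.r a b * ev b j (D.link (k + 1)) =
      ev b j (D.link (k + 1)) * Γ.r b a * ev a j (D.link k) := by
  have := congrArg (ev₃ a b j) (D.next_two h k)
  rwa [mm_mul (ev₃ a b j), mm_mul (ev₃ a b j), mm_mul (ev₃ a b j), mm_mul (ev₃ a b j), ev₃_leg₁,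
    ev₃_leg₂, ev₃_aux, ev₃_aux, ev_flip] at this

/-- The product of consecutive holonomies is again a holonomy. -/
lemma hol_mul {P J : G ⊗[ℂ] A} {X : E} (hP : ev a j P * ev b j P = Γ.r a b * ev (conv a b) j P)
    (hJ : ev a j J * ev b j J = Γ.r a b * ev (conv a b) j J)
    (hX : ev a j J * X * ev b j P = ev b j P * Γ.r b a * ev a j J)
    (hv : Commute (b (Γ.v⁻¹).1) X) :
    ev a j (inl G A (Γ.v⁻¹).1 * P * J) * X * ev b j (inl G A (Γ.v⁻¹).1 * P * J) =
      Γ.r a b * ev (conv a b) j (inl G A (Γ.v⁻¹).1 * P * J) := by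
  have hc := RibbonStar.central_inv Γ.v_central
  have e : ∀ (c : G →ₗ[ℂ] E) [IsMulMap c] [Comm c j], ev c j (inl G A (Γ.v⁻¹).1 * P * J) =
      c (Γ.v⁻¹).1 * ev c j P * ev c j J := by
    intro c _ _
    rw [mm_mul (ev c j), mm_mul (ev c j), inl_apply, ev_tmul, mm_one, mul_one]
  have cen : ∀ z : G, (∀ ξ, z * ξ = ξ * z) → ∀ (X : G ⊗[ℂ] A), Commute (b z) (ev a j X) :=
    fun z _ X => (commute_ev a j X (b z) (fun x => comm_of a b x z)
      (fun x => comm_of j b x z)).symm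
  have h1 := cen _ hc P
  have h2 := cen _ hc J
  have h3 : ∀ (z : G) (_ : ∀ ξ, z * ξ = ξ * z), Commute (a z * b z) (ev (conv a b) j P) := by
    intro z hz
    refine (commute_ev _ j P _ (fun x => commute_ev a b _ _ (fun y => ?_) fun y => ?_)
      (fun x => (comm_of j a x _).mul_right (comm_of j b x _))).symm
    · exact (RibbonStar.commute_central a hz y).mul_right (comm_of a b y z)
    · exact (comm_of b a y z).mul_right (RibbonStar.commute_central b hz y)
  have h4 := h3 _ Γ.v_central
  have h5 : Commute (conv a b (Γ.v⁻¹).1) (ev (conv a b) j P) :=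
    (commute_ev _ j P _ (fun x => RibbonStar.commute_central _ hc x)
      (fun x => comm_of j (conv a b) x _)).symm
  have h6 : Commute (a (Γ.v⁻¹).1 * b (Γ.v⁻¹).1) (Γ.r a b) := by
    refine (Γ.commute_r a b (fun y => ?_) fun y => ?_).symm
    · exact (RibbonStar.commute_central a hc y).mul_right (comm_of a b y _)
    · exact (comm_of b a y _).mul_right (RibbonStar.commute_central b hc y)
  have h7 : a (Γ.v⁻¹).1 * b (Γ.v⁻¹).1 * (a Γ.v.1 * b Γ.v.1) = 1 := by
    rw [mul_assoc, ← mul_assoc (b _), ← (comm_of a b _ _).eq, mul_assoc (a Γ.v.1),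
      RibbonStar.mm_unit_inv_mul, mul_one, RibbonStar.mm_unit_inv_mul]
  have hR := Γ.isRibbon_v.ev_eq (f := a) (g := b)
  rw [e a, e b, e (conv a b)]
  generalize a (Γ.v⁻¹).1 = va at *
  generalize b (Γ.v⁻¹).1 = vb at *
  generalize conv a b (Γ.v⁻¹).1 = vc at *
  generalize ev a j P = Pa at *
  generalize ev a j J = Ja at *
  generalize ev b j P = Pb at *
  generalize ev b j J = Jb at *
  generalize ev (conv a b) j P = Pc at *
  generalize ev (conv a b) j J = Jc at *
  generalize Γ.r a b = r at *
  generalize Γ.r b a = r' at *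
  generalize a Γ.v.1 * b Γ.v.1 = w at *
  calc va * Pa * Ja * X * (vb * Pb * Jb) = va * Pa * (Ja * (X * vb) * Pb * Jb) := by
        simp only [mul_assoc]
    _ = va * Pa * (Ja * vb * X * Pb * Jb) := by rw [← hv.eq]; simp only [mul_assoc]
    _ = va * (Pa * vb) * (Ja * X * Pb) * Jb := by rw [← h2.eq]; simp only [mul_assoc]
    _ = va * vb * (Pa * Pb) * r' * (Ja * Jb) := by rw [← h1.eq, hX]; simp only [mul_assoc]
    _ = (va * vb * r) * Pc * (r' * r) * Jc := by rw [hP, hJ]; simp only [mul_assoc]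
    _ = r * (va * vb) * (Pc * w) * vc * Jc := by rw [h6.eq, hR]; simp only [mul_assoc]
    _ = r * (va * vb * w) * (Pc * vc) * Jc := by rw [← h4.eq]; simp only [mul_assoc]
    _ = r * (vc * Pc * Jc) := by rw [h7, ← h5.eq]; simp only [mul_assoc, mul_one]

end

variable {n : ℕ} (D : CurrentData Γ (n + 1) A)

/-- The link with number `m + 1`. -/
def L (m : ℕ) : G ⊗[ℂ] A := D.link ((m + 1 : ℕ) : ZMod (n + 1))

/-- The site with number `m + 1`. -/
def T (m : ℕ) : G →ₗ[ℂ] A := D.site ((m + 1 : ℕ) : ZMod (n + 1))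

instance (m : ℕ) : IsMulMap (D.T m) := D.site_mul _

/-- The holonomy `v_a^{-k} J_1 ⋯ J_{k+1}`. -/
def hol : ℕ → G ⊗[ℂ] A
  | 0 => D.L 0
  | k + 1 => inl G A (Γ.v⁻¹).1 * hol k * D.L (k + 1)

section

variable (a b : G →ₗ[ℂ] E) (j : A →ₗ[ℂ] E) [IsMulMap a] [IsMulMap b] [IsMulMap j] [Comm a b]
  [Comm a j] [Comm b j]

lemma ev_hol_succ (k : ℕ) : ev a j (D.hol (k + 1)) =
    a (Γ.v⁻¹).1 * ev a j (D.hol k) * ev a j (D.L (k + 1)) := by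
  rw [hol, mm_mul (ev a j), mm_mul (ev a j), inl_apply, ev_tmul, mm_one, mul_one]

lemma commute_L {i m : ℕ} (hi : i ≤ n) (hm : m ≤ n) (h1 : i ≠ m) (h2 : i ≠ m + 1)
    (h3 : m ≠ i + 1) (h4 : ¬ (i = 0 ∧ m = n)) (h5 : ¬ (m = 0 ∧ i = n)) :
    ev a j (D.L i) * ev b j (D.L m) = ev b j (D.L m) * ev a j (D.L i) := by
  refine D.link_far_ev a b j _ _ (fun h => h1 (ZMod.natCast_add_one_inj hi hm h)) (fun h => ?_)
    fun h => ?_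
  · rcases ZMod.natCast_succ_inj hi hm h with h | h
    exacts [h2 h, h4 h]
  · rcases ZMod.natCast_succ_inj hm hi (eq_sub_iff_add_eq.mp h).symm with h | h
    exacts [h3 h, h5 h]

lemma L_mul_L (hn : 1 ≤ n) (m : ℕ) : ev a j (D.L m) * ev b j (D.L m) =
    Γ.r a b * ev (conv a b) j (D.L m) := D.funct_ev a b j (by omega) _

lemma L_next (hn : 2 ≤ n) (m : ℕ) :
    ev a j (D.L m) * Γ.r a b * ev b j (D.L (m + 1)) = ev b j (D.L (m + 1)) * ev a j (D.L m) := by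
  have := D.next_ev a b j (by omega) ((m + 1 : ℕ) : ZMod (n + 1))
  rwa [← Nat.cast_succ] at this

lemma L_last (hn : 2 ≤ n) :
    ev a j (D.L n) * Γ.r a b * ev b j (D.L 0) = ev b j (D.L 0) * ev a j (D.L n) := by
  have := D.next_ev a b j (by omega) ((n + 1 : ℕ) : ZMod (n + 1))
  rwa [show ((n + 1 : ℕ) : ZMod (n + 1)) + 1 = ((0 + 1 : ℕ) : ZMod (n + 1)) by
    rw [ZMod.natCast_self]; simp] at this

lemma L_last_two (hn : n = 1) :
    ev a j (D.L n) * Γ.r a b * ev b j (D.L 0) = ev b j (D.L 0) * Γ.r b a * ev a j (D.L n) := by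
  have := D.next_two_ev a b j (by omega) ((n + 1 : ℕ) : ZMod (n + 1))
  rwa [show ((n + 1 : ℕ) : ZMod (n + 1)) + 1 = ((0 + 1 : ℕ) : ZMod (n + 1)) by
    rw [ZMod.natCast_self]; simp] at this

lemma commute_L_hol (k m : ℕ) (hm : k + 2 ≤ m) (hn : m < n) :
    ev a j (D.L m) * ev b j (D.hol k) = ev b j (D.hol k) * ev a j (D.L m) := by
  induction k with
  | zero => exact D.commute_L a b j hn.le (Nat.zero_le _) (by omega) (by omega) (by omega) (by omega) (by omega)
  | succ k ih =>
    have h0 : Commute (ev a j (D.L m)) (b (Γ.v⁻¹).1) := comm_of (ev a j) b _ _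
    have h1 : Commute (ev a j (D.L m)) (ev b j (D.hol k)) := ih (by omega)
    have h2 : Commute (ev a j (D.L m)) (ev b j (D.L (k + 1))) :=
      D.commute_L a b j hn.le (by omega) (by omega) (by omega) (by omega) (by omega) (by omega)
    rw [ev_hol_succ]
    exact (h0.mul_right h1).mul_right h2

lemma L_mul_hol (k : ℕ) (hk : k + 1 < n) : ev a j (D.L (k + 1)) * ev b j (D.hol k) =
      ev b j (D.hol k) * Γ.r b a * ev a j (D.L (k + 1)) := by
  cases k with
  | zero => exact (D.L_next b a j (by omega) 0).symm
  | succ k =>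
    have h0 : Commute (ev a j (D.L (k + 2))) (b (Γ.v⁻¹).1) := comm_of (ev a j) b _ _
    have h1 : Commute (ev a j (D.L (k + 2))) (ev b j (D.hol k)) :=
      D.commute_L_hol a b j k _ le_rfl hk
    rw [ev_hol_succ, ← mul_assoc, (h0.mul_right h1).eq, mul_assoc,
      ← D.L_next b a j (by omega) (k + 1)]
    simp only [mul_assoc]

lemma L_last_mul_hol (k : ℕ) (hk : k + 2 ≤ n) :
    ev a j (D.L n) * Γ.r a b * ev b j (D.hol k) = ev b j (D.hol k) * ev a j (D.L n) := by
  induction k with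
  | zero => exact D.L_last a b j hk
  | succ k ih =>
    have h0 : Commute (ev a j (D.L n) * Γ.r a b) (b (Γ.v⁻¹).1) :=
      (show Commute _ _ from comm_of (ev a j) b _ _).mul_left
        (Γ.commute_r a b (fun x => comm_of a b x _) fun x =>
          RibbonStar.commute_central b (RibbonStar.central_inv Γ.v_central) x)
    have h2 : ev a j (D.L n) * ev b j (D.L (k + 1)) = ev b j (D.L (k + 1)) * ev a j (D.L n) :=
      D.commute_L a b j le_rfl (by omega) (by omega) (by omega) (by omega) (by omega) (by omega)
    rw [ev_hol_succ, ← mul_assoc, ← mul_assoc, h0.eq, mul_assoc (b _), ih (by omega), ← mul_assoc,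
      mul_assoc, h2]
    simp only [mul_assoc]

lemma L_last_mul_hol_pred (k : ℕ) (hk : k + 1 = n) : ev a j (D.L n) * Γ.r a b * ev b j (D.hol k) =
      ev b j (D.hol k) * Γ.r b a * ev a j (D.L n) := by
  cases k with
  | zero => exact D.L_last_two a b j (by omega)
  | succ k =>
    have h0 : Commute (ev a j (D.L n) * Γ.r a b) (b (Γ.v⁻¹).1) :=
      (show Commute _ _ from comm_of (ev a j) b _ _).mul_left
        (Γ.commute_r a b (fun x => comm_of a b x _) fun x =>
          RibbonStar.commute_central b (RibbonStar.central_inv Γ.v_central) x)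
    have h2 := D.L_next b a j (by omega) (k + 1)
    rw [ev_hol_succ, ← mul_assoc, ← mul_assoc, h0.eq, mul_assoc (b _),
      D.L_last_mul_hol a b j k (by omega), ← mul_assoc, mul_assoc,
      show ev a j (D.L n) = ev a j (D.L (k + 1 + 1)) by rw [hk], ← h2]
    simp only [mul_assoc]

lemma hol_funct (k : ℕ) (hk : k < n) : ev a j (D.hol k) * ev b j (D.hol k) =
    Γ.r a b * ev (conv a b) j (D.hol k) := by
  induction k with
  | zero => exact D.L_mul_L a b j hk 0
  | succ k ih =>
    have h := hol_mul (X := 1) a b j (ih (by omega)) (D.L_mul_L a b j (by omega) (k + 1))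
      (by rw [mul_one]; exact D.L_mul_hol a b j k hk) (Commute.one_right _)
    rwa [mul_one] at h

/-- Functoriality of the monodromy. -/
lemma monodromy_funct : ev a j (D.hol n) * Γ.r a b * ev b j (D.hol n) =
    Γ.r a b * ev (conv a b) j (D.hol n) := by
  rcases n with _ | k
  · exact D.funct_loop_ev a b j rfl _
  · exact hol_mul a b j (D.hol_funct a b j k (by omega)) (D.L_mul_L a b j (by omega) (k + 1))
      (D.L_last_mul_hol_pred a b j k rfl)
      (Γ.commute_r a b (fun x => comm_of a b x _) fun x =>
          RibbonStar.commute_central b (RibbonStar.central_inv Γ.v_central) x).symm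

end

lemma commute_T_L {i m : ℕ} (hn : 1 ≤ n) (hi : i ≤ n) (hm : m ≤ n) (h1 : m ≠ i) (h2 : i ≠ m + 1)
    (h3 : ¬ (i = 0 ∧ m = n)) (ξ : G) : Commute (inr G A (D.T m ξ)) (D.L i) := by
  refine D.far (by omega) _ _ (fun h => h1 (ZMod.natCast_add_one_inj hm hi h)) (fun h => ?_) ξ
  rcases ZMod.natCast_succ_inj hi hm (eq_sub_iff_add_eq.mp h).symm with h | h
  exacts [h2 h, h3 h]

lemma T_mul_L (hn : 1 ≤ n) (m : ℕ) (ξ : G) :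
    inr G A (D.T m ξ) * D.L m = D.L m * conv (inl G A) (inr G A ∘ₗ D.T m) ξ :=
  D.target (by omega) _ ξ

lemma conv_T_mul_L (hn : 1 ≤ n) (m : ℕ) (ξ : G) :
    conv (inl G A) (inr G A ∘ₗ D.T m) ξ * D.L (m + 1) = D.L (m + 1) * inr G A (D.T m ξ) := by
  have := D.source (by omega) ((m + 1 + 1 : ℕ) : ZMod (n + 1)) ξ
  rwa [show ((m + 1 + 1 : ℕ) : ZMod (n + 1)) - 1 = ((m + 1 : ℕ) : ZMod (n + 1)) by
    push_cast; ring] at this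

lemma conv_T_mul_L_zero (hn : 1 ≤ n) (ξ : G) :
    conv (inl G A) (inr G A ∘ₗ D.T n) ξ * D.L 0 = D.L 0 * inr G A (D.T n ξ) := by
  have := D.source (by omega) ((0 + 1 : ℕ) : ZMod (n + 1)) ξ
  rwa [show ((0 + 1 : ℕ) : ZMod (n + 1)) - 1 = ((n + 1 : ℕ) : ZMod (n + 1)) by
    rw [ZMod.natCast_self]; simp] at this

lemma hol_succ (k : ℕ) : D.hol (k + 1) = inl G A (Γ.v⁻¹).1 * D.hol k * D.L (k + 1) := rfl

lemma commute_v_inr (x : A) : Commute (inr G A x) (inl G A (Γ.v⁻¹).1) :=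
  comm_of (inr G A) (inl G A) _ _

lemma commute_v_conv (f : G →ₗ[ℂ] A) (ξ : G) :
    Commute (conv (inl G A) (inr G A ∘ₗ f) ξ) (inl G A (Γ.v⁻¹).1) :=
  commute_ev _ _ _ _ (fun x => RibbonStar.commute_central _ (RibbonStar.central_inv Γ.v_central) x)
    fun x => comm_of (inr G A) (inl G A) _ _

lemma commute_T_hol (hn : 1 ≤ n) (k m : ℕ) (hk : k < m) (hm : m < n) (ξ : G) :
    Commute (inr G A (D.T m ξ)) (D.hol k) := by
  induction k with
  | zero => exact D.commute_T_L hn (by omega) hm.le (by omega) (by omega) (by omega) ξ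
  | succ k ih =>
    exact ((commute_v_inr _).mul_right (ih (by omega))).mul_right
      (D.commute_T_L hn (by omega) hm.le (by omega) (by omega) (by omega) ξ)

lemma T_mul_hol (hn : 1 ≤ n) (m : ℕ) (hm : m < n) (ξ : G) :
    inr G A (D.T m ξ) * D.hol m = D.hol m * conv (inl G A) (inr G A ∘ₗ D.T m) ξ := by
  cases m with
  | zero => exact D.T_mul_L hn 0 ξ
  | succ m =>
    rw [hol_succ, ← mul_assoc, ((commute_v_inr _).mul_right
      (D.commute_T_hol hn m (m + 1) (by omega) hm ξ)).eq, mul_assoc, D.T_mul_L hn]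
    simp only [mul_assoc]

lemma commute_T_hol_of_lt (hn : 1 ≤ n) (k m : ℕ) (hk : m < k) (hm : k ≤ n) (ξ : G) :
    Commute (inr G A (D.T m ξ)) (D.hol k) := by
  induction k with
  | zero => omega
  | succ k ih =>
    rcases (Nat.lt_succ_iff.mp hk).lt_or_eq with h | rfl
    · exact ((commute_v_inr _).mul_right (ih h (by omega))).mul_right
        (D.commute_T_L hn (by omega) (by omega) (by omega) (by omega) (by omega) ξ)
    · rw [commute_iff_eq, hol_succ, ← mul_assoc, ← mul_assoc, (commute_v_inr _).eq,
        mul_assoc (inl G A _), D.T_mul_hol hn m (by omega), mul_assoc, mul_assoc, D.conv_T_mul_L hn]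
      simp only [mul_assoc]

lemma conv_T_mul_hol (hn : 1 ≤ n) (k : ℕ) (hk : k < n) (ξ : G) :
    conv (inl G A) (inr G A ∘ₗ D.T n) ξ * D.hol k = D.hol k * inr G A (D.T n ξ) := by
  induction k with
  | zero => exact D.conv_T_mul_L_zero hn ξ
  | succ k ih =>
    rw [hol_succ, ← mul_assoc, ← mul_assoc, (commute_v_conv _ ξ).eq, mul_assoc (inl G A _),
      ih (by omega), ← mul_assoc, mul_assoc, (D.commute_T_L hn (by omega) le_rfl (by omega)
      (by omega) (by omega) ξ).eq]
    simp only [mul_assoc]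

/-- The monodromy commutes with the sites different from its base point. -/
lemma commute_T_monodromy (m : ℕ) (hm : m < n) (ξ : G) :
    Commute (inr G A (D.T m ξ)) (D.hol n) := D.commute_T_hol_of_lt (by omega) n m hm le_rfl ξ

/-- Covariance of the monodromy at its base point. -/
lemma commute_conv_monodromy (ξ : G) : Commute (conv (inl G A) (inr G A ∘ₗ D.T n) ξ) (D.hol n) := by
  rcases n with _ | k
  · exact D.loop rfl _ ξ
  · rw [commute_iff_eq, hol_succ, ← mul_assoc, ← mul_assoc, (commute_v_conv _ ξ).eq,
      mul_assoc (inl G A _), D.conv_T_mul_hol (by omega) k (by omega), ← mul_assoc, mul_assoc,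
      D.T_mul_L (by omega)]
    simp only [mul_assoc]

end CurrentData

lemma CurrentAlgebra.holonomy_eq_hol {G : Type u} [Ring G] [HopfAlgebra ℂ G] [StarRing G]
    [StarModule ℂ G] [Module.Finite ℂ G] (Γ : RibbonStar G) (n k : ℕ) :
    CurrentAlgebra.holonomy Γ (n + 1) (k + 1) = (CurrentAlgebra.data Γ (n + 1)).hol k := by
  induction k with
  | zero => simp [holonomy, CurrentData.hol, CurrentData.L, CurrentAlgebra.data,
      ← Algebra.TensorProduct.one_def]
  | succ k ih =>
    rw [CurrentData.hol, ← ih, holonomy, holonomy, List.range_succ, List.map_append,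
      List.prod_append, ← mul_assoc, ← mul_assoc]
    congr 1
    · congr 1
      simp [pow_succ', Algebra.TensorProduct.tmul_mul_tmul]
    · simp [CurrentData.L, CurrentAlgebra.data]

/-! ## Integrals, characters and factorizability -/

section Integral

/-- A normalized left integral. -/
structure IsIntegral (h : G) : Prop where
  mul : ∀ ξ : G, ξ * h = counit (R := ℂ) ξ • h
  counit_eq : counit (R := ℂ) h = 1

lemma exists_isIntegral [IsSemisimpleRing G] : ∃ h : G, IsIntegral h := by
  obtain ⟨L, hL⟩ := exists_isCompl (RingHom.ker (Bialgebra.counitAlgHom ℂ G) : Submodule G G)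
  have h1 : (1 : G) ∈ (RingHom.ker (Bialgebra.counitAlgHom ℂ G) : Submodule G G) ⊔ L := by
    rw [hL.sup_eq_top]; trivial
  obtain ⟨i, hi, h, hh, hih⟩ := Submodule.mem_sup.mp h1
  have hi' : counit (R := ℂ) i = 0 := hi
  have hε : counit (R := ℂ) h = 1 := by
    have := congrArg (counit (R := ℂ)) hih
    rwa [map_add, hi', zero_add, Bialgebra.counit_one] at this
  refine ⟨h, fun ξ => ?_, hε⟩
  have h2 : ξ * h - counit (R := ℂ) ξ • h ∈
      (RingHom.ker (Bialgebra.counitAlgHom ℂ G) : Submodule G G) ⊓ L := by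
    refine ⟨?_, L.sub_mem (L.smul_mem ξ hh) ?_⟩
    · change counit (R := ℂ) _ = 0
      rw [map_sub, map_smul, Bialgebra.counit_mul, hε]
      simp
    · rw [Algebra.smul_def]
      exact L.smul_mem _ hh
  rw [hL.inf_eq_bot] at h2
  exact sub_eq_zero.mp h2

lemma inr_eq_ev_antipode (ξ : G) : inr G G ξ =
    ev (inl G G ∘ₗ antipode ℂ) comul (comul (R := ℂ) ξ) := by
  have h : inr G G = conv (inl G G ∘ₗ antipode ℂ) (conv (inl G G) (inr G G)) := by
    rw [← conv_assoc, antipode_conv, triv_conv]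
  rw [h, conv_apply]
  congr 2
  exact LinearMap.ext fun x => (comul_eq_conv x).symm

variable {h : G}

lemma IsIntegral.inr_mul_comul (hh : IsIntegral h) (ξ : G) : inr G G ξ * comul (R := ℂ) h =
      inl G G (antipode ℂ ξ) * comul (R := ℂ) h := by
  have key : ∀ X : G ⊗[ℂ] G, ev (inl G G ∘ₗ antipode ℂ) comul X *
      comul (R := ℂ) h = inl G G (antipode ℂ
        (TensorProduct.rid ℂ G (lTensor G (counit (R := ℂ)) X))) * comul (R := ℂ) h := by
    intro X
    induction X with
    | zero => simp
    | add X Y h h' => simp only [map_add, add_mul, h, h']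
    | tmul a b =>
      rw [ev_tmul, mul_assoc, ← Bialgebra.comul_mul, hh.mul]
      simp
  rw [inr_eq_ev_antipode, key, Coalgebra.lTensor_counit_comul]
  simp

/-- Every element of a Hopf algebra is of the form `π(h₁) h₂`. -/
lemma IsIntegral.exists_component [Module.Finite ℂ G] (hh : IsIntegral h) (x : G) :
    ∃ π : Dual ℂ G, component π (comul (R := ℂ) h) = x := by
  have h1 : ∀ (ξ : G) (π : Dual ℂ G), ∃ π' : Dual ℂ G, component π' (comul (R := ℂ) h) =
        ξ * component π (comul (R := ℂ) h) := by
    intro ξ π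
    refine ⟨π ∘ₗ LinearMap.mulLeft ℂ (antipode ℂ ξ), ?_⟩
    have := congrArg (component π) (hh.inr_mul_comul ξ)
    rw [inr_apply, inl_apply, component_tmul_mul, component_tmul_mul] at this
    simpa using this.symm
  have h2 : (1 : G) = ∑ i, antipode ℂ (Module.finBasis ℂ G i) *
      component ((Module.finBasis ℂ G).coord i) (comul (R := ℂ) h) := by
    have := HopfAlgebra.mul_antipode_rTensor_comul_apply (R := ℂ) h
    rw [hh.counit_eq, map_one, ← sum_tmul_component (comul (R := ℂ) h)] at this
    simp only [map_sum, LinearMap.rTensor_tmul, LinearMap.mul'_apply] at this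
    exact this.symm
  let Φ : Dual ℂ G →ₗ[ℂ] G := 
    { toFun := fun π => component π (comul (R := ℂ) h)
      map_add' := fun π π' => by simp [component, LinearMap.rTensor_add]
      map_smul' := fun c π => by simp [component, LinearMap.rTensor_smul] }
  have h3 : ∀ y ∈ LinearMap.range Φ, ∀ ξ, ξ * y ∈ LinearMap.range Φ := by
    rintro _ ⟨π, rfl⟩ ξ
    exact h1 ξ π
  have h4 : (1 : G) ∈ LinearMap.range Φ := by
    rw [h2]
    exact Submodule.sum_mem _ fun i _ => h3 _ ⟨_, rfl⟩ _
  have h5 := h3 1 h4 x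
  rw [mul_one] at h5
  exact h5

end Integral

section

variable (G A) in
/-- The components of an element, as a linear function of the functional. -/
def componentHom : Dual ℂ G →ₗ[ℂ] G ⊗[ℂ] A →ₗ[ℂ] A where
  toFun := component
  map_add' π π' := by ext; simp [component]
  map_smul' c π := by ext; simp [component]

@[simp] lemma componentHom_apply (π : Dual ℂ G) (X : G ⊗[ℂ] A) :
    componentHom G A π X = component π X := rfl

lemma component_lTensor (f : G →ₗ[ℂ] A) (π : Dual ℂ G) (X : G ⊗[ℂ] G) :
    component π (lTensor G f X) = f (component π X) := by
  induction X with
  | tmul x y => simp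
  | _ => simp_all

variable (Γ)

variable (G) in
/-- `a ⊗ b` acts on `p ⊗ q` by `p a ⊗ b q`. -/
def insideMul : G ⊗[ℂ] G →ₗ[ℂ] G ⊗[ℂ] G →ₗ[ℂ] G ⊗[ℂ] G :=
  TensorProduct.homTensorHomMap (.id ℂ) G G G G ∘ₗ
    TensorProduct.map (LinearMap.mul ℂ G).flip (LinearMap.mul ℂ G)

@[simp] lemma insideMul_tmul (a b p q : G) :
    insideMul G (a ⊗ₜ b) (p ⊗ₜ q) = (p * a) ⊗ₜ (b * q) := rfl

lemma insideMul_antipode_R : insideMul G (lTensor G (antipode ℂ) Γ.R.1) Γ.R = 1 := by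
  have key : ∀ X Y : G ⊗[ℂ] G, insideMul G (lTensor G (antipode ℂ) X) (lTensor G (antipode ℂ) Y) =
      lTensor G (antipode ℂ) (Y * X) := by
    intro X Y
    induction X with
    | tmul a b =>
      induction Y with
      | zero => simp
      | add Y Y' h h' => simp only [map_add, add_mul, h, h']
      | tmul p q =>
        simp only [LinearMap.lTensor_tmul, insideMul_tmul, Algebra.TensorProduct.tmul_mul_tmul,
          HopfAlgebra.antipode_mul_antidistrib]
    | _ => simp_all [mul_add]
  have h := key Γ.R (Γ.R⁻¹).1
  rwa [Γ.antipode_lTensor_R_inv, Units.inv_mul, Algebra.TensorProduct.one_def,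
    LinearMap.lTensor_tmul, HopfAlgebra.antipode_one, ← Algebra.TensorProduct.one_def] at h

lemma component_insideMul (π₁ π₂ : Dual ℂ G) (X Y : G ⊗[ℂ] A) (a b : G) (P : G ⊗[ℂ] G) :
    component π₂ (component π₁ (leg₁ G A X * aux G A (insideMul G (a ⊗ₜ b) P) * leg₂ G A Y)) =
      component (π₂ ∘ₗ LinearMap.mulLeft ℂ b) (component (π₁ ∘ₗ LinearMap.mulRight ℂ a)
        (leg₁ G A X * aux G A P * leg₂ G A Y)) := by
  have e : ∀ p q : G, leg₁ G A X * aux G A (p ⊗ₜ q) * leg₂ G A Y =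
      leg₁ G A (X * p ⊗ₜ 1) * leg₂ G A (q ⊗ₜ 1 * Y) := by
    intro p q
    have : aux G A (p ⊗ₜ q) = leg₁ G A (p ⊗ₜ 1) * leg₂ G A (q ⊗ₜ 1) := by
      simp [aux, leg₁, leg₂, Algebra.TensorProduct.tmul_mul_tmul]
    rw [this, map_mul, map_mul]
    simp only [mul_assoc]
  induction P with
  | tmul p q =>
    rw [insideMul_tmul, e, e, component_component_legs, component_component_legs,
      component_mul_tmul, component_tmul_mul, component_mul_tmul, component_tmul_mul]
    simp only [mul_one, one_mul]
    congr 2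
    · ext x; simp [mul_assoc]
    · ext x; simp
  | _ => simp_all [mul_add, add_mul]

/-- The components of `X₁ Y₂` are linear combinations of those of `X₁ R Y₂`. -/
lemma component_mul_component (π₁ π₂ : Dual ℂ G) {s : Finset (G × G)}
    (hs : lTensor G (antipode ℂ) Γ.R.1 = ∑ i ∈ s, i.1 ⊗ₜ[ℂ] i.2) (X Y : G ⊗[ℂ] A) :
    component π₁ X * component π₂ Y = ∑ i ∈ s, component (π₂ ∘ₗ LinearMap.mulLeft ℂ i.2)
      (component (π₁ ∘ₗ LinearMap.mulRight ℂ i.1) (leg₁ G A X * aux G A Γ.R * leg₂ G A Y)) := by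
  simp only [← component_insideMul]
  rw [← map_sum, ← map_sum, ← Finset.sum_mul, ← Finset.mul_sum, ← map_sum,
    ← LinearMap.sum_apply, ← map_sum, ← hs, insideMul_antipode_R, map_one, mul_one,
    component_component_legs]

end

section Modular

variable [Module.Finite ℂ G] (Γ) {h : G}

include Γ in
lemma IsIntegral.mul_right (hh : IsIntegral h) (ξ : G) : h * ξ = counit (R := ℂ) ξ • h := by
  have h1 : ∀ ξ, antipode ℂ h * antipode ℂ ξ = counit (R := ℂ) ξ • antipode ℂ h := fun ξ => by
    rw [← HopfAlgebra.antipode_mul_antidistrib, hh.mul, map_smul]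
  have h2 : antipode ℂ h = h := by
    obtain ⟨y, hy⟩ := (RibbonStar.antipode_bijective Γ).2 h
    have h3 := h1 y
    rw [hy, hh.mul, HopfAlgebra.counit_antipode, hh.counit_eq, one_smul,
      ← HopfAlgebra.counit_antipode (R := ℂ) y, hy, hh.counit_eq, one_smul] at h3
    exact h3.symm
  obtain ⟨y, rfl⟩ := (RibbonStar.antipode_bijective Γ).2 ξ
  have := h1 y
  rw [h2] at this
  rw [this, HopfAlgebra.counit_antipode]

end Modular

section Irreps

variable {G : Type u} [Ring G] [Algebra ℂ G] {W : Type v} [AddCommGroup W] [Module ℂ W]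

/-- Schur's lemma. -/
lemma IsIrreducibleRep.exists_smul [FiniteDimensional ℂ W] {ρ : G →ₐ[ℂ] End ℂ W}
    (hρ : IsIrreducibleRep ρ) (T : End ℂ W) (hT : ∀ ξ x, T (ρ ξ x) = ρ ξ (T x)) :
    ∃ c : ℂ, ∀ x, T x = c • x := by
  have := hρ.1
  obtain ⟨c, hc⟩ := Module.End.exists_eigenvalue T
  refine ⟨c, fun x => ?_⟩
  have hs : ∀ ξ, ∀ x ∈ Module.End.eigenspace T c, ρ ξ x ∈ Module.End.eigenspace T c := by
    intro ξ x hx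
    rw [Module.End.mem_eigenspace_iff] at hx ⊢
    rw [hT, hx, map_smul]
  rcases hρ.2 _ hs with h | h
  · exact absurd h hc
  · exact Module.End.mem_eigenspace_iff.mp (h ▸ Submodule.mem_top)

variable [StarRing G] {Λ : Type w} {V : Λ → Type v} [∀ I, NormedAddCommGroup (V I)]
  [∀ I, InnerProductSpace ℂ (V I)] {τ : ∀ I, G →ₐ[ℂ] End ℂ (V I)}

lemma IsIrrepList.mem_span [IsSemisimpleRing G] (hτ : IsIrrepList V τ) (x : G) :
    x ∈ Submodule.span ℂ {y : G | ∃ (I : Λ) (f : V I →ₗ[ℂ] G),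
      (∀ ξ z, f (τ I ξ z) = ξ * f z) ∧ ∃ a, f a = y} := by
  have hx : x ∈ sSup {m : Submodule G G | IsSimpleModule G m} := by
    rw [IsSemisimpleModule.sSup_simples_eq_top]; trivial
  rw [sSup_eq_iSup'] at hx
  induction hx using Submodule.iSup_induction' with
  | zero => exact zero_mem _
  | add x y _ _ hx hy => exact add_mem hx hy
  | mem m x hx =>
    obtain ⟨m, hm⟩ := m
    have hm : IsSimpleModule G m := hm
    let ρ : G →ₐ[ℂ] End ℂ m := Algebra.lsmul ℂ ℂ m
    have hρ : IsIrreducibleRep ρ := by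
      refine ⟨IsSimpleModule.nontrivial G m, fun p hp => ?_⟩
      let p' : Submodule G m := { p with smul_mem' := fun c x hx => hp c x hx }
      rcases eq_bot_or_eq_top p' with h | h
      · left
        ext z
        exact (Iff.of_eq (congrArg (z ∈ ·) h) : z ∈ p' ↔ z ∈ ⊥)
      · right
        ext z
        exact (Iff.of_eq (congrArg (z ∈ ·) h) : z ∈ p' ↔ z ∈ ⊤)
    obtain ⟨I, e, he⟩ := hτ.complete m ρ hρ
    refine Submodule.subset_span ⟨I, (m.restrictScalars ℂ).subtype ∘ₗ e.symm.toLinearMap,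
      fun ξ z => ?_, e ⟨x, hx⟩, ?_⟩
    · have : e.symm (τ I ξ z) = ρ ξ (e.symm z) := by
        rw [LinearEquiv.symm_apply_eq, he, LinearEquiv.apply_symm_apply]
      change ((e.symm (τ I ξ z) : m) : G) = ξ * ((e.symm z : m) : G)
      rw [this]
      rfl
    · change ((e.symm (e ⟨x, hx⟩) : m) : G) = x
      rw [LinearEquiv.symm_apply_apply]

lemma IsIrrepList.eq_zero [IsSemisimpleRing G] (hτ : IsIrrepList V τ) {x : G}
    (hx : ∀ I, τ I x = 0) : x = 0 := by
  have key : ∀ y : G, x * y = 0 := fun y => by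
    induction hτ.mem_span y using Submodule.span_induction with
    | mem y hy =>
      obtain ⟨I, f, hf, a, rfl⟩ := hy
      rw [← hf, hx]
      simp
    | zero => simp
    | add y z _ _ hy hz => rw [mul_add, hy, hz, add_zero]
    | smul c y _ hy => rw [mul_smul_comm, hy, smul_zero]
  simpa using key 1

lemma IsIrrepList.ext [IsSemisimpleRing G] (hτ : IsIrrepList V τ) {x y : G}
    (h : ∀ I, τ I x = τ I y) : x = y :=
  sub_eq_zero.mp (hτ.eq_zero fun I => by rw [map_sub, h, sub_self])

end Irreps

section Factorizable

variable (Γ)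

namespace RibbonStar

/-- The element `R'R`. -/
def Q : G ⊗[ℂ] G := flipTensor G Γ.R * Γ.R

lemma ev_Q (f g : G →ₗ[ℂ] E) [IsMulMap f] [IsMulMap g]
    [Comm f g] : ev f g Γ.Q = Γ.r g f * Γ.r f g := by
  rw [Q, mm_mul (ev f g), ev_flip]
  rfl

lemma Q_mul_comul (ξ : G) : Γ.Q * comul (R := ℂ) ξ = comul (R := ℂ) ξ * Γ.Q := by
  have h : ∀ X : G ⊗[ℂ] G, flipTensor G (flipTensor G X) = X := fun X => TensorProduct.comm_comm ..
  have h1 := congrArg (flipTensor G) (Γ.R_comul ξ)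
  rw [map_mul, map_mul, h] at h1
  rw [Q, mul_assoc, Γ.R_comul, ← mul_assoc, h1, mul_assoc]

/-- The component of `R'R` at a quantum trace is central. -/
lemma component_Q_central (χ : Dual ℂ G) (hχ : ∀ x y z : G, χ (antipode ℂ x * y * z) =
      χ (antipode ℂ (x * antipode ℂ z) * y)) (ξ : G) :
    ξ * component χ Γ.Q = component χ Γ.Q * ξ := by
  let M : G →ₗ[ℂ] G := (componentHom G G).flip Γ.Q ∘ₗ Module.Dual.transpose.flip χ ∘ₗ
    LinearMap.mul ℂ G ∘ₗ antipode ℂ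
  have hM : ∀ x, M x = component (χ ∘ₗ LinearMap.mulLeft ℂ (antipode ℂ x)) Γ.Q := fun x => rfl
  let N : G ⊗[ℂ] G →ₗ[ℂ] G := M ∘ₗ LinearMap.mul' ℂ G ∘ₗ lTensor G (antipode ℂ)
  have h1 : ∀ (a : G) (Y : G ⊗[ℂ] G), component χ (inl G G (antipode ℂ a) * Γ.Q * Y) =
      ev N LinearMap.id ((TensorProduct.assoc ℂ G G G).symm (a ⊗ₜ Y)) := by
    intro a Y
    induction Y with
    | tmul b c =>
      rw [TensorProduct.assoc_symm_tmul, ev_tmul, component_mul_tmul, inl_apply,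
        component_tmul_mul, one_mul]
      congr 1
      simp only [N, comp_apply, LinearMap.lTensor_tmul, LinearMap.mul'_apply, hM]
      refine congrArg (fun φ : Dual ℂ G => component φ Γ.Q) (LinearMap.ext fun y => ?_)
      simpa [mul_assoc] using hχ a y b
    | _ => simp_all [TensorProduct.tmul_add, mul_add]
  have h2 : ∀ X : G ⊗[ℂ] G, component χ (ev (inl G G ∘ₗ antipode ℂ) comul X
      * Γ.Q) = ev N LinearMap.id ((TensorProduct.assoc ℂ G G G).symm
        (lTensor G (comul (R := ℂ)) X)) := by
    intro X
    induction X with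
    | tmul a b =>
      rw [ev_tmul, mul_assoc, ← Q_mul_comul, ← mul_assoc, comp_apply, h1, LinearMap.lTensor_tmul]
    | _ => simp_all [add_mul]
  have h3 := h2 (comul (R := ℂ) ξ)
  rw [← inr_eq_ev_antipode, Coalgebra.coassoc_symm_apply, LinearMap.rTensor, ev_eq_of_eq, inr_apply,
    component_tmul_mul] at h3
  have h4 : N ∘ₗ comul (R := ℂ) = LinearMap.toSpanSingleton ℂ G (M 1) ∘ₗ counit := by
    ext y
    simp only [N, comp_apply, HopfAlgebra.mul_antipode_lTensor_comul_apply]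
    rw [Algebra.algebraMap_eq_smul_one, map_smul]
    rfl
  have h5 : ∀ X : G ⊗[ℂ] G, ev (LinearMap.toSpanSingleton ℂ G (M 1) ∘ₗ counit)
      LinearMap.id X = M 1 * TensorProduct.lid ℂ G (LinearMap.rTensor G (counit (R := ℂ)) X) := by
    intro X
    induction X with
    | tmul a b => simp
    | _ => simp_all [mul_add]
  have h6 : ∀ φ : Dual ℂ G, φ ∘ₗ LinearMap.mulLeft ℂ (1 : G) = φ := fun φ => by ext; simp
  rw [h4, LinearMap.comp_id, h5, Coalgebra.rTensor_counit_comul, hM, HopfAlgebra.antipode_one,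
    h6] at h3
  simpa using h3

lemma lTensor_comul_Q : lTensor G (comul (R := ℂ)) Γ.Q =
    aux G G (flipTensor G Γ.R) * leg₁ G G Γ.Q * aux G G Γ.R := by
  set a := inl G (G ⊗[ℂ] G) with ha
  set b := inr G (G ⊗[ℂ] G) ∘ₗ inl G G with hb
  set c := inr G (G ⊗[ℂ] G) ∘ₗ inr G G with hc
  have h0 : inr G (G ⊗[ℂ] G) ∘ₗ comul (R := ℂ) = conv b c := by
    rw [hb, hc, ← map_conv]
    exact LinearMap.ext fun x => congrArg (inr G (G ⊗[ℂ] G)) (comul_eq_conv x)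
  have h1 : aux G G (flipTensor G Γ.R) = Γ.r b a := by
    rw [← ev₃_self (aux G G _), ev₃_aux, ev_flip]; rfl
  have h2 : aux G G Γ.R = Γ.r a b := by rw [← ev₃_self (aux G G _), ev₃_aux]; rfl
  have h3 : leg₁ G G Γ.Q = Γ.r c a * Γ.r a c := by rw [← ev₃_self (leg₁ G G _), ev₃_leg₁, ev_Q]
  have h4 : lTensor G (comul (R := ℂ)) Γ.Q = Γ.r (conv b c) a * Γ.r a (conv b c) := by
    rw [← ev_inl_inr_comp, h0, ev_Q]
  rw [h4, h1, h2, h3, r_conv_left, r_conv_right]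
  simp only [mul_assoc]

lemma exists_component_comul_Q (c π : Dual ℂ G) : ∃ φ : Dual ℂ G,
    component φ Γ.Q = component π (comul (R := ℂ) (component c Γ.Q)) := by
  refine ⟨ev c π ∘ₗ LinearMap.mulRight ℂ Γ.R.1 ∘ₗ
    LinearMap.mulLeft ℂ (flipTensor G Γ.R) ∘ₗ inl G G, ?_⟩
  rw [← component_lTensor, lTensor_comul_Q]
  generalize flipTensor G Γ.R = X
  generalize Γ.R.1 = Y
  generalize Γ.Q = Z
  induction Z with
  | tmul x y =>
    induction X with
    | zero => simp
    | add X X' h h' =>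
      simp only [map_add, add_mul, ← h, ← h', component_tmul, comp_apply,
        LinearMap.mulRight_apply, LinearMap.mulLeft_apply, add_smul]
    | tmul p q =>
      induction Y with
      | zero => simp
      | add Y Y' h h' =>
        simp only [map_add, mul_add, ← h, ← h', component_tmul, comp_apply,
          LinearMap.mulRight_apply, add_smul]
      | tmul p' q' => simp [aux, leg₁, Algebra.TensorProduct.tmul_mul_tmul, mul_smul]
  | _ => simp_all [mul_add, add_mul]

variable [Module.Finite ℂ G]

lemma g_mul : Γ.g * ((Γ.v⁻¹).1 * Γ.u) = 1 := Ring.inverse_mul_cancel _ (Γ.v⁻¹.isUnit.mul Γ.isUnit_u)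

lemma mul_g : ((Γ.v⁻¹).1 * Γ.u) * Γ.g = 1 := Ring.mul_inverse_cancel _ (Γ.v⁻¹.isUnit.mul Γ.isUnit_u)

lemma mul_g_eq (ξ : G) : ξ * Γ.g = Γ.g * antipode ℂ (antipode ℂ ξ) := by
  have h : ((Γ.v⁻¹).1 * Γ.u) * ξ = antipode ℂ (antipode ℂ ξ) * ((Γ.v⁻¹).1 * Γ.u) := by
    rw [mul_assoc, Γ.u_mul, ← mul_assoc, central_inv Γ.v_central, mul_assoc]
  calc ξ * Γ.g = Γ.g * (((Γ.v⁻¹).1 * Γ.u) * ξ) * Γ.g := by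
        rw [← mul_assoc, Γ.g_mul, one_mul]
    _ = _ := by rw [h, ← mul_assoc, mul_assoc, Γ.mul_g, mul_one]

/-- The quantum trace of a representation. -/
def qtrace {W : Type v} [AddCommGroup W] [Module ℂ W] (ρ : G →ₐ[ℂ] End ℂ W) :
    Dual ℂ G := LinearMap.trace ℂ W ∘ₗ ρ.toLinearMap ∘ₗ LinearMap.mulLeft ℂ Γ.g

lemma qtrace_apply {W : Type v} [AddCommGroup W] [Module ℂ W] (ρ : G →ₐ[ℂ] End ℂ W)
    (x : G) : Γ.qtrace ρ x = LinearMap.trace ℂ W (ρ (Γ.g * x)) := rfl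

lemma qtrace_mul {W : Type v} [AddCommGroup W] [Module ℂ W] (ρ : G →ₐ[ℂ] End ℂ W)
    (x y z : G) : Γ.qtrace ρ (antipode ℂ x * y * z) =
      Γ.qtrace ρ (antipode ℂ (x * antipode ℂ z) * y) := by
  rw [qtrace_apply, qtrace_apply, ← mul_assoc, map_mul, LinearMap.trace_mul_comm, ← map_mul,
    ← mul_assoc, mul_g_eq, HopfAlgebra.antipode_mul_antidistrib]
  simp only [mul_assoc]

lemma sMatrix_apply {Λ : Type w} {V : Λ → Type v} [∀ I, AddCommGroup (V I)]
    [∀ I, Module ℂ (V I)] [∀ I, FiniteDimensional ℂ (V I)] (τ : ∀ I, G →ₐ[ℂ] End ℂ (V I))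
    (I J : Λ) : Γ.sMatrix τ I J = Γ.qtrace (τ J) (component (Γ.qtrace (τ I)) Γ.Q) := by
  have key : ∀ X : G ⊗[ℂ] G, LinearMap.trace ℂ (V I ⊗[ℂ] V J)
      (pairRep (τ I) (τ J) (X * (Γ.g ⊗ₜ[ℂ] Γ.g))) =
      Γ.qtrace (τ J) (component (Γ.qtrace (τ I)) X) := by
    intro X
    induction X with
    | tmul a b =>
      rw [Algebra.TensorProduct.tmul_mul_tmul, component_tmul, map_smul, qtrace_apply, qtrace_apply]
      have : pairRep (τ I) (τ J) ((a * Γ.g) ⊗ₜ (b * Γ.g)) =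
        TensorProduct.map (τ I (a * Γ.g)) (τ J (b * Γ.g)) := rfl
      rw [this, LinearMap.trace_tensorProduct', map_mul, LinearMap.trace_mul_comm, ← map_mul,
        map_mul (τ J), LinearMap.trace_mul_comm ℂ (τ J b), ← map_mul, smul_eq_mul]
    | _ => simp_all [add_mul]
  exact key _

variable [IsSemisimpleRing G] {Λ : Type w} [Fintype Λ] [DecidableEq Λ] {V : Λ → Type v}
  [∀ I, NormedAddCommGroup (V I)] [∀ I, InnerProductSpace ℂ (V I)] [∀ I, FiniteDimensional ℂ (V I)]
  {τ : ∀ I, G →ₐ[ℂ] End ℂ (V I)}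

/-- Central elements are components of `R'R` if the `S`-matrix is invertible. -/
lemma exists_component_Q_of_central (hτ : IsIrrepList V τ) (hmod : IsUnit (Γ.sMatrix τ))
    {h : G} (hh : ∀ ξ, h * ξ = ξ * h) : ∃ π : Dual ℂ G, component π Γ.Q = h := by
  have hz := fun I => Γ.component_Q_central (Γ.qtrace (τ I)) (Γ.qtrace_mul (τ I))
  have hs : ∀ z : G, (∀ ξ, ξ * z = z * ξ) → ∀ J, ∃ c : ℂ, ∀ x, τ J z x = c • x := fun z hz J =>
    (hτ.irreducible J).exists_smul (τ J z) fun ξ x => by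
      rw [← Module.End.mul_apply, ← Module.End.mul_apply, ← map_mul, ← map_mul, hz]
  choose l hl using fun I => hs _ (hz I)
  choose m hm using hs h fun ξ => (hh ξ).symm
  set t : Λ → ℂ := fun J => Γ.qtrace (τ J) 1 with ht
  have hS : ∀ I J, Γ.sMatrix τ I J = l I J * t J := fun I J => by
    have h1 : τ J (component (Γ.qtrace (τ I)) Γ.Q) = l I J • 1 := LinearMap.ext (hl I J)
    rw [sMatrix_apply, qtrace_apply, map_mul, h1, ht]
    simp [qtrace_apply]
  have ht0 : ∀ J, t J ≠ 0 := fun J h0 => by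
    have hdet := (Matrix.isUnit_iff_isUnit_det _).mp hmod
    rw [Matrix.det_eq_zero_of_column_eq_zero J fun I => by rw [hS, h0, mul_zero]] at hdet
    exact not_isUnit_zero hdet
  set c := Matrix.vecMul (fun J => m J * t J) (Γ.sMatrix τ)⁻¹ with hc
  have hcs : Matrix.vecMul c (Γ.sMatrix τ) = fun J => m J * t J := by
    rw [hc, Matrix.vecMul_vecMul, Matrix.nonsing_inv_mul _
      ((Matrix.isUnit_iff_isUnit_det _).mp hmod), Matrix.vecMul_one]
  refine ⟨∑ I, c I • Γ.qtrace (τ I), hτ.ext fun J => LinearMap.ext fun x => ?_⟩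
  have h1 : (∑ I, c I * l I J) = m J := by
    have := congrFun hcs J
    simp only [Matrix.vecMul, dotProduct, hS, ← mul_assoc] at this
    rw [← Finset.sum_mul] at this
    exact mul_right_cancel₀ (ht0 J) this
  rw [hm, ← componentHom_apply, map_sum, LinearMap.sum_apply, map_sum, LinearMap.sum_apply, ← h1,
    Finset.sum_smul]
  refine Finset.sum_congr rfl fun I _ => ?_
  rw [map_smul, LinearMap.smul_apply, map_smul, LinearMap.smul_apply, componentHom_apply, hl,
    smul_smul]

lemma component_Q_bijective (hτ : IsIrrepList V τ) (hmod : IsUnit (Γ.sMatrix τ)) :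
    Function.Bijective ((componentHom G G).flip Γ.Q) := by
  have hsurj : Function.Surjective ((componentHom G G).flip Γ.Q) := by
    intro x
    obtain ⟨h, hh⟩ := exists_isIntegral (G := G)
    obtain ⟨c, hc⟩ := Γ.exists_component_Q_of_central hτ hmod (h := h) fun ξ => by
      rw [hh.mul_right Γ, hh.mul]
    obtain ⟨π, hπ⟩ := hh.exists_component x
    obtain ⟨φ, hφ⟩ := Γ.exists_component_comul_Q c π
    exact ⟨φ, by rw [← hπ, ← hc, ← hφ]; rfl⟩
  refine ⟨?_, hsurj⟩
  exact (LinearMap.injective_iff_surjective_of_finrank_eq_finrank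
    (Subspace.dual_finrank_eq (K := ℂ) (V := G))).mpr hsurj

end RibbonStar

end Factorizable

/-! ## The commuting representations defined by the monodromy -/

lemma component_inr_mul (π : Dual ℂ G) (x : A) (X : G ⊗[ℂ] A) :
    component π (inr G A x * X) = x * component π X := by
  rw [inr_apply, component_tmul_mul]
  congr 2
  ext; simp

lemma component_mul_inr (π : Dual ℂ G) (x : A) (X : G ⊗[ℂ] A) :
    component π (X * inr G A x) = component π X * x := by
  rw [inr_apply, component_mul_tmul]
  congr 2
  ext; simp

lemma commute_component {x : A} {X : G ⊗[ℂ] A} (h : Commute (inr G A x) X)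
    (π : Dual ℂ G) : Commute x (component π X) := by
  rw [commute_iff_eq, ← component_inr_mul, h.eq, component_mul_inr]

namespace CurrentData

variable [Module.Finite ℂ G] {n : ℕ} (D : CurrentData Γ (n + 1) A)

lemma isUnit_L (m : ℕ) : IsUnit (D.L m) := ⟨⟨D.L m, D.linkInv _, D.inv_right _, D.inv_left _⟩, rfl⟩

lemma isUnit_hol (k : ℕ) : IsUnit (D.hol k) := by
  induction k with
  | zero => exact D.isUnit_L 0
  | succ k ih =>
    refine (IsUnit.mul ?_ ih).mul (D.isUnit_L _)
    exact Γ.v⁻¹.isUnit.map (Algebra.TensorProduct.includeLeft : G →ₐ[ℂ] G ⊗[ℂ] A)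

lemma component_monodromy_mul (π₁ π₂ : Dual ℂ G) :
    component π₂ (component π₁ (leg₁ G A (D.hol n) * aux G A Γ.R * leg₂ G A (D.hol n))) =
      component (twistedMul Γ π₁ π₂) (D.hol n) := by
  have h := D.monodromy_funct (inl G (G ⊗[ℂ] A)) (inr G (G ⊗[ℂ] A) ∘ₗ inl G A)
    (inr G (G ⊗[ℂ] A) ∘ₗ inr G A)
  rw [← component_aux_comulAux, ← ev₃_self (leg₁ G A (D.hol n) * aux G A Γ.R * leg₂ G A (D.hol n)),
    ← ev₃_self (aux G A Γ.R * comulAux G A (D.hol n)), mm_mul (ev₃ _ _ _), mm_mul (ev₃ _ _ _),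
    mm_mul (ev₃ _ _ _), ev₃_leg₁, ev₃_leg₂, ev₃_aux, ev₃_comulAux]
  exact congrArg (fun z => component π₂ (component π₁ z)) h

section

variable (hQ : Function.Bijective ((componentHom G G).flip Γ.Q))

/-- The representation of `G` defined by the monodromy. -/
def p : G →ₗ[ℂ] A :=
  (componentHom G A).flip (D.hol n) ∘ₗ (LinearEquiv.ofBijective _ hQ).symm.toLinearMap

lemma p_component (π : Dual ℂ G) : D.p hQ (component π Γ.Q) = component π (D.hol n) := by
  have : (LinearEquiv.ofBijective _ hQ).symm (component π Γ.Q) = π :=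
    (LinearEquiv.ofBijective _ hQ).symm_apply_apply π
  rw [p, comp_apply, LinearEquiv.coe_coe, this]
  rfl

include hQ in
lemma exists_component_Q (x : G) : ∃ π, component π Γ.Q = x := hQ.2 x

lemma lTensor_p : lTensor G (D.p hQ) Γ.Q = D.hol n :=
  component_ext fun π => by rw [component_lTensor, p_component]

lemma commute_p_of {x : A} (h : Commute (inr G A x) (D.hol n)) (ξ : G) : Commute x (D.p hQ ξ) := by
  obtain ⟨π, rfl⟩ := hQ.2 ξ
  have h1 := D.p_component hQ π
  change Commute x (D.p hQ (component π Γ.Q))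
  rw [h1]
  exact commute_component h π

instance isMulMap_p : IsMulMap (D.p hQ) := by
  have hmul : ∀ x y, D.p hQ (x * y) = D.p hQ x * D.p hQ y := by
    intro x y
    obtain ⟨π₁, rfl⟩ := exists_component_Q hQ x
    obtain ⟨π₂, rfl⟩ := exists_component_Q hQ y
    obtain ⟨s, hs⟩ := TensorProduct.exists_finset (lTensor G (antipode ℂ) Γ.R.1)
    have hQR : ∀ ρ₁ ρ₂ : Dual ℂ G,
        component ρ₂ (component ρ₁ (leg₁ G G Γ.Q * aux G G Γ.R * leg₂ G G Γ.Q)) =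
          component (twistedMul Γ ρ₁ ρ₂) Γ.Q := by
      intro ρ₁ ρ₂
      rw [← component_aux_comulAux]
      congr 2
      set a := inl G (G ⊗[ℂ] G)
      set b := inr G (G ⊗[ℂ] G) ∘ₗ inl G G
      set c := inr G (G ⊗[ℂ] G) ∘ₗ inr G G
      rw [← ev₃_self (leg₁ G G Γ.Q * aux G G Γ.R * leg₂ G G Γ.Q),
        ← ev₃_self (aux G G Γ.R * comulAux G G Γ.Q), mm_mul (ev₃ _ _ _), mm_mul (ev₃ _ _ _),
        mm_mul (ev₃ _ _ _), ev₃_leg₁, ev₃_leg₂, ev₃_aux, ev₃_comulAux, Γ.ev_Q, Γ.ev_Q, Γ.ev_Q,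
        Γ.r_conv_left, Γ.r_conv_right]
      change Γ.r c a * Γ.r a c * Γ.r a b * (Γ.r c b * Γ.r b c) =
        Γ.r a b * (Γ.r c b * Γ.r c a * (Γ.r a c * Γ.r b c))
      have h1 := Γ.yang_baxter c a b
      have h2 := Γ.yang_baxter a c b
      calc Γ.r c a * Γ.r a c * Γ.r a b * (Γ.r c b * Γ.r b c) =
          Γ.r c a * (Γ.r a c * Γ.r a b * Γ.r c b) * Γ.r b c := by simp only [mul_assoc]
        _ = (Γ.r c a * Γ.r c b * Γ.r a b) * Γ.r a c * Γ.r b c := by rw [h2]; simp only [mul_assoc]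
        _ = _ := by rw [h1]; simp only [mul_assoc]
    rw [component_mul_component Γ π₁ π₂ hs, map_sum, p_component, p_component,
      component_mul_component Γ π₁ π₂ hs]
    refine Finset.sum_congr rfl fun i _ => ?_
    rw [component_monodromy_mul, hQR, p_component]
  refine ⟨?_, hmul⟩
  have h1 : inr G A (D.p hQ 1) * D.hol n = D.hol n := by
    refine component_ext fun π => ?_
    rw [component_inr_mul, ← D.p_component hQ, ← hmul, one_mul]
  have h2 : inr G A (D.p hQ 1) = 1 := (D.isUnit_hol n).mul_right_cancel (by rw [h1, one_mul])
  have h3 := congrArg (component (counit (R := ℂ))) h2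
  rw [inr_apply, Algebra.TensorProduct.one_def, component_tmul, component_tmul,
    Bialgebra.counit_one, one_smul, one_smul] at h3
  exact h3

/-- The second representation of `G` that commutes with the sites different from the base
point. -/
def q : G →ₗ[ℂ] A := conv (D.p hQ ∘ₗ antipode ℂ) (D.T n)

lemma conv_p_q : conv (D.p hQ) (D.q hQ) = D.T n := by rw [q, ← conv_assoc, conv_antipode, triv_conv]

instance comm_p_q : Comm (D.p hQ) (D.q hQ) where
  comm x y := by
    refine (D.commute_p_of hQ ?_ x).symm
    set a := inl G A with ha
    set p' := inr G A ∘ₗ D.p hQ with hp'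
    have hM : D.hol n = Γ.r p' a * Γ.r a p' := by rw [← D.lTensor_p hQ, ← ev_inl_inr_comp, Γ.ev_Q]
    have h1 : ∀ ξ, Commute (conv a p' ξ) (D.hol n) := fun ξ => by
      rw [commute_iff_eq, hM, mul_assoc, Γ.r_mul_conv a p', ← mul_assoc, ← mul_assoc,
        Γ.r_mul_conv p' a]
    have h2 : inr G A ∘ₗ D.q hQ = conv (conv a p' ∘ₗ antipode ℂ) (conv a (inr G A ∘ₗ D.T n)) := by
      rw [← D.conv_p_q hQ, map_conv, ← conv_assoc a, ← conv_assoc, antipode_conv, triv_conv]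
    rw [← comp_apply, h2]
    exact commute_ev _ _ _ _ (fun ξ => h1 _) fun ξ => D.commute_conv_monodromy ξ

instance isMulMap_q : IsMulMap (D.q hQ) where
  map_one := by
    rw [q, conv_apply, Bialgebra.comul_one, Algebra.TensorProduct.one_def, ev_tmul,
      comp_apply, HopfAlgebra.antipode_one, mm_one, mm_one, one_mul]
  map_mul ξ η := by
    have key : ∀ X Y : G ⊗[ℂ] G, ev (D.p hQ ∘ₗ antipode ℂ) (D.T n) (X * Y) =
        ev ((LinearMap.mulRight ℂ (ev (D.p hQ ∘ₗ antipode ℂ) (D.T n) X)) ∘ₗ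
          D.p hQ ∘ₗ antipode ℂ) (D.T n) Y := by
      intro X Y
      induction Y with
      | tmul b c =>
        induction X with
        | zero => simp
        | add X X' h h' =>
          simp only [map_add, add_mul, h, h', ev_tmul, comp_apply,
            LinearMap.mulRight_apply, mul_add]
        | tmul a d =>
          simp only [Algebra.TensorProduct.tmul_mul_tmul, ev_tmul, comp_apply,
            LinearMap.mulRight_apply, HopfAlgebra.antipode_mul_antidistrib, mm_mul (D.p hQ),
            mm_mul (D.T n), mul_assoc]
      | _ => simp_all [mul_add]
    have h2 : ∀ Y : G ⊗[ℂ] G, ev ((LinearMap.mulRight ℂ (D.q hQ ξ)) ∘ₗ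
          D.p hQ ∘ₗ antipode ℂ) (D.T n) Y =
        D.q hQ ξ * ev (D.p hQ ∘ₗ antipode ℂ) (D.T n) Y := by
      intro Y
      induction Y with
      | tmul b c =>
        simp only [ev_tmul, comp_apply, LinearMap.mulRight_apply]
        rw [(comm_of (D.p hQ) (D.q hQ) _ _).eq, mul_assoc]
      | _ => simp_all [mul_add]
    have h1 := key (comul ξ) (comul η)
    rw [← Bialgebra.comul_mul, ← conv_apply, ← conv_apply] at h1
    exact h1.trans (h2 _)

lemma commute_T_p {m : ℕ} (hm : m < n) (ξ η : G) : Commute (D.T m ξ) (D.p hQ η) :=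
  D.commute_p_of hQ (D.commute_T_monodromy m hm ξ) η

lemma commute_T_T {m k : ℕ} (hm : m ≤ n) (hk : k ≤ n) (h : m ≠ k) (ξ η : G) :
    Commute (D.T m ξ) (D.T k η) :=
  (D.site_comm _ _ fun h' => h (ZMod.natCast_add_one_inj hm hk h')).comm ξ η

lemma commute_T_q {m : ℕ} (hm : m < n) (ξ η : G) : Commute (D.T m ξ) (D.q hQ η) :=
  (commute_ev (D.p hQ ∘ₗ antipode ℂ) (D.T n) (comul η) _ (fun _ => (D.commute_T_p hQ hm ξ _).symm)
    fun x => D.commute_T_T le_rfl hm.le hm.ne' x ξ).symm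

end

end CurrentData

/-! ## Subspaces that are stable under the current algebra -/

section

lemma component_mul [Module.Finite ℂ G] (π : Dual ℂ G) (X Y : G ⊗[ℂ] A) :
    component π (X * Y) = ∑ i, component (π ∘ₗ LinearMap.mulRight ℂ (Module.finBasis ℂ G i)) X *
      component ((Module.finBasis ℂ G).coord i) Y := by
  conv_lhs => rw [← sum_tmul_component Y]
  rw [Finset.mul_sum, map_sum]
  exact Finset.sum_congr rfl fun i _ => component_mul_tmul _ _ _ _

lemma component_component_legs' (π₁ π₂ : Dual ℂ G) (X Y : G ⊗[ℂ] A) :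
    component π₂ (component π₁ (leg₂ G A Y * leg₁ G A X)) = component π₂ Y * component π₁ X := by
  induction X with
  | tmul x a =>
    induction Y with
    | zero => simp
    | add Y Y' h h' => simp only [map_add, add_mul, h, h']
    | tmul y b =>
      simp only [leg₁, leg₂, Algebra.TensorProduct.includeRight_apply,
        Algebra.TensorProduct.map_tmul, Algebra.TensorProduct.tmul_mul_tmul, component_tmul,
        AlgHom.id_apply, one_mul, mul_one, map_smul, smul_mul_smul_comm, smul_smul, mul_comm]
  | _ => simp_all [mul_add]

lemma component_leg_aux_leg (π₁ π₂ : Dual ℂ G) (X Y : G ⊗[ℂ] A) (p q : G) :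
    component π₂ (component π₁ (leg₁ G A X * aux G A (p ⊗ₜ q) * leg₂ G A Y)) =
      component (π₁ ∘ₗ LinearMap.mulRight ℂ p) X * component (π₂ ∘ₗ LinearMap.mulLeft ℂ q) Y := by
  have : aux G A (p ⊗ₜ q) = leg₁ G A (p ⊗ₜ 1) * leg₂ G A (q ⊗ₜ 1) := by
    simp [aux, leg₁, leg₂, Algebra.TensorProduct.tmul_mul_tmul]
  rw [this, ← mul_assoc, ← map_mul, mul_assoc, ← map_mul, component_component_legs,
    component_mul_tmul, component_tmul_mul, one_mul, mul_one]

lemma component_leg_aux_leg' (π₁ π₂ : Dual ℂ G) (X Y : G ⊗[ℂ] A) (p q : G) :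
    component π₂ (component π₁ (leg₂ G A Y * aux G A (p ⊗ₜ q) * leg₁ G A X)) =
      component (π₂ ∘ₗ LinearMap.mulRight ℂ q) Y * component (π₁ ∘ₗ LinearMap.mulLeft ℂ p) X := by
  have : aux G A (p ⊗ₜ q) = leg₂ G A (q ⊗ₜ 1) * leg₁ G A (p ⊗ₜ 1) := by
    simp [aux, leg₁, leg₂, Algebra.TensorProduct.tmul_mul_tmul]
  rw [this, ← mul_assoc, ← map_mul, mul_assoc, ← map_mul, component_component_legs',
    component_mul_tmul, component_tmul_mul, one_mul, mul_one]

variable {H : Type*} [AddCommGroup H] [Module ℂ H] [Module A H] [IsScalarTower ℂ A H]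

lemma aux_smul_mem {P : Submodule ℂ H} {X Y : G ⊗[ℂ] A} {w : H}
    (h : ∀ π₁ π₂ : Dual ℂ G, (component π₁ X * component π₂ Y) • w ∈ P) (W : G ⊗[ℂ] G)
    (π₁ π₂ : Dual ℂ G) :
    component π₂ (component π₁ (leg₁ G A X * aux G A W * leg₂ G A Y)) • w ∈ P := by
  induction W with
  | zero => simp
  | add W W' h h' => simpa only [map_add, mul_add, add_mul, add_smul] using P.add_mem h h'
  | tmul p q => rw [component_leg_aux_leg]; exact h _ _

lemma aux_smul_mem' {P : Submodule ℂ H} {X Y : G ⊗[ℂ] A} {w : H}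
    (h : ∀ π₁ π₂ : Dual ℂ G, (component π₂ Y * component π₁ X) • w ∈ P) (W : G ⊗[ℂ] G)
    (π₁ π₂ : Dual ℂ G) :
    component π₂ (component π₁ (leg₂ G A Y * aux G A W * leg₁ G A X)) • w ∈ P := by
  induction W with
  | zero => simp
  | add W W' h h' => simpa only [map_add, mul_add, add_mul, add_smul] using P.add_mem h h'
  | tmul p q => rw [component_leg_aux_leg']; exact h _ _

lemma mul_smul_mem_of_aux [StarRing G] [StarModule ℂ G] (Γ : RibbonStar G) {P : Submodule ℂ H}
    {X Y : G ⊗[ℂ] A} {w : H} (h : ∀ π₁ π₂ : Dual ℂ G,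
      component π₂ (component π₁ (leg₁ G A X * aux G A Γ.R * leg₂ G A Y)) • w ∈ P)
    (π₁ π₂ : Dual ℂ G) : (component π₁ X * component π₂ Y) • w ∈ P := by
  obtain ⟨s, hs⟩ := TensorProduct.exists_finset (lTensor G (antipode ℂ) Γ.R.1)
  rw [component_mul_component Γ π₁ π₂ hs, Finset.sum_smul]
  exact P.sum_mem fun i _ => h _ _

/-- The components of `X` map the subspace `P` to itself. -/
def Stab (X : G ⊗[ℂ] A) (P : Submodule ℂ H) : Prop :=
  ∀ (π : Dual ℂ G), ∀ w ∈ P, component π X • w ∈ P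

variable [Module.Finite ℂ G]

lemma mul_smul_mem {P Q : Submodule ℂ H} {X Y : G ⊗[ℂ] A} {w : H}
    (hX : ∀ (π : Dual ℂ G), ∀ w ∈ P, component π X • w ∈ Q)
    (hY : ∀ π : Dual ℂ G, component π Y • w ∈ P) (π : Dual ℂ G) :
    component π (X * Y) • w ∈ Q := by
  rw [component_mul, Finset.sum_smul]
  refine Q.sum_mem fun i _ => ?_
  rw [mul_smul]
  exact hX _ _ (hY _)

lemma Stab.mul {P : Submodule ℂ H} {X Y : G ⊗[ℂ] A} (hX : Stab X P) (hY : Stab Y P) :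
    Stab (X * Y) P := fun π w hw => mul_smul_mem hX (fun π => hY π w hw) π

lemma stab_inl (P : Submodule ℂ H) (x : G) : Stab (inl G A x) P := fun π w hw => by
  rw [inl_apply, component_tmul, smul_assoc, one_smul]
  exact P.smul_mem _ hw

/-- The action of `G ⊗ A` on `G ⊗ H`. -/
def tensorAction (G A H : Type*) [Ring G] [HopfAlgebra ℂ G] [Ring A] [Algebra ℂ A] [AddCommGroup H] [Module ℂ H]
    [Module A H] [IsScalarTower ℂ A H] : G ⊗[ℂ] A →ₐ[ℂ] End ℂ (G ⊗[ℂ] H) :=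
  (Module.endTensorEndAlgHom (R := ℂ) (A := ℂ)).comp
    (Algebra.TensorProduct.map (Algebra.lmul ℂ G) (Algebra.lsmul ℂ ℂ H))

lemma tensorAction_tmul (x : G) (a : A) (y : G) (w : H) :
    tensorAction G A H (x ⊗ₜ a) (y ⊗ₜ w) = (x * y) ⊗ₜ (a • w) := rfl

lemma lid_rTensor_tensorAction (π : Dual ℂ G) (X : G ⊗[ℂ] A) (y : G) (w : H) :
    TensorProduct.lid ℂ H (LinearMap.rTensor H π (tensorAction G A H X (y ⊗ₜ w))) =
      component (π ∘ₗ LinearMap.mulRight ℂ y) X • w := by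
  induction X with
  | tmul x a => rw [tensorAction_tmul]; simp
  | _ => simp_all [add_smul]

lemma Stab.tensorAction_mem {P : Submodule ℂ H} {X : G ⊗[ℂ] A} (hX : Stab X P)
    {z : G ⊗[ℂ] H} (hz : z ∈ LinearMap.range (lTensor G P.subtype)) :
    tensorAction G A H X z ∈ LinearMap.range (lTensor G P.subtype) := by
  obtain ⟨z, rfl⟩ := hz
  induction z with
  | zero => simp
  | add z z' h h' => simpa only [map_add] using Submodule.add_mem _ h h'
  | tmul y w =>
    rw [LinearMap.lTensor_tmul, ← sum_tmul_component X, map_sum, LinearMap.sum_apply]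
    refine Submodule.sum_mem _ fun i _ => ?_
    exact ⟨(Module.finBasis ℂ G i * y) ⊗ₜ ⟨_, hX ((Module.finBasis ℂ G).coord i) w w.2⟩, rfl⟩

/-- A finite-dimensional stable subspace is stable under the inverse. -/
lemma Stab.of_mul_eq_one {P : Submodule ℂ H} [FiniteDimensional ℂ P] {X Y : G ⊗[ℂ] A}
    (hX : Stab X P) (h : X * Y = 1) (h' : Y * X = 1) : Stab Y P := by
  intro π w hw
  set P' := LinearMap.range (lTensor G P.subtype) with hP'
  have hXY : ∀ z, tensorAction G A H X (tensorAction G A H Y z) = z := fun z => by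
    rw [← Module.End.mul_apply, ← map_mul, h, map_one, Module.End.one_apply]
  have hYX : ∀ z, tensorAction G A H Y (tensorAction G A H X z) = z := fun z => by
    rw [← Module.End.mul_apply, ← map_mul, h', map_one, Module.End.one_apply]
  have hmap : P'.map (tensorAction G A H X) ≤ P' := by
    rintro _ ⟨z, hz, rfl⟩
    exact hX.tensorAction_mem hz
  have heq : P'.map (tensorAction G A H X) = P' := by
    refine Submodule.eq_of_le_of_finrank_eq hmap ?_
    exact (LinearEquiv.finrank_eq (Submodule.equivMapOfInjective _
      (Function.LeftInverse.injective hYX) P')).symm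
  have h1 : (1 : G) ⊗ₜ[ℂ] w ∈ P' := ⟨1 ⊗ₜ ⟨w, hw⟩, rfl⟩
  rw [← heq] at h1
  obtain ⟨z, hz, hz'⟩ := h1
  have h2 : tensorAction G A H Y (1 ⊗ₜ w) = z := by rw [← hz', hYX]
  have h3 := lid_rTensor_tensorAction π Y 1 w
  rw [h2] at h3
  have h4 : π ∘ₗ LinearMap.mulRight ℂ (1 : G) = π := by ext; simp
  rw [h4] at h3
  rw [← h3]
  obtain ⟨z, rfl⟩ := hz
  clear * -
  induction z with
  | zero => simp
  | add z z' h h' => simpa only [map_add] using Submodule.add_mem _ h h'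
  | tmul y w => simpa using P.smul_mem _ w.2

variable (H) in
/-- The action of the components of `X`. -/
def act (X : G ⊗[ℂ] A) : Dual ℂ G →ₗ[ℂ] H →ₗ[ℂ] H :=
  (Algebra.lsmul ℂ ℂ H : A →ₐ[ℂ] End ℂ H).toLinearMap ∘ₗ (componentHom G A).flip X

@[simp] lemma act_apply (X : G ⊗[ℂ] A) (π : Dual ℂ G) (w : H) : act H X π w = component π X • w := rfl

lemma map₂_act_le {X : G ⊗[ℂ] A} {P P' : Submodule ℂ H} :
    Submodule.map₂ (act H X) ⊤ P ≤ P' ↔ ∀ π, ∀ w ∈ P, component π X • w ∈ P' := by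
  rw [Submodule.map₂_le]
  simp

lemma component_smul_mem_map₂ (X : G ⊗[ℂ] A) {P : Submodule ℂ H} (π : Dual ℂ G) {w : H}
    (hw : w ∈ P) : component π X • w ∈ Submodule.map₂ (act H X) ⊤ P :=
  Submodule.apply_mem_map₂ (act H X) Submodule.mem_top hw

lemma map₂_act_le_range (X : G ⊗[ℂ] A) (P : Submodule ℂ H) : Submodule.map₂ (act H X) ⊤ P ≤
    LinearMap.range (TensorProduct.lift ((act H X).compl₂ P.subtype)) := by
  rw [map₂_act_le]
  exact fun π w hw => ⟨π ⊗ₜ ⟨w, hw⟩, rfl⟩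

instance (X : G ⊗[ℂ] A) (P : Submodule ℂ H) [FiniteDimensional ℂ P] :
    FiniteDimensional ℂ (Submodule.map₂ (act H X) ⊤ P : Submodule ℂ H) :=
  Submodule.finiteDimensional_of_le (map₂_act_le_range X P)

lemma finrank_map₂_act_le (X : G ⊗[ℂ] A) (P : Submodule ℂ H) [FiniteDimensional ℂ P] :
    Module.finrank ℂ (Submodule.map₂ (act H X) ⊤ P : Submodule ℂ H) ≤
      Module.finrank ℂ G * Module.finrank ℂ P := by
  refine (Submodule.finrank_mono (map₂_act_le_range X P)).trans
    ((LinearMap.finrank_range_le _).trans ?_)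
  rw [Module.finrank_tensorProduct, Subspace.dual_finrank_eq]

end

namespace CurrentData

variable [Module.Finite ℂ G] {n : ℕ} (D : CurrentData Γ (n + 1) A) {H : Type*} [AddCommGroup H]
  [Module ℂ H] [Module A H] [IsScalarTower ℂ A H]

/-- Two links can be interchanged. -/
lemma link_swap {k m : ℕ} (hk : k < m) (hm : m ≤ n) {P : Submodule ℂ H} {w : H}
    (h : ∀ π₁ π₂ : Dual ℂ G, (component π₂ (D.L k) * component π₁ (D.L m)) • w ∈ P)
    (π₁ π₂ : Dual ℂ G) : (component π₁ (D.L m) * component π₂ (D.L k)) • w ∈ P := by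
  by_cases h1 : m = k + 1
  · subst h1
    by_cases hn : 2 ≤ n
    · have e := D.L_next (fst G A) (snd G A) (thd G A) hn k
      rw [← leg₁_eq, ← leg₂_eq, RibbonStar.r, ← aux_eq] at e
      rw [← component_component_legs', ← e]
      exact aux_smul_mem (fun ρ₁ ρ₂ => h ρ₂ ρ₁) _ _ _
    · obtain rfl : k = 0 := by omega
      have hn : n = 1 := by omega
      have e := D.L_last_two (fst G A) (snd G A) (thd G A) hn
      have e' : Γ.r (snd G A) (fst G A) = aux G A (flipTensor G Γ.R) := by rw [aux_eq, ev_flip]; rfl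
      rw [← leg₁_eq, ← leg₂_eq, e', RibbonStar.r, ← aux_eq] at e
      have hL : D.L (0 + 1) = D.L n := by congr 1; exact hn.symm
      rw [hL] at h ⊢
      refine mul_smul_mem_of_aux Γ (fun ρ₁ ρ₂ => ?_) _ _
      rw [e]
      exact aux_smul_mem' h _ _ _
  · by_cases h2 : k = 0 ∧ m = n
    · obtain ⟨rfl, rfl⟩ := h2
      have e := D.L_last (fst G A) (snd G A) (thd G A) (by omega)
      rw [← leg₁_eq, ← leg₂_eq, RibbonStar.r, ← aux_eq] at e
      refine mul_smul_mem_of_aux Γ (fun ρ₁ ρ₂ => ?_) _ _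
      rw [e, component_component_legs']
      exact h _ _
    · have e := D.commute_L (fst G A) (snd G A) (thd G A) hm (by omega : k ≤ n) (by omega)
        (by omega) (by omega) (by omega) (by omega)
      rw [← leg₁_eq, ← leg₂_eq] at e
      rw [← component_component_legs, e, component_component_legs']
      exact h _ _

/-- A site can be moved past a link. -/
lemma site_swap {k m : ℕ} (hk : k < n) (hm : m ≤ n) {P : Submodule ℂ H} {w : H}
    (h : ∀ (π : Dual ℂ G) (ξ : G), (component π (D.L k) * D.T m ξ) • w ∈ P)
    (π : Dual ℂ G) (ξ : G) : (D.T m ξ * component π (D.L k)) • w ∈ P := by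
  have hn : 1 ≤ n := by omega
  have source : conv (inl G A) (inr G A ∘ₗ D.T m) ξ * D.L k = D.L k * inr G A (D.T m ξ) →
      (∀ ξ, conv (inl G A) (inr G A ∘ₗ D.T m) ξ * D.L k = D.L k * inr G A (D.T m ξ)) →
      (D.T m ξ * component π (D.L k)) • w ∈ P := by
    intro _ e
    have e1 : inr G A (D.T m ξ) = ev (inl G A ∘ₗ antipode ℂ)
        (conv (inl G A) (inr G A ∘ₗ D.T m)) (comul ξ) := by
      rw [← conv_apply, ← conv_assoc, antipode_conv, triv_conv]; rfl
    rw [← component_inr_mul, e1]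
    generalize comul (R := ℂ) ξ = X
    induction X with
    | zero => simp
    | add X Y h h' => simpa only [map_add, add_mul, add_smul] using P.add_mem h h'
    | tmul x y =>
      rw [ev_tmul, mul_assoc, e, comp_apply, inl_apply, component_tmul_mul,
        one_mul, component_mul_inr]
      exact h _ _
  by_cases h1 : k = m
  · subst h1
    rw [← component_inr_mul, D.T_mul_L hn, conv_apply]
    generalize comul (R := ℂ) ξ = X
    induction X with
    | zero => simp
    | add X Y h h' => simpa only [map_add, mul_add, add_smul] using P.add_mem h h'
    | tmul x y =>
      rw [ev_tmul, inl_apply, comp_apply, inr_apply, Algebra.TensorProduct.tmul_mul_tmul,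
        one_mul, mul_one, component_mul_tmul]
      exact h _ _
  · by_cases h2 : k = m + 1
    · subst h2
      exact source (D.conv_T_mul_L hn m ξ) (D.conv_T_mul_L hn m)
    · by_cases h3 : k = 0 ∧ m = n
      · obtain ⟨rfl, rfl⟩ := h3
        exact source (D.conv_T_mul_L_zero hn ξ) (D.conv_T_mul_L_zero hn)
      · rw [← component_inr_mul, (D.commute_T_L hn hk.le hm (Ne.symm h1) h2 h3 ξ).eq,
          component_mul_inr]
        exact h _ _

/-! ### The vacuum -/

variable (H) in
/-- The vectors that are invariant under the sites different from the base point. -/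
def vac : Submodule ℂ H where
  carrier := {w | ∀ m < n, ∀ ξ, D.T m ξ • w = counit (R := ℂ) ξ • w}
  add_mem' hx hy m hm ξ := by rw [smul_add, smul_add, hx m hm, hy m hm]
  zero_mem' m hm ξ := by simp
  smul_mem' c x hx m hm ξ := by rw [smul_comm, hx m hm, smul_comm]

/-- A submodule is generated by its vacuum vectors. -/
lemma le_of_vac_le [IsSemisimpleRing G] {P P' : Submodule A H}
    (h : ∀ w ∈ P', w ∈ D.vac H → w ∈ P) : P' ≤ P := by
  obtain ⟨h₀, hh⟩ := exists_isIntegral (G := G)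
  obtain ⟨π, hπ⟩ := hh.exists_component 1
  have key : ∀ k ≤ n, ∀ w ∈ P', (∀ m, k ≤ m → m < n → ∀ ξ, D.T m ξ • w =
      counit (R := ℂ) ξ • w) → w ∈ P := by
    intro k
    induction k with
    | zero => exact fun _ w hw hv => h w hw fun m hm => hv m (Nat.zero_le _) hm
    | succ k ih =>
      intro hk w hw hv
      have hn : 1 ≤ n := by omega
      have e : conv (inl G A) (inr G A ∘ₗ D.T k) h₀ =
          D.linkInv ((k + 1 : ℕ) : ZMod (n + 1)) * (inr G A (D.T k h₀) * D.L k) := by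
        rw [D.T_mul_L hn, ← mul_assoc]
        exact (by rw [show D.linkInv _ * D.L k = 1 from D.inv_left _, one_mul])
      have e1 : component π (conv (inl G A) (inr G A ∘ₗ D.T k) h₀) = 1 := by
        rw [conv_apply, ev_inl_inr_comp, component_lTensor, hπ, mm_one]
      have e2 : w = component π (D.linkInv ((k + 1 : ℕ) : ZMod (n + 1)) *
          (inr G A (D.T k h₀) * D.L k)) • w := by rw [← e, e1, one_smul]
      rw [e2]
      refine mul_smul_mem (P := P.restrictScalars ℂ) (Q := P.restrictScalars ℂ)
        (fun π w hw => P.smul_mem _ hw) (fun π => ?_) π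
      rw [component_inr_mul, mul_smul]
      refine ih (by omega) _ (P'.smul_mem _ (P'.smul_mem _ hw)) fun m hm hmn ξ => ?_
      rcases hm.eq_or_lt with rfl | hm
      · rw [← mul_smul, ← mm_mul, hh.mul, map_smul, smul_assoc]
      · have c1 := D.commute_T_T (by omega : m ≤ n) (by omega : k ≤ n) (by omega) ξ h₀
        have c2 := commute_component (D.commute_T_L hn (by omega : k ≤ n) (by omega : m ≤ n)
          (by omega) (by omega) (by omega) ξ) π
        rw [← mul_smul, c1.eq, mul_smul, ← mul_smul (D.T m ξ), c2.eq, mul_smul, hv m (by omega) hmn,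
          smul_comm (component π (D.L k)), smul_comm (D.T k h₀)]
  exact fun w hw => key n le_rfl w hw fun m hm hmn => absurd hmn (by omega)

/-! ### The subspace generated by vacuum vectors -/

/-- The subspaces `J_{n-j+1} ⋯ J_n V₀`. -/
def tower (V₀ : Submodule ℂ H) : ℕ → Submodule ℂ H
  | 0 => V₀
  | j + 1 => Submodule.map₂ (act H (D.L (n - 1 - j))) ⊤ (tower V₀ j)

variable {V₀ : Submodule ℂ H}

instance [FiniteDimensional ℂ V₀] (j : ℕ) : FiniteDimensional ℂ (D.tower V₀ j) := by
  induction j with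
  | zero => assumption
  | succ j ih => rw [tower]; infer_instance

lemma finrank_tower_le [FiniteDimensional ℂ V₀] (j : ℕ) : Module.finrank ℂ (D.tower V₀ j) ≤
    Module.finrank ℂ G ^ j * Module.finrank ℂ V₀ := by
  induction j with
  | zero => rw [pow_zero, one_mul, tower]
  | succ j ih =>
    rw [tower, pow_succ', mul_assoc]
    exact (finrank_map₂_act_le _ _).trans (Nat.mul_le_mul_left _ ih)

lemma tower_stab_L {j m : ℕ} (hj : j ≤ n) (hm : n - j ≤ m) (hmn : m < n) :
    Stab (D.L m) (D.tower V₀ j) := by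
  induction j with
  | zero => omega
  | succ j ih =>
    intro π₁ w hw
    have : Submodule.map₂ (act H (D.L (n - 1 - j))) ⊤ (D.tower V₀ j) ≤
        (D.tower V₀ (j + 1)).comap (Algebra.lsmul ℂ ℂ H (component π₁ (D.L m))) := by
      rw [map₂_act_le]
      intro π₂ w hw
      change component π₁ (D.L m) • component π₂ (D.L (n - 1 - j)) • w ∈ D.tower V₀ (j + 1)
      rw [← mul_smul]
      rcases hm.eq_or_lt with h | h
      · rw [show n - 1 - j = m by omega]
        have e := D.L_mul_L (fst G A) (snd G A) (thd G A) (by omega) m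
        rw [← leg₁_eq, ← leg₂_eq, RibbonStar.r, ← aux_eq, ← comulAux_eq] at e
        rw [← component_component_legs, e, component_aux_comulAux, tower,
          show n - 1 - j = m by omega]
        exact component_smul_mem_map₂ _ _ hw
      · refine D.link_swap (by omega) hmn.le (fun ρ₁ ρ₂ => ?_) _ _
        rw [mul_smul]
        exact component_smul_mem_map₂ _ _ (ih (by omega) (by omega) _ _ hw)
    exact this hw

lemma tower_T (hV : V₀ ≤ D.vac H) (hT : ∀ ξ, ∀ w ∈ V₀, D.T n ξ • w ∈ V₀) {j m : ℕ} (hj : j ≤ n)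
    (hm : m ≤ n) (ξ : G) : ∀ w ∈ D.tower V₀ j, D.T m ξ • w ∈ D.tower V₀ j := by
  induction j generalizing ξ with
  | zero =>
    intro w hw
    rcases hm.lt_or_eq with hm | rfl
    · rw [hV hw m hm]
      exact Submodule.smul_mem _ _ hw
    · exact hT ξ w hw
  | succ j ih =>
    intro w hw
    have : Submodule.map₂ (act H (D.L (n - 1 - j))) ⊤ (D.tower V₀ j) ≤
        (D.tower V₀ (j + 1)).comap (Algebra.lsmul ℂ ℂ H (D.T m ξ)) := by
      rw [map₂_act_le]
      intro π w hw
      change D.T m ξ • component π (D.L (n - 1 - j)) • w ∈ D.tower V₀ (j + 1)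
      rw [← mul_smul]
      refine D.site_swap (by omega) hm (fun π ξ => ?_) _ _
      rw [mul_smul]
      exact component_smul_mem_map₂ _ _ (ih (by omega) ξ w hw)
    exact this hw

section

variable [FiniteDimensional ℂ V₀]

lemma stab_L_tower {m : ℕ} (hm : m < n) : Stab (D.L m) (D.tower V₀ n) :=
  D.tower_stab_L le_rfl (by omega) hm

lemma linkInv_stab {P : Submodule ℂ H} [FiniteDimensional ℂ P] {m : ℕ} (h : Stab (D.L m) P) :
    Stab (D.linkInv ((m + 1 : ℕ) : ZMod (n + 1))) P :=
  h.of_mul_eq_one (D.inv_right _) (D.inv_left _)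

lemma exists_hol_inv {P : Submodule ℂ H} [FiniteDimensional ℂ P] (h : ∀ m < n, Stab (D.L m) P)
    (k : ℕ) (hk : k < n) : ∃ Y, Y * D.hol k = 1 ∧ Stab Y P := by
  induction k with
  | zero => exact ⟨_, D.inv_left _, D.linkInv_stab (h 0 hk)⟩
  | succ k ih =>
    obtain ⟨Y, hY, hs⟩ := ih (by omega)
    refine ⟨D.linkInv ((k + 1 + 1 : ℕ) : ZMod (n + 1)) * (Y * inl G A Γ.v.1), ?_,
      (D.linkInv_stab (h _ hk)).mul (hs.mul (stab_inl P _))⟩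
    rw [hol_succ]
    calc _ = D.linkInv ((k + 1 + 1 : ℕ) : ZMod (n + 1)) * (Y * (inl G A Γ.v.1 *
            inl G A (Γ.v⁻¹).1) * D.hol k * D.L (k + 1)) := by simp only [mul_assoc]
      _ = 1 := by
        rw [RibbonStar.mm_unit_mul_inv, mul_one, hY, one_mul]
        exact D.inv_left _

lemma stab_L_last (hM : Stab (D.hol n) V₀) (hV : V₀ ≤ D.tower V₀ n) :
    Stab (D.L n) (D.tower V₀ n) := by
  have key : ∀ j ≤ n, ∀ π, ∀ w ∈ D.tower V₀ j, component π (D.L n) • w ∈ D.tower V₀ n := by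
    intro j
    induction j with
    | zero =>
      intro _ π w hw
      rcases n with _ | k
      · exact hV (hM π w hw)
      · obtain ⟨Y, hY, hs⟩ := D.exists_hol_inv (fun m hm => D.stab_L_tower (V₀ := V₀) hm) k
          (by omega)
        have e : D.L (k + 1) = Y * inl G A Γ.v.1 * D.hol (k + 1) := by
          rw [hol_succ]
          calc D.L (k + 1) = Y * D.hol k * D.L (k + 1) := by rw [hY, one_mul]
            _ = Y * (inl G A Γ.v.1 * inl G A (Γ.v⁻¹).1) * D.hol k * D.L (k + 1) := by
              rw [RibbonStar.mm_unit_mul_inv, mul_one]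
            _ = _ := by simp only [mul_assoc]
        rw [e]
        exact mul_smul_mem (P := D.tower V₀ (k + 1)) (hs.mul (stab_inl _ _))
          (fun π => hV (hM π w hw)) π
    | succ j ih =>
      intro hj π w hw
      have : Submodule.map₂ (act H (D.L (n - 1 - j))) ⊤ (D.tower V₀ j) ≤
          (D.tower V₀ n).comap (Algebra.lsmul ℂ ℂ H (component π (D.L n))) := by
        rw [map₂_act_le]
        intro π₂ w hw
        change component π (D.L n) • component π₂ (D.L (n - 1 - j)) • w ∈ D.tower V₀ n
        rw [← mul_smul]
        refine D.link_swap (by omega) le_rfl (fun ρ₁ ρ₂ => ?_) _ _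
        rw [mul_smul]
        exact D.stab_L_tower (by omega) _ _ (ih (by omega) _ _ hw)
      exact this hw
  exact key n le_rfl

lemma le_tower : V₀ ≤ D.tower V₀ n := by
  have key : ∀ j ≤ n, D.tower V₀ (n - j) ≤ D.tower V₀ n := by
    intro j
    induction j with
    | zero => exact fun _ => le_rfl
    | succ j ih =>
      intro hj w hw
      have h1 : ∀ π, component π (D.L (n - 1 - (n - (j + 1)))) • w ∈ D.tower V₀ n := fun π =>
        ih (by omega) (by
          rw [show n - j = n - (j + 1) + 1 by omega]
          exact component_smul_mem_map₂ _ _ hw)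
      have h2 := mul_smul_mem (P := D.tower V₀ n) (Q := D.tower V₀ n)
        (D.linkInv_stab (D.stab_L_tower (m := n - 1 - (n - (j + 1))) (by omega))) h1
        (counit (R := ℂ))
      rw [show D.linkInv _ * D.L _ = 1 from D.inv_left _, Algebra.TensorProduct.one_def,
        component_tmul, Bialgebra.counit_one, one_smul, one_smul] at h2
      exact h2
  simpa [tower] using key n le_rfl

end

end CurrentData

/-! ## Representations as modules -/

section RepSpace

variable {A : Type u} [Ring A] [Algebra ℂ A] {W : Type v} [AddCommGroup W] [Module ℂ W]

/-- The space of a representation, as a module. -/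
def RepSpace (_ : A →ₐ[ℂ] End ℂ W) : Type v := W

variable (ρ : A →ₐ[ℂ] End ℂ W)

instance : AddCommGroup (RepSpace ρ) := inferInstanceAs (AddCommGroup W)
instance : Module ℂ (RepSpace ρ) := inferInstanceAs (Module ℂ W)
instance : Module A (RepSpace ρ) := Module.compHom W ρ.toRingHom
instance [h : Module.Finite ℂ W] : Module.Finite ℂ (RepSpace ρ) := h

/-- The identification of a representation space with the underlying space. -/
def RepSpace.equiv : RepSpace ρ ≃ₗ[ℂ] W := LinearEquiv.refl ℂ W

lemma RepSpace.equiv_smul (a : A) (w : RepSpace ρ) :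
    RepSpace.equiv ρ (a • w) = ρ a (RepSpace.equiv ρ w) := rfl

instance : IsScalarTower ℂ A (RepSpace ρ) where
  smul_assoc c a w := (RepSpace.equiv ρ).injective (by
    rw [RepSpace.equiv_smul, map_smul, map_smul, RepSpace.equiv_smul, LinearMap.smul_apply])

lemma isSimpleModule_iff : IsSimpleModule A (RepSpace ρ) ↔ IsIrreducibleRep ρ := by
  constructor
  · intro h
    refine ⟨IsSimpleModule.nontrivial A (RepSpace ρ), fun p hp => ?_⟩
    let p' : Submodule A (RepSpace ρ) :=
      { p.toAddSubmonoid with smul_mem' := fun c x hx => hp c x hx }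
    rcases eq_bot_or_eq_top p' with h | h
    · left
      ext z
      exact (Iff.of_eq (congrArg (z ∈ ·) h) : z ∈ p' ↔ z ∈ ⊥)
    · right
      ext z
      exact (Iff.of_eq (congrArg (z ∈ ·) h) : z ∈ p' ↔ z ∈ ⊤)
  · intro h
    have : Nontrivial (RepSpace ρ) := h.1
    refine { eq_bot_or_eq_top := fun p => ?_ }
    rcases h.2 ((p.restrictScalars ℂ).map (RepSpace.equiv ρ).toLinearMap) (by
      rintro a _ ⟨z, hz, rfl⟩
      exact ⟨a • z, p.smul_mem a hz, rfl⟩) with h | h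
    · left
      exact (Submodule.eq_bot_iff _).mpr fun z hz => (Submodule.eq_bot_iff _).mp h _ ⟨z, hz, rfl⟩
    · right
      refine (Submodule.eq_top_iff').mpr fun z => ?_
      obtain ⟨y, hy, e⟩ := (Submodule.eq_top_iff'.mp h) (RepSpace.equiv ρ z)
      rwa [← (RepSpace.equiv ρ).injective e]

variable {ρ}

/-- Burnside's theorem. -/
lemma IsIrreducibleRep.surjective [FiniteDimensional ℂ W] (hρ : IsIrreducibleRep ρ) :
    Function.Surjective ρ := by
  intro f
  have := (isSimpleModule_iff ρ).mpr hρ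
  have hT : ∀ T : End A (RepSpace ρ), ∃ c : ℂ, ∀ x, T x = c • x := by
    intro T
    obtain ⟨c, hc⟩ := hρ.exists_smul ((RepSpace.equiv ρ).conj (T.restrictScalars ℂ))
      fun ξ x => congrArg (RepSpace.equiv ρ) (map_smul T ξ ((RepSpace.equiv ρ).symm x))
    exact ⟨c, fun x => (RepSpace.equiv ρ).injective (hc (RepSpace.equiv ρ x))⟩
  let f' : End (End A (RepSpace ρ)) (RepSpace ρ) :=
    { toFun := (RepSpace.equiv ρ).symm.conj f
      map_add' := map_add _
      map_smul' := fun T x => by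
        obtain ⟨c, hc⟩ := hT T
        rw [Module.End.smul_def, hc, map_smul, RingHom.id_apply, Module.End.smul_def, hc] }
  classical
  obtain ⟨a, ha⟩ := jacobson_density (R := A) f' (Finset.univ.image fun i =>
    (RepSpace.equiv ρ).symm (Module.finBasis ℂ W i))
  refine ⟨a, (Module.finBasis ℂ W).ext fun i => ?_⟩
  exact (congrArg (RepSpace.equiv ρ) (ha _ (Finset.mem_image_of_mem _ (Finset.mem_univ i)))).symm

variable {B : Type w} [Ring B] [Algebra ℂ B] {W' : Type x} [AddCommGroup W'] [Module ℂ W']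
  {ρ' : B →ₐ[ℂ] End ℂ W'}

lemma exists_dual_apply_ne [FiniteDimensional ℂ W] {z : W ⊗[ℂ] W'} (hz : z ≠ 0) :
    ∃ φ : Dual ℂ W, TensorProduct.lid ℂ W' (LinearMap.rTensor W' φ z) ≠ 0 := by
  by_contra! h
  refine hz ?_
  have key : ∀ z : W ⊗[ℂ] W', z = ∑ i, Module.finBasis ℂ W i ⊗ₜ[ℂ]
      TensorProduct.lid ℂ W' (LinearMap.rTensor W' ((Module.finBasis ℂ W).coord i) z) := by
    intro z
    induction z with
    | zero => simp
    | add z z' h h' =>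
      conv_lhs => rw [h, h']
      simp only [map_add, TensorProduct.tmul_add, Finset.sum_add_distrib]
    | tmul x y =>
      conv_lhs => rw [← (Module.finBasis ℂ W).sum_repr x, TensorProduct.sum_tmul]
      exact Finset.sum_congr rfl fun i _ => by simp [TensorProduct.smul_tmul']
  rw [key z]
  simp [h]

/-- The tensor product of irreducible representations of two algebras is irreducible. -/
lemma IsIrreducibleRep.eq_top_of_tensor [FiniteDimensional ℂ W] [FiniteDimensional ℂ W']
    (hρ : IsIrreducibleRep ρ) (hρ' : IsIrreducibleRep ρ') {S : Submodule ℂ (W ⊗[ℂ] W')}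
    (h1 : ∀ a, ∀ z ∈ S, LinearMap.rTensor W' (ρ a) z ∈ S)
    (h2 : ∀ b, ∀ z ∈ S, lTensor W (ρ' b) z ∈ S) (hS : S ≠ ⊥) : S = ⊤ := by
  obtain ⟨z, hzS, hz⟩ := S.ne_bot_iff.mp hS
  obtain ⟨φ, hφ⟩ := exists_dual_apply_ne hz
  set y := TensorProduct.lid ℂ W' (LinearMap.rTensor W' φ z) with hy
  have hx : ∀ x : W, x ⊗ₜ[ℂ] y ∈ S := by
    intro x
    obtain ⟨a, ha⟩ := hρ.surjective (φ.smulRight x)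
    have e : ∀ z : W ⊗[ℂ] W', LinearMap.rTensor W' (φ.smulRight x) z =
        x ⊗ₜ TensorProduct.lid ℂ W' (LinearMap.rTensor W' φ z) := by
      intro z
      induction z with
      | tmul p q => simp [TensorProduct.smul_tmul]
      | _ => simp_all [TensorProduct.tmul_add]
    rw [hy, ← e, ← ha]
    exact h1 a z hzS
  rw [eq_top_iff]
  rintro z' -
  induction z' with
  | zero => exact S.zero_mem
  | add z z' h h' => exact S.add_mem h h'
  | tmul p q =>
    obtain ⟨ψ, hψ⟩ := Module.Projective.exists_dual_eq_one ℂ hφ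
    obtain ⟨b, hb⟩ := hρ'.surjective (ψ.smulRight q)
    have := h2 b _ (hx p)
    rw [hb, LinearMap.lTensor_tmul] at this
    simpa [hψ] using this

end RepSpace

/-! ## The vacuum of the carrier spaces -/

section ActsTrivially

variable {W : Type*} [AddCommGroup W] [Module ℂ W]

/-- `f` acts on `w` by the counit. -/
def ActsTrivially (f : G →ₗ[ℂ] End ℂ W) (w : W) : Prop := ∀ ξ, f ξ w = counit (R := ℂ) ξ • w

lemma ev_apply_of_actsTrivially_left {f g : G →ₗ[ℂ] End ℂ W} {w : W}
    (hf : ∀ ξ, ActsTrivially f (g ξ w)) (Z : G ⊗[ℂ] G) :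
    ev (E := End ℂ W) f g Z w = g (ev (triv G G) LinearMap.id Z) w := by
  induction Z with
  | tmul a b =>
    rw [ev_tmul, ev_tmul, Module.End.mul_apply, hf, triv_apply,
      ← Algebra.smul_def, LinearMap.id_apply, map_smul, LinearMap.smul_apply]
  | _ => simp_all

lemma ActsTrivially.conv_apply {f g : G →ₗ[ℂ] End ℂ W} {w : W}
    (hf : ∀ ξ, ActsTrivially f (g ξ w)) (ξ : G) : conv (A := End ℂ W) f g ξ w = g ξ w := by
  rw [LatticeCurrent.conv_apply, ev_apply_of_actsTrivially_left hf, ← LatticeCurrent.conv_apply,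
    triv_conv, LinearMap.id_apply]

lemma ActsTrivially.conv {f g : G →ₗ[ℂ] End ℂ W} {w : W} (hf : ActsTrivially f w)
    (hg : ActsTrivially g w) : ActsTrivially (LatticeCurrent.conv (A := End ℂ W) f g) w := by
  intro ξ
  rw [ActsTrivially.conv_apply, hg]
  intro η ζ
  rw [hg, map_smul, hf, smul_comm]

lemma component_mul_lTensor_apply {f : G →ₗ[ℂ] End ℂ W} {w : W} (hf : ActsTrivially f w)
    (π : Dual ℂ G) (X : G ⊗[ℂ] End ℂ W) (Z : G ⊗[ℂ] G) :
    component π (X * lTensor G f Z) w =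
      component (π ∘ₗ LinearMap.mulRight ℂ (ev LinearMap.id (triv G G) Z)) X w := by
  have e : ∀ a : G, component (π ∘ₗ LinearMap.mulRight ℂ a) X = component π (X * a ⊗ₜ 1) := by
    intro a
    rw [component_mul_tmul, mul_one]
  rw [e]
  induction Z with
  | tmul a b =>
    rw [LinearMap.lTensor_tmul, ev_tmul, component_mul_tmul, component_mul_tmul,
      Module.End.mul_apply, hf, map_smul, triv_apply, ← Algebra.commutes, ← Algebra.smul_def,
      LinearMap.id_apply, ← LinearMap.smul_apply, mul_one, e, e, ← map_smul, ← mul_smul_comm,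
      TensorProduct.smul_tmul']
  | _ => simp_all [mul_add, TensorProduct.add_tmul]

lemma component_lTensor_mul_apply {f : G →ₗ[ℂ] End ℂ W} {w : W}
    {X : G ⊗[ℂ] End ℂ W} (hf : ∀ π, ActsTrivially f (component π X w))
    (π : Dual ℂ G) (Z : G ⊗[ℂ] G) :
    component π (lTensor G f Z * X) w =
      component (π ∘ₗ LinearMap.mulLeft ℂ (ev LinearMap.id (triv G G) Z)) X w := by
  have e : ∀ a : G, component (π ∘ₗ LinearMap.mulLeft ℂ a) X = component π (a ⊗ₜ 1 * X) := by
    intro a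
    rw [component_tmul_mul, one_mul]
  rw [e]
  induction Z with
  | tmul a b =>
    rw [LinearMap.lTensor_tmul, ev_tmul, component_tmul_mul, component_tmul_mul,
      Module.End.mul_apply, hf, triv_apply, ← Algebra.commutes, ← Algebra.smul_def,
      LinearMap.id_apply, ← LinearMap.smul_apply, one_mul, e, e, ← map_smul, ← smul_mul_assoc,
      TensorProduct.smul_tmul']
  | _ => simp_all [add_mul, TensorProduct.add_tmul]

end ActsTrivially

section Vacuum

variable [Module.Finite ℂ G] {V V' : Type v} [AddCommGroup V] [Module ℂ V] [AddCommGroup V']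
  [Module ℂ V'] {n : ℕ}

lemma onRe_tmul (k : Fin n) (f : End ℂ (Re G)) (m : Fin n → Re G) (z : V ⊗[ℂ] V') :
    onRe G V V' (n + 1) k f (PiTensorProduct.tprod ℂ m ⊗ₜ z) =
      PiTensorProduct.tprod ℂ (Function.update m k (f (m k))) ⊗ₜ z := by
  rw [onRe_apply]
  refine (LinearMap.rTensor_tmul _ _ _ _).trans ?_
  rw [PiTensorProduct.map_tprod]
  congr 2
  ext i : 1
  by_cases h : i = k
  · subst h; simp
  · simp [h]

variable (G) in
/-- The vector `|ε⟩`. -/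
def Re.vac : Re G := Re.vec G (counit (R := ℂ))

lemma reTarget_vac : ActsTrivially (reTarget G) (Re.vac G) := fun ξ => by
  refine (Re.vec G).symm.injective (LinearMap.ext fun η => ?_)
  rw [Re.vac, reTarget_apply, map_smul, LinearEquiv.symm_apply_apply, LinearMap.smul_apply,
    Bialgebra.counit_mul, mul_comm, smul_eq_mul]

lemma reSource_vac : ActsTrivially (reSource G) (Re.vac G) := fun ξ => by
  refine (Re.vec G).symm.injective (LinearMap.ext fun η => ?_)
  rw [Re.vac, reSource_apply, map_smul, LinearEquiv.symm_apply_apply, LinearMap.smul_apply,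
    Bialgebra.counit_mul, HopfAlgebra.counit_antipode, smul_eq_mul]

lemma reTarget_integral {h : G} (hh : IsIntegral h) (w : Re G) :
    reTarget G h w = (Re.vec G).symm w h • Re.vac G := by
  obtain ⟨π, rfl⟩ := (Re.vec G).surjective w
  refine (Re.vec G).symm.injective (LinearMap.ext fun η => ?_)
  rw [reTarget_apply, hh.mul, map_smul, map_smul, LinearEquiv.symm_apply_apply, Re.vac,
    LinearEquiv.symm_apply_apply, LinearMap.smul_apply, smul_eq_mul, smul_eq_mul, mul_comm]

variable (G V V' n) in
/-- The vectors `|ε, …, ε⟩ ⊗ z`. -/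
def vacVec : V ⊗[ℂ] V' →ₗ[ℂ] Carrier G V V' (n + 1) :=
  TensorProduct.mk ℂ _ _ (PiTensorProduct.tprod ℂ fun _ => Re.vac G)

lemma onRe_vacVec (k : Fin n) {f : G →ₗ[ℂ] End ℂ (Re G)} (hf : ActsTrivially f (Re.vac G))
    (z : V ⊗[ℂ] V') : ActsTrivially (onRe G V V' (n + 1) k ∘ₗ f) (vacVec G V V' n z) := fun ξ => by
  refine (onRe_tmul k (f ξ) _ z).trans ?_
  rw [hf, MultilinearMap.map_update_smul, ← TensorProduct.smul_tmul', Function.update_eq_self]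
  rfl

lemma tail_vacVec (z : V ⊗[ℂ] V') {k : ℕ} (hk : k ≤ n) :
    ActsTrivially (tail G V V' (n + 1) k) (vacVec G V V' n z) := by
  induction k with
  | zero => exact fun ξ => rfl
  | succ k ih =>
    refine ActsTrivially.conv (ih (by omega)) ?_
    have hk' : k < n + 1 - 1 := by omega
    simp only [hk', dite_true]
    exact onRe_vacVec ⟨k, hk'⟩ reSource_vac z

variable (τ : G →ₐ[ℂ] End ℂ V) (τ' : G →ₐ[ℂ] End ℂ V')

lemma component_monodromy_vacVec (π : Dual ℂ G) (z : V ⊗[ℂ] V') :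
    component (A := CEnd G V V' n) π (idTensor (B := CEnd G V V' n) G (carrierRep Γ n τ τ')
      (CurrentAlgebra.holonomy Γ (n + 1) (n + 1))) (vacVec G V V' n z) =
      vacVec G V V' n (LinearMap.rTensor V' (τ (component π Γ.Q)) z) := by
  have h := (isJordanWigner_carrierRep (Γ := Γ) (n := n) (τ := τ) (τ' := τ')).monodromy
  have hQ : ∀ (π : Dual ℂ G) z, component (A := CEnd G V V' n) π
      (lTensor G (onLast G V V' (n + 1) ∘ₗ LinearMap.rTensorHom V' ∘ₗ τ.toLinearMap)
          (flipTensor G Γ.R * Γ.R)) (vacVec G V V' n z) =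
      vacVec G V V' n (LinearMap.rTensor V' (τ (component π Γ.Q)) z) := by
    intro π z
    refine (LinearMap.congr_fun (component_lTensor (A := CEnd G V V' n) _ π _) _).trans ?_
    rfl
  have e1 : ev LinearMap.id (triv G G) Γ.R.1 = 1 := Γ.r_triv LinearMap.id
  have e2 : ev LinearMap.id (triv G G) (Γ.R⁻¹).1 = 1 := Γ.ri_triv LinearMap.id
  have h6 : ∀ φ : Dual ℂ G, φ ∘ₗ LinearMap.mulLeft ℂ (1 : G) = φ := fun φ => by ext; simp
  have h7 : ∀ φ : Dual ℂ G, φ ∘ₗ LinearMap.mulRight ℂ (1 : G) = φ := fun φ => by ext; simp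
  refine (congrArg (fun X => component (A := CEnd G V V' n) π X (vacVec G V V' n z)) h).trans ?_
  refine (component_mul_lTensor_apply (tail_vacVec z le_rfl) π _ _).trans ?_
  rw [e1, h7]
  refine (component_lTensor_mul_apply (fun π => ?_) π _).trans ?_
  · rw [hQ]
    exact tail_vacVec _ le_rfl
  · rw [e2, h6, hQ]

lemma site_zero_vacVec (ξ : G) (z : V ⊗[ℂ] V') :
    carrierRep Γ n τ τ' (CurrentAlgebra.site Γ (n + 1) 0 ξ) (vacVec G V V' n z) =
      vacVec G V V' n (pairRep τ τ' (comul ξ) z) := by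
  have h := (isJordanWigner_carrierRep (Γ := Γ) (n := n) (τ := τ) (τ' := τ')).base ξ
  refine (LinearMap.congr_fun h _).trans ?_
  exact ActsTrivially.conv_apply (fun ξ => tail_vacVec _ le_rfl) ξ

/-- The carrier space, as a module. -/
abbrev CarrierModule (Γ : RibbonStar G) (n : ℕ) (τ : G →ₐ[ℂ] End ℂ V)
    (τ' : G →ₐ[ℂ] End ℂ V') := RepSpace (carrierRep Γ n τ τ')

variable (Γ n) in
/-- The vacuum vectors of the carrier space. -/
def vacMap : V ⊗[ℂ] V' →ₗ[ℂ] CarrierModule Γ n τ τ' :=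
  (RepSpace.equiv (carrierRep Γ n τ τ')).symm.toLinearMap ∘ₗ vacVec G V V' n

lemma T_smul_vacMap (ξ : G) (z : V ⊗[ℂ] V') :
    (CurrentAlgebra.data Γ (n + 1)).T n ξ • vacMap Γ n τ τ' z =
      vacMap Γ n τ τ' (pairRep τ τ' (comul ξ) z) := by
  have h : (CurrentAlgebra.data Γ (n + 1)).T n = CurrentAlgebra.site Γ (n + 1) 0 := by
    rw [CurrentData.T, ZMod.natCast_self]; rfl
  rw [h]
  exact site_zero_vacVec τ τ' ξ z

lemma T_smul_eq {m : ℕ} (hm : m < n) (ξ : G) (w : CarrierModule Γ n τ τ') :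
    RepSpace.equiv _ ((CurrentAlgebra.data Γ (n + 1)).T m ξ • w) =
      onRe G V V' (n + 1) ⟨m, hm⟩ (reTarget G ξ) (RepSpace.equiv _ w) := by
  have h := (isJordanWigner_carrierRep (Γ := Γ) (n := n) (τ := τ) (τ' := τ')).site ⟨m, hm⟩ ξ
  exact LinearMap.congr_fun h _

lemma vacMap_mem_vac (z : V ⊗[ℂ] V') :
    vacMap Γ n τ τ' z ∈ (CurrentAlgebra.data Γ (n + 1)).vac (CarrierModule Γ n τ τ') :=
  fun _ hm ξ => (T_smul_eq τ τ' hm ξ _).trans (onRe_vacVec _ reTarget_vac z ξ)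

lemma span_tmul_eq_top : Submodule.span ℂ {w : Carrier G V V' (n + 1) |
    ∃ (m : Fin n → Re G) (z : V ⊗[ℂ] V'), PiTensorProduct.tprod ℂ m ⊗ₜ z = w} = ⊤ := by
  rw [eq_top_iff]
  rintro w -
  induction w using TensorProduct.induction_on with
  | zero => exact zero_mem _
  | add x y hx hy => exact add_mem hx hy
  | tmul x z =>
    induction x using PiTensorProduct.induction_on with
    | smul_tprod r m =>
      rw [← TensorProduct.smul_tmul']
      exact Submodule.smul_mem _ _ (Submodule.subset_span ⟨m, z, rfl⟩)
    | add x y hx hy => rw [TensorProduct.add_tmul]; exact add_mem hx hy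

lemma vac_le_range [IsSemisimpleRing G] :
    (CurrentAlgebra.data Γ (n + 1)).vac (CarrierModule Γ n τ τ') ≤
      LinearMap.range (vacMap Γ n τ τ') := by
  obtain ⟨h, hh⟩ := exists_isIntegral (G := G)
  intro w hw
  have key : ∀ j ≤ n, RepSpace.equiv _ w ∈ Submodule.span ℂ {w : Carrier G V V' (n + 1) |
      ∃ (m : Fin n → Re G) (z : V ⊗[ℂ] V'), (∀ i : Fin n, (i : ℕ) < j → m i = Re.vac G) ∧
        PiTensorProduct.tprod ℂ m ⊗ₜ z = w} := by
    intro j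
    induction j with
    | zero =>
      intro _
      have : RepSpace.equiv _ w ∈ (⊤ : Submodule ℂ (Carrier G V V' (n + 1))) := trivial
      rw [← span_tmul_eq_top] at this
      exact Submodule.span_mono
        (by rintro _ ⟨m, z, e⟩; exact ⟨m, z, fun i hi => absurd hi (Nat.not_lt_zero _), e⟩) this
    | succ j ih =>
      intro hj
      have e := T_smul_eq τ τ' (show j < n by omega) h w
      have hj' : j < n := by omega
      rw [hw j hj' h, hh.counit_eq, one_smul] at e
      rw [e]
      refine Submodule.mem_comap.mp (Submodule.span_le.mpr ?_ (ih (by omega)))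
      rintro _ ⟨m, z, hm, rfl⟩
      rw [SetLike.mem_coe, Submodule.mem_comap]
      refine (onRe_tmul (⟨j, by omega⟩ : Fin n) (reTarget G h) m z).symm ▸ ?_
      rw [reTarget_integral hh, MultilinearMap.map_update_smul, ← TensorProduct.smul_tmul']
      refine Submodule.smul_mem _ _ (Submodule.subset_span ⟨_, z, fun i hi => ?_, rfl⟩)
      by_cases hij : i = (⟨j, hj⟩ : Fin n)
      · rw [hij, Function.update_self]
      · rw [Function.update_of_ne hij]
        exact hm i (lt_of_le_of_ne (Nat.lt_succ_iff.mp hi) fun h => hij (Fin.ext h))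
  have h1 := key n le_rfl
  have h2 : RepSpace.equiv _ w ∈ LinearMap.range (vacVec G V V' n) := by
    refine Submodule.span_le.mpr ?_ h1
    rintro _ ⟨m, z, hm, rfl⟩
    exact ⟨z, by rw [show m = fun _ => Re.vac G from funext fun i => hm i i.2]; rfl⟩
  obtain ⟨z, hz⟩ := h2
  exact ⟨z, (RepSpace.equiv _).injective hz⟩

lemma finrank_carrier [FiniteDimensional ℂ V] [FiniteDimensional ℂ V'] :
    Module.finrank ℂ (Carrier G V V' (n + 1)) =
      Module.finrank ℂ G ^ n * Module.finrank ℂ (V ⊗[ℂ] V') := by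
  have h : Module.finrank ℂ (⨂[ℂ] _ : Fin n, Re G) = Module.finrank ℂ G ^ n := by
    rw [Module.finrank_eq_card_basis (Basis.piTensorProduct fun _ : Fin n =>
      Module.finBasis ℂ (Re G))]
    have : Module.finrank ℂ (Re G) = Module.finrank ℂ G := Subspace.dual_finrank_eq
    simp [this]
  rw [← h]
  exact Module.finrank_tensorProduct

section

variable (hQ : Function.Bijective ((componentHom G G).flip Γ.Q))

lemma smul_vacMap (x : CurrentAlgebra Γ (n + 1)) (z : V ⊗[ℂ] V') : x • vacMap Γ n τ τ' z =
      (RepSpace.equiv (carrierRep Γ n τ τ')).symm (carrierRep Γ n τ τ' x (vacVec G V V' n z)) := rfl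

lemma p_smul_vacMap (ξ : G) (z : V ⊗[ℂ] V') :
    (CurrentAlgebra.data Γ (n + 1)).p hQ ξ • vacMap Γ n τ τ' z =
      vacMap Γ n τ τ' (LinearMap.rTensor V' (τ ξ) z) := by
  obtain ⟨π, rfl⟩ := CurrentData.exists_component_Q hQ ξ
  rw [CurrentData.p_component, ← CurrentAlgebra.holonomy_eq_hol, smul_vacMap]
  refine congrArg (RepSpace.equiv (carrierRep Γ n τ τ')).symm ?_
  rw [← component_monodromy_vacVec τ τ' π z]
  exact (LinearMap.congr_fun (component_idTensor (B := CEnd G V V' n) (carrierRep Γ n τ τ') π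
    (CurrentAlgebra.holonomy Γ (n + 1) (n + 1))) _).symm

end

end Vacuum

/-! ## Modules over the current algebra -/

section Modules

variable [Module.Finite ℂ G] {V V' : Type v} [AddCommGroup V] [Module ℂ V] [AddCommGroup V']
  [Module ℂ V'] {n : ℕ} {H : Type*} [AddCommGroup H] [Module ℂ H]
  [Module (CurrentAlgebra Γ (n + 1)) H] [IsScalarTower ℂ (CurrentAlgebra Γ (n + 1)) H]

lemma ev_smul_map [Module A H] [IsScalarTower ℂ A H]
    {W : Type*} [AddCommGroup W] [Module ℂ W]
    {φ : W →ₗ[ℂ] H} {f g : G →ₗ[ℂ] A} {f' g' : G →ₗ[ℂ] End ℂ W}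
    (hf : ∀ ξ z, f ξ • φ z = φ (f' ξ z)) (hg : ∀ ξ z, g ξ • φ z = φ (g' ξ z)) (X : G ⊗[ℂ] G)
    (z : W) : ev f g X • φ z = φ (ev (E := End ℂ W) f' g' X z) := by
  induction X with
  | tmul x y => rw [ev_tmul, ev_tmul, mul_smul, hg, hf, Module.End.mul_apply]
  | _ => simp_all [add_smul]

lemma conv_smul_map [Module A H] [IsScalarTower ℂ A H]
    {W : Type*} [AddCommGroup W] [Module ℂ W]
    {φ : W →ₗ[ℂ] H} {f g : G →ₗ[ℂ] A} {f' g' : G →ₗ[ℂ] End ℂ W}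
    (hf : ∀ ξ z, f ξ • φ z = φ (f' ξ z)) (hg : ∀ ξ z, g ξ • φ z = φ (g' ξ z)) (ξ : G) (z : W) :
    conv f g ξ • φ z = φ (conv (A := End ℂ W) f' g' ξ z) :=
  ev_smul_map hf hg _ z

/-- A subspace that is stable under the sites and the links is a submodule. -/
lemma smul_mem_of_stab {P : Submodule ℂ H} [FiniteDimensional ℂ P]
    (hT : ∀ m ≤ n, ∀ ξ, ∀ w ∈ P, (CurrentAlgebra.data Γ (n + 1)).T m ξ • w ∈ P)
    (hL : ∀ m ≤ n, Stab ((CurrentAlgebra.data Γ (n + 1)).L m) P)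
    (x : CurrentAlgebra Γ (n + 1)) : ∀ w ∈ P, x • w ∈ P := by
  induction x using CurrentAlgebra.induction with
  | scalar c =>
    intro w hw
    rw [algebraMap_smul]
    exact P.smul_mem _ hw
  | add x y hx hy =>
    intro w hw
    rw [add_smul]
    exact P.add_mem (hx w hw) (hy w hw)
  | mul x y hx hy =>
    intro w hw
    rw [mul_smul]
    exact hx _ (hy w hw)
  | hsite k ξ =>
    obtain ⟨m, hm, rfl⟩ := ZMod.exists_eq_add_one k
    have := hT m hm ξ
    rwa [CurrentData.T, Nat.cast_succ] at this
  | hlink k π =>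
    obtain ⟨m, hm, rfl⟩ := ZMod.exists_eq_add_one k
    have := hL m hm π
    rwa [CurrentData.L, Nat.cast_succ] at this
  | hlinkInv k π =>
    obtain ⟨m, hm, rfl⟩ := ZMod.exists_eq_add_one k
    have := (CurrentAlgebra.data Γ (n + 1)).linkInv_stab (hL m hm) π
    rwa [Nat.cast_succ] at this

variable (hQ : Function.Bijective ((componentHom G G).flip Γ.Q))

/-- The finite dimensional submodule generated by a subspace of the vacuum. -/
lemma exists_submodule {V₀ : Submodule ℂ H} [FiniteDimensional ℂ V₀]
    (hV : V₀ ≤ (CurrentAlgebra.data Γ (n + 1)).vac H)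
    (hp : ∀ ξ, ∀ w ∈ V₀, (CurrentAlgebra.data Γ (n + 1)).p hQ ξ • w ∈ V₀)
    (hq : ∀ ξ, ∀ w ∈ V₀, (CurrentAlgebra.data Γ (n + 1)).q hQ ξ • w ∈ V₀) :
    ∃ P : Submodule (CurrentAlgebra Γ (n + 1)) H, V₀ ≤ P.restrictScalars ℂ ∧ FiniteDimensional ℂ P ∧
      Module.finrank ℂ P ≤ Module.finrank ℂ G ^ n * Module.finrank ℂ V₀ := by
  set D := CurrentAlgebra.data Γ (n + 1)
  have hT : ∀ ξ, ∀ w ∈ V₀, D.T n ξ • w ∈ V₀ := by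
    intro ξ w hw
    rw [← D.conv_p_q hQ, conv_apply]
    induction (comul ξ : G ⊗[ℂ] G) with
    | zero => simp
    | add X Y h h' => simpa only [map_add, add_smul] using V₀.add_mem h h'
    | tmul x y => rw [ev_tmul, mul_smul]; exact hp _ _ (hq _ _ hw)
  have hM : Stab (D.hol n) V₀ := fun π w hw => by
    rw [← D.p_component hQ]
    exact hp _ w hw
  have hle := D.le_tower (V₀ := V₀)
  let P : Submodule (CurrentAlgebra Γ (n + 1)) H :=
    { (D.tower V₀ n).toAddSubmonoid with
      smul_mem' := fun x w hw => smul_mem_of_stab (fun m hm ξ => D.tower_T hV hT le_rfl hm ξ)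
        (fun m hm => hm.lt_or_eq.elim (fun h => D.stab_L_tower h)
          fun h => by rw [h]; exact D.stab_L_last hM hle) x w hw }
  have e : P.restrictScalars ℂ = D.tower V₀ n := Submodule.ext fun _ => Iff.rfl
  refine ⟨P, hle.trans_eq e.symm, ?_, ?_⟩
  · exact (inferInstance : FiniteDimensional ℂ (D.tower V₀ n))
  · exact D.finrank_tower_le n

/-- A map from `V ⊗ V'` to the vacuum of a module which intertwines the representations `p` and
`q` with the given ones. -/
structure IsVacuumMap (τ : G →ₐ[ℂ] End ℂ V) (τ' : G →ₐ[ℂ] End ℂ V')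
    (φ : V ⊗[ℂ] V' →ₗ[ℂ] H) : Prop where
  mem_vac : ∀ z, φ z ∈ (CurrentAlgebra.data Γ (n + 1)).vac H
  p_smul : ∀ ξ z, (CurrentAlgebra.data Γ (n + 1)).p hQ ξ • φ z = φ (LinearMap.rTensor V' (τ ξ) z)
  q_smul : ∀ ξ z, (CurrentAlgebra.data Γ (n + 1)).q hQ ξ • φ z = φ (lTensor V (τ' ξ) z)

variable (τ : G →ₐ[ℂ] End ℂ V) (τ' : G →ₐ[ℂ] End ℂ V')

lemma pairRep_comul (ξ : G) : pairRep τ τ' (comul ξ) =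
    conv (A := End ℂ (V ⊗[ℂ] V')) (LinearMap.rTensorHom V' ∘ₗ τ.toLinearMap)
      (LinearMap.lTensorHom V ∘ₗ τ'.toLinearMap) ξ := by
  rw [conv_apply]
  induction (comul ξ : G ⊗[ℂ] G) with
  | tmul x y =>
    rw [ev_tmul]
    refine TensorProduct.ext' fun a b => ?_
    rfl
  | _ => simp_all

lemma isVacuumMap_vacMap : IsVacuumMap (n := n) hQ τ τ' (vacMap Γ n τ τ') where
  mem_vac := vacMap_mem_vac τ τ'
  p_smul := p_smul_vacMap τ τ' hQ
  q_smul ξ z := by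
    have : IsMulMap (LinearMap.rTensorHom V' ∘ₗ τ.toLinearMap : G →ₗ[ℂ] End ℂ (V ⊗[ℂ] V')) :=
      ⟨by rw [comp_apply, AlgHom.toLinearMap_apply, map_one]; exact LinearMap.rTensor_id (R := ℂ) V' V, fun x y => by simp [LinearMap.rTensor_mul]⟩
    rw [CurrentData.q, conv_smul_map
      (f' := (LinearMap.rTensorHom V' ∘ₗ τ.toLinearMap) ∘ₗ antipode ℂ)
      (g' := (pairRep τ τ').toLinearMap ∘ₗ comul)
      (fun ξ z => p_smul_vacMap τ τ' hQ _ z) (fun ξ z => T_smul_vacMap τ τ' ξ z)]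
    have e : (pairRep τ τ').toLinearMap ∘ₗ comul =
      conv (A := End ℂ (V ⊗[ℂ] V')) (LinearMap.rTensorHom V' ∘ₗ τ.toLinearMap)
        (LinearMap.lTensorHom V ∘ₗ τ'.toLinearMap) := LinearMap.ext (pairRep_comul τ τ')
    rw [e, ← conv_assoc (E := End ℂ (V ⊗[ℂ] V')),
      antipode_conv (E := End ℂ (V ⊗[ℂ] V')), triv_conv (E := End ℂ (V ⊗[ℂ] V'))]
    rfl

/-- The carrier spaces are irreducible. -/
lemma isSimpleModule_carrier [IsSemisimpleRing G] [FiniteDimensional ℂ V] [FiniteDimensional ℂ V']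
    (hQ : Function.Bijective ((componentHom G G).flip Γ.Q))
    (hτ : IsIrreducibleRep τ) (hτ' : IsIrreducibleRep τ') :
    IsSimpleModule (CurrentAlgebra Γ (n + 1)) (CarrierModule Γ n τ τ') := by
  have h0 := hτ.1
  have h0' := hτ'.1
  have hφ := isVacuumMap_vacMap (n := n) hQ τ τ'
  have hG : Nontrivial G := ⟨1, 0, fun h => by
    have := congrArg (counit (R := ℂ)) h
    simp at this⟩
  have hpos : 0 < Module.finrank ℂ (Carrier G V V' (n + 1)) := by
    rw [finrank_carrier, Module.finrank_tensorProduct]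
    have := Module.finrank_pos (R := ℂ) (M := G)
    have := Module.finrank_pos (R := ℂ) (M := V)
    have := Module.finrank_pos (R := ℂ) (M := V')
    positivity
  have hnt : Nontrivial (CarrierModule Γ n τ τ') := Module.nontrivial_of_finrank_pos (R := ℂ)
    (M := Carrier G V V' (n + 1)) hpos
  refine { eq_bot_or_eq_top := fun P => or_iff_not_imp_left.mpr fun hP => ?_ }
  set D := CurrentAlgebra.data Γ (n + 1)
  have h1 : (P.restrictScalars ℂ).comap (vacMap Γ n τ τ') = ⊤ := by
    refine IsIrreducibleRep.eq_top_of_tensor hτ hτ' (fun a z hz => ?_) (fun b z hz => ?_) ?_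
    · rw [Submodule.mem_comap, ← hφ.p_smul]
      exact P.smul_mem _ hz
    · rw [Submodule.mem_comap, ← hφ.q_smul]
      exact P.smul_mem _ hz
    · intro hbot
      refine hP (le_bot_iff.mp (D.le_of_vac_le fun w hw hv => ?_))
      obtain ⟨z, rfl⟩ := vac_le_range τ τ' hv
      have : z ∈ (P.restrictScalars ℂ).comap (vacMap Γ n τ τ') := hw
      rw [hbot, Submodule.mem_bot] at this
      rw [this, map_zero]
      exact zero_mem _
  rw [eq_top_iff]
  refine D.le_of_vac_le fun w _ hv => ?_
  obtain ⟨z, rfl⟩ := vac_le_range τ τ' hv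
  exact (h1 ▸ Submodule.mem_top : z ∈ (P.restrictScalars ℂ).comap (vacMap Γ n τ τ'))

variable {τ τ'}

/-- A vacuum map extends to a homomorphism of the carrier space. -/
lemma IsVacuumMap.exists_hom [IsSemisimpleRing G] [FiniteDimensional ℂ V]
    [FiniteDimensional ℂ V'] {φ : V ⊗[ℂ] V' →ₗ[ℂ] H} (hφ : IsVacuumMap (n := n) hQ τ τ' φ) :
    ∃ T : CarrierModule Γ n τ τ' →ₗ[CurrentAlgebra Γ (n + 1)] H,
      ∀ z, T (vacMap Γ n τ τ' z) = φ z := by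
  set K := CurrentAlgebra Γ (n + 1)
  set D := CurrentAlgebra.data Γ (n + 1)
  have hψ := isVacuumMap_vacMap (n := n) hQ τ τ'
  obtain ⟨P, hVP, hfin, hP⟩ := exists_submodule (H := CarrierModule Γ n τ τ' × H) hQ
    (V₀ := LinearMap.range ((vacMap Γ n τ τ').prod φ))
    (by
      rintro _ ⟨z, rfl⟩ m hm ξ
      exact Prod.ext (hψ.mem_vac z m hm ξ) (hφ.mem_vac z m hm ξ))
    (by
      rintro ξ _ ⟨z, rfl⟩
      exact ⟨_, Prod.ext (hψ.p_smul ξ z).symm (hφ.p_smul ξ z).symm⟩)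
    (by
      rintro ξ _ ⟨z, rfl⟩
      exact ⟨_, Prod.ext (hψ.q_smul ξ z).symm (hφ.q_smul ξ z).symm⟩)
  set F : P →ₗ[K] CarrierModule Γ n τ τ' := LinearMap.fst K _ _ ∘ₗ P.subtype with hF
  have hmem : ∀ z, ((vacMap Γ n τ τ' z, φ z) : CarrierModule Γ n τ τ' × H) ∈ P :=
    fun z => hVP ⟨z, rfl⟩
  have hsurj : Function.Surjective F := by
    rw [← LinearMap.range_eq_top, eq_top_iff]
    refine D.le_of_vac_le fun w _ hv => ?_
    obtain ⟨z, rfl⟩ := vac_le_range τ τ' hv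
    exact ⟨⟨_, hmem z⟩, rfl⟩
  have hinj : Function.Injective F := by
    have h1 : Module.finrank ℂ P = Module.finrank ℂ (Carrier G V V' (n + 1)) := by
      refine le_antisymm (hP.trans ?_) ?_
      · rw [finrank_carrier]
        exact Nat.mul_le_mul_left _ (LinearMap.finrank_range_le _)
      · exact LinearMap.finrank_le_finrank_of_surjective (f := F.restrictScalars ℂ) hsurj
    exact (LinearMap.injective_iff_surjective_of_finrank_eq_finrank
      (f := F.restrictScalars ℂ) h1).mpr hsurj
  let e := LinearEquiv.ofBijective F ⟨hinj, hsurj⟩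
  refine ⟨(LinearMap.snd K _ _ ∘ₗ P.subtype) ∘ₗ e.symm.toLinearMap, fun z => ?_⟩
  have : e.symm (vacMap Γ n τ τ' z) = ⟨_, hmem z⟩ := by
    rw [LinearEquiv.symm_apply_eq]
    rfl
  change (((e.symm (vacMap Γ n τ τ' z) : P) : CarrierModule Γ n τ τ' × H)).2 = φ z
  rw [this]

variable {Λ : Type w} {V : Λ → Type v} [∀ I, NormedAddCommGroup (V I)]
  [∀ I, InnerProductSpace ℂ (V I)] [∀ I, FiniteDimensional ℂ (V I)] {τ : ∀ I, G →ₐ[ℂ] End ℂ (V I)}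

include hQ in
/-- Every module is the sum of images of the carrier spaces. -/
lemma IsIrrepList.iSup_range_eq_top [IsSemisimpleRing G] (hτ : IsIrrepList V τ) :
    (⨆ (I : Λ) (J : Λ) (T : CarrierModule Γ n (τ I) (τ J) →ₗ[CurrentAlgebra Γ (n + 1)] H),
      LinearMap.range T) = ⊤ := by
  set D := CurrentAlgebra.data Γ (n + 1)
  rw [eq_top_iff]
  refine D.le_of_vac_le fun w _ hv => ?_
  have key : ∀ x y : G, (D.p hQ x * D.q hQ y) • w ∈ (⨆ (I : Λ) (J : Λ)
      (T : CarrierModule Γ n (τ I) (τ J) →ₗ[CurrentAlgebra Γ (n + 1)] H),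
      LinearMap.range T).restrictScalars ℂ := by
    intro x y
    induction hτ.mem_span x using Submodule.span_induction with
    | zero => simp
    | add a b _ _ ha hb =>
      rw [map_add, add_mul, add_smul]
      exact Submodule.add_mem _ ha hb
    | smul c a _ ha =>
      rw [map_smul, smul_mul_assoc, smul_assoc]
      exact Submodule.smul_mem _ _ ha
    | mem x hx =>
      obtain ⟨I, f, hf, a, rfl⟩ := hx
      induction hτ.mem_span y using Submodule.span_induction with
      | zero => simp
      | add a b _ _ ha hb =>
        rw [map_add, mul_add, add_smul]
        exact Submodule.add_mem _ ha hb
      | smul c a _ ha =>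
        rw [map_smul, mul_smul_comm, smul_assoc]
        exact Submodule.smul_mem _ _ ha
      | mem y hy =>
        obtain ⟨J, g, hg, b, rfl⟩ := hy
        let φ : V I ⊗[ℂ] V J →ₗ[ℂ] H :=
          (LinearMap.toSpanSingleton (CurrentAlgebra Γ (n + 1)) H w).restrictScalars ℂ ∘ₗ
            ev (D.p hQ ∘ₗ f) (D.q hQ ∘ₗ g)
        have hφ_tmul : ∀ a b, φ (a ⊗ₜ b) = (D.p hQ (f a) * D.q hQ (g b)) • w := fun a b => by
          change ev (D.p hQ ∘ₗ f) (D.q hQ ∘ₗ g) (a ⊗ₜ b) • w = _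
          rw [ev_tmul]
          rfl
        have hφ : IsVacuumMap (n := n) hQ (τ I) (τ J) φ := by
          refine ⟨fun z => ?_, fun ξ z => ?_, fun ξ z => ?_⟩
          · induction z with
            | zero => rw [map_zero]; exact zero_mem _
            | add x y hx hy => rw [map_add]; exact add_mem hx hy
            | tmul a b =>
              intro m hm ξ
              rw [hφ_tmul, ← mul_smul, ← mul_assoc, (D.commute_T_p hQ hm ξ _).eq, mul_assoc,
                (D.commute_T_q hQ hm ξ _).eq, ← mul_assoc, mul_smul, hv m hm, smul_comm]
          · induction z with
            | tmul a b =>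
              rw [LinearMap.rTensor_tmul, hφ_tmul, hφ_tmul, hf, mm_mul (D.p hQ), ← mul_smul,
                ← mul_assoc]
            | _ => simp_all [smul_add]
          · induction z with
            | tmul a b =>
              rw [LinearMap.lTensor_tmul, hφ_tmul, hφ_tmul, hg, mm_mul (D.q hQ), ← mul_smul,
                ← mul_assoc, ← mul_assoc, (comm_of (D.p hQ) (D.q hQ) _ _).eq]
            | _ => simp_all [smul_add]
        obtain ⟨T, hT⟩ := hφ.exists_hom
        refine (le_iSup_of_le I (le_iSup_of_le J (le_iSup_of_le T le_rfl)) :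
          LinearMap.range T ≤ _) ⟨vacMap Γ n (τ I) (τ J) (a ⊗ₜ b), ?_⟩
        rw [hT, hφ_tmul]
  have := key 1 1
  rwa [mm_one, mm_one, one_mul, one_smul] at this

include hQ in
/-- The carrier spaces form a faithful family of representations. -/
lemma IsIrrepList.carrier_faithful [IsSemisimpleRing G] (hτ : IsIrrepList V τ)
    {x : CurrentAlgebra Γ (n + 1)} (hx : ∀ I J, carrierRep Γ n (τ I) (τ J) x = 0) : x = 0 := by
  let P : Submodule (CurrentAlgebra Γ (n + 1)) (CurrentAlgebra Γ (n + 1)) :=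
    { carrier := {y | ∀ z, x * z * y = 0}
      add_mem' := fun hx hy z => by rw [mul_add, hx, hy, add_zero]
      zero_mem' := fun z => mul_zero _
      smul_mem' := fun a y hy z => by rw [smul_eq_mul, ← mul_assoc, mul_assoc x, hy] }
  have h : (⨆ (I : Λ) (J : Λ) (T : CarrierModule Γ n (τ I) (τ J) →ₗ[CurrentAlgebra Γ (n + 1)]
      CurrentAlgebra Γ (n + 1)),
      LinearMap.range T) ≤ P := by
    refine iSup_le fun I => iSup_le fun J => iSup_le fun T => ?_
    rintro _ ⟨w, rfl⟩ z
    have : (x * z) • w = 0 := (RepSpace.equiv _).injective (by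
      rw [RepSpace.equiv_smul, map_mul, hx, zero_mul]; rfl)
    rw [← smul_eq_mul, ← map_smul, this, map_zero]
  rw [hτ.iSup_range_eq_top hQ] at h
  simpa using h (Submodule.mem_top (x := 1)) 1

end Modules

/-! ## Involutions -/

/-- The linear map `f` commutes with the involutions. -/
class IsStarMap {B E : Type*} [AddCommMonoid B] [Module ℂ B] [Star B] [AddCommMonoid E] [Module ℂ E]
    [Star E] (f : B →ₗ[ℂ] E) : Prop where
  protected map_star : ∀ x, f (star x) = star (f x)

section Star

variable {C D : Type*} [StarRing B] [StarModule ℂ B] [Ring C] [Algebra ℂ C] [StarRing C]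
  [StarModule ℂ C] [StarRing E] [StarModule ℂ E]

lemma map_star' (f : B →ₗ[ℂ] E) [h : IsStarMap f] (x : B) : f (star x) = star (f x) := h.map_star x

instance (f : B →ₗ[ℂ] C) (g : C →ₗ[ℂ] E) [IsStarMap f] [IsStarMap g] : IsStarMap (g ∘ₗ f) :=
  ⟨fun x => by simp [map_star']⟩

instance : IsStarMap (inl G E) := ⟨fun x => by simp [TensorProduct.star_tmul]⟩

instance : IsStarMap (inr G E) := ⟨fun x => by simp [TensorProduct.star_tmul]⟩

/-- If `f` is a star map with respect to the involution twisted by `Ω`, then so is `f · g`. -/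
lemma star_ev_mul {Ω : E} (f : B →ₗ[ℂ] E) (g : C →ₗ[ℂ] E) [Comm f g] [IsStarMap g]
    (hf : ∀ x, star (f x) * Ω = Ω * f (star x)) (hg : ∀ x, Commute (g x) Ω) (X : B ⊗[ℂ] C) :
    star (ev f g X) * Ω = Ω * ev f g (star X) := by
  induction X with
  | tmul x y =>
    rw [TensorProduct.star_tmul, ev_tmul, ev_tmul, star_mul, mul_assoc, hf, ← map_star' g,
      ← mul_assoc, (hg _).eq, mul_assoc, (comm_of f g _ _).eq]
  | _ => simp_all [add_mul, mul_add]

lemma star_ev_mul' {Ω : E} (f : B →ₗ[ℂ] E) (g : C →ₗ[ℂ] E) [Comm f g] [IsStarMap g]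
    (hf : ∀ x, star (f x) * Ω = Ω * f (star x)) (hg : ∀ x, Commute (g x) Ω) (X : C ⊗[ℂ] B) :
    star (ev g f X) * Ω = Ω * ev g f (star X) := by
  induction X with
  | tmul x y =>
    rw [TensorProduct.star_tmul, ev_tmul, ev_tmul, star_mul, ← map_star' g, mul_assoc, (hg _).eq,
      ← mul_assoc, hf, mul_assoc, (comm_of g f _ _).eq]
  | _ => simp_all [add_mul, mul_add]

lemma star_ev (f : B →ₗ[ℂ] E) (g : C →ₗ[ℂ] E) [Comm f g] [IsStarMap f] [IsStarMap g]
    (X : B ⊗[ℂ] C) : star (ev f g X) = ev f g (star X) := by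
  simpa using star_ev_mul (Ω := 1) f g (fun x => by simp [map_star']) (fun x => .one_right _) X

instance (f : B →ₗ[ℂ] E) (g : C →ₗ[ℂ] E) [Comm f g] [IsStarMap f] [IsStarMap g] :
    IsStarMap (ev f g) := ⟨fun X => (star_ev f g X).symm⟩

namespace RibbonStar

variable (Γ) (f g h k : G →ₗ[ℂ] E)

lemma star_R_inv : star (Γ.R⁻¹).1 = flipTensor G Γ.R := by
  have h1 : star (Γ.R⁻¹).1 * star Γ.R.1 = 1 := by rw [← star_mul, Units.mul_inv, star_one]
  refine left_inv_eq_right_inv h1 ?_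
  rw [Γ.star_R, ← map_mul, Units.inv_mul, map_one]

lemma star_r [Comm f g] [IsStarMap f] [IsStarMap g] : star (Γ.r f g) = Γ.ri g f := by
  rw [r, star_ev, Γ.star_R, ev_flip, ri]

lemma star_ri [Comm f g] [IsStarMap f] [IsStarMap g] : star (Γ.ri f g) = Γ.r g f := by
  rw [ri, star_ev, star_R_inv, ev_flip, r]

lemma star_v [IsMulMap f] [IsStarMap f] : star (f Γ.v.1) = f (Γ.v⁻¹).1 := by
  rw [← map_star']
  congr 1
  exact left_inv_eq_right_inv (Unitary.mem_iff.mp Γ.v_unitary).1 (Units.mul_inv _)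

/-- A central square root of the ribbon element for which the twist is self-adjoint. -/
structure IsStarRoot (κ : Gˣ) : Prop extends Γ.IsRoot κ where
  star_twist : star (Γ.twist κ).1 = Γ.twist κ
  counit : counit (R := ℂ) (κ : G) = 1

variable {Γ} {κ : Gˣ}

variable [IsMulMap f] [IsMulMap g] [IsMulMap h] [IsMulMap k] [Comm f g] [Comm f h] [Comm g h]
  [Comm f k] [Comm g k] [Comm h k]

omit [StarRing E] [StarModule ℂ E] in
lemma IsRoot.conv_mul_si (hκ : Γ.IsRoot κ) (ξ : G) :
    conv g f ξ * Γ.si κ f g = Γ.si κ f g * conv f g ξ := by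
  rw [← hκ.s_flip f g, s_eq, mul_assoc _ _ (conv f g ξ), ← RibbonStar.conv_mul_ri]
  have h1 : Commute (conv g f ξ) (conv g f (κ⁻¹).1) :=
    commute_central (conv g f) (central_inv hκ.central) ξ
  have h2 : Commute (conv g f ξ) (g (κ : G)) := (hκ.commute_r g f _).symm
  have h3 : Commute (conv g f ξ) (f (κ : G)) := (hκ.commute_r' g f _).symm
  rw [← mul_assoc, (h1.mul_right (h2.mul_right h3)).eq, mul_assoc]

lemma si_conv_mul_r : Γ.si κ (conv g f) h * Γ.r f g = Γ.r f g * Γ.si κ (conv f g) h :=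
  (Γ.r_mul_ev_conv f g h _).symm

/-- `S_{fg}⁻¹ S_{fg,h}⁻¹ S_{fgh,k}⁻¹` with a variable moved to the left. -/
lemma IsRoot.si_move (hκ : Γ.IsRoot κ) :
    Γ.s κ h g * (Γ.si κ f (conv g h) * Γ.si κ (conv f (conv g h)) k) =
      Γ.si κ h k * (Γ.si κ f g * Γ.si κ (conv f g) (conv h k)) := by
  have c : Commute (Γ.si κ h k) (Γ.si κ f g) := comm_of (ev h k) (ev f g) _ _
  rw [← mul_assoc (Γ.si κ h k), c.eq, mul_assoc, ← hκ.si_assoc (conv f g) h k, ← conv_assoc,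
    ← mul_assoc (Γ.si κ f g), hκ.si_assoc f g h, conv_assoc, hκ.s_flip g h, mul_assoc]

lemma IsRoot.r_mul_r_mul_si (hκ : Γ.IsRoot κ) :
    Γ.r f g * Γ.r g f * Γ.si κ f g = Γ.si κ f g * (Γ.r g f * Γ.r f g) := by
  have c1 : Commute (Γ.si κ f g) (f Γ.v.1) := Γ.commute_si f g κ
    (fun x => commute_central f Γ.v_central x) (fun x => comm_of g f x _)
  have c2 : Commute (Γ.si κ f g) (g Γ.v.1) := Γ.commute_si f g κ
    (fun x => comm_of f g x _) (fun x => commute_central g Γ.v_central x)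
  rw [Γ.isRibbon_v.ev_eq f g, Γ.isRibbon_v.ev_eq g f, mul_assoc, hκ.conv_mul_si f g, ← mul_assoc,
    ← mul_assoc, ← (c2.mul_right c1).eq, (comm_of f g Γ.v.1 Γ.v.1).eq]

lemma commute_r_mul_r (ξ : G) : Commute (conv f g ξ) (Γ.r g f * Γ.r f g) := by
  rw [commute_iff_eq, mul_assoc, Γ.r_mul_conv f g, ← mul_assoc, ← mul_assoc, Γ.r_mul_conv g f]

/-- The identity behind the behaviour of the last link under the involution. -/
lemma IsRoot.si_core (hκ : Γ.IsRoot κ) :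
    Γ.ri g f * (Γ.ri h f * Γ.ri f h) * (Γ.si κ g f * Γ.si κ (conv g f) h *
      Γ.si κ (conv (conv g f) h) k) * ((Γ.r h f * Γ.r f h) * Γ.r f g) =
      Γ.si κ g h * Γ.si κ (conv g h) k * Γ.si κ f (conv (conv g h) k) := by
  have e1 : Commute (Γ.si κ (conv (conv g f) h) k) (Γ.r h f * Γ.r f h) := by
    rw [conv_assoc]
    refine Γ.commute_si _ _ κ (fun x => commute_ev _ _ _ _ (fun y => ?_) fun y =>
      commute_r_mul_r f h y) fun x => ?_
    · exact (comm_of g (ev h f) y _).mul_right (comm_of g (ev f h) y _)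
    · exact (comm_of k (ev h f) x _).mul_right (comm_of k (ev f h) x _)
  have e2 : Γ.si κ (conv (conv g f) h) k * Γ.r f g = Γ.r f g * Γ.si κ (conv (conv f g) h) k :=
    (ev_conj_left (conv (conv f g) h) (conv (conv g f) h) _ _ (fun ξ => Γ.r_mul_ev_conv f g h _)
      (fun ξ => comm_of k (ev f g) ξ _)
      _).symm
  have e4 : Commute (Γ.si κ g (conv f h)) (Γ.r h f * Γ.r f h) :=
    Γ.commute_si _ _ κ (fun y => (comm_of g (ev h f) y _).mul_right (comm_of g (ev f h) y _))
      fun y => commute_r_mul_r f h y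
  have e5 : Γ.ri h f * (Γ.ri f h * (Γ.si κ f h * (Γ.r h f * Γ.r f h))) = Γ.si κ f h := by
    rw [← hκ.r_mul_r_mul_si f h, mul_assoc, reassoc (Γ.ri_mul_r f h), one_mul,
      reassoc (Γ.ri_mul_r h f), one_mul]
  have e7 : Γ.ri g f * (Γ.si κ g f * Γ.r f g) = Γ.si κ f g := by
    rw [← hκ.s_mul_r_mul_s g f, ← mul_assoc, ← mul_assoc, mul_assoc (Γ.ri g f),
      ← mul_assoc (Γ.si κ g f), Γ.si_mul_s, one_mul, Γ.ri_mul_r, one_mul, hκ.s_flip f g]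
  calc _ = Γ.ri g f * (Γ.ri h f * (Γ.ri f h * (Γ.si κ g f * Γ.si κ (conv g f) h *
        (Γ.r h f * Γ.r f h)))) * Γ.r f g * Γ.si κ (conv (conv f g) h) k := by
        simp only [mul_assoc]
        rw [← e2, ← mul_assoc (Γ.r h f), ← mul_assoc (Γ.si κ (conv (conv g f) h) k), e1.eq]
        simp only [mul_assoc]
    _ = Γ.ri g f * (Γ.si κ g f * Γ.si κ (conv g f) h) * Γ.r f g * Γ.si κ (conv (conv f g) h) k := by
        rw [hκ.si_assoc g f h, mul_assoc (Γ.si κ f h), e4.eq, ← mul_assoc (Γ.si κ f h),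
          ← mul_assoc (Γ.ri f h), ← mul_assoc (Γ.ri h f), e5]
    _ = Γ.ri g f * (Γ.si κ g f * Γ.r f g) * Γ.si κ (conv f g) h * Γ.si κ (conv (conv f g) h) k := by
        simp only [mul_assoc]
        rw [reassoc₂ (si_conv_mul_r f g h)]
    _ = _ := by
        rw [e7, hκ.si_assoc f g h, mul_assoc, conv_assoc f g h, hκ.si_assoc f (conv g h) k,
          mul_assoc]

/-- The twisted involution for which the product of `f` and `g` is a star map. -/
lemma IsStarRoot.star_conv_mul (hκ : Γ.IsStarRoot κ) {Ω : E} [IsStarMap g]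
    (hf : ∀ x, star (f x) * Ω = Ω * f (star x)) (hg : ∀ x, Commute (g x) Ω) (ξ : G) :
    star (conv f g ξ) * (Ω * Γ.si κ f g) = Ω * Γ.si κ f g * conv f g (star ξ) := by
  rw [← mul_assoc, conv_apply, star_ev_mul f g hf hg, Γ.star_comul, ev_flip, ← conv_apply,
    mul_assoc, mul_assoc, hκ.conv_mul_si f g]

end RibbonStar

end Star

/-! ## The involution of a chain of links -/

section ChainStar

variable {κ : Gˣ} [StarRing B] [StarModule ℂ B] [StarRing E] [StarModule ℂ E]

lemma RibbonStar.counit_star (Γ : RibbonStar G) (ξ : G) :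
    counit (R := ℂ) (star ξ) = star (counit (R := ℂ) ξ) := by
  let e : G →ₗ[ℂ] ℂ :=
    { toFun := fun ξ => star (counit (R := ℂ) (star ξ))
      map_add' := by simp
      map_smul' := by simp }
  let e' : G →ₗ[ℂ] G := Algebra.linearMap ℂ G ∘ₗ e
  have h : ∀ X : G ⊗[ℂ] G, star (ev LinearMap.id e' X) = ev LinearMap.id (triv G G) (star X) := by
    intro X
    induction X with
    | tmul x y => simp [e', e, TensorProduct.star_tmul, Algebra.algebraMap_eq_smul_one]
    | _ => simp_all
  have h1 : conv LinearMap.id e' = LinearMap.id := LinearMap.ext fun ξ => star_injective (by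
    rw [conv_apply, h, Γ.star_comul, ev_flip, ← conv_apply, triv_conv]; rfl)
  have h2 : triv G G = e' := by rw [← triv_conv e', ← antipode_conv LinearMap.id, conv_assoc, h1]
  have h3 := congrArg (counit (R := ℂ)) (LinearMap.congr_fun h2 ξ)
  simp only [e', e, triv_apply, comp_apply, Algebra.linearMap_apply,
    Bialgebra.counit_algebraMap, LinearMap.coe_mk, AddHom.coe_mk] at h3
  rw [h3, star_star]

lemma RibbonStar.IsStarRoot.triv_si (hκ : Γ.IsStarRoot κ) (f : G →ₗ[ℂ] E) [IsMulMap f] :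
    Γ.si κ (triv G E) f = 1 := by
  have h := Γ.si_mul_s (triv G E) f κ
  rwa [RibbonStar.s_eq, triv_conv, Γ.triv_ri, triv_apply, hκ.counit, map_one, one_mul, mul_one,
    RibbonStar.mm_unit_inv_mul, mul_one] at h

omit [StarRing E] [StarModule ℂ E] in
lemma RibbonStar.si_ev {C : Type*} [Ring C] [Algebra ℂ C] (j : C →ₗ[ℂ] E) [IsMulMap j]
    (f g : G →ₗ[ℂ] C) : j (Γ.si κ f g) = Γ.si κ (j ∘ₗ f) (j ∘ₗ g) := map_ev j f g _

/-- The compatibility of a link with an involution. -/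
structure Link.IsStarLink (d : Link Γ B) (κ : Gˣ) : Prop where
  star_t : IsStarMap d.t
  star_s : IsStarMap d.s
  star_U : star d.U * Γ.si κ (inl G B) (inr G B ∘ₗ d.s) * d.U = Γ.si κ (inl G B) (inr G B ∘ₗ d.t)

namespace Link

variable {d : Link Γ B}

section

variable (a : G →ₗ[ℂ] E) (x : B →ₗ[ℂ] E) [IsMulMap a] [IsMulMap x] [Comm a x] [IsStarMap a]
  [IsStarMap x]

lemma IsStarLink.star_u (hd : d.IsStarLink κ) : star (ev a x d.U) * Γ.si κ a (x ∘ₗ d.s) *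
    ev a x d.U = Γ.si κ a (x ∘ₗ d.t) := by
  have h := congrArg (ev a x) hd.star_U
  rwa [mm_mul (ev a x), mm_mul (ev a x), map_star', RibbonStar.si_ev, RibbonStar.si_ev,
    ev_comp_inl, ev_comp_inr_comp, ev_comp_inr_comp] at h

lemma IsStarLink.star_left (hd : d.IsStarLink κ) (hκ : Γ.IsStarRoot κ) :
    star (d.left a x) * Γ.si κ a (x ∘ₗ d.t) * d.left a x = Γ.s κ a (x ∘ₗ d.s) := by
  have := hd.star_s
  have h1 : star (ev a x d.Ui) * (Γ.si κ a (x ∘ₗ d.t) * ev a x d.Ui) = Γ.si κ a (x ∘ₗ d.s) := by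
    rw [← hd.star_u a x]
    simp only [mul_assoc]
    rw [d.u_mul_ui a x, mul_one, ← mul_assoc, ← star_mul, d.u_mul_ui a x, star_one, one_mul]
  have h2 : a (Γ.v⁻¹).1 * (Γ.si κ a (x ∘ₗ d.t) * (a Γ.v.1 * (ev a x d.Ui * Γ.ri a (x ∘ₗ d.s)))) =
      Γ.si κ a (x ∘ₗ d.t) * (ev a x d.Ui * Γ.ri a (x ∘ₗ d.s)) := by
    have c : Commute (Γ.si κ a (x ∘ₗ d.t)) (a Γ.v.1) := Γ.commute_si _ _ κ
      (fun y => RibbonStar.commute_central a Γ.v_central y) fun y => comm_of (x ∘ₗ d.t) a y _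
    rw [reassoc₂ c.eq, reassoc (RibbonStar.mm_unit_inv_mul a Γ.v), one_mul]
  rw [left, star_mul, star_mul, Γ.star_v a, Γ.star_ri]
  simp only [mul_assoc]
  rw [h2, ← mul_assoc (Γ.si κ a (x ∘ₗ d.t)), ← mul_assoc (star (ev a x d.Ui)), h1,
    ← hκ.s_mul_r_mul_s a (x ∘ₗ d.s), ← mul_assoc, mul_assoc _ (Γ.s κ a (x ∘ₗ d.s)),
    Γ.s_mul_si, mul_one, mul_assoc, Γ.r_mul_ri, mul_one]

end

variable (d) (κ) (y : ℕ → (B →ₗ[ℂ] E)) (p q a : G →ₗ[ℂ] E) (n : ℕ)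

/-- The operator that relates the involutions on a chain of sources. -/
def omega : ℕ → E
  | 0 => 1
  | k + 1 => omega k * Γ.si κ (d.theta y k) (y k ∘ₗ d.s)

/-- The operator that defines the inner product of the chain. -/
def form : E := d.omega κ y n * Γ.si κ (d.theta y n) p * Γ.si κ (conv (d.theta y n) p) q

variable {d κ y p q a n}

lemma commute_omega {z : E} (k : ℕ) (hf : ∀ i < k, ∀ ξ, Commute (y i (d.s ξ)) z) :
    Commute (d.omega κ y k) z := by
  induction k with
  | zero => exact Commute.one_left z
  | succ k ih =>
    exact (ih fun i hi => hf i (hi.trans k.lt_succ_self)).mul_left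
      (Γ.commute_si _ _ κ (commute_theta k fun i hi => hf i (hi.trans k.lt_succ_self))
        (hf k k.lt_succ_self))

lemma commute_form {z : E} (hf : ∀ i < n, ∀ ξ, Commute (y i (d.s ξ)) z)
    (hp : ∀ ξ, Commute (p ξ) z) (hq : ∀ ξ, Commute (q ξ) z) : Commute (d.form κ y p q n) z :=
  ((commute_omega n hf).mul_left (Γ.commute_si _ _ κ (commute_theta n hf) hp)).mul_left
    (Γ.commute_si _ _ κ (fun ξ => commute_ev _ _ _ _ (commute_theta n hf) hp) hq)

variable (hκ : Γ.IsStarRoot κ) (hd : d.IsStarLink κ) (h : IsChain n y p q)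
  (hy : ∀ k < n, IsStarMap (y k)) [IsStarMap p] [IsStarMap q]
include hκ hd h hy

lemma star_theta_mul_omega (k : ℕ) (hk : k ≤ n) (ξ : G) :
    star (d.theta y k ξ) * d.omega κ y k = d.omega κ y k * d.theta y k (star ξ) := by
  induction k generalizing ξ with
  | zero =>
    change star (algebraMap ℂ E _) * 1 = 1 * algebraMap ℂ E _
    rw [mul_one, one_mul, ← algebraMap_star_comm, Γ.counit_star]
  | succ k ih =>
    have := theta_mul (d := d) h k (by omega)
    have := h.mul k hk
    have := hy k hk
    have := hd.star_s
    have : Comm (d.theta y k) (y k) := theta_comm _ k fun i hi => h.comm i (hi.trans hk) k hk hi.ne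
    refine hκ.star_conv_mul (d.theta y k) (y k ∘ₗ d.s) (ih (by omega)) (fun ξ => ?_) ξ
    refine (commute_omega k fun i hi η => ?_).symm
    have := h.comm i (hi.trans hk) k hk hi.ne
    exact comm_of (y i) (y k) _ _

lemma star_base_mul_form (ξ : G) : star (d.chainSite y p q n n ξ) * d.form κ y p q n =
    d.form κ y p q n * d.chainSite y p q n n (star ξ) := by
  have := h.mul_p
  have := h.mul_q
  have := h.comm_pq
  have := theta_mul (d := d) h n le_rfl
  obtain ⟨_, _⟩ := comm_pq_theta (d := d) h n le_rfl
  rw [chainSite, if_neg (lt_irrefl _), ← conv_assoc]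
  refine hκ.star_conv_mul _ q (hκ.star_conv_mul _ p
    (star_theta_mul_omega hκ hd h hy n le_rfl) fun ξ => ?_) (fun ξ => ?_) ξ
  · refine (commute_omega n fun i hi η => ?_).symm
    have := h.comm_p i hi
    exact comm_of (y i) p _ _
  · refine ((commute_omega n fun i hi η => ?_).mul_left (comm_of (ev (d.theta y n) p) q _ _)).symm
    have := h.comm_q i hi
    exact comm_of (y i) q _ _

lemma star_site_mul_form {m : ℕ} (hm : m < n) (ξ : G) :
    star (d.chainSite y p q n m ξ) * d.form κ y p q n =
      d.form κ y p q n * d.chainSite y p q n m (star ξ) := by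
  have := hy m hm
  have := hd.star_t
  have := h.mul m hm
  rw [chainSite, if_pos hm, ← map_star' (y m ∘ₗ d.t)]
  refine (commute_form (fun i hi η => ?_) (fun η => ?_) fun η => ?_).eq.symm
  · by_cases him : i = m
    · subst him
      exact comm_of (y i ∘ₗ d.s) (y i ∘ₗ d.t) _ _
    · have := h.comm i hi m hm him
      exact comm_of (y i) (y m) _ _
  · have := h.comm_p m hm
    exact comm_of p (y m) _ _
  · have := h.comm_q m hm
    exact comm_of q (y m) _ _

omit hd h hy [IsStarMap p] [IsStarMap q] hκ in
lemma star_mul_step (hκ : Γ.IsRoot κ) {U W X : E} {θ z : G →ₗ[ℂ] E} [IsMulMap a] [IsMulMap θ]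
    [IsMulMap z] [Comm a θ] [Comm a z] [Comm θ z]
    (hU : star U * (W * Γ.si κ a θ) * U = W * X) (hz : ∀ ξ, Commute (z ξ) U)
    (hθ : ∀ ξ, conv a θ ξ * U = U * θ ξ) (hX : Commute X (Γ.si κ θ z)) :
    star U * (W * Γ.si κ θ z * Γ.si κ a (conv θ z)) * U = W * Γ.si κ θ z * X := by
  have e : Γ.si κ (conv a θ) z * U = U * Γ.si κ θ z :=
    (ev_conj_left θ (conv a θ) z U (fun ξ => (hθ ξ).symm) hz _).symm
  rw [mul_assoc W, ← hκ.si_assoc a θ z, ← mul_assoc W, ← mul_assoc, mul_assoc _ _ U, e, ← mul_assoc,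
    hU, mul_assoc, hX.eq, mul_assoc]

variable (ha : Off n y p q a) [IsStarMap a]
include ha

lemma star_link_zero (hn : n ≠ 0) :
    star (d.chainLink y p n a 0) * (d.form κ y p q n * Γ.si κ a (d.chainSite y p q n n)) *
      d.chainLink y p n a 0 = d.form κ y p q n * Γ.si κ a (d.chainSite y p q n 0) := by
  have hn' := Nat.pos_of_ne_zero hn
  have := ha.mul
  have := h.mul 0 hn'
  have := ha.comm 0 hn'
  have := hy 0 hn'
  have := ha.comm_p
  have := ha.comm_q
  have := h.mul_p
  have := h.mul_q
  have := h.comm_pq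
  have := theta_mul (d := d) h n le_rfl
  obtain ⟨_, _⟩ := comm_pq_theta (d := d) h n le_rfl
  have := off_theta (d := d) ha n le_rfl
  simp only [chainLink, chainSite, if_pos hn', if_neg (lt_irrefl n), pre, one_mul]
  set U := ev a (y 0) d.U
  set X := Γ.si κ a (y 0 ∘ₗ d.t)
  have cX : ∀ f g : G →ₗ[ℂ] E, (∀ ξ, ∀ z, Commute (f ξ) (a z) ∧ Commute (f ξ) (y 0 (d.t z))) →
      (∀ ξ, ∀ z, Commute (g ξ) (a z) ∧ Commute (g ξ) (y 0 (d.t z))) →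
      Commute X (Γ.si κ f g) := fun f g hf hg =>
    Γ.commute_si _ _ κ
      (fun z => (Γ.commute_si _ _ κ (fun ξ => (hf ξ z).1) fun ξ => (hg ξ z).1).symm)
      (fun z => (Γ.commute_si _ _ κ (fun ξ => (hf ξ z).2) fun ξ => (hg ξ z).2).symm)
  have cθ : ∀ k ≤ n, ∀ ξ z, Commute (d.theta y k ξ) (a z) ∧
      Commute (d.theta y k ξ) (y 0 (d.t z)) := fun k hk ξ z => by
    have := off_theta (d := d) ha k hk
    exact ⟨comm_of (d.theta y k) a _ _, commute_t_theta h ha hn' hk _ _⟩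
  have cp : ∀ ξ z, Commute (p ξ) (a z) ∧ Commute (p ξ) (y 0 (d.t z)) := fun ξ z => by
    have := h.comm_p 0 hn'
    exact ⟨comm_of p a _ _, comm_of p (y 0) _ _⟩
  have cq : ∀ ξ z, Commute (q ξ) (a z) ∧ Commute (q ξ) (y 0 (d.t z)) := fun ξ z => by
    have := h.comm_q 0 hn'
    exact ⟨comm_of q a _ _, comm_of q (y 0) _ _⟩
  have key : ∀ k < n, star U * (d.omega κ y (k + 1) * Γ.si κ a (d.theta y (k + 1))) * U =
      d.omega κ y (k + 1) * X := by
    intro k hk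
    induction k with
    | zero =>
      have e : d.theta y 1 = y 0 ∘ₗ d.s := triv_conv _
      have e' : d.omega κ y 1 = 1 := by
        change 1 * Γ.si κ (triv G E) _ = 1
        rw [one_mul, hκ.triv_si]
      rw [e, e', one_mul, one_mul]
      exact hd.star_u a (y 0)
    | succ k ih =>
      have := theta_mul (d := d) h (k + 1) hk.le
      have := h.mul (k + 1) hk
      have := off_theta (d := d) ha (k + 1) hk.le
      have := ha.comm (k + 1) hk
      have : Comm (d.theta y (k + 1)) (y (k + 1)) :=
        theta_comm _ _ fun i hi => h.comm i (hi.trans hk) _ hk hi.ne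
      refine star_mul_step hκ.toIsRoot (ih (by omega)) (fun ξ => ?_)
        (conv_theta_mul_u h ha (k + 1) hk.le (by omega)) (cX _ _ (cθ _ hk.le) fun ξ z => ?_)
      · exact commute_y_u h ha hk hn' (by omega) _ _
      · have := h.comm (k + 1) hk 0 hn' (by omega)
        exact ⟨comm_of (y (k + 1)) a _ _, comm_of (y (k + 1)) (y 0) _ _⟩
  have k1 := key (n - 1) (by omega)
  rw [Nat.sub_add_cancel hn'] at k1
  have c1 := conv_theta_mul_u (d := d) h ha n le_rfl hn
  have k2 := star_mul_step hκ.toIsRoot k1 (fun ξ => (commute_pq_u h ha hn' d.U ξ).1) c1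
    (cX _ _ (cθ n le_rfl) cp)
  have k3 := star_mul_step hκ.toIsRoot k2 (fun ξ => (commute_pq_u h ha hn' d.U ξ).2) (fun ξ => by
      rw [← conv_assoc]
      exact conv_conj_left _ _ _ _ c1 (fun ξ => (commute_pq_u h ha hn' d.U ξ).1) ξ)
    (cX _ _ (fun ξ z => ⟨commute_ev _ _ _ _ (fun x => (cθ n le_rfl x z).1) fun x => (cp x z).1,
      commute_ev _ _ _ _ (fun x => (cθ n le_rfl x z).2) fun x => (cp x z).2⟩) cq)
  rwa [conv_assoc] at k3

omit hκ hd h hy [IsStarMap p] [IsStarMap q] ha [IsStarMap a] in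
lemma star_mul_commute {J W X X' z : E} (hJ : star J * (W * X) * J = W * X')
    (hz : Commute z J) (hX : Commute z X) (hX' : Commute z X') :
    star J * (W * z * X) * J = W * z * X' := by
  rw [mul_assoc W, hX.eq, ← mul_assoc W, mul_assoc, mul_assoc _ z, hz.eq, ← mul_assoc, ← mul_assoc,
    hJ, mul_assoc, ← hX'.eq, ← mul_assoc]

lemma star_left_form {l : ℕ} (hl : l < n) (W : E) (W' : E)
    (hW : W * d.left a (y l) = d.left a (y l) * W')
    (hWt : Commute W (Γ.si κ a (y l ∘ₗ d.t))) :
    star (d.left a (y l)) * (W * Γ.si κ a (y l ∘ₗ d.t)) * d.left a (y l) =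
      Γ.si κ (y l ∘ₗ d.s) a * W' := by
  have := ha.mul
  have := h.mul l hl
  have := ha.comm l hl
  have := hy l hl
  rw [hWt.eq, mul_assoc, mul_assoc (Γ.si κ a _), hW, ← mul_assoc (Γ.si κ a _), ← mul_assoc,
    ← mul_assoc (star _), hd.star_left a (y l) hκ, hκ.s_flip (y l ∘ₗ d.s) a]

lemma commute_site_aux {l k : ℕ} (hl : l < n) (hk : k ≤ n) (ξ : G) :
    Commute (d.theta y k ξ) (Γ.si κ a (y l ∘ₗ d.t)) := by
  have := off_theta (d := d) ha k hk
  exact (Γ.commute_si _ _ κ (fun η => comm_of a (d.theta y k) _ _)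
    fun η => (commute_t_theta h ha hl hk _ _).symm).symm

lemma commute_omega_site {l k : ℕ} (hl : l < n) (hk : k ≤ n) :
    Commute (d.omega κ y k) (Γ.si κ a (y l ∘ₗ d.t)) := by
  have := h.mul l hl
  refine commute_omega k fun i hi ξ => ?_
  have := ha.comm i (by omega)
  refine (Γ.commute_si _ _ κ (fun η => comm_of a (y i) _ _) fun η => ?_).symm
  by_cases e : i = l
  · subst e
    exact comm_of (y i ∘ₗ d.t) (y i ∘ₗ d.s) _ _
  · have := h.comm i (by omega) l hl e
    exact comm_of (y l) (y i) _ _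

lemma star_link_succ {l : ℕ} (hl : l + 1 < n) :
    star (d.chainLink y p n a (l + 1)) * (d.form κ y p q n * Γ.si κ a (d.chainSite y p q n l)) *
      d.chainLink y p n a (l + 1) =
      d.form κ y p q n * Γ.si κ a (d.chainSite y p q n (l + 1)) := by
  have := ha.mul
  have := h.mul l (by omega)
  have := h.mul (l + 1) hl
  have := h.comm l (by omega) (l + 1) hl (by omega)
  have := ha.comm l (by omega)
  have := ha.comm (l + 1) hl
  have := hy (l + 1) hl
  have := theta_mul (d := d) h l (by omega)
  have := off_theta (d := d) ha l (by omega)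
  have : Comm (d.theta y l) (y l) :=
    theta_comm _ _ fun i hi => h.comm i (by omega) _ (by omega) hi.ne
  have : Comm (d.theta y l) (y (l + 1)) :=
    theta_comm _ _ fun i hi => h.comm i (by omega) _ (by omega) (by omega)
  have cL : ∀ {l k : ℕ}, l < n → k ≤ n → _ := fun {l k} =>
    commute_omega_site (d := d) (l := l) (k := k) hκ hd h hy ha
  have cT : ∀ {l k : ℕ}, l < n → k ≤ n → ∀ ξ, _ := fun {l k} =>
    commute_site_aux (d := d) (l := l) (k := k) hκ hd h hy ha
  simp only [chainLink, chainSite, if_pos hl, if_pos (Nat.lt_of_succ_lt hl)]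
  have hO : Commute (d.omega κ y l) (d.left a (y l)) := commute_omega l fun i hi ξ =>
    commute_y_pre (m := l + 1) h ha (by omega) (by omega) (by omega) _
  have hθ : ∀ ξ, Commute (d.theta y l ξ) (d.left a (y l)) := commute_theta l fun i hi ξ =>
    commute_y_pre (m := l + 1) h ha (by omega) (by omega) (by omega) _
  have hs : ∀ ξ, Commute (y (l + 1) (d.s ξ)) (d.left a (y l)) := fun ξ =>
    commute_y_pre (m := l + 1) h ha hl (by omega) (by omega) _
  have hOL : d.omega κ y (l + 2) * d.left a (y l) = d.left a (y l) * (d.omega κ y l *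
      (Γ.si κ (d.theta y l) (conv (y l ∘ₗ d.s) a) *
        Γ.si κ (conv (d.theta y l) (conv (y l ∘ₗ d.s) a)) (y (l + 1) ∘ₗ d.s))) := by
    have c := d.source_mul_left a (y l)
    have e1 := (ev_conj_right (d.theta y l) (conv (y l ∘ₗ d.s) a) (y l ∘ₗ d.s) _ hθ
      (fun ξ => (c ξ).symm) ((Γ.twist κ)⁻¹).1).symm
    have e2 := (ev_conj_left (conv (d.theta y l) (conv (y l ∘ₗ d.s) a)) (d.theta y (l + 1))
      (y (l + 1) ∘ₗ d.s) _ (fun ξ => (conv_conj_right _ _ _ _ hθ c ξ).symm) hs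
      ((Γ.twist κ)⁻¹).1).symm
    change d.omega κ y l * Γ.si κ _ _ * Γ.si κ _ _ * _ = _
    change Γ.si κ _ _ * _ = _ * Γ.si κ _ _ at e1 e2
    rw [mul_assoc, e2, reassoc₂ (by rw [mul_assoc, e1] : d.omega κ y l * Γ.si κ (d.theta y l)
      (y l ∘ₗ d.s) * d.left a (y l) = d.omega κ y l * (d.left a (y l) * _)), mul_assoc (d.left a _),
      reassoc₂ hO.eq]
  have h1 := star_left_form hκ hd h hy ha (l := l) (by omega) _ _ hOL (cL (by omega) hl)
  have cO : ∀ X : G →ₗ[ℂ] E, (∀ i < l, ∀ ξ η, Commute (y i ξ) (X η)) → Commute (d.omega κ y l)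
      (Γ.si κ a X) := fun X hX => commute_omega l fun i hi ξ => by
    have := ha.comm i (by omega)
    exact (Γ.commute_si _ _ κ (fun η => comm_of a (y i) _ _) fun η => (hX i hi _ η).symm).symm
  have cs : Commute (d.omega κ y l) (Γ.si κ (y l ∘ₗ d.s) a) := commute_omega l fun i hi ξ => by
    have := ha.comm i (by omega)
    have := h.comm i (by omega) l (by omega) hi.ne
    exact (Γ.commute_si _ _ κ (fun η => comm_of (y l) (y i) _ _)
      fun η => comm_of a (y i) _ _).symm
  have cs' := cO (y (l + 1) ∘ₗ d.s) fun i hi ξ η => by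
    have := h.comm i (by omega) (l + 1) hl (by omega)
    exact comm_of (y i) (y (l + 1)) _ _
  have hm := hκ.si_move (d.theta y l) (y l ∘ₗ d.s) a (y (l + 1) ∘ₗ d.s)
  rw [hκ.s_flip (y l ∘ₗ d.s) a] at hm
  rw [← reassoc₂ cs.eq, hm] at h1
  set U := ev a (y (l + 1)) d.U
  have hU : ∀ i < n, i ≠ l + 1 → ∀ ξ, Commute (y i (d.s ξ)) U := fun i hi e ξ =>
    commute_y_u h ha hi hl e _ _
  have e3 : Γ.si κ (conv (d.theta y l) (y l ∘ₗ d.s)) (conv a (y (l + 1) ∘ₗ d.s)) * U =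
      U * Γ.si κ (d.theta y (l + 1)) (y (l + 1) ∘ₗ d.s) :=
    (ev_conj_right (d.theta y (l + 1)) (y (l + 1) ∘ₗ d.s) _ _
      (commute_theta (l + 1) fun i hi ξ => hU i (by omega) (by omega) ξ)
      (fun ξ => (d.source_ev a (y (l + 1)) ξ).symm) _).symm
  have e4 : Commute (d.omega κ y (l + 1)) U :=
    commute_omega (l + 1) fun i hi ξ => hU i (by omega) (by omega) ξ
  have base : star (d.left a (y l) * U) * (d.omega κ y (l + 2) * Γ.si κ a (y l ∘ₗ d.t)) *
      (d.left a (y l) * U) = d.omega κ y (l + 2) * Γ.si κ a (y (l + 1) ∘ₗ d.t) := by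
    have e5 : star (d.left a (y l) * U) * (d.omega κ y (l + 2) * Γ.si κ a (y l ∘ₗ d.t)) *
      (d.left a (y l) * U) = star U * (star (d.left a (y l)) * (d.omega κ y (l + 2) *
        Γ.si κ a (y l ∘ₗ d.t)) * d.left a (y l)) * U := by
      rw [star_mul]; simp only [mul_assoc]
    have e6 : d.omega κ y l * (Γ.si κ a (y (l + 1) ∘ₗ d.s) * (Γ.si κ (d.theta y l) (y l ∘ₗ d.s) *
        Γ.si κ (conv (d.theta y l) (y l ∘ₗ d.s)) (conv a (y (l + 1) ∘ₗ d.s)))) =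
        Γ.si κ a (y (l + 1) ∘ₗ d.s) * (d.omega κ y (l + 1) *
          Γ.si κ (conv (d.theta y l) (y l ∘ₗ d.s)) (conv a (y (l + 1) ∘ₗ d.s))) := by
      rw [reassoc₂ cs'.eq, ← mul_assoc (d.omega κ y l)]; rfl
    rw [e5, h1, e6, (cL hl (by omega)).eq, ← hd.star_u a (y (l + 1))]
    simp only [mul_assoc]
    rw [e3, reassoc₂ e4.eq]
    rfl
  have ext : ∀ k, l + 2 ≤ k → k ≤ n → star (d.left a (y l) * U) * (d.omega κ y k *
      Γ.si κ a (y l ∘ₗ d.t)) * (d.left a (y l) * U) =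
      d.omega κ y k * Γ.si κ a (y (l + 1) ∘ₗ d.t) := by
    intro k hk
    induction k, hk using Nat.le_induction with
    | base => exact fun _ => base
    | succ k hk ih =>
      intro hkn
      have c : ∀ m < n, m ≠ k → ∀ ξ, Commute (y k (d.s ξ)) (Γ.si κ a (y m ∘ₗ d.t)) :=
        fun m hm e ξ => by
        have := ha.comm k hkn
        have := h.comm m hm k hkn e
        exact (Γ.commute_si _ _ κ (fun η => comm_of a (y k) _ _)
          fun η => comm_of (y m) (y k) _ _).symm
      refine star_mul_commute (ih (by omega)) (Γ.commute_si _ _ κ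
        (commute_theta_link h ha (l + 1) k (by omega) (by omega) (by omega)) fun ξ => ?_)
        (Γ.commute_si _ _ κ (cT (by omega) (by omega)) (c l (by omega) (by omega)))
        (Γ.commute_si _ _ κ (cT hl (by omega)) (c (l + 1) hl (by omega)))
      exact (commute_y_pre (m := l + 1) h ha hkn (by omega) (by omega) _).mul_right
        (commute_y_u h ha hkn hl (by omega) _ _)
  have hθ := commute_theta_link (d := d) h ha (l + 1) n (by omega) hl le_rfl
  have hp := fun ξ => (commute_pq_pre (d := d) h ha (m := l + 1) hl.le ξ).1.mul_right
    (commute_pq_u h ha hl d.U ξ).1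
  have hq := fun ξ => (commute_pq_pre (d := d) h ha (m := l + 1) hl.le ξ).2.mul_right
    (commute_pq_u h ha hl d.U ξ).2
  have cpq : ∀ m < n, ∀ ξ, Commute (p ξ) (Γ.si κ a (y m ∘ₗ d.t)) ∧
      Commute (q ξ) (Γ.si κ a (y m ∘ₗ d.t)) := fun m hm ξ => by
    have := ha.comm_p
    have := ha.comm_q
    have := h.comm_p m hm
    have := h.comm_q m hm
    exact ⟨(Γ.commute_si _ _ κ (fun η => comm_of a p _ _) fun η => comm_of (y m) p _ _).symm,
      (Γ.commute_si _ _ κ (fun η => comm_of a q _ _) fun η => comm_of (y m) q _ _).symm⟩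
  exact star_mul_commute (star_mul_commute (ext n (by omega) le_rfl) (Γ.commute_si _ _ κ hθ hp)
    (Γ.commute_si _ _ κ (cT (by omega) le_rfl) fun ξ => (cpq l (by omega) ξ).1)
    (Γ.commute_si _ _ κ (cT hl le_rfl) fun ξ => (cpq _ hl ξ).1))
    (Γ.commute_si _ _ κ (fun ξ => commute_ev _ _ _ _ hθ hp) hq)
    (Γ.commute_si _ _ κ (fun ξ => commute_ev _ _ _ _ (cT (by omega) le_rfl)
      fun ξ => (cpq l (by omega) ξ).1) fun ξ => (cpq l (by omega) ξ).2)
    (Γ.commute_si _ _ κ (fun ξ => commute_ev _ _ _ _ (cT hl le_rfl)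
      fun ξ => (cpq _ hl ξ).1) fun ξ => (cpq _ hl ξ).2)

lemma star_core_mul : star (d.core y p n a) * (d.omega κ y n *
    (Γ.si κ (d.theta y n) a * Γ.si κ (conv (d.theta y n) a) p *
      Γ.si κ (conv (conv (d.theta y n) a) p) q)) * d.core y p n a =
    d.form κ y p q n * Γ.si κ a (d.chainSite y p q n n) := by
  have := ha.mul
  have := ha.comm_p
  have := ha.comm_q
  have := h.mul_p
  have := h.mul_q
  have := h.comm_pq
  have := theta_mul (d := d) h n le_rfl
  obtain ⟨_, _⟩ := comm_pq_theta (d := d) h n le_rfl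
  have := off_theta (d := d) ha n le_rfl
  have e : star (Γ.r a (d.theta y n)) * d.omega κ y n = d.omega κ y n * Γ.ri (d.theta y n) a := by
    rw [RibbonStar.r, star_ev_mul' (d.theta y n) a (star_theta_mul_omega hκ hd h hy n le_rfl)
      fun ξ => (commute_omega n fun i hi η => ?_).symm, Γ.star_R, ev_flip]
    · rfl
    · have := ha.comm i hi
      exact comm_of (y i) a _ _
  have c : Commute (Γ.ri p a * Γ.ri a p) (d.omega κ y n) := (commute_omega n fun i hi η => by
    have := ha.comm i hi
    have := h.comm_p i hi
    have h1 : ∀ ξ, Commute (a ξ) (y i (d.s η)) := fun ξ => comm_of a (y i) _ _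
    have h2 : ∀ ξ, Commute (p ξ) (y i (d.s η)) := fun ξ => comm_of p (y i) _ _
    exact ((Γ.commute_ri p a h2 h1).mul_left (Γ.commute_ri a p h1 h2)).symm).symm
  rw [core, star_mul, star_mul, Γ.star_r p a, Γ.star_r a p, chainSite, if_neg (lt_irrefl _),
    ← conv_assoc, form]
  have hc := hκ.si_core a (d.theta y n) p q
  simp only [mul_assoc] at hc c ⊢
  rw [← mul_assoc (Γ.ri _ _) (Γ.ri _ _), reassoc₂ c.eq, ← mul_assoc (star _), e]
  simp only [mul_assoc]
  rw [hc]

lemma star_link_last {l : ℕ} (hl : l + 1 = n) :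
    star (d.chainLink y p n a n) * (d.form κ y p q n * Γ.si κ a (d.chainSite y p q n l)) *
      d.chainLink y p n a n = d.form κ y p q n * Γ.si κ a (d.chainSite y p q n n) := by
  subst hl
  have := ha.mul
  have := ha.comm_p
  have := ha.comm_q
  have := h.mul_p
  have := h.mul_q
  have := h.comm_pq
  have := h.mul l (by omega)
  have := ha.comm l (by omega)
  have := theta_mul (d := d) h l (by omega)
  have := off_theta (d := d) ha l (by omega)
  have : Comm (d.theta y l) (y l) :=
    theta_comm _ _ fun i hi => h.comm i (by omega) _ (by omega) hi.ne
  rw [← star_core_mul hκ hd h hy ha]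
  simp only [chainLink, if_neg (lt_irrefl _), chainSite, if_pos l.lt_succ_self, pre]
  have hO : Commute (d.omega κ y l) (d.left a (y l)) := commute_omega l fun i hi ξ =>
    commute_y_pre (m := l + 1) h ha (by omega) (by omega) (by omega) _
  have hθ : ∀ ξ, Commute (d.theta y l ξ) (d.left a (y l)) := commute_theta l fun i hi ξ =>
    commute_y_pre (m := l + 1) h ha (by omega) (by omega) (by omega) _
  have hpq := fun ξ => commute_pq_pre (d := d) (m := l + 1) h ha le_rfl ξ
  have hθ' := theta_mul_pre (d := d) h ha (l + 1) le_rfl (by omega)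
  have hOL : d.form κ y p q (l + 1) * d.left a (y l) = d.left a (y l) * (d.omega κ y l *
      (Γ.si κ (d.theta y l) (conv (y l ∘ₗ d.s) a) * (Γ.si κ (conv (d.theta y (l + 1)) a) p *
          Γ.si κ (conv (conv (d.theta y (l + 1)) a) p) q))) := by
    have e1 := (ev_conj_right (d.theta y l) (conv (y l ∘ₗ d.s) a) (y l ∘ₗ d.s) _ hθ
      (fun ξ => (d.source_mul_left a (y l) ξ).symm)
      ((Γ.twist κ)⁻¹).1).symm
    have e2 := (ev_conj_left (conv (d.theta y (l + 1)) a) (d.theta y (l + 1)) p _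
      (fun ξ => (hθ' ξ).symm) (fun ξ => (hpq ξ).1)
      ((Γ.twist κ)⁻¹).1).symm
    have e3 := (ev_conj_left (conv (conv (d.theta y (l + 1)) a) p) (conv (d.theta y (l + 1)) p) q _
      (fun ξ => (conv_conj_left _ _ _ _ hθ' (fun ξ => (hpq ξ).1) ξ).symm) (fun ξ => (hpq ξ).2)
      ((Γ.twist κ)⁻¹).1).symm
    change d.omega κ y l * Γ.si κ _ _ * Γ.si κ _ _ * Γ.si κ _ _ * _ = _
    change Γ.si κ _ _ * _ = _ * Γ.si κ _ _ at e1 e2 e3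
    simp only [pre] at e2 e3
    simp only [mul_assoc]
    rw [e3, reassoc₂ e2, reassoc₂ e1, reassoc₂ hO.eq]
  have cT := commute_site_aux (d := d) hκ hd h hy ha (l := l) (k := l + 1) (by omega) le_rfl
  have cpq : ∀ ξ, Commute (p ξ) (Γ.si κ a (y l ∘ₗ d.t)) ∧
      Commute (q ξ) (Γ.si κ a (y l ∘ₗ d.t)) := fun ξ => by
    have := h.comm_p l (by omega)
    have := h.comm_q l (by omega)
    exact ⟨(Γ.commute_si _ _ κ (fun η => comm_of a p _ _) fun η => comm_of (y l) p _ _).symm,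
      (Γ.commute_si _ _ κ (fun η => comm_of a q _ _) fun η => comm_of (y l) q _ _).symm⟩
  have h1 := star_left_form hκ hd h hy ha (l := l) (by omega) _ _ hOL
    (((commute_omega_site hκ hd h hy ha (by omega) le_rfl).mul_left
      (Γ.commute_si _ _ κ cT fun ξ => (cpq ξ).1)).mul_left
      (Γ.commute_si _ _ κ (fun ξ => commute_ev _ _ _ _ cT fun ξ => (cpq ξ).1) fun ξ => (cpq ξ).2))
  have cs : Commute (d.omega κ y l) (Γ.si κ (y l ∘ₗ d.s) a) := commute_omega l fun i hi ξ => by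
    have := ha.comm i (by omega)
    have := h.comm i (by omega) l (by omega) hi.ne
    exact (Γ.commute_si _ _ κ (fun η => comm_of (y l) (y i) _ _)
      fun η => comm_of a (y i) _ _).symm
  have e4 := hκ.si_assoc (d.theta y l) (y l ∘ₗ d.s) a
  rw [reassoc₂ cs.eq.symm, reassoc e4.symm] at h1
  have e5 : ∀ L C W : E, star (L * C) * W * (L * C) = star C * (star L * W * L) * C := by
    intro L C W
    rw [star_mul]; simp only [mul_assoc]
  rw [e5, h1]
  change _ = _ * (d.omega κ y l * Γ.si κ (d.theta y l) (y l ∘ₗ d.s) *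
    (Γ.si κ (conv (d.theta y l) (y l ∘ₗ d.s)) a * _ * _)) * _
  simp only [mul_assoc]

lemma star_loop (hn : n = 0) :
    star (d.chainLink y p n a 0) * (d.form κ y p q n * Γ.si κ a (d.chainSite y p q n 0)) *
      d.chainLink y p n a 0 = d.form κ y p q n * Γ.si κ a (d.chainSite y p q n 0) := by
  subst hn
  have := ha.mul
  have := ha.comm_p
  have := ha.comm_q
  have := h.mul_p
  have := h.mul_q
  have := h.comm_pq
  have e := star_core_mul hκ hd h hy ha
  have e1 : d.theta y 0 = triv G E := rfl
  have e2 : d.omega κ y 0 = 1 := rfl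
  simp only [chainLink, pre, one_mul, if_neg (lt_irrefl _)]
  convert e using 3
  simp only [form, chainSite, if_neg (lt_irrefl _), e1, e2, triv_conv, hκ.triv_si, one_mul]
  exact (hκ.si_assoc a p q).symm

end Link

end ChainStar

/-! ## Positivity -/

section Positivity

/-- A faithful positive trace. -/
structure IsPosTrace (tr : G →ₗ[ℂ] ℂ) : Prop where
  comm : ∀ x y, tr (x * y) = tr (y * x)
  star : ∀ x, tr (star x) = star (tr x)
  nonneg : ∀ x, 0 ≤ (tr (Star.star x * x)).re
  eq_zero : ∀ x, tr (Star.star x * x) = 0 → x = 0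

lemma exists_orthonormal {W : Type*} [AddCommGroup W] [Module ℂ W] [FiniteDimensional ℂ W]
    (c : Core ℂ W) :
    ∃ b : Module.Basis (Fin (Module.finrank ℂ W)) ℂ W, ∀ x i, b.repr x i = c.inner (b i) x := by
  let := c.toNormedAddCommGroup
  let : InnerProductSpace ℂ W := InnerProductSpace.ofCore c.toCore
  refine ⟨(stdOrthonormalBasis ℂ W).toBasis, fun x i => ?_⟩
  rw [OrthonormalBasis.coe_toBasis_repr_apply, OrthonormalBasis.repr_apply_apply,
    OrthonormalBasis.coe_toBasis]

section

variable {tr : G →ₗ[ℂ] ℂ} (ht : IsPosTrace tr) [Module.Finite ℂ G]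
include ht

lemma IsPosTrace.exists_basis : ∃ b : Module.Basis (Fin (Module.finrank ℂ G)) ℂ G,
    ∀ x i, b.repr x i = tr (Star.star (b i) * x) :=
  exists_orthonormal
    { inner := fun x y => tr (Star.star x * y)
      conj_inner_symm := fun x y => by
        change Star.star (tr _) = _
        rw [← ht.star, star_mul, star_star]
      re_inner_nonneg := ht.nonneg
      add_left := fun x y z => by rw [star_add, add_mul, map_add]
      smul_left := fun x y r => by rw [star_smul, smul_mul_assoc, map_smul]; rfl
      definite := ht.eq_zero }

lemma IsPosTrace.sum_comm {b : Module.Basis (Fin (Module.finrank ℂ G)) ℂ G}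
    (hb : ∀ x i, b.repr x i = tr (Star.star (b i) * x)) (x w : G) :
    ∑ j, Star.star (b j) * x * w * b j = ∑ j, Star.star (b j) * w * x * b j := by
  have h1 : ∀ j, x * b j = ∑ k, tr (Star.star (b k) * x * b j) • b k := fun j => by
    conv_lhs => rw [← b.sum_repr (x * b j)]
    simp only [hb, mul_assoc]
  have h2 : ∀ k, Star.star (b k) * x = ∑ j, tr (Star.star (b k) * x * b j) • Star.star (b j) := fun k => by
    have h := congrArg Star.star (b.sum_repr (Star.star x * b k))
    simp only [hb, star_sum, star_smul, star_mul, star_star] at h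
    refine h.symm.trans ?_
    refine Finset.sum_congr rfl fun j _ => ?_
    rw [← ht.star]
    simp only [star_mul, star_star, mul_assoc]
  calc _ = ∑ k, ∑ j, tr (Star.star (b k) * x * b j) • (Star.star (b j) * w * b k) :=
        Finset.sum_congr rfl fun k _ => by
          conv_lhs => rw [h2, Finset.sum_mul, Finset.sum_mul]
          simp only [smul_mul_assoc]
    _ = _ := by
      rw [Finset.sum_comm]
      refine Finset.sum_congr rfl fun j _ => ?_
      rw [mul_assoc _ x, h1, Finset.mul_sum]
      simp only [mul_smul_comm, mul_assoc]

end

lemma RibbonStar.antipode_star (Γ : RibbonStar G) (ξ : G) :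
    antipode ℂ (star ξ) = star (antipode ℂ ξ) := by
  let S : G →ₗ[ℂ] G :=
    { toFun := fun ξ => star (antipode ℂ (star ξ))
      map_add' := by simp
      map_smul' := by simp }
  have h : ∀ X : G ⊗[ℂ] G, ev S LinearMap.id X =
      star (ev LinearMap.id (antipode ℂ) (flipTensor G (star X))) := by
    intro X
    induction X with
    | tmul x y => simp [S, TensorProduct.star_tmul, flipTensor]
    | _ => simp_all
  have h1 : conv S LinearMap.id = triv G G := LinearMap.ext fun ξ => by
    have e : ∀ X, flipTensor G (flipTensor G X) = X := fun X => by
      exact (Algebra.TensorProduct.comm ℂ G G).symm_apply_apply X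
    have h2 := LinearMap.congr_fun (conv_antipode (LinearMap.id : G →ₗ[ℂ] G)) (star ξ)
    rw [LinearMap.id_comp, conv_apply] at h2
    rw [conv_apply, h, Γ.star_comul, e, h2, triv_apply, triv_apply, Γ.counit_star,
      algebraMap_star_comm, star_star]
  have h2 := conv_inv_unique S LinearMap.id _ h1 (conv_antipode LinearMap.id)
  have h3 := LinearMap.congr_fun h2 (star ξ)
  simp only [S, LinearMap.coe_mk, AddHom.coe_mk, star_star, LinearMap.id_comp] at h3
  rw [← h3]

variable {Λ : Type w} [Finite Λ] {V : Λ → Type v} [∀ I, NormedAddCommGroup (V I)]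
  [∀ I, InnerProductSpace ℂ (V I)] [∀ I, FiniteDimensional ℂ (V I)] {τ : ∀ I, G →ₐ[ℂ] End ℂ (V I)}

lemma IsIrrepList.exists_posTrace [IsSemisimpleRing G] (hτ : IsIrrepList V τ) :
    ∃ tr : G →ₗ[ℂ] ℂ, IsPosTrace tr := by
  have := Fintype.ofFinite Λ
  let b := fun I => stdOrthonormalBasis ℂ (V I)
  let tr : G →ₗ[ℂ] ℂ := ∑ I, LinearMap.trace ℂ (V I) ∘ₗ (τ I).toLinearMap
  have key : ∀ x, tr x = ∑ I, ∑ i, inner ℂ (b I i) (τ I x (b I i)) := fun x => by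
    simp only [tr, LinearMap.sum_apply, comp_apply, AlgHom.toLinearMap_apply]
    exact Finset.sum_congr rfl fun I _ => LinearMap.trace_eq_sum_inner _ (b I)
  have pos : ∀ x, tr (Star.star x * x) = ((∑ I, ∑ i, ‖τ I x (b I i)‖ ^ 2 : ℝ) : ℂ) := fun x => by
    rw [key]
    push_cast
    refine Finset.sum_congr rfl fun I _ => Finset.sum_congr rfl fun i _ => ?_
    rw [map_mul, Module.End.mul_apply, ← star_star x, ← hτ.star, star_star,
      inner_self_eq_norm_sq_to_K]
    rfl
  refine ⟨tr, fun x y => ?_, fun x => ?_, fun x => ?_, fun x hx => ?_⟩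
  · simp only [tr, LinearMap.sum_apply, comp_apply, AlgHom.toLinearMap_apply, map_mul]
    exact Finset.sum_congr rfl fun I _ => LinearMap.trace_mul_comm ℂ _ _
  · rw [key, key, star_sum]
    refine Finset.sum_congr rfl fun I _ => ?_
    rw [star_sum]
    refine Finset.sum_congr rfl fun i _ => ?_
    rw [← star_star x, ← hτ.star, star_star]
    exact (inner_conj_symm _ _).symm
  · rw [pos, Complex.ofReal_re]
    positivity
  · rw [pos, Complex.ofReal_eq_zero, Finset.sum_eq_zero_iff_of_nonneg fun I _ => by positivity] at hx
    refine hτ.eq_zero fun I => (b I).toBasis.ext fun i => ?_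
    have h := (Finset.sum_eq_zero_iff_of_nonneg fun i _ => by positivity).mp
      (hx I (Finset.mem_univ I)) i (Finset.mem_univ i)
    rw [OrthonormalBasis.coe_toBasis, LinearMap.zero_apply]
    simpa using h

section

variable [Module.Finite ℂ G] [IsSemisimpleRing G] (hτ : IsIrrepList V τ)
include hτ

lemma IsIrrepList.pairRep_eq_zero {X : G ⊗[ℂ] G} (hX : ∀ I J, pairRep (τ I) (τ J) X = 0) :
    X = 0 := by
  have h1 : ∀ I J, Algebra.TensorProduct.map (τ I) (τ J) X = 0 := fun I J => by
    have e : Function.Injective (Module.endTensorEndAlgHom (R := ℂ) (S := ℂ) (A := ℂ) (M := V I)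
        (N := V J)) := by
      have := (homTensorHomEquiv ℂ (V I) (V J) (V I) (V J)).injective
      convert this using 1
      ext X : 1
      rw [homTensorHomEquiv_apply]
      induction X with
      | tmul f g => rfl
      | _ => simp_all
    exact e (by rw [map_zero]; exact hX I J)
  have h2 : ∀ I (π : Dual ℂ (End ℂ (V I))),
      component (π ∘ₗ (τ I).toLinearMap) X = 0 := fun I π => hτ.eq_zero fun J => by
    have e : ∀ X : G ⊗[ℂ] G, τ J (component (π ∘ₗ (τ I).toLinearMap) X) =
        TensorProduct.lid ℂ _ (LinearMap.rTensor _ π (Algebra.TensorProduct.map (τ I) (τ J) X)) := by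
      intro X
      induction X with
      | tmul x y => simp
      | _ => simp_all
    rw [e, h1, map_zero, map_zero]
  have h3 : ∀ ρ : Dual ℂ G, component ρ (flipTensor G X) = 0 := fun ρ =>
    hτ.eq_zero fun I => by
      refine (Module.forall_dual_apply_eq_zero_iff ℂ _).mp fun π => ?_
      have e : ∀ X : G ⊗[ℂ] G, π (τ I (component ρ (flipTensor G X))) =
          ρ (component (π ∘ₗ (τ I).toLinearMap) X) := by
        intro X
        induction X with
        | tmul x y => simp [flipTensor, mul_comm]
        | _ => simp_all
      rw [e, h2, map_zero]
  exact (Algebra.TensorProduct.comm ℂ G G).injective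
    ((component_ext fun π => (h3 π).trans (map_zero _).symm).trans (map_zero _).symm)

omit [Module.Finite ℂ G] [IsSemisimpleRing G] [Finite Λ] in
lemma IsIrrepList.star_pairRep (I J : Λ) (X : G ⊗[ℂ] G) (x y : V I ⊗[ℂ] V J) :
    inner ℂ (pairRep (τ I) (τ J) (Star.star X) x) y = inner ℂ x (pairRep (τ I) (τ J) X y) := by
  induction X with
  | tmul ξ η =>
    induction x with
    | zero => simp
    | add x x' h h' => simp only [map_add, inner_add_left, h, h']
    | tmul a b =>
      induction y with
      | zero => simp
      | add x x' h h' => simp only [map_add, inner_add_right, h, h']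
      | tmul c d =>
        rw [TensorProduct.star_tmul]
        change inner ℂ (_ ⊗ₜ[ℂ] _) (_ ⊗ₜ[ℂ] _) = inner ℂ (_ ⊗ₜ[ℂ] _) (_ ⊗ₜ[ℂ] _)
        rw [TensorProduct.inner_tmul, TensorProduct.inner_tmul]
        exact congrArg₂ (· * ·) (hτ.star I ξ a c) (hτ.star J η b d)
  | _ => simp_all [inner_add_left, inner_add_right]

variable {κ : Gˣ}

lemma RibbonStar.IsAdmissibleRoot.star_twist (hκ : Γ.IsAdmissibleRoot τ κ) :
    star (Γ.twist κ).1 = Γ.twist κ := by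
  refine sub_eq_zero.mp (hτ.pairRep_eq_zero fun I J => ?_)
  rw [map_sub, sub_eq_zero]
  refine LinearMap.ext fun x => ext_inner_right ℂ fun y => ?_
  rw [hτ.star_pairRep, ← (hκ.positive I J).isSymmetric x y]

lemma RibbonStar.IsAdmissibleRoot.exists_sqrt (hκ : Γ.IsAdmissibleRoot τ κ) :
    ∃ A : G ⊗[ℂ] G, star A = A ∧ A * A = Γ.twist κ := by
  classical
  have := Fintype.ofFinite Λ
  set S : G ⊗[ℂ] G := (Γ.twist κ).val with hS
  let P := fun I J => pairRep (τ I) (τ J) S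
  let ev := fun I J => (hκ.positive I J).isSymmetric.eigenvalues rfl
  let s : Finset ℝ := Finset.univ.biUnion fun I => Finset.univ.biUnion fun J =>
    Finset.univ.image (ev I J)
  let p : Polynomial ℝ := Lagrange.interpolate s id fun t => √t
  have hp : ∀ I J i, p.eval (ev I J i) = √(ev I J i) := fun I J i =>
    Lagrange.eval_interpolate_at_node (v := id) _ Function.injective_id.injOn
      (by simp only [s, Finset.mem_biUnion, Finset.mem_image, Finset.mem_univ, true_and]
          exact ⟨I, J, i, rfl⟩)
  let A := Polynomial.aeval S (p.map (algebraMap ℝ ℂ))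
  refine ⟨A, ?_, sub_eq_zero.mp (hτ.pairRep_eq_zero fun I J => ?_)⟩
  · simp only [A, Polynomial.aeval_eq_sum_range, star_sum, star_smul, star_pow,
      RibbonStar.IsAdmissibleRoot.star_twist hτ hκ, hS]
    refine Finset.sum_congr rfl fun i _ => ?_
    simp
  · rw [map_sub, sub_eq_zero]
    refine ((hκ.positive I J).isSymmetric.eigenvectorBasis rfl).toBasis.ext fun i => ?_
    have hv := (hκ.positive I J).isSymmetric.hasEigenvector_eigenvectorBasis rfl i
    have hA : pairRep (τ I) (τ J) A ((hκ.positive I J).isSymmetric.eigenvectorBasis rfl i) =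
        ((√(ev I J i) : ℝ) : ℂ) • (hκ.positive I J).isSymmetric.eigenvectorBasis rfl i := by
      have e := Module.End.aeval_apply_of_hasEigenvector (p := p.map (algebraMap ℝ ℂ)) hv
      rw [Polynomial.aeval_algHom_apply] at e
      rw [e]
      congr 1
      rw [← hp]
      exact Polynomial.eval_map_apply _ _
    rw [OrthonormalBasis.coe_toBasis, map_mul, Module.End.mul_apply, hA, map_smul, hA, smul_smul,
      ← Complex.ofReal_mul, Real.mul_self_sqrt ((hκ.positive I J).nonneg_eigenvalues rfl i)]
    exact (hv.apply_eq_smul).symm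

lemma RibbonStar.IsAdmissibleRoot.exists_invSqrt (hκ : Γ.IsAdmissibleRoot τ κ) : Γ.IsStarRoot κ ∧
      ∃ Z : G ⊗[ℂ] G, star Z = Z ∧ Z * Z = ((Γ.twist κ)⁻¹).1 := by
  obtain ⟨A, hA, hS⟩ := hκ.exists_sqrt hτ
  have hstar := hκ.star_twist hτ
  set S := Γ.twist κ
  have hstar' : star ((S⁻¹ : (G ⊗[ℂ] G)ˣ) : G ⊗[ℂ] G) = (S⁻¹ : (G ⊗[ℂ] G)ˣ) := by
    refine left_inv_eq_right_inv (a := (S : G ⊗[ℂ] G)) ?_ S.mul_inv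
    rw [← hstar, ← star_mul, Units.mul_inv, star_one]
  have hc : Commute A (S⁻¹ : (G ⊗[ℂ] G)ˣ) :=
    Commute.units_inv_right (by rw [← hS]; exact (Commute.refl A).mul_right (Commute.refl A))
  refine ⟨⟨⟨hκ.central, hκ.sq⟩, hstar, ?_⟩, A * (S⁻¹ : (G ⊗[ℂ] G)ˣ), ?_, ?_⟩
  · have : IsStarMap (triv G ℂ) := ⟨fun x => by simp [triv_apply, Γ.counit_star]⟩
    have e1 : Γ.s κ (triv G ℂ) (triv G ℂ) = counit (R := ℂ) (κ : G) := by
      rw [RibbonStar.s_eq, triv_conv, Γ.triv_ri, mul_one, ← mul_assoc,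
        RibbonStar.mm_unit_inv_mul, one_mul]
      rfl
    have e2 : Γ.s κ (triv G ℂ) (triv G ℂ) = ev (triv G ℂ) (triv G ℂ) A *
        ev (triv G ℂ) (triv G ℂ) A := by
      rw [RibbonStar.s, ← mm_mul (ev (triv G ℂ) (triv G ℂ)), hS]
    have e3 : star (ev (triv G ℂ) (triv G ℂ) A) = ev (triv G ℂ) (triv G ℂ) A := by rw [star_ev, hA]
    obtain ⟨r, hr⟩ := Complex.conj_eq_iff_real.mp e3
    have e4 : counit (R := ℂ) (κ : G) * counit (R := ℂ) (κ : G) = 1 := by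
      rw [← Bialgebra.counit_mul, ← Units.val_mul, hκ.sq, Γ.counit_v]
    rw [← e1, e2, hr] at e4 ⊢
    norm_cast at e4 ⊢
    nlinarith [mul_self_nonneg r]
  · rw [star_mul, hA, hstar', hc.eq]
  · rw [mul_assoc, ← mul_assoc _ A, ← hc.eq, mul_assoc A, ← mul_assoc A A, hS, ← mul_assoc,
      Units.mul_inv, one_mul]

end

end Positivity

/-! ## Adjoints with respect to an inner product -/

section EndStar

variable {W : Type*} [AddCommGroup W] [Module ℂ W] [FiniteDimensional ℂ W] (c : Core ℂ W)

/-- The involution of `End(W)` given by the adjoint. -/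
abbrev endStar : StarRing (End ℂ W) := letI := c.toNormedAddCommGroup
  letI : InnerProductSpace ℂ W := InnerProductSpace.ofCore c.toCore
  inferInstanceAs (StarRing (W →ₗ[ℂ] W))

lemma endStarModule : letI := endStar c; StarModule ℂ (End ℂ W) := letI := c.toNormedAddCommGroup
  letI : InnerProductSpace ℂ W := InnerProductSpace.ofCore c.toCore
  inferInstanceAs (StarModule ℂ (W →ₗ[ℂ] W))

lemma inner_endStar (T : End ℂ W) (x y : W) : c.inner ((endStar c).star T x) y = c.inner x (T y) :=
  letI := c.toNormedAddCommGroup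
  letI : InnerProductSpace ℂ W := InnerProductSpace.ofCore c.toCore
  LinearMap.adjoint_inner_left T y x

lemma endStar_eq {T T' : End ℂ W} (h : ∀ x y, c.inner (T' x) y = c.inner x (T y)) :
    (endStar c).star T = T' :=
  letI := c.toNormedAddCommGroup
  letI : InnerProductSpace ℂ W := InnerProductSpace.ofCore c.toCore
  ((LinearMap.eq_adjoint_iff T' T).mpr h).symm

end EndStar

/-! ## The adjoint of a link -/

section Adj

variable {κ : Gˣ}

namespace Link

variable (d : Link Γ B) (κ) (a b : G →ₗ[ℂ] E) (x : B →ₗ[ℂ] E)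

/-- `S_{at}⁻¹ U⁻¹ S_{as}`. -/
def adj : E := Γ.si κ a (x ∘ₗ d.t) * ev a x d.Ui * Γ.s κ a (x ∘ₗ d.s)

variable {κ} [IsMulMap a] [IsMulMap b] [IsMulMap x] [Comm a b] [Comm a x] [Comm b x]
  (hκ : Γ.IsRoot κ)

lemma ev_adj : ev a x (d.adj κ (inl G B) (inr G B)) = d.adj κ a x := by
  rw [adj, mm_mul (ev a x), mm_mul (ev a x), RibbonStar.si_ev, RibbonStar.s, map_ev (ev a x),
    map_ev (ev a x), ev_comp_inl, ev_comp_inr, ev_comp_inr_comp, ev_comp_inr_comp]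
  rfl

include hκ

lemma conv_mul_adj (ξ : G) : conv (x ∘ₗ d.t) a ξ * d.adj κ a x = d.adj κ a x * x (d.t ξ) := by
  have c : Commute (Γ.s κ a (x ∘ₗ d.s)) (x (d.t ξ)) := Γ.commute_s _ _ κ
    (fun y => comm_of a x _ _) fun y => comm_of (x ∘ₗ d.s) (x ∘ₗ d.t) y ξ
  simp only [adj, mul_assoc]
  rw [reassoc₂ (hκ.conv_mul_si a (x ∘ₗ d.t) ξ), reassoc₂ (d.conv_mul_ui a x ξ), c.eq]

lemma adj_mul_conv (ξ : G) : d.adj κ a x * conv (x ∘ₗ d.s) a ξ = x (d.s ξ) * d.adj κ a x := by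
  have c : Commute (Γ.si κ a (x ∘ₗ d.t)) (x (d.s ξ)) := Γ.commute_si _ _ κ
    (fun y => comm_of a x _ _) fun y => comm_of (x ∘ₗ d.t) (x ∘ₗ d.s) y ξ
  have e := hκ.conv_mul_si (x ∘ₗ d.s) a ξ
  rw [← hκ.s_flip (x ∘ₗ d.s) a] at e
  simp only [adj, mul_assoc]
  rw [← e, ← mul_assoc (ev a x d.Ui), ← d.source_mul_ui a x ξ, mul_assoc, reassoc₂ c.eq]

lemma adj_mul_adj : d.adj κ a x * d.adj κ b x = d.adj κ (conv a b) x * Γ.ri a b := by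
  have c1 : Commute (Γ.s κ a (x ∘ₗ d.s)) (Γ.si κ b (x ∘ₗ d.t)) :=
    comm_of (ev a (x ∘ₗ d.s)) (ev b (x ∘ₗ d.t)) _ _
  have c2 : Γ.s κ a (x ∘ₗ d.s) * ev b x d.Ui = ev b x d.Ui * Γ.s κ a (conv b (x ∘ₗ d.s)) :=
    (ev_conj_right a (conv b (x ∘ₗ d.s)) (x ∘ₗ d.s) _ (fun y => comm_of a (ev b x) y _)
      (fun ξ => (d.source_mul_ui b x ξ).symm) _).symm
  have c3 : ev a x d.Ui * Γ.si κ b (x ∘ₗ d.t) = Γ.si κ b (conv a (x ∘ₗ d.t)) * ev a x d.Ui :=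
    ev_conj_right b (x ∘ₗ d.t) (conv a (x ∘ₗ d.t)) _ (fun y => comm_of b (ev a x) y _)
      (fun ξ => (d.conv_mul_ui a x ξ).symm) _
  have c4 : ev a x d.Ui * ev b x d.Ui = ev (conv b a) x d.Ui * Γ.ri b a := by
    have e : ev b x d.U * ev a x d.U * (ev a x d.Ui * ev b x d.Ui) = 1 := by
      rw [mul_assoc, reassoc (d.u_mul_ui a x), one_mul, d.u_mul_ui b x]
    have e' : ev (conv b a) x d.Ui * Γ.ri b a * (ev b x d.U * ev a x d.U) = 1 := by
      rw [d.funct_ev b a x, mul_assoc, reassoc (Γ.ri_mul_r b a), one_mul, d.ui_mul_u]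
    exact (left_inv_eq_right_inv e' e).symm
  have c5 : Γ.s κ a (conv b (x ∘ₗ d.s)) * Γ.s κ b (x ∘ₗ d.s) =
      Γ.s κ (conv a b) (x ∘ₗ d.s) * Γ.s κ a b := by
    have e := hκ.si_assoc a b (x ∘ₗ d.s)
    refine left_inv_eq_right_inv (a := Γ.si κ b (x ∘ₗ d.s) * Γ.si κ a (conv b (x ∘ₗ d.s))) ?_ ?_
    · rw [mul_assoc, reassoc (Γ.s_mul_si b (x ∘ₗ d.s) κ), one_mul, Γ.s_mul_si]
    · rw [← e, mul_assoc, reassoc (Γ.si_mul_s (conv a b) (x ∘ₗ d.s) κ), one_mul, Γ.si_mul_s]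
  have c6 : Γ.ri b a * Γ.s κ (conv a b) (x ∘ₗ d.s) = Γ.s κ (conv b a) (x ∘ₗ d.s) * Γ.ri b a :=
    ev_conj_left (conv a b) (conv b a) (x ∘ₗ d.s) _ (fun ξ => (Γ.conv_mul_ri b a ξ).symm)
      (fun ξ => (Γ.commute_ri b a (fun y => comm_of b x y _) fun y => comm_of a x y _).symm) _
  have c7 : Γ.si κ b a * d.adj κ (conv b a) x = d.adj κ (conv a b) x * Γ.si κ b a := by
    rw [← d.ev_adj (conv b a) x, ← d.ev_adj (conv a b) x]
    exact ev_conj_left (conv b a) (conv a b) x _ (fun ξ => (hκ.conv_mul_si b a ξ).symm)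
      (fun ξ => (Γ.commute_si b a κ (fun y => comm_of b x y _)
        fun y => comm_of a x y _).symm) _
  have c8 : Γ.si κ b a * (Γ.ri b a * Γ.si κ b a) = Γ.ri a b := by
    have e := hκ.s_mul_r_mul_s b a
    refine left_inv_eq_right_inv (a := Γ.r a b) ?_ (Γ.r_mul_ri a b)
    rw [← e]
    simp only [mul_assoc]
    rw [reassoc (Γ.si_mul_s b a κ), one_mul, reassoc (Γ.ri_mul_r b a), one_mul, Γ.si_mul_s]
  calc _ = Γ.si κ a (x ∘ₗ d.t) * Γ.si κ b (conv a (x ∘ₗ d.t)) * (ev a x d.Ui * ev b x d.Ui) *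
        (Γ.s κ a (conv b (x ∘ₗ d.s)) * Γ.s κ b (x ∘ₗ d.s)) := by
        simp only [adj, mul_assoc]
        rw [reassoc₂ c1.eq, reassoc₂ c2, reassoc₂ c3]
    _ = Γ.si κ b a * d.adj κ (conv b a) x * (Γ.ri b a * Γ.s κ a b) := by
        rw [← hκ.si_assoc b a (x ∘ₗ d.t), c4, c5]
        simp only [adj, mul_assoc]
        rw [reassoc₂ c6]
    _ = _ := by rw [c7, mul_assoc, hκ.s_flip b a, c8]

end Link

end Adj

/-! ## The inner product of `Re` -/

section ReForm

/-- `(y ⊗ T) ↦ ⟨h, T w⟩ y`. -/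
def slice (h : G) (w : Re G) : G ⊗[ℂ] End ℂ (Re G) →ₗ[ℂ] G :=
  (TensorProduct.rid ℂ G).toLinearMap ∘ₗ lTensor G
    (LinearMap.applyₗ h ∘ₗ (Re.vec G).symm.toLinearMap ∘ₗ LinearMap.applyₗ w)

@[simp] lemma slice_tmul (h : G) (w : Re G) (y : G) (T : End ℂ (Re G)) :
    slice h w (y ⊗ₜ T) = (Re.vec G).symm (T w) h • y := rfl

lemma dual_slice (h : G) (w : Re G) (π : Dual ℂ G) (X : G ⊗[ℂ] End ℂ (Re G)) :
    π (slice h w X) = (Re.vec G).symm (component π X w) h := by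
  induction X with
  | tmul x T => simp [mul_comm]
  | _ => simp_all

lemma slice_mul_inr (h : G) (w : Re G) (X : G ⊗[ℂ] End ℂ (Re G))
    (T : End ℂ (Re G)) : slice h w (X * inr G _ T) = slice h (T w) X := by
  induction X with
  | tmul x S => simp
  | _ => simp_all [add_mul]

lemma slice_mul_inl (h : G) (w : Re G) (X : G ⊗[ℂ] End ℂ (Re G)) (y : G) :
    slice h w (X * inl G _ y) = slice h w X * y := by
  induction X with
  | tmul x S => simp
  | _ => simp_all [add_mul]

lemma slice_inl_mul (h : G) (w : Re G) (X : G ⊗[ℂ] End ℂ (Re G)) (y : G) :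
    slice h w (inl G _ y * X) = y * slice h w X := by
  induction X with
  | tmul x S => simp
  | _ => simp_all [mul_add]

variable (Γ) {h : G} (hh : IsIntegral h)
include hh

lemma slice_source_mul (w : Re G) (X : G ⊗[ℂ] End ℂ (Re G)) (ξ : G) :
    slice h w (inr G _ (reSource G ξ) * X) = counit (R := ℂ) ξ • slice h w X := by
  induction X with
  | tmul x S =>
    have e : (Re.vec G).symm (reSource G ξ (S w)) h =
        (Re.vec G).symm (S w) (antipode ℂ ξ * h) := rfl
    simp [e, hh.mul, HopfAlgebra.counit_antipode, smul_smul]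
  | _ => simp_all [mul_add, smul_add]

include Γ in
lemma slice_target_mul [Module.Finite ℂ G] (w : Re G) (X : G ⊗[ℂ] End ℂ (Re G)) (ξ : G) :
    slice h w (inr G _ (reTarget G ξ) * X) = counit (R := ℂ) ξ • slice h w X := by
  induction X with
  | tmul x S =>
    have e : (Re.vec G).symm (reTarget G ξ (S w)) h = (Re.vec G).symm (S w) (h * ξ) := rfl
    simp [e, hh.mul_right Γ, smul_smul]
  | _ => simp_all [mul_add, smul_add]

variable [Module.Finite ℂ G] (κ : Gˣ)

omit hh in
/-- The adjoint of the holonomy on `Re`. -/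
def reAdj : G ⊗[ℂ] End ℂ (Re G) := (reLink Γ).adj κ (inl G _) (inr G _)

omit hh in
lemma slice_mul_reU (X : G ⊗[ℂ] End ℂ (Re G)) {n : ℕ} (b : Module.Basis (Fin n) ℂ G) :
    slice h (Re.vec G (counit (R := ℂ))) (X * reU Γ) =
      ∑ l, slice h (Re.vec G (b.coord l)) X * b l := by
  have e : reU Γ = ∑ l, inr G _ (reHol Γ (b.coord l)) * inl G _ (b l) := by
    refine component_ext fun π => ?_
    rw [component_reU, map_sum]
    simp only [inr_apply, inl_apply, Algebra.TensorProduct.tmul_mul_tmul, one_mul, mul_one,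
      component_tmul]
    simp only [← map_smul]
    rw [← map_sum]
    congr 1
    exact b.ext fun i => by simp
  rw [e, Finset.mul_sum, map_sum]
  refine Finset.sum_congr rfl fun l _ => ?_
  rw [← mul_assoc, slice_mul_inl, slice_mul_inr, reHol_apply]
  refine congrArg (fun π => slice h (Re.vec G π) X * b l) (LinearMap.ext fun ξ => ?_)
  rw [twistedMul_eq]
  have : ∀ X : G ⊗[ℂ] G, ev (b.coord l) (counit (R := ℂ)) X =
      b.coord l (ev LinearMap.id (triv G G) X) := by
    intro X
    induction X with
    | tmul x y => simp [Algebra.algebraMap_eq_smul_one, mul_comm]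
    | _ => simp_all
  rw [this, mm_mul (ev LinearMap.id (triv G G)), ← conv_apply, conv_triv]
  change b.coord l (Γ.r LinearMap.id (triv G G) * ξ) = _
  rw [Γ.r_triv, one_mul]

variable {κ} (hκ : Γ.IsStarRoot κ)
include hκ

lemma slice_target (ξ : G) (w : Re G) : slice h (reTarget G ξ w) (reAdj Γ κ) =
    ξ * slice h w (reAdj Γ κ) := by
  have e := (reLink Γ).conv_mul_adj (inl G _) (inr G (End ℂ (Re G))) hκ.toIsRoot ξ
  rw [← slice_mul_inr]
  change slice h w (_ * inr G _ ((reLink Γ).t ξ)) = _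
  rw [reAdj, ← e, conv_apply]
  have key : ∀ P : G ⊗[ℂ] G, slice h w (ev (inr G _ ∘ₗ reTarget G) (inl G _) P * reAdj Γ κ) =
      ev (triv G G) LinearMap.id P * slice h w (reAdj Γ κ) := by
    intro P
    induction P with
    | tmul x y =>
      rw [ev_tmul, ev_tmul, comp_apply, mul_assoc, slice_target_mul Γ hh, slice_inl_mul]
      simp [Algebra.algebraMap_eq_smul_one]
    | _ => simp_all [add_mul]
  refine (key _).trans ?_
  rw [← conv_apply, triv_conv]
  rfl

lemma slice_source (ξ : G) (w : Re G) : slice h (reSource G ξ w) (reAdj Γ κ) =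
    slice h w (reAdj Γ κ) * antipode ℂ ξ := by
  let H : G →ₗ[ℂ] G := slice h w ∘ₗ LinearMap.mulLeft ℂ (reAdj Γ κ) ∘ₗ inr G _ ∘ₗ reSource G
  have h0 : ∀ ξ, H ξ = slice h (reSource G ξ w) (reAdj Γ κ) := fun ξ => slice_mul_inr _ _ _ _
  have h1 : conv H LinearMap.id = LinearMap.mulLeft ℂ (slice h w (reAdj Γ κ)) ∘ₗ triv G G := by
    ext ξ
    have e := (reLink Γ).adj_mul_conv (inl G _) (inr G (End ℂ (Re G))) hκ.toIsRoot ξ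
    have key : ∀ P : G ⊗[ℂ] G, ev H LinearMap.id P =
        slice h w (reAdj Γ κ * ev (inr G _ ∘ₗ reSource G) (inl G _) P) := by
      intro P
      induction P with
      | tmul x y =>
        rw [ev_tmul, ev_tmul, ← mul_assoc, slice_mul_inl]
        rfl
      | _ => simp_all [mul_add]
    rw [conv_apply, key, ← conv_apply]
    refine (congrArg (slice h w) e).trans ((slice_source_mul hh w _ ξ).trans ?_)
    simp [reAdj, Algebra.algebraMap_eq_smul_one]
  have h2 : H = LinearMap.mulLeft ℂ (slice h w (reAdj Γ κ)) ∘ₗ antipode ℂ := by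
    have h3 := conv_assoc H LinearMap.id (antipode ℂ)
    have h4 := conv_antipode (LinearMap.id : G →ₗ[ℂ] G)
    rw [LinearMap.id_comp] at h4
    rw [h4, conv_triv, h1] at h3
    rw [← h3]
    ext ξ
    have key : ∀ P : G ⊗[ℂ] G, ev (LinearMap.mulLeft ℂ (slice h w (reAdj Γ κ)) ∘ₗ triv G G)
        (antipode ℂ) P = slice h w (reAdj Γ κ) * ev (triv G G) (antipode ℂ) P := by
      intro P
      induction P with
      | tmul x y => simp [mul_assoc]
      | _ => simp_all [mul_add]
    rw [conv_apply, key, ← conv_apply, triv_conv]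
    rfl
  rw [← h0, h2]
  rfl

omit hh in
lemma slice_component (ρ π : Dual ℂ G) (w : Re G) :
    ρ (slice h (component π (reAdj Γ κ) w) (reAdj Γ κ)) =
      ev ρ π (comul (R := ℂ) (slice h w (reAdj Γ κ)) * (Γ.R⁻¹).1) := by
  have e := (reLink Γ).adj_mul_adj (fst G _) (snd G _) (thd G (End ℂ (Re G))) hκ.toIsRoot
  have e1 : leg₁ G _ (reAdj Γ κ) * leg₂ G _ (reAdj Γ κ) = comulAux G _ (reAdj Γ κ) *
      aux G _ (Γ.R⁻¹).1 := by
    rw [leg₁_eq, leg₂_eq, comulAux_eq, aux_eq, reAdj, Link.ev_adj, Link.ev_adj, Link.ev_adj, e]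
    rfl
  have key : ∀ (Y : G ⊗[ℂ] G) (Z : G ⊗[ℂ] End ℂ (Re G)),
      component π (component ρ (comulAux G _ Z * aux G _ Y)) =
      component (Module.Dual.transpose (LinearMap.mulRight ℂ Y ∘ₗ comul) (ev ρ π)) Z := by
    intro Y Z
    induction Z with
    | tmul z f =>
      simp only [comulAux, AlgHom.coe_comp, Function.comp_apply, Algebra.TensorProduct.map_tmul,
        AlgHom.coe_id, id_eq, Bialgebra.comulAlgHom_apply, component_tmul,
        Module.Dual.transpose_apply, comp_apply, LinearMap.mulRight_apply]
      generalize comul (R := ℂ) z = X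
      induction X with
      | zero => simp
      | add X Y h h' => simp only [map_add, TensorProduct.add_tmul, add_mul, h, h', add_smul]
      | tmul y z =>
        induction Y with
        | zero => simp
        | add X Y h h' => simp only [map_add, mul_add, h, h', add_smul]
        | tmul y' z' => simp [aux, mul_smul]
    | _ => simp_all [add_mul]
  have h1 := component_component_legs ρ π (reAdj Γ κ) (reAdj Γ κ)
  rw [e1, key] at h1
  rw [dual_slice, ← Module.End.mul_apply, ← h1, ← dual_slice]
  rfl

end ReForm

/-- `ξ ↦ conj π(ξ^*)`. -/
def dualStar (π : Dual ℂ G) : Dual ℂ G where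
  toFun ξ := star (π (star ξ))
  map_add' := by simp
  map_smul' := by simp

@[simp] lemma dualStar_apply (π : Dual ℂ G) (ξ : G) : dualStar π ξ = star (π (star ξ)) := rfl

@[simp] lemma dualStar_dualStar (π : Dual ℂ G) : dualStar (dualStar π) = π := by ext; simp

lemma component_star [StarRing A] [StarModule ℂ A]
    (π : Dual ℂ G) (X : G ⊗[ℂ] A) :
    component π (star X) = star (component (dualStar π) X) := by
  induction X with
  | tmul x y => simp [TensorProduct.star_tmul]
  | _ => simp_all

lemma star_ev_dual (π ρ : Dual ℂ G) (X : G ⊗[ℂ] G) :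
    star (ev π ρ X) = ev (dualStar ρ) (dualStar π) (flipTensor G (star X)) := by
  induction X with
  | tmul x y => simp [TensorProduct.star_tmul, flipTensor, mul_comm]
  | _ => simp_all

lemma flipTensor_flipTensor (X : G ⊗[ℂ] G) : flipTensor G (flipTensor G X) = X :=
  (Algebra.TensorProduct.comm ℂ G G).symm_apply_apply X

lemma RibbonStar.star_ev_antipode (Γ : RibbonStar G) (X : G ⊗[ℂ] G) :
    star (ev LinearMap.id (antipode ℂ) X) = drinfeldElement (star X) := by
  induction X with
  | zero => simp [drinfeldElement]
  | add X Y h h' =>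
    simp only [drinfeldElement, star_add, map_add] at h h' ⊢
    rw [h, h']
  | tmul x y => simp [TensorProduct.star_tmul, drinfeldElement, flipTensor, Γ.antipode_star]

/-! ## The Hilbert space `Re` -/

section ReCore

variable {κ : Gˣ} (hκ : Γ.IsStarRoot κ) {h : G} (hh : IsIntegral h) {tr : G →ₗ[ℂ] ℂ}
  (ht : IsPosTrace tr)

/-- The vector `|tr(· y)⟩`. -/
def traceVec (tr : G →ₗ[ℂ] ℂ) (y : G) : Re G := Re.vec G (tr ∘ₗ LinearMap.mulRight ℂ y)

variable [Module.Finite ℂ G]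
include hκ hh

lemma slice_traceVec (y : G) : slice h (traceVec tr y) (reAdj Γ κ) =
    y * slice h (traceVec tr 1) (reAdj Γ κ) := by
  rw [← slice_target Γ hh hκ]
  refine congrArg (fun w => slice h w _) (congrArg (Re.vec G) (LinearMap.ext fun ξ => ?_))
  change tr (ξ * y) = tr (ξ * y * 1)
  rw [mul_one]

include ht

lemma slice_traceVec_central (y : G) : slice h (traceVec tr 1) (reAdj Γ κ) * y =
    y * slice h (traceVec tr 1) (reAdj Γ κ) := by
  obtain ⟨ξ, rfl⟩ := Γ.antipode_bijective.2 y
  rw [← slice_source Γ hh hκ, ← slice_traceVec hκ hh]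
  refine congrArg (fun w => slice h w _) (congrArg (Re.vec G) (LinearMap.ext fun η => ?_))
  change tr (antipode ℂ ξ * η * 1) = tr (η * antipode ℂ ξ)
  rw [mul_one, ht.comm]

omit ht in
lemma sum_slice_mul {n : ℕ} (b : Module.Basis (Fin n) ℂ G) :
    ∑ l, slice h (Re.vec G (b.coord l)) (reAdj Γ κ) *
      drinfeldElement ((Γ.twist κ)⁻¹).1 * b l = 1 := by
  have key : ∀ (w : Re G) (P : G ⊗[ℂ] G), slice h w (reAdj Γ κ *
      ev (inl G _) (inr G _ ∘ₗ reSource G) P) = slice h w (reAdj Γ κ) * drinfeldElement P := by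
    intro w P
    induction P with
    | zero => simp [drinfeldElement]
    | add X Y h h' =>
      simp only [drinfeldElement, map_add, mul_add] at h h' ⊢
      rw [h, h']
    | tmul x y =>
      rw [ev_tmul, comp_apply, (comm_of (inl G _) (inr G _) x _).eq, ← mul_assoc,
        slice_mul_inl, slice_mul_inr, slice_source Γ hh hκ]
      simp [drinfeldElement, flipTensor, mul_assoc]
  have key' : ∀ P : G ⊗[ℂ] G, slice h (Re.vec G (counit (R := ℂ)))
      (ev (inl G _) (inr G _ ∘ₗ reTarget G) P) = ev LinearMap.id (triv G G) P := by
    intro P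
    induction P with
    | tmul x y =>
      have e : (Re.vec G).symm (reTarget G y (Re.vec G (counit (R := ℂ)))) h =
        counit (R := ℂ) (h * y) := rfl
      simp [e, hh.counit_eq, Algebra.algebraMap_eq_smul_one]
    | _ => simp_all
  have e := slice_mul_reU Γ (h := h) (reAdj Γ κ * Γ.si κ (inl G _) (inr G _ ∘ₗ reSource G)) b
  have e1 : reAdj Γ κ * Γ.si κ (inl G _) (inr G _ ∘ₗ reSource G) * reU Γ =
      Γ.si κ (inl G _) (inr G _ ∘ₗ reTarget G) := by
    have e2 := (reLink Γ).ui_mul_u (inl G _) (inr G (End ℂ (Re G)))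
    change Γ.si κ _ (_ ∘ₗ reTarget G) * _ * Γ.s κ _ (_ ∘ₗ reSource G) * _ * _ = _
    rw [mul_assoc _ (Γ.s κ _ _), Γ.s_mul_si, mul_one, mul_assoc]
    conv_rhs => rw [← mul_one (Γ.si κ _ _), ← e2]
    congr 2
    exact (ev_inl_inr _).symm
  have e3 : Γ.si κ LinearMap.id (triv G G) = 1 := by
    have e4 := Γ.s_mul_si (triv G G) LinearMap.id κ
    rw [hκ.triv_si, mul_one] at e4
    rw [← hκ.s_flip LinearMap.id (triv G G), e4]
  rw [e1, RibbonStar.si, key', ← RibbonStar.si, e3] at e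
  rw [e]
  exact Finset.sum_congr rfl fun l _ => by rw [RibbonStar.si, key]

lemma exists_sum_star_mul {Z : G ⊗[ℂ] G} (hZ : star Z = Z) (hS : Z * Z = ((Γ.twist κ)⁻¹).1) :
    ∃ x : Fin (Module.finrank ℂ G) → G,
      slice h (traceVec tr 1) (reAdj Γ κ) * ∑ l, star (x l) * x l = 1 := by
  obtain ⟨b, hb⟩ := ht.exists_basis
  set c := slice h (traceVec tr 1) (reAdj Γ κ)
  have hc : ∀ y, c * y = y * c := slice_traceVec_central hκ hh ht
  have key : ∀ Z Z' : G ⊗[ℂ] G, ∑ l, star (b l) * drinfeldElement (Z * Z') * b l =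
      ∑ l, star (b l) * (drinfeldElement Z * ev LinearMap.id (antipode ℂ) Z') * b l := by
    intro Z Z'
    induction Z' with
    | zero => simp [drinfeldElement]
    | add X Y h h' =>
      simp only [drinfeldElement, map_add, mul_add, add_mul, Finset.sum_add_distrib] at h h' ⊢
      rw [h, h']
    | tmul p q =>
      have e : ∀ Z : G ⊗[ℂ] G, drinfeldElement (Z * (p ⊗ₜ q)) =
          antipode ℂ q * (drinfeldElement Z * p) := by
        intro Z
        induction Z with
        | zero => simp [drinfeldElement]
        | add X Y h h' =>
          simp only [drinfeldElement, map_add, mul_add, add_mul] at h h' ⊢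
          rw [h, h']
        | tmul x y =>
          simp [drinfeldElement, flipTensor, HopfAlgebra.antipode_mul_antidistrib, mul_assoc]
      have e2 := ht.sum_comm hb (antipode ℂ q) (drinfeldElement Z * p)
      simp only [e, ev_tmul, LinearMap.id_apply, mul_assoc] at e2 ⊢
      exact e2
  have e := sum_slice_mul hκ hh b
  have e1 : ∀ l, slice h (Re.vec G (b.coord l)) (reAdj Γ κ) = c * star (b l) := fun l => by
    rw [hc, ← slice_traceVec hκ hh]
    refine congrArg (fun w => slice h w _) (congrArg (Re.vec G) (LinearMap.ext fun η => ?_))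
    change b.repr η l = tr (η * star (b l))
    rw [hb, ht.comm]
  simp only [e1, mul_assoc] at e
  rw [← Finset.mul_sum] at e
  refine ⟨fun l => ev LinearMap.id (antipode ℂ) Z * b l, ?_⟩
  have e2 := key Z Z
  rw [hS] at e2
  simp only [mul_assoc] at e2
  rw [e2] at e
  rw [← e]
  simp only [star_mul, Γ.star_ev_antipode, hZ, mul_assoc]

variable (Γ κ) in
omit hκ hh ht in
/-- The form of `Re`. -/
def reInner (h : G) (w w' : Re G) : ℂ := star ((Re.vec G).symm w (star (slice h w' (reAdj Γ κ))))

lemma exists_reCore {Z : G ⊗[ℂ] G} (hZ : star Z = Z) (hS : Z * Z = ((Γ.twist κ)⁻¹).1) :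
    ∃ c : Core ℂ (Re G), ∀ w w', c.inner w w' = reInner Γ κ h w w' := by
  obtain ⟨x, hx⟩ := exists_sum_star_mul hκ hh ht hZ hS
  have hA := slice_traceVec (tr := tr) hκ hh
  have hc := slice_traceVec_central hκ hh ht
  set c := slice h (traceVec tr 1) (reAdj Γ κ)
  have hW : star (∑ l, star (x l) * x l) = ∑ l, star (x l) * x l := by simp [star_sum]
  have hcs : star c = c := by
    have e := congrArg star hx
    rw [star_mul, hW, star_one] at e
    exact (left_inv_eq_right_inv hx e).symm
  have hsurj : ∀ w : Re G, ∃ y, w = traceVec tr y := fun w => by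
    obtain ⟨b, hb⟩ := ht.exists_basis
    obtain ⟨π, rfl⟩ := (Re.vec G).surjective w
    refine ⟨∑ l, π (b l) • star (b l), congrArg _ (b.ext fun j => ?_)⟩
    have e : ∀ i, tr (b j * star (b i)) = if j = i then 1 else 0 := fun i => by
      rw [ht.comm, ← hb, b.repr_self, Finsupp.single_apply]
    simp [Finset.mul_sum, e]
  have hin : ∀ a b, reInner Γ κ h (traceVec tr a) (traceVec tr b) = tr (star a * (b * c)) :=
    fun a b => by
    rw [reInner, hA]
    change star (tr (star _ * a)) = _
    rw [← ht.star, star_mul, star_star]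
  have hpos : ∀ a, tr (star a * (a * c)) = ∑ l, tr (star (a * c * star (x l)) *
      (a * c * star (x l))) := fun a => by
    have e : ∀ l, tr (star (a * c * star (x l)) * (a * c * star (x l))) =
        tr (star a * (a * c) * (star (x l) * x l) * c) := fun l => by
      simp only [star_mul, star_star, hcs]
      rw [mul_assoc (x l), ht.comm, mul_assoc c, mul_assoc c, ht.comm c]
      simp only [mul_assoc]
    simp only [e]
    rw [← map_sum, ← Finset.sum_mul, ← Finset.mul_sum, mul_assoc, ← hc (∑ l, _), hx, mul_one]
  refine ⟨{ inner := reInner Γ κ h, conj_inner_symm := fun w w' => ?_, re_inner_nonneg := fun w => ?_, add_left := fun w w' z => ?_, smul_left := fun w w' r => ?_, definite := fun w hw => ?_ }, fun _ _ => rfl⟩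
  · obtain ⟨a, rfl⟩ := hsurj w
    obtain ⟨b, rfl⟩ := hsurj w'
    change star (reInner Γ κ h _ _) = reInner Γ κ h _ _
    rw [hin, hin, ← ht.star, star_mul, star_mul, star_star, hcs, mul_assoc, ht.comm, mul_assoc]
  · obtain ⟨a, rfl⟩ := hsurj w
    change 0 ≤ (reInner Γ κ h _ _).re
    rw [hin, hpos, Complex.re_sum]
    exact Finset.sum_nonneg fun l _ => ht.nonneg _
  · simp [reInner]
  · simp [reInner]
  · obtain ⟨a, rfl⟩ := hsurj w
    change reInner Γ κ h _ _ = 0 at hw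
    rw [hin, hpos] at hw
    have h1 := congrArg Complex.re hw
    rw [Complex.re_sum, Complex.zero_re, Finset.sum_eq_zero_iff_of_nonneg fun l _ => ht.nonneg _] at h1
    have h2 : ∀ l, a * c * star (x l) = 0 := fun l => ht.eq_zero _ (Complex.ext (h1 l (Finset.mem_univ l)) (by
      have e := ht.star (star (a * c * star (x l)) * (a * c * star (x l)))
      rw [star_mul, star_star] at e
      have := congrArg Complex.im e
      simp only [Complex.star_def, Complex.conj_im] at this
      simp only [Complex.zero_im]
      linarith))
    have h3 : a = 0 := by
      rw [← mul_one a, ← hx, ← mul_assoc, Finset.mul_sum]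
      exact Finset.sum_eq_zero fun l _ => by rw [← mul_assoc, h2, zero_mul]
    rw [h3, traceVec]
    simp

omit hh ht in
lemma isStarLink_reLink (c : Core ℂ (Re G))
    (hc : ∀ w w', c.inner w w' = reInner Γ κ h w w') (hh : IsIntegral h) :
    letI := endStar c
    letI := endStarModule c
    (reLink Γ).IsStarLink κ := by
  letI := endStar c
  letI := endStarModule c
  have hU : star (reU Γ) = reAdj Γ κ := by
    refine component_ext fun π => ?_
    rw [component_star, component_reU]
    refine endStar_eq c fun w w' => ?_
    rw [← c.conj_inner_symm, ← c.conj_inner_symm w, hc, hc]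
    refine congrArg star ?_
    obtain ⟨ρ, rfl⟩ := (Re.vec G).surjective w'
    have e := slice_component Γ hκ (h := h) (dualStar ρ) π w
    rw [reInner, reInner, reHol_apply]
    refine e.trans ?_
    change _ = star (twistedMul Γ _ _ _)
    rw [twistedMul_eq, star_ev_dual, dualStar_dualStar, star_mul, Γ.star_comul, star_star,
      Γ.star_R, map_mul (flipTensor G), flipTensor_flipTensor, flipTensor_flipTensor]
  refine ⟨⟨fun ξ => ?_⟩, ⟨fun ξ => ?_⟩, ?_⟩
  · refine (endStar_eq c fun w w' => ?_).symm
    rw [hc, hc]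
    change star ((Re.vec G).symm w (_ * star ξ)) = star ((Re.vec G).symm w (star (slice h (reTarget G ξ w') _)))
    rw [slice_target Γ hh hκ, star_mul]
  · refine (endStar_eq c fun w w' => ?_).symm
    rw [hc, hc]
    change star ((Re.vec G).symm w (antipode ℂ (star ξ) * _)) =
      star ((Re.vec G).symm w (star (slice h (reSource G ξ w') _)))
    rw [slice_source Γ hh hκ, star_mul, Γ.antipode_star]
  · change star (reU Γ) * _ * reU Γ = _
    rw [hU]
    have e2 := (reLink Γ).ui_mul_u (inl G _) (inr G (End ℂ (Re G)))
    change Γ.si κ _ (_ ∘ₗ reTarget G) * _ * Γ.s κ _ (_ ∘ₗ reSource G) * Γ.si κ _ (_ ∘ₗ reSource G) * _ = Γ.si κ _ (_ ∘ₗ reTarget G)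
    rw [mul_assoc _ (Γ.s κ _ _), Γ.s_mul_si, mul_one, mul_assoc]
    conv_rhs => rw [← mul_one (Γ.si κ _ _), ← e2]
    congr 2
    exact (ev_inl_inr _).symm

end ReCore

/-! ## Inner products defined by operators -/

section CoreForm

lemma exists_basis_inner {W : Type*} [AddCommGroup W] [Module ℂ W] [FiniteDimensional ℂ W]
    (c : Core ℂ W) : ∃ b : Module.Basis (Fin (Module.finrank ℂ W)) ℂ W,
      ∀ x y, c.inner x y = ∑ i, star (b.repr x i) * b.repr y i := by
  obtain ⟨b, hb⟩ := exists_orthonormal c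
  refine ⟨b, fun x y => ?_⟩
  let := c.toNormedAddCommGroup
  let : InnerProductSpace ℂ W := InnerProductSpace.ofCore c.toCore
  conv_lhs => rw [← b.sum_repr y]
  refine (inner_sum (𝕜 := ℂ) Finset.univ _ x).trans (Finset.sum_congr rfl fun i _ => ?_)
  refine (inner_smul_right x (b i) (b.repr y i)).trans ?_
  rw [hb x i, mul_comm]
  exact congrArg (· * _) (c.conj_inner_symm x (b i)).symm

/-- The inner product for which a given basis is orthonormal. -/
def basisCore {W ι : Type*} [AddCommGroup W] [Module ℂ W] [Fintype ι] (b : Module.Basis ι ℂ W) :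
    Core ℂ W where
  inner x y := ∑ i, star (b.repr x i) * b.repr y i
  conj_inner_symm x y := by simp [mul_comm]
  re_inner_nonneg x := by
    simp only [RCLike.re_to_complex, Complex.re_sum]
    refine Finset.sum_nonneg fun i _ => ?_
    rw [Complex.star_def, Complex.conj_mul', ← Complex.ofReal_pow, Complex.ofReal_re]
    positivity
  add_left x y z := by simp [add_mul, Finset.sum_add_distrib]
  smul_left x y r := by simp [Finset.mul_sum, mul_assoc]
  definite x hx := by
    have h : ∀ i, star (b.repr x i) * b.repr x i = ((‖b.repr x i‖ ^ 2 : ℝ) : ℂ) := fun i => by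
      rw [Complex.star_def, Complex.conj_mul']
      norm_cast
    change ∑ i, star (b.repr x i) * b.repr x i = 0 at hx
    simp only [h] at hx
    rw [← Complex.ofReal_sum, Complex.ofReal_eq_zero,
      Finset.sum_eq_zero_iff_of_nonneg fun i _ => by positivity] at hx
    refine b.ext_elem fun i => ?_
    simpa using hx i (Finset.mem_univ i)

variable {W : Type*} [AddCommGroup W] [Module ℂ W] [FiniteDimensional ℂ W] {c c₀ : Core ℂ W}
  {Ω : End ℂ W} (hc : ∀ x y, c.inner x y = c₀.inner x (Ω y))
include hc

lemma inner_form_left (x y : W) : c₀.inner (Ω x) y = c.inner x y := by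
  rw [← c₀.conj_inner_symm, ← hc, c.conj_inner_symm]

lemma endStar_form {T T' : End ℂ W} (h : (endStar c₀).star T * Ω = Ω * T') :
    (endStar c).star T = T' := by
  refine endStar_eq c fun x y => ?_
  rw [← inner_form_left hc, ← inner_form_left hc, ← Module.End.mul_apply, ← h,
    Module.End.mul_apply, inner_endStar]

lemma exists_core_mul_self {Z Z' : End ℂ W} (hZ : (endStar c₀).star Z * Ω = Ω * Z)
    (hZ' : Z' * Z = 1) :
    ∃ c' : Core ℂ W, ∀ x y, c'.inner x y = c₀.inner x ((Ω * (Z * Z)) y) := by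
  refine ⟨
    { inner := fun x y => c.inner (Z x) (Z y)
      conj_inner_symm := fun x y => c.conj_inner_symm _ _
      re_inner_nonneg := fun x => c.re_inner_nonneg _
      add_left := fun x y z => by rw [map_add]; exact c.add_left _ _ _
      smul_left := fun x y r => by rw [map_smul]; exact c.smul_left _ _ _
      definite := fun x hx => by
        rw [← Module.End.one_apply (R := ℂ) x, ← hZ', Module.End.mul_apply, c.definite _ hx,
          map_zero] }, fun x y => ?_⟩
  have h : ∀ a b, c.inner (Z a) b = c.inner a (Z b) := fun a b => by
    rw [← inner_endStar, endStar_form hc hZ]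
  change c.inner (Z x) (Z y) = _
  rw [h, hc]
  rfl

end CoreForm

section ChainCore

variable {κ : Gˣ} [StarRing B] [StarModule ℂ B]

namespace Link

lemma map_form
    (d : Link Γ B) (y : ℕ → B →ₗ[ℂ] E) (p q : G →ₗ[ℂ] E) (k : E →ₗ[ℂ] F) [IsMulMap k] (n : ℕ) :
    k (d.form κ y p q n) = d.form κ (fun i => k ∘ₗ y i) (k ∘ₗ p) (k ∘ₗ q) n := by
  have h : ∀ m, k (d.omega κ y m) = d.omega κ (fun i => k ∘ₗ y i) m := fun m => by
    induction m with
    | zero => exact mm_one k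
    | succ m ih => rw [omega, omega, mm_mul k, ih, RibbonStar.si_ev, map_theta]; rfl
  rw [form, form, mm_mul k, mm_mul k, h, RibbonStar.si_ev, RibbonStar.si_ev, map_conv, map_theta]

lemma star_link [StarRing E] [StarModule ℂ E]
    {d : Link Γ B} {y : ℕ → B →ₗ[ℂ] E} {p q a : G →ₗ[ℂ] E} {n : ℕ}
    (hκ : Γ.IsStarRoot κ) (hd : d.IsStarLink κ) (h : IsChain n y p q)
    (hy : ∀ k < n, IsStarMap (y k)) [IsStarMap p] [IsStarMap q] (ha : Off n y p q a) [IsStarMap a]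
    {m l : ℕ} (hm : m ≤ n) (hl : m = l + 1 ∨ m = 0 ∧ l = n) :
    star (d.chainLink y p n a m) * (d.form κ y p q n * Γ.si κ a (d.chainSite y p q n l)) *
      d.chainLink y p n a m = d.form κ y p q n * Γ.si κ a (d.chainSite y p q n m) := by
  rcases hl with rfl | ⟨rfl, rfl⟩
  · rcases hm.lt_or_eq with hm | hm
    · exact star_link_succ hκ hd h hy ha hm
    · have e := star_link_last hκ hd h hy ha hm
      subst hm
      exact e
  · by_cases hn : l = 0
    · have e := star_loop hκ hd h hy ha hn
      subst hn
      exact e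
    · exact star_link_zero hκ hd h hy ha hn

variable {W : Type*} [AddCommGroup W] [Module ℂ W] [FiniteDimensional ℂ W]

lemma exists_core_form (c₀ : Core ℂ W) {d : Link Γ B}
    {y : ℕ → B →ₗ[ℂ] End ℂ W} {p q : G →ₗ[ℂ] End ℂ W} {n : ℕ}
    (hκ : Γ.IsStarRoot κ) (hd : d.IsStarLink κ) (h : IsChain (E := End ℂ W) n y p q)
    (hst : letI := endStar c₀; (∀ k < n, IsStarMap (y k)) ∧ IsStarMap p ∧ IsStarMap q)
    {Z : G ⊗[ℂ] G} (hZ : star Z = Z) (hS : Z * Z = ((Γ.twist κ)⁻¹).1) :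
    ∃ c : Core ℂ W, ∀ x z, c.inner x z = c₀.inner x (d.form (E := End ℂ W) κ y p q n z) := by
  letI := endStar c₀
  letI := endStarModule c₀
  obtain ⟨hy, _, _⟩ := hst
  have := h.mul_p
  have := h.mul_q
  have := h.comm_pq
  have := theta_mul (E := End ℂ W) (d := d) h n le_rfl
  obtain ⟨_, _⟩ := comm_pq_theta (E := End ℂ W) (d := d) h n le_rfl
  have step : ∀ (Ω : End ℂ W) (f g : G →ₗ[ℂ] End ℂ W) [IsMulMap (E := End ℂ W) f]
      [IsMulMap (E := End ℂ W) g] [Comm (E := End ℂ W) f g] [IsStarMap g]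
      (c : Core ℂ W) (_ : ∀ x z, c.inner x z = c₀.inner x (Ω z))
      (_ : ∀ ξ, star (f ξ) * Ω = Ω * f (star ξ)) (_ : ∀ ξ, Commute (g ξ) Ω),
      ∃ c : Core ℂ W, ∀ x z, c.inner x z = c₀.inner x ((Ω * Γ.si (E := End ℂ W) κ f g) z) := by
    intro Ω f g _ _ _ _ c hc hf hg
    have e := star_ev_mul (E := End ℂ W) f g hf hg Z
    rw [hZ] at e
    have e1 : ev (E := End ℂ W) f g Z * ev f g Z = Γ.si (E := End ℂ W) κ f g := by
      rw [← mm_mul (E := End ℂ W) (ev f g), hS]; rfl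
    obtain ⟨c', hc'⟩ := exists_core_mul_self hc e (Z' := Γ.s (E := End ℂ W) κ f g * ev f g Z) (by
        rw [mul_assoc, e1]; exact Γ.s_mul_si (E := End ℂ W) f g κ)
    exact ⟨c', fun x z => by rw [hc', e1]⟩
  have hΩ : ∀ k ≤ n, ∃ c : Core ℂ W, ∀ x z, c.inner x z =
      c₀.inner x (d.omega (E := End ℂ W) κ y k z) := by
    intro k
    induction k with
    | zero => exact fun _ => ⟨c₀, fun x z => rfl⟩
    | succ k ih =>
      intro hk
      obtain ⟨c, hc⟩ := ih (by omega)
      have := theta_mul (E := End ℂ W) (d := d) h k (by omega)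
      have := h.mul k hk
      have := hy k hk
      have := hd.star_s
      have : Comm (E := End ℂ W) (d.theta (E := End ℂ W) y k) (y k) :=
        theta_comm (E := End ℂ W) _ k fun i hi => h.comm i (hi.trans hk) k hk hi.ne
      refine step _ _ (y k ∘ₗ d.s) c hc
        (star_theta_mul_omega (E := End ℂ W) hκ hd h hy k (by omega)) fun ξ => ?_
      refine (commute_omega (E := End ℂ W) k fun i hi η => ?_).symm
      have := h.comm i (hi.trans hk) k hk hi.ne
      exact comm_of (E := End ℂ W) (y i) (y k) _ _
  have cp : ∀ ξ, Commute (p ξ) (d.omega (E := End ℂ W) κ y n) := fun ξ =>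
    (commute_omega (E := End ℂ W) n fun i hi η => by
      have := h.comm_p i hi
      exact comm_of (E := End ℂ W) (y i) p _ _).symm
  obtain ⟨c, hc⟩ := hΩ n le_rfl
  obtain ⟨c', hc'⟩ := step _ (d.theta (E := End ℂ W) y n) p c hc
    (star_theta_mul_omega (E := End ℂ W) hκ hd h hy n le_rfl) cp
  refine step _ (conv (A := End ℂ W) (d.theta (E := End ℂ W) y n) p) q c' hc'
    (hκ.star_conv_mul (E := End ℂ W) _ p
      (star_theta_mul_omega (E := End ℂ W) hκ hd h hy n le_rfl) cp) fun ξ => ?_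
  refine ((commute_omega (E := End ℂ W) n fun i hi η => ?_).mul_left
    (comm_of (E := End ℂ W) (ev (E := End ℂ W) (d.theta (E := End ℂ W) y n) p) q _ _)).symm
  have := h.comm_q i hi
  exact comm_of (E := End ℂ W) (y i) q _ _

end Link

end ChainCore

/-! ## The inner products of the carrier spaces -/

section TensorCore

lemma core_ext {W : Type*} [AddCommGroup W] [Module ℂ W] (c : Core ℂ W)
    {x y : W} (h : ∀ z, c.inner x z = c.inner y z) : x = y := by
  let := c.toNormedAddCommGroup
  let : InnerProductSpace ℂ W := InnerProductSpace.ofCore c.toCore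
  exact ext_inner_right ℂ h

/-- The inner product as a linear functional. -/
def coreFun {W : Type*} [AddCommGroup W] [Module ℂ W] (c : Core ℂ W) (x : W) : W →ₗ[ℂ] ℂ where
  toFun y := c.inner x y
  map_add' y z := by
    rw [← c.conj_inner_symm, c.add_left, map_add, c.conj_inner_symm, c.conj_inner_symm]
  map_smul' r y := by
    rw [← c.conj_inner_symm, c.smul_left, map_mul, c.conj_inner_symm]
    simp

variable {W W' : Type*} [AddCommGroup W] [Module ℂ W] [FiniteDimensional ℂ W] [AddCommGroup W']
  [Module ℂ W'] [FiniteDimensional ℂ W'] {n : ℕ}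

lemma exists_tensorCore (c : Core ℂ W) (c' : Core ℂ W')
    (n : ℕ) : ∃ c₀ : Core ℂ ((⨂[ℂ] _ : Fin n, W) ⊗[ℂ] W'), ∀ x y v v',
      c₀.inner (PiTensorProduct.tprod ℂ x ⊗ₜ v) (PiTensorProduct.tprod ℂ y ⊗ₜ v') =
        (∏ i, c.inner (x i) (y i)) * c'.inner v v' := by
  obtain ⟨b, hb⟩ := exists_basis_inner c
  obtain ⟨b', hb'⟩ := exists_basis_inner c'
  refine ⟨basisCore ((Basis.piTensorProduct fun _ : Fin n => b).tensorProduct b'),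
    fun x y v v' => ?_⟩
  simp only [hb, hb', Finset.prod_univ_sum, Fintype.piFinset_univ, Finset.sum_mul_sum]
  rw [← Finset.sum_product']
  refine Finset.sum_congr rfl fun ⟨i, j⟩ _ => ?_
  simp only [Module.Basis.tensorProduct_repr_tmul_apply, Basis.piTensorProduct_repr_tprod_apply,
    smul_eq_mul, star_mul', star_prod, Finset.prod_mul_distrib]
  ring

lemma endStar_tensor {c₀ : Core ℂ ((⨂[ℂ] _ : Fin n, W) ⊗[ℂ] W')}
    {T T' : End ℂ ((⨂[ℂ] _ : Fin n, W) ⊗[ℂ] W')}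
    (h : ∀ x y v v', c₀.inner (T' (PiTensorProduct.tprod ℂ x ⊗ₜ v)) (PiTensorProduct.tprod ℂ y ⊗ₜ v') =
      c₀.inner (PiTensorProduct.tprod ℂ x ⊗ₜ v) (T (PiTensorProduct.tprod ℂ y ⊗ₜ v'))) :
    T' = (endStar c₀).star T := by
  refine TensorProduct.ext (PiTensorProduct.ext (MultilinearMap.ext fun x => LinearMap.ext fun v =>
    core_ext c₀ fun z => ?_))
  change c₀.inner (T' (_ ⊗ₜ v)) z = c₀.inner ((endStar c₀).star T (_ ⊗ₜ v)) z
  rw [inner_endStar]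
  have e : coreFun c₀ (T' (PiTensorProduct.tprod ℂ x ⊗ₜ v)) =
      coreFun c₀ (PiTensorProduct.tprod ℂ x ⊗ₜ v) ∘ₗ T :=
    TensorProduct.ext (PiTensorProduct.ext (MultilinearMap.ext fun y => LinearMap.ext fun v' =>
      h x y v v'))
  exact LinearMap.congr_fun e z

end TensorCore

section CarrierCore

variable [Module.Finite ℂ G] {κ : Gˣ} {Λ : Type w} {V : Λ → Type v} [∀ I, NormedAddCommGroup (V I)]
  [∀ I, InnerProductSpace ℂ (V I)] [∀ I, FiniteDimensional ℂ (V I)] {τ : ∀ I, G →ₐ[ℂ] End ℂ (V I)}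
  (hτ : IsIrrepList V τ)

instance : FiniteDimensional ℂ (Re G) := inferInstanceAs (FiniteDimensional ℂ (Dual ℂ G))

lemma pairRep_tmul_one (I J : Λ) (ξ : G) :
    pairRep (τ I) (τ J) (ξ ⊗ₜ 1) = LinearMap.rTensorHom (V J) (τ I ξ) := by
  simp only [pairRep, AlgHom.comp_apply, Algebra.TensorProduct.map_tmul, map_one]
  rfl

lemma pairRep_one_tmul (I J : Λ) (ξ : G) :
    pairRep (τ I) (τ J) (1 ⊗ₜ ξ) = LinearMap.lTensorHom (V I) (τ J ξ) := by
  simp only [pairRep, AlgHom.comp_apply, Algebra.TensorProduct.map_tmul, map_one]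
  rfl

include hτ in
lemma exists_baseCore (c : Core ℂ (Re G)) (I J : Λ) (n : ℕ) :
    ∃ c₀ : Core ℂ (Carrier G (V I) (V J) (n + 1)), letI : StarRing (End ℂ (Re G)) := endStar c
      letI : StarRing (CEnd G (V I) (V J) n) := endStar c₀
      (∀ k < n, IsStarMap (onReChain G (V I) (V J) n k)) ∧ IsStarMap (onFst G (V J) n (τ I)) ∧
        IsStarMap (onSnd G (V I) n (τ J)) := by
  obtain ⟨c₀, h₀⟩ := exists_tensorCore (n := n) c (InnerProductSpace.toCore : Core ℂ (V I ⊗[ℂ] V J))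
  have hlast : ∀ X : G ⊗[ℂ] G, onLast G (V I) (V J) (n + 1) (pairRep (τ I) (τ J) (Star.star X)) =
      (endStar c₀).star (onLast G (V I) (V J) (n + 1) (pairRep (τ I) (τ J) X)) := fun X =>
    endStar_tensor fun x y v v' => by
      refine (h₀ x y _ _).trans (Eq.trans ?_ (h₀ x y _ _).symm)
      exact congrArg _ (hτ.star_pairRep I J X v v')
  letI : StarRing (End ℂ (Re G)) := endStar c
  letI : StarRing (CEnd G (V I) (V J) n) := endStar c₀
  refine ⟨c₀, fun k hk => ⟨fun T => ?_⟩, ⟨fun ξ => ?_⟩, ⟨fun ξ => ?_⟩⟩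
  · rw [onReChain, dif_pos hk]
    refine endStar_tensor fun x y v v' => ?_
    have e : ∀ (T : End ℂ (Re G)) (x : Fin n → Re G) (v : V I ⊗[ℂ] V J),
        onRe G (V I) (V J) (n + 1) ⟨k, hk⟩ T (PiTensorProduct.tprod ℂ x ⊗ₜ v) =
          PiTensorProduct.tprod ℂ (Function.update x ⟨k, hk⟩ (T (x ⟨k, hk⟩))) ⊗ₜ v := by
      intro T x v
      rw [onRe_apply, LinearMap.rTensor_tmul]
      refine (congrArg (· ⊗ₜ v) (PiTensorProduct.map_tprod ..)).trans ?_
      congr 2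
      ext i : 1
      by_cases hi : i = ⟨k, hk⟩
      · subst hi; simp
      · simp [hi]
    rw [e, e]
    refine (h₀ _ _ v v').trans (Eq.trans ?_ (h₀ _ _ v v').symm)
    refine congrArg (· * _) (Finset.prod_congr rfl fun i _ => ?_)
    by_cases hi : i = ⟨k, hk⟩
    · subst hi
      simp only [Function.update_self]
      exact inner_endStar c T _ _
    · rw [Function.update_of_ne hi, Function.update_of_ne hi]
  · have := hlast (ξ ⊗ₜ 1)
    rwa [TensorProduct.star_tmul, star_one, pairRep_tmul_one, pairRep_tmul_one] at this
  · have := hlast (1 ⊗ₜ ξ)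
    rwa [TensorProduct.star_tmul, star_one, pairRep_one_tmul, pairRep_one_tmul] at this

end CarrierCore

/-! ## The involution of the lattice current algebra -/

section LinkStar

variable [Module.Finite ℂ G] (Γ) (κ : Gˣ)

namespace CurrentAlgebra

/-- The element `S_m⁻¹ J_m⁻¹ S_{m-1}`. -/
def linkStar (N : ℕ) (m : ZMod N) : G ⊗[ℂ] CurrentAlgebra Γ N :=
  lTensor G (site Γ N m) ((Γ.twist κ)⁻¹).1 * linkInv Γ N m *
    lTensor G (site Γ N (m - 1)) (Γ.twist κ).1

/-- The inverse `S_{m-1}⁻¹ J_m S_m` of `linkStar`. -/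
def linkInvStar (N : ℕ) (m : ZMod N) : G ⊗[ℂ] CurrentAlgebra Γ N :=
  lTensor G (site Γ N (m - 1)) ((Γ.twist κ)⁻¹).1 * link Γ N m * lTensor G (site Γ N m) (Γ.twist κ).1

lemma lTensor_twist_mul_inv (N : ℕ) (m : ZMod N) : lTensor G (site Γ N m) (Γ.twist κ).1 *
      lTensor G (site Γ N m) ((Γ.twist κ)⁻¹).1 = 1 := by
  have : IsMulMap (site Γ N m) := (data Γ N).site_mul m
  rw [lTensor_eq_ev, lTensor_eq_ev]
  exact Γ.s_mul_si (inl G _) (inr G _ ∘ₗ site Γ N m) κ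

lemma lTensor_twist_inv_mul (N : ℕ) (m : ZMod N) : lTensor G (site Γ N m) ((Γ.twist κ)⁻¹).1 *
      lTensor G (site Γ N m) (Γ.twist κ).1 = 1 := by
  have : IsMulMap (site Γ N m) := (data Γ N).site_mul m
  rw [lTensor_eq_ev, lTensor_eq_ev]
  exact Γ.si_mul_s (inl G _) (inr G _ ∘ₗ site Γ N m) κ

lemma link_mul_linkInv (N : ℕ) (m : ZMod N) : link Γ N m * linkInv Γ N m = 1 :=
  (data Γ N).inv_right m

lemma linkInv_mul_link (N : ℕ) (m : ZMod N) : linkInv Γ N m * link Γ N m = 1 :=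
  (data Γ N).inv_left m

lemma linkStar_mul_linkInvStar (N : ℕ) (m : ZMod N) :
    linkStar Γ κ N m * linkInvStar Γ κ N m = 1 := by
  rw [linkInvStar, linkStar, mul_assoc, ← mul_assoc (lTensor G _ _) (_ * _),
    ← mul_assoc (lTensor G _ _), lTensor_twist_mul_inv, one_mul, mul_assoc,
    ← mul_assoc (linkInv Γ N m), linkInv_mul_link, one_mul, lTensor_twist_inv_mul]

lemma idTensor_lTensor_twist_inv {N : ℕ}
    (D : CurrentAlgebra Γ N →ₐ[ℂ] E) (m : ZMod N) :
    idTensor G D (lTensor G (site Γ N m) ((Γ.twist κ)⁻¹).1) =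
    Γ.si κ (inl G E) (inr G E ∘ₗ D.toLinearMap ∘ₗ site Γ N m) := by
  rw [lTensor_eq_ev, idTensor_ev_inl]
  rfl

variable {Γ κ}

lemma exists_starCore {n : ℕ} {B W : Type*} [Ring B] [Algebra ℂ B] [StarRing B] [StarModule ℂ B]
    [AddCommGroup W] [Module ℂ W] [FiniteDimensional ℂ W]
    {D : CurrentAlgebra Γ (n + 1) →ₐ[ℂ] End ℂ W} (c₀ : Core ℂ W)
    {d : Link Γ B} {y : ℕ → B →ₗ[ℂ] End ℂ W} {p q : G →ₗ[ℂ] End ℂ W}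
    (hκ : Γ.IsStarRoot κ) (hd : d.IsStarLink κ) (h : IsChain (E := End ℂ W) n y p q)
    (hst : letI := endStar c₀; (∀ k < n, IsStarMap (y k)) ∧ IsStarMap p ∧ IsStarMap q)
    (hs : ∀ m ≤ n, D.toLinearMap ∘ₗ site Γ (n + 1) ((m + 1 : ℕ) : ZMod (n + 1)) =
      d.chainSite (E := End ℂ W) y p q n m)
    (hl : ∀ m ≤ n, idTensor (B := End ℂ W) G D (link Γ (n + 1) ((m + 1 : ℕ) : ZMod (n + 1))) =
      IsChain.link (A := End ℂ W) d y p n m)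
    {Z : G ⊗[ℂ] G} (hZ : star Z = Z) (hS : Z * Z = ((Γ.twist κ)⁻¹).1) :
    ∃ c : Core ℂ W,
      (∀ m ξ, (endStar c).star (D (site Γ (n + 1) m ξ)) = D (site Γ (n + 1) m (star ξ))) ∧
      ∀ m π, (endStar c).star (D (component (dualStar π) (link Γ (n + 1) m))) =
        D (component π (linkStar Γ κ (n + 1) m)) := by
  obtain ⟨c, hc⟩ := Link.exists_core_form c₀ hκ hd h hst hZ hS
  refine ⟨c, fun m ξ => ?_, fun m π => ?_⟩
  · obtain ⟨k, hk, rfl⟩ := ZMod.exists_eq_add_one m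
    refine endStar_form hc ?_
    have e := fun ξ => LinearMap.congr_fun (hs k hk) ξ
    simp only [comp_apply, AlgHom.toLinearMap_apply, Nat.cast_succ] at e
    rw [e, e]
    letI := endStar c₀
    letI := endStarModule c₀
    obtain ⟨hy, _, _⟩ := hst
    rcases hk.lt_or_eq with hk | rfl
    · exact Link.star_site_mul_form hκ hd h hy hk ξ
    · exact Link.star_base_mul_form hκ hd h hy ξ
  · obtain ⟨k, hk, rfl⟩ := ZMod.exists_eq_add_one m
    refine endStar_form hc ?_
    letI := endStar c₀
    letI := endStarModule c₀
    obtain ⟨hy, _, _⟩ := hst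
    obtain ⟨l, hl', hlk⟩ : ∃ l ≤ n, (k = l + 1 ∨ k = 0 ∧ l = n) := by
      cases k with
      | zero => exact ⟨n, le_rfl, .inr ⟨rfl, rfl⟩⟩
      | succ k => exact ⟨k, by omega, .inl rfl⟩
    have hkl : (k : ZMod (n + 1)) + 1 - 1 = (l + 1 : ℕ) := by
      rcases hlk with rfl | ⟨rfl, rfl⟩
      · simp
      · rw [Nat.cast_succ, ZMod.natCast_self_add_one]; simp
    have hyi : ∀ i < n, IsStarMap (inr G (End ℂ W) ∘ₗ y i) := fun i hi => by
      have := hy i hi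
      infer_instance
    have : IsStarMap (inr G (End ℂ W) ∘ₗ p) := inferInstance
    have : IsStarMap (inr G (End ℂ W) ∘ₗ q) := inferInstance
    have e := Link.star_link (E := G ⊗[ℂ] End ℂ W) hκ hd (h.map (inr G _)) hyi h.off_inl hk hlk
    have hk1 := hs k hk
    have hk2 := hl k hk
    rw [Nat.cast_succ] at hk1 hk2
    have e3 := idTensor_lTensor_twist_inv Γ κ D ((k : ZMod (n + 1)) + 1)
    have e4 := idTensor_lTensor_twist_inv Γ κ D (l + 1 : ℕ)
    rw [hk1, Link.map_chainSite] at e3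
    rw [hs l hl', Link.map_chainSite] at e4
    change star (IsChain.link (A := End ℂ W) d y p n k) * _ *
      IsChain.link (A := End ℂ W) d y p n k = _ at e
    rw [← Link.map_form, ← hk2, ← e3, ← e4] at e
    rw [← component_idTensor, ← component_star, ← component_mul_inr, ← component_idTensor,
      ← component_inr_mul, linkStar, hkl, map_mul (idTensor G D), map_mul (idTensor G D), ← mul_assoc,
      ← mul_assoc, ← e,
      mul_assoc (_ * _) (idTensor G D (link _ _ _)), ← map_mul (idTensor G D) (link _ _ _),
      link_mul_linkInv, map_one, mul_one, ← mul_assoc, mul_assoc,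
      ← map_mul (idTensor G D) (lTensor _ _ _), lTensor_twist_inv_mul, map_one, mul_one]

lemma endStar_linkInv {N : ℕ} {W : Type*} [AddCommGroup W] [Module ℂ W] [FiniteDimensional ℂ W]
    {D : CurrentAlgebra Γ N →ₐ[ℂ] End ℂ W} {c : Core ℂ W}
    (h : ∀ m π, (endStar c).star (D (component (dualStar π) (link Γ N m))) =
      D (component π (linkStar Γ κ N m))) (m : ZMod N) (π : Dual ℂ G) :
    (endStar c).star (D (component (dualStar π) (linkInv Γ N m))) =
      D (component π (linkInvStar Γ κ N m)) := by
  letI := endStar c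
  letI := endStarModule c
  rw [← component_idTensor, ← component_idTensor]
  refine (component_star π _).symm.trans (congrArg _ ?_)
  have h1 : star (idTensor G D (link Γ N m)) = idTensor G D (linkStar Γ κ N m) :=
    component_ext fun π => by
      rw [component_star, component_idTensor, component_idTensor]
      exact h m π
  refine left_inv_eq_right_inv (a := idTensor G D (linkStar Γ κ N m)) ?_ ?_
  · rw [← h1, ← star_mul, ← map_mul, link_mul_linkInv, map_one, star_one]
  · rw [← map_mul, linkStar_mul_linkInvStar, map_one]

section Uniqueness

variable {N : ℕ} {σ σ' : CurrentAlgebra Γ N →ₗ⋆[ℂ] CurrentAlgebra Γ N}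

lemma component_map_star (σ : CurrentAlgebra Γ N →ₗ⋆[ℂ] CurrentAlgebra Γ N)
    (π : Dual ℂ G) (X : G ⊗[ℂ] CurrentAlgebra Γ N) :
    component π (TensorProduct.map (starLinearEquiv ℂ : G ≃ₗ⋆[ℂ] G).toLinearMap σ X) =
      σ (component (dualStar π) X) := by
  induction X with
  | tmul x y => simp
  | _ => simp_all

lemma IsStarOperation.one (h : IsStarOperation Γ N κ σ) : σ 1 = 1 := by
  have e := h.mul 1 (σ 1)
  rwa [one_mul, h.involutive, one_mul, eq_comm] at e

lemma IsStarOperation.component_link (h : IsStarOperation Γ N κ σ) (m : ZMod N) (π : Dual ℂ G) :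
    σ (component (dualStar π) (CurrentAlgebra.link Γ N m)) = component π (linkStar Γ κ N m) := by
  rw [← component_map_star, h.link]
  rfl

lemma IsStarOperation.component_linkInv (h : IsStarOperation Γ N κ σ) (m : ZMod N) (π : Dual ℂ G) :
    σ (component (dualStar π) (linkInv Γ N m)) = component π (linkInvStar Γ κ N m) := by
  set φ := TensorProduct.map (starLinearEquiv ℂ : G ≃ₗ⋆[ℂ] G).toLinearMap σ with hφ
  have hmul : ∀ X Y : G ⊗[ℂ] CurrentAlgebra Γ N, φ (X * Y) = φ Y * φ X := by
    intro X Y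
    induction X with
    | tmul x y =>
      induction Y with
      | zero => simp
      | add X Y h h' => simp only [add_mul, map_add, mul_add, h, h']
      | tmul x' y' => simp [hφ, h.mul]
    | _ => simp_all [add_mul, mul_add]
  have h1 : φ 1 = 1 := by simp [hφ, Algebra.TensorProduct.one_def, h.one]
  rw [← component_map_star]
  refine congrArg _ (left_inv_eq_right_inv (a := linkStar Γ κ N m) ?_
    (linkStar_mul_linkInvStar Γ κ N m))
  have e : φ (CurrentAlgebra.link Γ N m) = linkStar Γ κ N m := h.link m
  rw [← e, ← hmul, link_mul_linkInv, h1]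

lemma IsStarOperation.unique (h : IsStarOperation Γ N κ σ) (h' : IsStarOperation Γ N κ σ') :
    σ' = σ := by
  ext x
  induction x using CurrentAlgebra.induction with
  | scalar c => rw [Algebra.algebraMap_eq_smul_one, map_smulₛₗ, map_smulₛₗ, h.one, h'.one]
  | add x y hx hy => rw [map_add, map_add, hx, hy]
  | mul x y hx hy => rw [h.mul, h'.mul, hx, hy]
  | hsite n ξ => rw [h.site, h'.site]
  | hlink n π => rw [← dualStar_dualStar π, h.component_link, h'.component_link]
  | hlinkInv n π => rw [← dualStar_dualStar π, h.component_linkInv, h'.component_linkInv]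

end Uniqueness

lemma exists_isStarOperation {N : ℕ} {ι : Type*} {W : ι → Type*} [∀ i, AddCommGroup (W i)]
    [∀ i, Module ℂ (W i)] [∀ i, FiniteDimensional ℂ (W i)]
    (D : ∀ i, CurrentAlgebra Γ N →ₐ[ℂ] End ℂ (W i)) (c : ∀ i, Core ℂ (W i))
    (hD : ∀ x, (∀ i, D i x = 0) → x = 0)
    (hs : ∀ i m ξ, (endStar (c i)).star (D i (site Γ N m ξ)) = D i (site Γ N m (star ξ)))
    (hl : ∀ i m π, (endStar (c i)).star (D i (component (dualStar π) (link Γ N m))) =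
      D i (component π (linkStar Γ κ N m))) :
    ∃ σ : CurrentAlgebra Γ N →ₗ⋆[ℂ] CurrentAlgebra Γ N, IsStarOperation Γ N κ σ ∧
      ∀ i x, (endStar (c i)).star (D i x) = D i (σ x) := by
  have hD' : ∀ x y, (∀ i, D i x = D i y) → x = y := fun x y h =>
    sub_eq_zero.mp (hD _ fun i => by rw [map_sub, h, sub_self])
  have hsmul : ∀ i (r : ℂ) T, (endStar (c i)).star (r • T) = star r • (endStar (c i)).star T :=
    fun i r T =>
    letI := endStar (c i)
    letI := endStarModule (c i)
    star_smul r T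
  have key : ∀ x, ∃ x', ∀ i, (endStar (c i)).star (D i x) = D i x' := fun x => by
    induction x using CurrentAlgebra.induction with
    | scalar r =>
      refine ⟨star r • 1, fun i => ?_⟩
      letI := endStar (c i)
      rw [Algebra.algebraMap_eq_smul_one, map_smul, map_smul, hsmul, map_one]
      exact congrArg _ (star_one _)
    | add x y hx hy =>
      obtain ⟨x', hx⟩ := hx
      obtain ⟨y', hy⟩ := hy
      exact ⟨x' + y', fun i => by rw [map_add, map_add, (endStar (c i)).star_add, hx, hy]⟩
    | mul x y hx hy =>
      obtain ⟨x', hx⟩ := hx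
      obtain ⟨y', hy⟩ := hy
      exact ⟨y' * x', fun i => by rw [map_mul, map_mul, (endStar (c i)).star_mul, hx, hy]⟩
    | hsite n ξ => exact ⟨_, fun i => hs i n ξ⟩
    | hlink n π => exact ⟨_, fun i => by rw [← hl, dualStar_dualStar]⟩
    | hlinkInv n π => exact ⟨_, fun i => by rw [← endStar_linkInv (hl i), dualStar_dualStar]⟩
  choose f hf using key
  refine ⟨
    { toFun := f
      map_add' := fun x y => hD' _ _ fun i => by
        rw [← hf, map_add, map_add, (endStar (c i)).star_add, hf, hf]
      map_smul' := fun r x => hD' _ _ fun i => by rw [← hf, map_smul, map_smul, hsmul, hf]; rfl },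
    ⟨fun x y => hD' _ _ fun i => ?_, fun x => hD' _ _ fun i => ?_, fun m ξ => hD' _ _ fun i => ?_,
      fun m => component_ext fun π => hD' _ _ fun i => ?_⟩, fun i x => hf x i⟩
  · change D i (f _) = D i (f _ * f _)
    rw [← hf, map_mul, map_mul, (endStar (c i)).star_mul, hf, hf]
  · change D i (f (f _)) = _
    rw [← hf, ← hf, (endStar (c i)).star_involutive]
  · change D i (f _) = _
    rw [← hf, hs]
  · rw [component_map_star]
    change D i (f _) = _
    rw [← hf, hl]
    rfl

end CurrentAlgebra

end LinkStar

/-! ## Decomposition of representations by bounded operators -/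

section Hilbert

lemma exists_form_operator {W H : Type*} [AddCommGroup W] [Module ℂ W] [FiniteDimensional ℂ W]
    [NormedAddCommGroup H] [InnerProductSpace ℂ H] [CompleteSpace H]
    (c : Core ℂ W) (T : W →ₗ[ℂ] H) :
    ∃ Q : End ℂ W, ∀ a b, c.inner a (Q b) = inner ℂ (T a) (T b) := by
  letI := c.toNormedAddCommGroup
  letI : InnerProductSpace ℂ W := InnerProductSpace.ofCore c.toCore
  have := FiniteDimensional.complete ℂ W
  let T' : W →L[ℂ] H := LinearMap.toContinuousLinearMap T
  exact ⟨(ContinuousLinearMap.adjoint T').toLinearMap ∘ₗ T, fun a b =>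
    ContinuousLinearMap.adjoint_inner_right T' a (T b)⟩

lemma core_self_pos {W : Type*} [AddCommGroup W] [Module ℂ W] (c : Core ℂ W)
    {a : W} (ha : a ≠ 0) : ∃ t : ℝ, 0 < t ∧ c.inner a a = t := by
  letI := c.toNormedAddCommGroup
  letI : InnerProductSpace ℂ W := InnerProductSpace.ofCore c.toCore
  refine ⟨‖a‖ ^ 2, by positivity, ?_⟩
  exact (inner_self_eq_norm_sq_to_K (𝕜 := ℂ) a).trans (by norm_cast)

variable {σ : A → A} {ι : Type*} {W : ι → Type*} [∀ i, AddCommGroup (W i)] [∀ i, Module ℂ (W i)]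
  [∀ i, FiniteDimensional ℂ (W i)] {D : ∀ i, A →ₐ[ℂ] End ℂ (W i)} (hD : ∀ i, IsIrreducibleRep (D i))
  {c : ∀ i, Core ℂ (W i)} (hc : ∀ i x a b, (c i).inner (D i (σ x) a) b = (c i).inner a (D i x b))
  {H : Type*} [NormedAddCommGroup H] [InnerProductSpace ℂ H] [CompleteSpace H]
  {ρ : A →ₐ[ℂ] (H →L[ℂ] H)} (hρ : ∀ x, ρ (σ x) = ContinuousLinearMap.adjoint (ρ x))

include hD hc hρ in
/-- Two invariant inner products on an irreducible representation are proportional. -/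
lemma exists_isometry (i : ι) {T : W i →ₗ[ℂ] H} (hT : ∀ x a, T (D i x a) = ρ x (T a))
    (hT0 : T ≠ 0) : ∃ e : W i ≃ₗ[ℂ] LinearMap.range T,
      (∀ x a, (e (D i x a) : H) = ρ x (e a)) ∧ ∀ a b, inner ℂ (e a) (e b) = (c i).inner a b := by
  obtain ⟨_, hirr⟩ := hD i
  have hinj : Function.Injective T := by
    rw [← LinearMap.ker_eq_bot]
    refine (hirr (LinearMap.ker T) fun x a ha => ?_).resolve_right fun h =>
      hT0 (LinearMap.ker_eq_top.mp h)
    rw [LinearMap.mem_ker] at ha ⊢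
    rw [hT, ha, map_zero]
  obtain ⟨Q, hQ⟩ := exists_form_operator (c i) T
  have hcomm : ∀ x b, Q (D i x b) = D i x (Q b) := fun x b => by
    refine core_ext (c i) fun z => ?_
    rw [← (c i).conj_inner_symm, ← (c i).conj_inner_symm (D i x (Q b)), hQ, ← hc, hQ, hT, hT, hρ,
      ContinuousLinearMap.adjoint_inner_left]
  obtain ⟨μ, hμ⟩ := Module.End.exists_eigenvalue Q
  have htop : Module.End.eigenspace Q μ = ⊤ := by
    refine (hirr _ fun x a ha => ?_).resolve_left hμ
    rw [Module.End.mem_eigenspace_iff] at ha ⊢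
    rw [hcomm, ha, map_smul]
  have hform : ∀ a b, inner ℂ (T a) (T b) = μ * (c i).inner a b := fun a b => by
    have e : Q b = μ • b := Module.End.mem_eigenspace_iff.mp (htop ▸ Submodule.mem_top)
    rw [← hQ, e]
    exact (coreFun (c i) a).map_smul μ b
  obtain ⟨a, ha⟩ := exists_ne (0 : W i)
  obtain ⟨t, ht, hta⟩ := core_self_pos (c i) ha
  obtain ⟨r, hr, rfl⟩ : ∃ r : ℝ, 0 < r ∧ μ = r := by
    have e := hform a a
    rw [hta, inner_self_eq_norm_sq_to_K] at e
    have hTa : 0 < ‖T a‖ := norm_pos_iff.mpr fun h => ha (hinj (h.trans (map_zero T).symm))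
    refine ⟨‖T a‖ ^ 2 / t, by positivity, ?_⟩
    have ht' : (t : ℂ) ≠ 0 := by exact_mod_cast ht.ne'
    push_cast
    rw [eq_div_iff ht', ← e]
    norm_cast
  obtain ⟨s, hs0, rfl⟩ : ∃ s : ℝ, s ≠ 0 ∧ s * s = r :=
    ⟨√r, (Real.sqrt_pos.mpr hr).ne', Real.mul_self_sqrt hr.le⟩
  have hs : (s : ℂ) ≠ 0 := by exact_mod_cast hs0
  let e := (LinearEquiv.ofInjective T hinj).trans (LinearEquiv.smulOfNeZero ℂ _ _ (inv_ne_zero hs))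
  have he : ∀ a, (e a : H) = (s : ℂ)⁻¹ • T a := fun a => rfl
  refine ⟨e, fun x a => ?_, fun a b => ?_⟩
  · rw [he, he, hT, map_smul]
  · rw [Submodule.coe_inner, he, he, inner_smul_left, inner_smul_right, hform, map_inv₀,
      Complex.conj_ofReal, Complex.ofReal_mul]
    field_simp

include hD hc hρ in
lemma exists_isHilbertSum (hgen : ∀ P : Submodule ℂ H, (∀ x, ∀ w ∈ P, ρ x w ∈ P) → P ≠ ⊥ →
      ∃ i, ∃ T : W i →ₗ[ℂ] H, T ≠ 0 ∧ (∀ x a, T (D i x a) = ρ x (T a)) ∧ LinearMap.range T ≤ P) :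
    ∃ s : Set (Submodule ℂ H),
      IsHilbertSum ℂ (fun F : s => (F : Submodule ℂ H)) (fun F => (F : Submodule ℂ H).subtypeₗᵢ) ∧
      ∀ F : s, ∃ i, ∃ e : W i ≃ₗ[ℂ] (F : Submodule ℂ H),
        (∀ x a, (e (D i x a) : H) = ρ x (e a)) ∧ ∀ a b, inner ℂ (e a) (e b) = (c i).inner a b := by
  let good : Submodule ℂ H → Prop := fun F => ∃ i, ∃ e : W i ≃ₗ[ℂ] F,
    (∀ x a, (e (D i x a) : H) = ρ x (e a)) ∧ ∀ a b, inner ℂ (e a) (e b) = (c i).inner a b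
  obtain ⟨s, hs⟩ := zorn_subset
    {s : Set (Submodule ℂ H) | (∀ F ∈ s, good F) ∧ s.Pairwise (· ⟂ ·)} (by
      intro C hC hchain
      refine ⟨⋃₀ C, ⟨fun F ⟨t, ht, hF⟩ => (hC ht).1 F hF, ?_⟩, fun t ht => Set.subset_sUnion_of_mem ht⟩
      exact (Set.pairwise_sUnion hchain.directedOn).mpr fun t ht => (hC ht).2)
  obtain ⟨hgood, horth⟩ := hs.prop
  have hfin : ∀ F : s, FiniteDimensional ℂ (F : Submodule ℂ H) := fun F => by
    obtain ⟨i, e, -⟩ := hgood F F.2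
    exact Module.Finite.equiv e
  have hcompl : ∀ F : s, CompleteSpace (F : Submodule ℂ H) := fun F => FiniteDimensional.complete ℂ _
  refine ⟨s, IsHilbertSum.mkInternal _ (OrthogonalFamily.of_pairwise fun F F' h =>
    horth F.2 F'.2 fun e => h (Subtype.ext e)) ?_, fun F => hgood F F.2⟩
  rw [top_le_iff, Submodule.topologicalClosure_eq_top_iff]
  by_contra hP
  obtain ⟨i, T, hT0, hT, hle⟩ := hgen _ (fun x w hw => by
    rw [← Submodule.iInf_orthogonal, Submodule.mem_iInf] at hw ⊢
    intro F y hy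
    obtain ⟨i, e, he, -⟩ := hgood F F.2
    rw [← ContinuousLinearMap.adjoint_inner_left, ← hρ]
    refine hw F _ ?_
    obtain ⟨z, rfl⟩ : ∃ z, (e z : H) = y := ⟨e.symm ⟨y, hy⟩, by simp⟩
    rw [← he]
    exact (e _).2) hP
  have hF : good (LinearMap.range T) := ⟨i, exists_isometry hD hc hρ i hT hT0⟩
  have hperp : ∀ F ∈ s, LinearMap.range T ⟂ F := fun F hF =>
    (Submodule.isOrtho_iff_le.mpr (hle.trans
      (Submodule.orthogonal_le (le_iSup (fun F : s => (F : Submodule ℂ H)) ⟨F, hF⟩))))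
  have hmem : LinearMap.range T ∈ s := hs.le_of_ge (y := insert (LinearMap.range T) s) ⟨by
      rintro F (rfl | h)
      exacts [hF, hgood F h], horth.insert fun F h _ => ⟨hperp F h, (hperp F h).symm⟩⟩
    (Set.subset_insert _ _) (Set.mem_insert _ _)
  exact hT0 (LinearMap.range_eq_bot.mp (Submodule.isOrtho_self.mp (hperp _ hmem)))

end Hilbert

section Assembly

variable [Module.Finite ℂ G] [IsSemisimpleRing G] {κ : Gˣ} {Λ : Type w} [Finite Λ] {V : Λ → Type v}
  [∀ I, NormedAddCommGroup (V I)] [∀ I, InnerProductSpace ℂ (V I)] [∀ I, FiniteDimensional ℂ (V I)]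
  {τ : ∀ I, G →ₐ[ℂ] End ℂ (V I)} {n : ℕ}

/-- Every nonzero invariant subspace contains an image of a carrier space. -/
lemma IsIrrepList.exists_hom_range_le (hτ : IsIrrepList V τ)
    (hQ : Function.Bijective ((componentHom G G).flip Γ.Q)) {H : Type*} [NormedAddCommGroup H]
    [InnerProductSpace ℂ H] (ρ : CurrentAlgebra Γ (n + 1) →ₐ[ℂ] (H →L[ℂ] H)) (P : Submodule ℂ H)
    (hP : ∀ x, ∀ w ∈ P, ρ x w ∈ P) (hP0 : P ≠ ⊥) :
    ∃ i : Λ × Λ, ∃ T : Carrier G (V i.1) (V i.2) (n + 1) →ₗ[ℂ] H, T ≠ 0 ∧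
      (∀ x a, T (carrierRep Γ n (τ i.1) (τ i.2) x a) = ρ x (T a)) ∧ LinearMap.range T ≤ P := by
  let ρ' : CurrentAlgebra Γ (n + 1) →ₐ[ℂ] End ℂ P := AlgHom.ofLinearMap
    { toFun := fun x => (ρ x).toLinearMap.restrict (hP x)
      map_add' := fun x y => by ext; simp
      map_smul' := fun r x => by ext; simp }
    (by ext; simp) (fun x y => by ext; simp)
  have htop := hτ.iSup_range_eq_top (n := n) (H := RepSpace ρ') hQ
  have : Nontrivial P := Submodule.nontrivial_iff_ne_bot.mpr hP0
  have : Nontrivial (RepSpace ρ') := this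
  obtain ⟨I, J, T, hT⟩ : ∃ (I J : Λ)
      (T : CarrierModule Γ n (τ I) (τ J) →ₗ[CurrentAlgebra Γ (n + 1)] RepSpace ρ'), T ≠ 0 := by
    by_contra! h
    simp only [h, LinearMap.range_zero, iSup_const, iSup_bot] at htop
    exact bot_ne_top htop
  refine ⟨(I, J), P.subtype ∘ₗ T.restrictScalars ℂ, fun h => hT ?_, fun x a => ?_, ?_⟩
  · ext a
    exact Subtype.ext (LinearMap.congr_fun h a)
  · exact congrArg P.subtype (T.map_smul x a)
  · rintro _ ⟨a, rfl⟩
    exact (T a : P).2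

lemma IsIrrepList.exists_carrierCore (hτ : IsIrrepList V τ) (hκ : Γ.IsAdmissibleRoot τ κ)
    (I J : Λ) : ∃ c : Core ℂ (Carrier G (V I) (V J) (n + 1)),
      (∀ m ξ, (endStar c).star (carrierRep Γ n (τ I) (τ J) (CurrentAlgebra.site Γ (n + 1) m ξ)) =
        carrierRep Γ n (τ I) (τ J) (CurrentAlgebra.site Γ (n + 1) m (Star.star ξ))) ∧
      ∀ m π, (endStar c).star (carrierRep Γ n (τ I) (τ J)
          (component (dualStar π) (CurrentAlgebra.link Γ (n + 1) m))) =
        carrierRep Γ n (τ I) (τ J) (component π (CurrentAlgebra.linkStar Γ κ (n + 1) m)) := by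
  obtain ⟨h, hh⟩ := exists_isIntegral (G := G)
  obtain ⟨tr, ht⟩ := hτ.exists_posTrace
  obtain ⟨hκ', Z, hZ, hS⟩ := hκ.exists_invSqrt hτ
  obtain ⟨c, hc⟩ := exists_reCore hκ' hh ht hZ hS
  obtain ⟨c₀, hst⟩ := exists_baseCore hτ c I J n
  letI : StarRing (End ℂ (Re G)) := endStar c
  letI := endStarModule c
  exact CurrentAlgebra.exists_starCore c₀ hκ' (isStarLink_reLink hκ' c hc hh)
    (isChain_carrier n (τ I) (τ J)) hst
    (fun m hm => LinearMap.ext fun ξ => carrierRep_site (τ I) (τ J) m hm ξ)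
    (fun m hm => carrierRep_link (τ I) (τ J) m hm) hZ hS

end Assembly

end LatticeCurrent

end

theorem mainTheorem1 {G : Type u} [Ring G] [HopfAlgebra ℂ G] [StarRing G] [StarModule ℂ G]
    [Module.Finite ℂ G] [IsSemisimpleRing G] (𝓖 : LatticeCurrent.RibbonStar G)
    {Λ : Type w} [Fintype Λ] [DecidableEq Λ] (V : Λ → Type v) [∀ I, NormedAddCommGroup (V I)]
    [∀ I, InnerProductSpace ℂ (V I)] [∀ I, FiniteDimensional ℂ (V I)]
    (τ : ∀ I, G →ₐ[ℂ] Module.End ℂ (V I)) (hτ : LatticeCurrent.IsIrrepList V τ)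
    (hmod : IsUnit (𝓖.sMatrix τ)) (κ : Gˣ) (hκ : 𝓖.IsAdmissibleRoot τ κ)
    (N : ℕ) (hN : 1 ≤ N) :
    ∃ σ : LatticeCurrent.CurrentAlgebra 𝓖 N →ₗ⋆[ℂ] LatticeCurrent.CurrentAlgebra 𝓖 N,
      -- the *-operation of `K_N` exists and is unique
      LatticeCurrent.CurrentAlgebra.IsStarOperation 𝓖 N κ σ ∧
      (∀ σ', LatticeCurrent.CurrentAlgebra.IsStarOperation 𝓖 N κ σ' → σ' = σ) ∧
      ∃ D : ∀ I J, LatticeCurrent.CurrentAlgebra 𝓖 N →ₐ[ℂ]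
          Module.End ℂ (LatticeCurrent.Carrier G (V I) (V J) N),
        -- the representations given by the explicit formulas, and their irreducibility
        (∀ I J, LatticeCurrent.IsJordanWigner 𝓖 N (τ I) (τ J) (D I J) ∧
          ∀ D', LatticeCurrent.IsJordanWigner 𝓖 N (τ I) (τ J) D' → D' = D I J) ∧
        (∀ I J, LatticeCurrent.IsIrreducibleRep (D I J)) ∧
        -- Hilbert space structures that make them *-representations
        ∃ c : ∀ I J, InnerProductSpace.Core ℂ (LatticeCurrent.Carrier G (V I) (V J) N),
          (∀ I J x a b, (c I J).inner (D I J (σ x) a) b = (c I J).inner a (D I J x b)) ∧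
          -- complete reducibility of *-representations on Hilbert spaces
          ∀ (H : Type x) [NormedAddCommGroup H] [InnerProductSpace ℂ H] [CompleteSpace H]
            (ρ : LatticeCurrent.CurrentAlgebra 𝓖 N →ₐ[ℂ] (H →L[ℂ] H)),
            (∀ x, ρ (σ x) = ContinuousLinearMap.adjoint (ρ x)) →
            ∃ (ι : Type x) (I J : ι → Λ) (F : ι → Submodule ℂ H),
              IsHilbertSum ℂ (fun k => F k) (fun k => (F k).subtypeₗᵢ) ∧
              ∀ k, ∃ e : LatticeCurrent.Carrier G (V (I k)) (V (J k)) N ≃ₗ[ℂ] F k,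
                (∀ x a, (e (D (I k) (J k) x a) : H) = ρ x (e a)) ∧
                ∀ a b, inner ℂ (e a) (e b) = (c (I k) (J k)).inner a b := by
  obtain ⟨n, rfl⟩ : ∃ n, N = n + 1 := ⟨N - 1, by omega⟩
  have hQ := 𝓖.component_Q_bijective hτ hmod
  have hirr : ∀ I J, LatticeCurrent.IsIrreducibleRep (LatticeCurrent.carrierRep 𝓖 n (τ I) (τ J)) :=
    fun I J => (LatticeCurrent.isSimpleModule_iff _).mp (LatticeCurrent.isSimpleModule_carrier
      (τ I) (τ J) hQ (hτ.irreducible I) (hτ.irreducible J))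
  choose c hs hl using fun i : Λ × Λ => hτ.exists_carrierCore (n := n) hκ i.1 i.2
  obtain ⟨σ, hσ, hσD⟩ := LatticeCurrent.CurrentAlgebra.exists_isStarOperation
    (fun i : Λ × Λ => LatticeCurrent.carrierRep 𝓖 n (τ i.1) (τ i.2)) c
    (fun x hx => hτ.carrier_faithful hQ fun I J => hx (I, J)) hs hl
  have hc : ∀ (i : Λ × Λ) x a b, (c i).inner (LatticeCurrent.carrierRep 𝓖 n (τ i.1) (τ i.2) (σ x) a)
      b = (c i).inner a (LatticeCurrent.carrierRep 𝓖 n (τ i.1) (τ i.2) x b) := fun i x a b => by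
    rw [← hσD, LatticeCurrent.inner_endStar]
  refine ⟨σ, hσ, fun σ' h => hσ.unique h, fun I J => LatticeCurrent.carrierRep 𝓖 n (τ I) (τ J),
    fun I J => ⟨LatticeCurrent.isJordanWigner_carrierRep _ _, fun D' hD' =>
      hD'.unique (LatticeCurrent.isJordanWigner_carrierRep _ _)⟩, hirr, fun I J => c (I, J),
    fun I J => hc (I, J), fun H _ _ _ ρ hρ => ?_⟩
  obtain ⟨s, hsum, hF⟩ := LatticeCurrent.exists_isHilbertSum
    (fun i : Λ × Λ => hirr i.1 i.2) hc hρ (hτ.exists_hom_range_le hQ ρ)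
  choose i hi using hF
  exact ⟨s, fun F => (i F).1, fun F => (i F).2, fun F => F, hsum, hi⟩
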